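/- **Setting.** Let $L_2=L_2([0,1],\mathrm{Leb})$ with inner product $\langle\cdot,\cdot\rangle$ and norm $\|\cdot\|_2$. Let $D^{\uparrow}$ be the set of càdlàg nondecreasing functions $[0,1]\to[-\infty,\infty]$ that are continuous at $1$, and let $L_2^{\uparrow}\subset L_2$ be the set of classes having a version in $D^{\uparrow}$. For a function $g$ on $[0,1]$ let $L_2(g)\subset L_2$ be the closed subspace of functions measurable with respect to the Lebesgue-completion of $\sigma(g)$, and let $\mathrm{pr}_g$ be the orthogonal projection of $L_2$ onto $L_2(g)$. Fix a bounded $\xi\in D^{\uparrow}$ and put $L_2^{\uparrow}(\xi)=L_2^{\uparrow}\cap L_2(\xi)$, with the $L_2$-metric. For $n\ge 1$ let $E^n=\{x\in\mathbb R^n: x_1\le\dots\le x_n\}$, $Q^n=\{q=(q_1,\dots,q_{n-1}):0<q_1<\dots<q_{n-1}<1\}$, $q_0=0$, $q_n=1$, and $\chi_n(q,x)=\sum_{i=1}^n x_i\mathbb 1_{[q_{i-1},q_i)}\in L_2^{\uparrow}$. Let $\Xi=\sum_{n\ge1}\Xi_n$, where $$\Xi_n(A)=\int_{Q^n}\prod_{i=1}^n(q_i-q_{i-1})\,\lambda_n\{x\in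 E^n:\chi_n(q,x)\in A\}\,d\xi^{\otimes(n-1)}(q),$$ $\lambda_n$ being Lebesgue measure and $d\xi$ the Lebesgue–Stieltjes measure of $\xi$ (for $n=1$ this is $\Xi_1(A)=\lambda_1\{x\in\mathbb R: x\mathbb 1_{[0,1]}\in A\}$). $\Xi$ is regarded as a measure on $L_2^{\uparrow}(\xi)$, on which it is concentrated. Let $\mathcal{FC}$ be the linear span of the functions $U(g)=u(\langle g,h_1\rangle,\dots,\langle g,h_m\rangle)\,\varphi(\|g\|_2^2)$, where $m\ge 0$, $u\in C_b^\infty(\mathbb R^m)$, $\varphi\in C_0^\infty(\mathbb R)$, $h_j\in L_2(\xi)$. Put $\mathrm DU(g)=\mathrm{pr}_g[\nabla^{L_2}U(g)]$ and $$\mathcal E(U,V)=\frac12\int_{L_2^{\uparrow}(\xi)}\langle \mathrm DU(g),\mathrm DV(g)\rangle\,\Xi(dg),\qquad U,V\in\mathcal{FC}.$$ **Proposition.** Suppose that there is $\delta\in(0,\frac12)$ such that $\xi(u)=\xi(0)$ for $u\in[0,\delta)$ and $\xi(u)=\xi(1)$ for $u\in(1-\delta,1]$. Then $L_2^{\uparrow}(\xi)$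 is locally compact. The form $(\mathcal E,\mathcal{FC})$ is closable on $L_2(L_2^{\uparrow}(\xi),\Xi)$, and its closure $(\mathcal E,\mathbb D)$ is a symmetric Dirichlet form with the following properties. 1. It is regular: $\Xi$ is a Radon measure with full support, and the set of continuous compactly supported functions on $L_2^{\uparrow}(\xi)$ that belong to $\mathbb D$ is dense in $\mathbb D$ for the norm $(\mathcal E+\|\cdot\|^2_{L_2(\Xi)})^{1/2}$ and is uniformly dense in the space of all continuous compactly supported functions. 2. It is strictly quasi-regular in the sense of Ma and Röckner, where the cemetery point $\Delta$ is adjoined to $L_2^{\uparrow}(\xi)$ as the point at infinity of the one-point compactification. 3. It is conservative: its semigroup satisfies $T_t1=1$ $\Xi$-a.e. for all $t>0$. Consequently, every normal Markov process $(X_t)_{t\ge0}$ with state space $L_2^{\uparrow}(\xi)$, cemetery $\Delta$, right-continuous paths and life time $\zeta$ that is properly associated with $(\mathcal E,\mathbb D)$ (for all $t>0$ and all bounded Borel $f\in L_2(\Xi)$, the function $g\mapsto\mathbb E_g f(X_t)$ with $f(\Delta)=0$ is an $\mathcal E$-quasi-continuous version of $T_tf$), in particular the diffusion associated with $(\mathcal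 E,\mathbb D)$, has infinite life time: $\mathbb P_g\{\zeta<\infty\}=0$ for $\mathcal E$-quasi-every $g\in L_2^{\uparrow}(\xi)$. -/

import Mathlib

open MeasureTheory Filter Topology Set
open scoped ENNReal NNReal InnerProductSpace unitInterval

noncomputable section

/-! ## Symmetric Dirichlet forms on `L²(X, m)` -/

/-- A symmetric Dirichlet form `(𝓔, 𝔻)` on `L²(X, m)`: a densely defined, nonnegative, symmetric
bilinear form which is closed (`𝔻` is complete for `𝓔₁ = 𝓔 + ⟨·,·⟩`) and Markovian (the unit
contraction `(u ∨ 0) ∧ 1` operates on it). -/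
structure DirichletForm {X : Type*} [MeasurableSpace X] (m : Measure X) where
  domain : Submodule ℝ (Lp ℝ 2 m)
  form : domain →ₗ[ℝ] domain →ₗ[ℝ] ℝ
  dense' : Dense (domain : Set (Lp ℝ 2 m))
  symm' : ∀ u v, form u v = form v u
  nonneg' : ∀ u, 0 ≤ form u u
  closed' : ∀ u : ℕ → domain,
    (∀ ε : ℝ, 0 < ε → ∃ N, ∀ i ≥ N, ∀ j ≥ N,
      form (u i - u j) (u i - u j) + ‖((u i - u j : domain) : Lp ℝ 2 m)‖ ^ 2 < ε) →
    ∃ w : domain, Tendsto (fun i =>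
      form (u i - w) (u i - w) + ‖((u i - w : domain) : Lp ℝ 2 m)‖ ^ 2) atTop (𝓝 0)
  markov' : ∀ (u : domain) (v : Lp ℝ 2 m),
    (∀ᵐ x ∂m, v x = min (max ((u : Lp ℝ 2 m) x) 0) 1) →
    ∃ hv : v ∈ domain, form ⟨v, hv⟩ ⟨v, hv⟩ ≤ form u u

namespace DirichletForm

section Basic

variable {X : Type*} [MeasurableSpace X] {m : Measure X}

/-- `𝓔₁(u, v) = 𝓔(u, v) + ⟨u, v⟩_{L²(m)}`. -/
def form₁ (𝓔 : DirichletForm m) (u v : 𝓔.domain) : ℝ :=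
  𝓔.form u v + ⟪(u : Lp ℝ 2 m), (v : Lp ℝ 2 m)⟫_ℝ

/-- `(T_t)_{t ≥ 0}` is the semigroup of `(𝓔, 𝔻)`: a strongly continuous contraction semigroup on
`L²(m)` whose resolvent `G_α f = ∫₀^∞ e^{-αt} T_t f dt` satisfies `G_α f ∈ 𝔻` and
`𝓔(G_α f, v) + α ⟨G_α f, v⟩ = ⟨f, v⟩` for all `v ∈ 𝔻`, `α > 0`. -/
structure IsSemigroup (𝓔 : DirichletForm m) (T : ℝ≥0 → Lp ℝ 2 m →L[ℝ] Lp ℝ 2 m) : Prop where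
  zero : ∀ f, T 0 f = f
  add : ∀ s t f, T (s + t) f = T s (T t f)
  contraction : ∀ t f, ‖T t f‖ ≤ ‖f‖
  continuous : ∀ f, Continuous fun t => T t f
  resolvent : ∀ α : ℝ, 0 < α → ∀ f : Lp ℝ 2 m, ∃ u : 𝓔.domain,
    (u : Lp ℝ 2 m) = ∫ t in Ioi (0 : ℝ), Real.exp (-(α * t)) • T t.toNNReal f ∧
    ∀ v : 𝓔.domain, 𝓔.form u v + α * ⟪(u : Lp ℝ 2 m), (v : Lp ℝ 2 m)⟫_ℝ
      = ⟪f, (v : Lp ℝ 2 m)⟫_ℝ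

/-- Conservativeness: `T_t 1 = 1` `m`-a.e. for all `t > 0`, where `T_t 1` is the a.e. limit of
`T_t f_n` for `f_n ∈ L²(m)` with `0 ≤ f_n ↑ 1` a.e. -/
def IsConservative (𝓔 : DirichletForm m) : Prop :=
  ∃ T, 𝓔.IsSemigroup T ∧ ∀ t : ℝ≥0, 0 < t → ∀ f : ℕ → Lp ℝ 2 m,
    (∀ᵐ x ∂m, 0 ≤ f 0 x ∧ Monotone (fun n => f n x) ∧
      Tendsto (fun n => f n x) atTop (𝓝 1)) →
    ∀ᵐ x ∂m, Tendsto (fun n => T t (f n) x) atTop (𝓝 1)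

/-- `h ∈ 𝔻` is 1-excessive: `𝓔₁(h, v) ≥ 0` for all `v ∈ 𝔻` with `v ≥ 0` a.e. -/
def IsExcessive (𝓔 : DirichletForm m) (h : 𝓔.domain) : Prop :=
  ∀ v : 𝓔.domain, (∀ᵐ x ∂m, 0 ≤ (v : Lp ℝ 2 m) x) → 0 ≤ 𝓔.form₁ h v

/-- `w = h_U`, the 1-reduced function of `h` on `U`: the element of
`{v ∈ 𝔻 : v ≥ h a.e. on U}` with `𝓔₁(w, w) ≤ 𝓔₁(w, v)` for all `v` in that set. -/
def IsReduced (𝓔 : DirichletForm m) (h : 𝓔.domain) (U : Set X) (w : 𝓔.domain) : Prop :=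
  (∀ᵐ x ∂m, x ∈ U → (h : Lp ℝ 2 m) x ≤ (w : Lp ℝ 2 m) x) ∧
  ∀ v : 𝓔.domain, (∀ᵐ x ∂m, x ∈ U → (h : Lp ℝ 2 m) x ≤ (v : Lp ℝ 2 m) x) →
    𝓔.form₁ w w ≤ 𝓔.form₁ w v

/-- The weighted capacity `Cap_{1,g}(U) = sup {𝓔₁(h_U, g) : h ∈ 𝔻 1-excessive, h ≤ 1}` of an open
set `U`. -/
def cap (𝓔 : DirichletForm m) (g : 𝓔.domain) (U : Set X) : ℝ≥0∞ :=
  ⨆ (h : 𝓔.domain) (w : 𝓔.domain)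
    (_ : 𝓔.IsExcessive h ∧ (∀ᵐ x ∂m, (h : Lp ℝ 2 m) x ≤ 1) ∧ 𝓔.IsReduced h U w),
    ENNReal.ofReal (𝓔.form₁ w g)

end Basic

section Topological

variable {X : Type*} [TopologicalSpace X] [MeasurableSpace X] {m : Measure X}

/-- `(F_k)` is an `𝓔`-nest: an increasing sequence of closed sets such that `⋃_k 𝔻_{F_k}` is
`𝓔₁`-dense in `𝔻`, where `𝔻_F = {v ∈ 𝔻 : v = 0 a.e. off F}`. -/
def IsNest (𝓔 : DirichletForm m) (F : ℕ → Set X) : Prop :=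
  (∀ k, IsClosed (F k)) ∧ Monotone F ∧
  ∀ (u : 𝓔.domain) (ε : ℝ), 0 < ε → ∃ (k : ℕ) (v : 𝓔.domain),
    (∀ᵐ x ∂m, x ∉ F k → (v : Lp ℝ 2 m) x = 0) ∧ 𝓔.form₁ (u - v) (u - v) < ε

/-- `N` is `𝓔`-exceptional: it is disjoint from all members of some `𝓔`-nest. -/
def IsExceptional (𝓔 : DirichletForm m) (N : Set X) : Prop :=
  ∃ F, 𝓔.IsNest F ∧ N ⊆ ⋂ k, (F k)ᶜ

/-- `p` holds `𝓔`-quasi-everywhere. -/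
def QuasiEverywhere (𝓔 : DirichletForm m) (p : X → Prop) : Prop :=
  𝓔.IsExceptional {x | ¬ p x}

/-- `f` is `𝓔`-quasi-continuous. -/
def IsQuasiContinuous (𝓔 : DirichletForm m) (f : X → ℝ) : Prop :=
  ∃ F, 𝓔.IsNest F ∧ ∀ k, ContinuousOn f (F k)

/-- Regularity: `m` is a Radon measure with full support, and `C_0(X) ∩ 𝔻` is dense both in `𝔻`
with respect to `𝓔₁` and in `C_0(X)` with respect to the uniform norm, where `C_0(X)` is the
space of continuous functions with compact support. -/
structure IsRegular (𝓔 : DirichletForm m) : Prop where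
  finite_compact : IsFiniteMeasureOnCompacts m
  full_support : m.IsOpenPosMeasure
  dense_domain : ∀ (u : 𝓔.domain) (ε : ℝ), 0 < ε → ∃ (v : 𝓔.domain) (f : X → ℝ),
    Continuous f ∧ HasCompactSupport f ∧ (v : Lp ℝ 2 m) =ᵐ[m] f ∧ 𝓔.form₁ (u - v) (u - v) < ε
  dense_uniform : ∀ f : X → ℝ, Continuous f → HasCompactSupport f → ∀ ε : ℝ, 0 < ε →
    ∃ (v : 𝓔.domain) (f' : X → ℝ), Continuous f' ∧ HasCompactSupport f' ∧
      (v : Lp ℝ 2 m) =ᵐ[m] f' ∧ ∀ x, |f x - f' x| < ε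

/-- `(F_k)` is a strict `𝓔`-nest: an increasing sequence of closed sets with
`Cap_{1, G₁φ}(X \ F_k) → 0` for some integrable `φ ∈ L²(m)` with `0 < φ ≤ 1` a.e.; here `g = G₁φ`
is the element of `𝔻` with `𝓔₁(g, v) = ⟨φ, v⟩` for all `v ∈ 𝔻`. -/
def IsStrictNest (𝓔 : DirichletForm m) (F : ℕ → Set X) : Prop :=
  (∀ k, IsClosed (F k)) ∧ Monotone F ∧
  ∃ (φ : Lp ℝ 2 m) (g : 𝓔.domain), Integrable φ m ∧ (∀ᵐ x ∂m, 0 < φ x ∧ φ x ≤ 1) ∧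
    (∀ v : 𝓔.domain, 𝓔.form₁ g v = ⟪φ, (v : Lp ℝ 2 m)⟫_ℝ) ∧
    Tendsto (fun k => 𝓔.cap g (F k)ᶜ) atTop (𝓝 0)

/-- `N` is strictly `𝓔`-exceptional. -/
def IsStrictlyExceptional (𝓔 : DirichletForm m) (N : Set X) : Prop :=
  ∃ F, 𝓔.IsStrictNest F ∧ N ⊆ ⋂ k, (F k)ᶜ

end Topological

end DirichletForm

/-- Extension of a function on `X` to `X_Δ = X ∪ {Δ}` by `f(Δ) = 0`. Here `X_Δ` is the one-point
compactification of the (locally compact) space `X`, with `Δ = ∞`. -/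
def extendZero {X : Type*} (f : X → ℝ) (z : OnePoint X) : ℝ := z.elim 0 f

namespace DirichletForm

variable {X : Type*} [TopologicalSpace X] [MeasurableSpace X] {m : Measure X}

/-- `f` is strictly `𝓔`-quasi-continuous: for some strict `𝓔`-nest `(F_k)`, the function `f`,
extended by `f(Δ) = 0`, is continuous on each `F_k ∪ {Δ}`. -/
def IsStrictlyQuasiContinuous (𝓔 : DirichletForm m) (f : X → ℝ) : Prop :=
  ∃ F, 𝓔.IsStrictNest F ∧
    ∀ k, ContinuousOn (extendZero f) (insert OnePoint.infty ((fun x : X => (x : OnePoint X)) '' F k))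

/-- Strict quasi-regularity of a Dirichlet form on a locally compact space. -/
structure IsStrictlyQuasiRegular (𝓔 : DirichletForm m) : Prop where
  compact_nest : ∃ F, 𝓔.IsStrictNest F ∧
    ∀ k, IsCompact (insert OnePoint.infty ((fun x : X => (x : OnePoint X)) '' F k))
  dense_quasiContinuous : ∀ (u : 𝓔.domain) (ε : ℝ), 0 < ε → ∃ (v : 𝓔.domain) (f : X → ℝ),
    𝓔.IsStrictlyQuasiContinuous f ∧ (v : Lp ℝ 2 m) =ᵐ[m] f ∧ 𝓔.form₁ (u - v) (u - v) < ε
  separating : ∃ (u : ℕ → 𝓔.domain) (f : ℕ → X → ℝ) (N : Set X),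
    (∀ n, 𝓔.IsStrictlyQuasiContinuous (f n) ∧ (u n : Lp ℝ 2 m) =ᵐ[m] f n) ∧
    𝓔.IsStrictlyExceptional N ∧
    ∀ y z : OnePoint X, y ∉ (fun x : X => (x : OnePoint X)) '' N →
      z ∉ (fun x : X => (x : OnePoint X)) '' N → y ≠ z →
      ∃ n, extendZero (f n) y ≠ extendZero (f n) z

end DirichletForm

/-! ## Markov processes -/

/-- The Borel `σ`-algebra on `X_Δ`. -/
instance OnePoint.instMeasurableSpaceBorel {X : Type*} [TopologicalSpace X] :
    MeasurableSpace (OnePoint X) := borel (OnePoint X)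

instance OnePoint.instBorelSpaceBorel {X : Type*} [TopologicalSpace X] :
    BorelSpace (OnePoint X) := ⟨rfl⟩

/-- A normal, time-homogeneous Markov process with state space `X`, cemetery `Δ = ∞`, life time
`ζ` and right-continuous paths. -/
structure MarkovProcess (X : Type*) [TopologicalSpace X]
    (Ω : Type*) [mΩ : MeasurableSpace Ω] where
  filtration : Filtration ℝ≥0 mΩ
  path : ℝ≥0 → Ω → OnePoint X
  lifetime : Ω → ℝ≥0∞
  P : OnePoint X → Measure Ω
  isProbabilityMeasure : ∀ z, IsProbabilityMeasure (P z)
  adapted : ∀ t, Measurable[filtration t] (path t)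
  path_eq_infty_iff : ∀ t ω, path t ω = OnePoint.infty ↔ lifetime ω ≤ t
  measurable_transition : ∀ t (A : Set (OnePoint X)), MeasurableSet A →
    Measurable fun z => P z (path t ⁻¹' A)
  markov : ∀ z s t (A : Set (OnePoint X)), MeasurableSet A →
    (P z)[(path (s + t) ⁻¹' A).indicator (fun _ => (1 : ℝ)) | filtration s]
      =ᵐ[P z] fun ω => (P (path s ω)).real (path t ⁻¹' A)
  normal : ∀ z, ∀ᵐ ω ∂(P z), path 0 ω = z
  rightContinuous : ∀ ω t, ContinuousWithinAt (fun s => path s ω) (Ici t) t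

namespace MarkovProcess

variable {X : Type*} [TopologicalSpace X] {Ω : Type*} [MeasurableSpace Ω]

/-- The transition function `p_t f(x) = E_x[f(X_t)]`, with `f(Δ) = 0`. -/
def transition (M : MarkovProcess X Ω) (t : ℝ≥0) (f : X → ℝ) (x : X) : ℝ :=
  ∫ ω, extendZero f (M.path t ω) ∂(M.P (x : OnePoint X))

/-- The process is properly associated with `(𝓔, 𝔻)`: for all `t > 0` and all bounded Borel
functions `f ∈ L²(m)`, `p_t f` is an `𝓔`-quasi-continuous `m`-version of `T_t f`. -/
def IsProperlyAssociated [MeasurableSpace X] {m : Measure X} (M : MarkovProcess X Ω)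
    (𝓔 : DirichletForm m) : Prop :=
  ∃ T, 𝓔.IsSemigroup T ∧ ∀ t : ℝ≥0, 0 < t → ∀ f : X → ℝ, Measurable f →
    (∃ C : ℝ, ∀ x, |f x| ≤ C) → ∀ hf : MemLp f 2 m,
    𝓔.IsQuasiContinuous (M.transition t f) ∧ M.transition t f =ᵐ[m] T t (hf.toLp f)

end MarkovProcess

/-! ## The cone `L_2^↑(ξ)` -/

/-- The real Hilbert space `L_2 = L_2([0,1], Leb)`. -/
abbrev L2I : Type := Lp ℝ 2 (volume : Measure I)

instance L2I.instMeasurableSpace : MeasurableSpace L2I := borel L2I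

instance L2I.instBorelSpace : BorelSpace L2I := ⟨rfl⟩

/-- `D^↑`: càdlàg nondecreasing functions `[0,1] → [-∞, ∞]` that are continuous at `1` (left limits
exist by monotonicity). -/
def MemDup (g : I → EReal) : Prop :=
  Monotone g ∧ (∀ u, ContinuousWithinAt g (Ici u) u) ∧ ContinuousAt g 1

/-- `L_2^↑`: the classes in `L_2` having a version in `D^↑`. -/
def L2up : Set L2I := {f | ∃ g, MemDup g ∧ ∀ᵐ u, ((f u : ℝ) : EReal) = g u}

/-- `L_2(ξ)`: the closed subspace of `L_2` of classes of `σ^⋆(ξ)`-measurable functions, i.e. of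
functions that agree a.e. with a `σ(ξ)`-measurable one. -/
def L2of (ξ : I → ℝ) : Submodule ℝ L2I :=
  lpMeas ℝ ℝ (MeasurableSpace.comap ξ inferInstance) 2 (volume : Measure I)

/-- `L_2^↑(ξ) = L_2^↑ ∩ L_2(ξ)`, with the metric of `L_2` and its Borel `σ`-algebra. -/
abbrev ConeOf (ξ : I → ℝ) : Type := {f : L2I // f ∈ L2up ∧ f ∈ L2of ξ}

/-- `pr_g`: the orthogonal projection of `L_2` onto `L_2(g)`. -/
def prL2 (g : L2I) : L2I → L2I := fun h =>
  (condExpL2 (μ := (volume : Measure I)) ℝ ℝ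
    (Lp.stronglyMeasurable g).measurable.comap_le h : L2I)

/-! ## The measure `Ξ` -/

/-- The partition points `q_0 = 0, q_1, …, q_k, q_{k+1} = 1`. -/
def partitionPoints {k : ℕ} (q : Fin k → I) : Fin (k + 2) → I :=
  Fin.cons (α := fun _ => I) 0 (Fin.snoc (α := fun _ => I) q 1)

/-- `Q^{k+1} = {q : 0 < q_1 < ⋯ < q_k < 1}`. -/
def QSimplex (k : ℕ) : Set (Fin k → I) := {q | StrictMono (partitionPoints q)}

/-- The step function `χ(q, x) = ∑_i x_i 1_{[q_{i-1}, q_i)}` as an element of `L_2`. -/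
def stepFun {k : ℕ} (q : Fin k → I) (x : Fin (k + 1) → ℝ) : L2I :=
  ∑ i : Fin (k + 1), x i • indicatorConstLp 2 (μ := (volume : Measure I))
    (s := Ico (partitionPoints q i.castSucc) (partitionPoints q i.succ))
    measurableSet_Ico (measure_ne_top _ _) (1 : ℝ)

/-- The measure `∏_i (q_i - q_{i-1}) dξ^{⊗k}(q)` on `Q^{k+1}`, where `dξ` is the
Lebesgue–Stieltjes measure of `ξ` on `[0,1]`. -/
def muQ (ξ : StieltjesFunction I) (k : ℕ) : Measure (Fin k → I) :=
  ((Measure.pi fun _ : Fin k => ξ.measure).restrict (QSimplex k)).withDensity fun q =>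
    ∏ i : Fin (k + 1), ENNReal.ofReal
      ((partitionPoints q i.succ : ℝ) - (partitionPoints q i.castSucc : ℝ))

/-- The measure `Ξ_{k+1}` on `L_2`:
`Ξ_{k+1}(A) = ∫_{Q^{k+1}} ∏_i (q_i - q_{i-1}) λ_{k+1}{x ∈ E^{k+1} : χ(q, x) ∈ A} dξ^{⊗k}(q)`,
where `E^{k+1} = {x : x_1 ≤ ⋯ ≤ x_{k+1}}` and `λ_{k+1}` is Lebesgue measure. -/
def XiStep (ξ : StieltjesFunction I) (k : ℕ) : Measure L2I :=
  ((muQ ξ k).prod ((volume : Measure (Fin (k + 1) → ℝ)).restrict {x | Monotone x})).map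
    fun p => stepFun p.1 p.2

/-- The measure `Ξ = ∑_{n ≥ 1} Ξ_n`, regarded as a measure on `L_2^↑(ξ)`. -/
def Xi (ξ : StieltjesFunction I) : Measure (ConeOf ξ) :=
  (Measure.sum fun k => XiStep ξ k).comap Subtype.val

/-! ## The form -/

/-- `C_b^∞(ℝ^n)`: smooth functions with bounded derivatives of all orders (including order 0). -/
def IsCbInfty {n : ℕ} (u : (Fin n → ℝ) → ℝ) : Prop :=
  ContDiff ℝ ((⊤ : ℕ∞) : WithTop ℕ∞) u ∧ ∀ k : ℕ, ∃ C : ℝ, ∀ x, ‖iteratedFDeriv ℝ k u x‖ ≤ C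

/-- `𝓕𝓒`: the linear span of the functions
`U(g) = u(⟨g, h_1⟩, …, ⟨g, h_n⟩) φ(‖g‖²)` with `u ∈ C_b^∞(ℝ^n)`, `φ ∈ C_0^∞(ℝ)` and
`h_j ∈ L_2(ξ)`. They are kept as functions on all of `L_2`, so that Fréchet derivatives make sense;
the form only sees them on `L_2^↑(ξ)`. -/
def CylFun (ξ : I → ℝ) : Submodule ℝ (L2I → ℝ) :=
  Submodule.span ℝ {U | ∃ (n : ℕ) (u : (Fin n → ℝ) → ℝ) (φ : ℝ → ℝ) (h : Fin n → L2I),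
    IsCbInfty u ∧ ContDiff ℝ ((⊤ : ℕ∞) : WithTop ℕ∞) φ ∧ HasCompactSupport φ ∧ (∀ j, h j ∈ L2of ξ) ∧
    U = fun g => u (fun j => ⟪g, h j⟫_ℝ) * φ (‖g‖ ^ 2)}

/-- `D U(g) = pr_g [∇^{L_2} U(g)]`. -/
def gradD (U : L2I → ℝ) (g : L2I) : L2I := prL2 g (gradient U g)

/-- `(𝓔, 𝔻)` is the closure on `L²(L_2^↑(ξ), Ξ)` of the form
`𝓔(U, V) = ½ ∫ ⟨D U(g), D V(g)⟩ Ξ(dg)`, `U, V ∈ 𝓕𝓒`: it extends that form, and `𝓕𝓒` is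
`𝓔₁`-dense in `𝔻`. Since a Dirichlet form is closed, these properties determine `(𝓔, 𝔻)`. -/
structure IsClosureOfCylForm (ξ : StieltjesFunction I) (𝓔 : DirichletForm (Xi ξ)) : Prop where
  mem_domain : ∀ U ∈ CylFun ξ, ∃ u : 𝓔.domain,
    (u : Lp ℝ 2 (Xi ξ)) =ᵐ[Xi ξ] fun g => U g
  form_eq : ∀ U ∈ CylFun ξ, ∀ V ∈ CylFun ξ, ∀ u v : 𝓔.domain,
    ((u : Lp ℝ 2 (Xi ξ)) =ᵐ[Xi ξ] fun g => U g) →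
    ((v : Lp ℝ 2 (Xi ξ)) =ᵐ[Xi ξ] fun g => V g) →
    Integrable (fun g : ConeOf ξ => ⟪gradD U g, gradD V g⟫_ℝ) (Xi ξ) ∧
    𝓔.form u v = 1 / 2 * ∫ g : ConeOf ξ, ⟪gradD U g, gradD V g⟫_ℝ ∂(Xi ξ)
  dense_core : ∀ (u : 𝓔.domain) (ε : ℝ), 0 < ε → ∃ U ∈ CylFun ξ, ∃ v : 𝓔.domain,
    ((v : Lp ℝ 2 (Xi ξ)) =ᵐ[Xi ξ] fun g => U g) ∧ 𝓔.form₁ (u - v) (u - v) < ε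

end

/-! Compactness and growth. An element `g` of the cone is a.e. a function of `ξ`, so it equals
constants `c` and `d` on the two flat ends, and monotonicity keeps all its values between them. Each
end has length `δ`, hence `|c| √δ` and `|d| √δ` are at most `‖g‖` (`exists_monotone_version`). A
ball of the cone therefore consists of uniformly bounded monotone functions, and Helly's theorem
makes it compact (`isCompact_cone_closedBall`). The same bound puts the values of a step function in
a ball of radius `r` into a cube of side `2 r / √δ`; since the product of the `k + 1` cell lengths
is at most `1 / (k + 1)!`, the balls have `Ξ`-measure at most `exp (c r)` for some constant `c`
(`exists_Xi_ball_le`).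

The form. At a step function with strictly increasing values, `pr_g` averages over the cells
(`prL2_stepFun`), so the pairing of `D U` with a cell indicator is a partial derivative of `x ↦ U
(χ(q, x))`. For fixed `q` these derivatives are closable with respect to Lebesgue measure by
integration by parts, and Fubini carries this over to `Ξ` (`ae_inner_cellInd_eq_zero`,
`cylGraph_zero`). The unit contraction operates because it is a limit of polynomials vanishing at
`0` with almost contractive derivatives, and bounded gradients have weak limits in the closed graph.
Regularity is the Stone–Weierstrass theorem on balls. Strict quasi-regularity is then cheap: the
space with `Δ` is compact, so the constant nest given by the whole space is strict.

Conservativeness. The resolvent equation for `u = G_α f`, tested with `W(‖g‖²) u`, bounds the energy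
of `u` with the weight `W`, provided `α` dominates the logarithmic derivative of `W`
(`integral_weight_mul_norm_sq_le`). Weights that stay bounded where `f` lives and exceed `exp (4 c
R)` at radius `R` beat the volume growth, so the energy between `u` and a cut-off at radius `R` is
`O(exp (-c R))` (`exists_form_cut_le`). Hence `α G_α`, and with it the semigroup, loses no mass
(`semigroup_tendsto_one`).

Life time. The semigroup is built by Yosida approximation and is unique
(`IsSemigroup.eq_semigroup`), so the process has this semigroup. Then `1 - p_1 1` vanishes a.e., and
`p_s (1 - p_1 1)`, being quasi-continuous, vanishes quasi-everywhere, simultaneously for countably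
many `s`. Its value at `x` is the probability of dying in `(s, s + 1]` when starting at `x`, and
such intervals cover all positive finite times. -/

noncomputable section


/-! ## Weak limits in Hilbert spaces via convex combinations -/

section WeakLimits

variable {H : Type*} [NormedAddCommGroup H] [InnerProductSpace ℝ H] [CompleteSpace H]

/-- A decreasing sequence of nonempty bounded closed convex sets in a Hilbert space has a common
point. -/
theorem exists_mem_of_antitone_convex (C : ℕ → Set H) (hanti : Antitone C)
    (hne : ∀ n, (C n).Nonempty) (hcl : ∀ n, IsClosed (C n)) (hconv : ∀ n, Convex ℝ (C n))
    (B : ℝ) (hB : ∀ n, ∀ x ∈ C n, ‖x‖ ≤ B) : ∃ w, ∀ n, w ∈ C n := by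
  -- The points of minimal norm converge: their norms increase with `n` and stay below `B`, and the
  -- parallelogram law turns convergence of the norms into a Cauchy property of the points.
  have hmin : ∀ n, ∃ v ∈ C n, ∀ w ∈ C n, ‖v‖ ≤ ‖w‖ := by
    intro n
    obtain ⟨v, hv, hve⟩ := exists_norm_eq_iInf_of_complete_convex (hne n) (hcl n).isComplete
      (hconv n) 0
    refine ⟨v, hv, fun w hw => ?_⟩
    have : (⨅ w : C n, ‖(0 : H) - w‖) ≤ ‖(0 : H) - (⟨w, hw⟩ : C n)‖ :=
      ciInf_le ⟨0, by rintro _ ⟨x, rfl⟩; exact norm_nonneg _⟩ _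
    rw [← hve] at this
    simpa using this
  choose v hv hvmin using hmin
  have hmono : Monotone fun n => ‖v n‖ ^ 2 := fun m n hmn => by
    have := hvmin m (v n) (hanti hmn (hv n))
    dsimp only; gcongr
  have hbdd : BddAbove (range fun n => ‖v n‖ ^ 2) :=
    ⟨B ^ 2, by rintro _ ⟨n, rfl⟩; dsimp only; gcongr; exact hB n _ (hv n)⟩
  have hlim := (tendsto_atTop_ciSup hmono hbdd).cauchySeq
  have hpar : ∀ m n, m ≤ n → ‖v n - v m‖ ^ 2 ≤ 2 * (‖v n‖ ^ 2 - ‖v m‖ ^ 2) := by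
    intro m n hmn
    -- The midpoint lies in the larger set `C m`, so its norm is at least that of `v m`.
    have hmid : (1 / 2 : ℝ) • v n + (1 / 2 : ℝ) • v m ∈ C m :=
      hconv m (hanti hmn (hv n)) (hv m) (by norm_num) (by norm_num) (by norm_num)
    have h1 := hvmin m _ hmid
    rw [← smul_add, norm_smul] at h1
    have h2 := parallelogram_law_with_norm ℝ (v n) (v m)
    have h3 : ‖v m‖ ≤ 1 / 2 * ‖v n + v m‖ := by simpa using h1
    nlinarith [norm_nonneg (v m), norm_nonneg (v n + v m)]
  have hcau : CauchySeq v := by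
    rw [Metric.cauchySeq_iff'] at hlim ⊢
    intro ε hε
    obtain ⟨N, hN⟩ := hlim (ε ^ 2 / 2) (by positivity)
    refine ⟨N, fun n hn => ?_⟩
    have h1 := hpar N n hn
    have h2 := hN n hn
    rw [Real.dist_eq] at h2
    have h3 := (abs_lt.1 h2).2
    rw [dist_eq_norm]
    exact lt_of_pow_lt_pow_left₀ 2 hε.le (by linarith)
  obtain ⟨w, hw⟩ := cauchySeq_tendsto_of_complete hcau
  exact ⟨w, fun n => (hcl n).mem_of_tendsto hw
    (eventually_atTop.2 ⟨n, fun k hk => hanti hk (hv k)⟩)⟩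

/-- If `p n` is a sequence in `E × H` whose first components converge and whose second components
are bounded, then the limit of the first components is the first component of a point that is in
the closed convex hull of every tail. -/
theorem exists_mem_closure_convexHull_of_bounded {E : Type*} [NormedAddCommGroup E]
    [NormedSpace ℝ E] (p : ℕ → E × H) (u : E) (hu : Tendsto (fun n => (p n).1) atTop (𝓝 u))
    (B : ℝ) (hB : ∀ n, ‖(p n).2‖ ≤ B) :
    ∃ z, ∀ n, (u, z) ∈ closure (convexHull ℝ (p '' Ici n)) := by
  have hanti : Antitone fun n => p '' Ici n := fun m n hmn => image_mono (Ici_subset_Ici.2 hmn)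
  -- Only the second components need a weak limit: `z` lies in the closed convex hulls of all their
  -- tails.
  obtain ⟨z, hz⟩ := exists_mem_of_antitone_convex
    (fun n => closure (convexHull ℝ ((LinearMap.snd ℝ E H) '' (p '' Ici n))))
    (fun m n hmn => closure_mono (convexHull_mono (image_mono (hanti hmn))))
    (fun n => ⟨(p n).2, subset_closure (subset_convexHull _ _ ⟨p n, ⟨n, self_mem_Ici, rfl⟩, rfl⟩)⟩)
    (fun n => isClosed_closure) (fun n => (convex_convexHull _ _).closure) B
    (fun n x hx => by
      have : closure (convexHull ℝ ((LinearMap.snd ℝ E H) '' (p '' Ici n)))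
          ⊆ Metric.closedBall 0 B := by
        refine closure_minimal (convexHull_min ?_ (convex_closedBall _ _)) Metric.isClosed_closedBall
        rintro _ ⟨_, ⟨k, -, rfl⟩, rfl⟩
        simpa using hB k
      simpa using this hx)
  refine ⟨z, fun n => Metric.mem_closure_iff.2 fun ε hε => ?_⟩
  -- Beyond `N` the first components lie in a ball of radius `ε / 2` around `u`. The ball is convex,
  -- so the same holds for the convex combination whose second component approximates `z`.
  obtain ⟨N, hN⟩ := Metric.tendsto_atTop.1 hu (ε / 2) (by positivity)
  have hzN := hz (max n N)
  rw [← LinearMap.image_convexHull] at hzN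
  obtain ⟨_, ⟨q, hq, rfl⟩, hqz⟩ := Metric.mem_closure_iff.1 hzN ε hε
  refine ⟨q, convexHull_mono (hanti (le_max_left _ _)) hq, ?_⟩
  rw [Prod.dist_eq]
  refine max_lt ?_ hqz
  have hq1 : (LinearMap.fst ℝ E H) q ∈ (LinearMap.fst ℝ E H) '' convexHull ℝ (p '' Ici (max n N)) :=
    ⟨q, hq, rfl⟩
  rw [LinearMap.image_convexHull] at hq1
  have : convexHull ℝ ((LinearMap.fst ℝ E H) '' (p '' Ici (max n N)))
      ⊆ Metric.closedBall u (ε / 2) := by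
    refine convexHull_min ?_ (convex_closedBall _ _)
    rintro _ ⟨_, ⟨k, hk, rfl⟩, rfl⟩
    exact (hN k ((le_max_right _ _).trans hk)).le
  have h2 := this hq1
  rw [Metric.mem_closedBall, dist_comm] at h2
  exact h2.trans_lt (by linarith)

/-- A closed subspace of `E × H` that contains a sequence `p n` with convergent first components
and second components asymptotically bounded by `c` contains a point over the limit with second
component bounded by `c`. -/
theorem exists_mem_of_tendsto_of_norm_le {E : Type*} [NormedAddCommGroup E] [NormedSpace ℝ E]
    (G : Submodule ℝ (E × H)) (hG : IsClosed (G : Set (E × H))) (p : ℕ → E × H)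
    (hp : ∀ n, p n ∈ G) (u : E) (hu : Tendsto (fun n => (p n).1) atTop (𝓝 u)) (b : ℕ → ℝ) (c : ℝ)
    (hb : ∀ n, ‖(p n).2‖ ≤ b n) (hbc : Tendsto b atTop (𝓝 c)) :
    ∃ z, (u, z) ∈ G ∧ ‖z‖ ≤ c := by
  obtain ⟨B, hB⟩ := hbc.bddAbove_range
  obtain ⟨z, hz⟩ := exists_mem_closure_convexHull_of_bounded p u hu B
    (fun n => (hb n).trans (hB ⟨n, rfl⟩))
  refine ⟨z, ?_, le_of_forall_pos_le_add fun ε hε => ?_⟩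
  · have : closure (convexHull ℝ (p '' Ici 0)) ⊆ G := by
      refine closure_minimal (convexHull_min ?_ G.convex) hG
      rintro _ ⟨k, -, rfl⟩
      exact hp k
    exact this (hz 0)
  · obtain ⟨N, hN⟩ := eventually_atTop.1 (hbc.eventually (gt_mem_nhds (lt_add_of_pos_right c hε)))
    have : closure (convexHull ℝ (p '' Ici N)) ⊆
        (LinearMap.snd ℝ E H) ⁻¹' Metric.closedBall 0 (c + ε) := by
      refine closure_minimal (convexHull_min ?_ ((convex_closedBall _ _).linear_preimage _))
        (Metric.isClosed_closedBall.preimage continuous_snd)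
      rintro _ ⟨k, hk, rfl⟩
      simpa using (hb k).trans (hN k hk).le
    simpa using this (hz N)

end WeakLimits

/-! ## The Hilbert space of a Dirichlet form -/

namespace DirichletForm

section Energy

variable {X : Type*} [MeasurableSpace X] {m : Measure X}

/-- The form `𝓔_α(u, v) = 𝓔(u, v) + α ⟨u, v⟩`. -/
def formα (𝓔 : DirichletForm m) (α : ℝ) (u v : 𝓔.domain) : ℝ :=
  𝓔.form u v + α * ⟪(u : Lp ℝ 2 m), (v : Lp ℝ 2 m)⟫_ℝ

theorem formα_one (𝓔 : DirichletForm m) (u v : 𝓔.domain) : 𝓔.formα 1 u v = 𝓔.form₁ u v := by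
  simp [formα, form₁]

theorem formα_comm (𝓔 : DirichletForm m) (α : ℝ) (u v : 𝓔.domain) :
    𝓔.formα α u v = 𝓔.formα α v u := by
  rw [formα, formα, 𝓔.symm' u v, real_inner_comm]

theorem formα_add_left (𝓔 : DirichletForm m) (α : ℝ) (u v w : 𝓔.domain) :
    𝓔.formα α (u + v) w = 𝓔.formα α u w + 𝓔.formα α v w := by
  simp only [formα, map_add, LinearMap.add_apply, Submodule.coe_add, inner_add_left]
  ring

theorem formα_smul_left (𝓔 : DirichletForm m) (α r : ℝ) (u v : 𝓔.domain) :
    𝓔.formα α (r • u) v = r * 𝓔.formα α u v := by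
  simp only [formα, map_smul, LinearMap.smul_apply, Submodule.coe_smul, real_inner_smul_left,
    smul_eq_mul]
  ring

theorem formα_self (𝓔 : DirichletForm m) (α : ℝ) (u : 𝓔.domain) :
    𝓔.formα α u u = 𝓔.form u u + α * ‖(u : Lp ℝ 2 m)‖ ^ 2 := by
  rw [formα, real_inner_self_eq_norm_sq]

/-- The domain of a Dirichlet form, to be equipped with the inner product `𝓔_α`. -/
def EnergySpace (𝓔 : DirichletForm m) (_ : Ioi (0 : ℝ)) : Type _ := 𝓔.domain

variable (𝓔 : DirichletForm m) (α : Ioi (0 : ℝ))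

instance : AddCommGroup (𝓔.EnergySpace α) := inferInstanceAs (AddCommGroup 𝓔.domain)
instance : Module ℝ (𝓔.EnergySpace α) := inferInstanceAs (Module ℝ 𝓔.domain)

/-- The identification of the domain with the energy space. -/
def toEnergy : 𝓔.domain ≃ₗ[ℝ] 𝓔.EnergySpace α := LinearEquiv.refl ℝ 𝓔.domain

/-- The identification of the energy space with the domain. -/
abbrev ofEnergy : 𝓔.EnergySpace α ≃ₗ[ℝ] 𝓔.domain := (𝓔.toEnergy α).symm

/-- The form itself may be degenerate; the term with `α > 0` is what makes the inner product
definite. -/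
instance energyCore : InnerProductSpace.Core ℝ (𝓔.EnergySpace α) where
  inner u v := 𝓔.formα α (𝓔.ofEnergy α u) (𝓔.ofEnergy α v)
  conj_inner_symm u v := 𝓔.formα_comm α _ _
  re_inner_nonneg u := by
    have := 𝓔.nonneg' (𝓔.ofEnergy α u)
    have h2 : (0 : ℝ) < α := α.2
    rw [formα_self, RCLike.re_to_real]
    positivity
  add_left u v w := by rw [map_add, formα_add_left]
  smul_left u v r := by rw [map_smul, formα_smul_left, conj_trivial]
  definite u hu := by
    have h1 := 𝓔.nonneg' (𝓔.ofEnergy α u)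
    have h2 : (0 : ℝ) < α := α.2
    change 𝓔.formα α _ _ = 0 at hu
    rw [formα_self] at hu
    have h3 : ‖(𝓔.ofEnergy α u : Lp ℝ 2 m)‖ ^ 2 = 0 := by
      nlinarith [sq_nonneg ‖(𝓔.ofEnergy α u : Lp ℝ 2 m)‖]
    have h4 : 𝓔.ofEnergy α u = 0 := Subtype.ext (by simpa using h3)
    simpa using h4

instance : NormedAddCommGroup (𝓔.EnergySpace α) :=
  (𝓔.energyCore α).toNormedAddCommGroup

instance : InnerProductSpace ℝ (𝓔.EnergySpace α) :=
  InnerProductSpace.ofCore (𝓔.energyCore α).toCore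

variable {𝓔 α}

theorem energy_inner (u v : 𝓔.EnergySpace α) :
    ⟪u, v⟫_ℝ = 𝓔.formα α (𝓔.ofEnergy α u) (𝓔.ofEnergy α v) := rfl

theorem energy_norm_sq (u : 𝓔.EnergySpace α) :
    ‖u‖ ^ 2 = 𝓔.form (𝓔.ofEnergy α u) (𝓔.ofEnergy α u)
      + α * ‖(𝓔.ofEnergy α u : Lp ℝ 2 m)‖ ^ 2 := by
  rw [← formα_self, ← energy_inner, real_inner_self_eq_norm_sq]

theorem toEnergy_norm_sq (u : 𝓔.domain) :
    ‖𝓔.toEnergy α u‖ ^ 2 = 𝓔.form u u + α * ‖(u : Lp ℝ 2 m)‖ ^ 2 := by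
  rw [energy_norm_sq, ofEnergy, LinearEquiv.symm_apply_apply]

/-- The norm of `𝓔_α` is equivalent to the one in the closedness axiom, with factors `1 + 1 / α` and
`1 + α` for the squares, so closedness is completeness. -/
instance : CompleteSpace (𝓔.EnergySpace α) := by
  have hα : (0 : ℝ) < α := α.2
  refine Metric.complete_of_cauchySeq_tendsto fun u hu => ?_
  have hcomp : ∀ v : 𝓔.domain, 𝓔.form v v + ‖(v : Lp ℝ 2 m)‖ ^ 2
      ≤ (1 + 1 / α) * ‖𝓔.toEnergy α v‖ ^ 2 := by
    intro v
    rw [toEnergy_norm_sq]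
    have h1 := 𝓔.nonneg' v
    have h2 : (1 + 1 / (α : ℝ)) * (𝓔.form v v + α * ‖(v : Lp ℝ 2 m)‖ ^ 2) =
      𝓔.form v v + ‖(v : Lp ℝ 2 m)‖ ^ 2 + ((1 / α) * 𝓔.form v v + α * ‖(v : Lp ℝ 2 m)‖ ^ 2) := by
      field_simp
      ring
    have h3 : 0 ≤ (1 / (α : ℝ)) * 𝓔.form v v + α * ‖(v : Lp ℝ 2 m)‖ ^ 2 := by positivity
    exact (le_add_of_nonneg_right h3).trans_eq h2.symm
  obtain ⟨w, hw⟩ := 𝓔.closed' (fun n => 𝓔.ofEnergy α (u n)) (fun ε hε => by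
    obtain ⟨N, hN⟩ := Metric.cauchySeq_iff.1 hu (√(ε / (1 + 1 / α))) (by positivity)
    refine ⟨N, fun i hi j hj => (hcomp _).trans_lt ?_⟩
    have h1 := hN i hi j hj
    rw [dist_eq_norm, Real.lt_sqrt (norm_nonneg _), lt_div_iff₀' (by positivity)] at h1
    simpa using h1)
  refine ⟨𝓔.toEnergy α w, tendsto_iff_norm_sub_tendsto_zero.2 ?_⟩
  have hcomp' : ∀ v : 𝓔.domain, ‖𝓔.toEnergy α v‖
      ≤ √((1 + α) * (𝓔.form v v + ‖(v : Lp ℝ 2 m)‖ ^ 2)) := by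
    intro v
    refine Real.le_sqrt_of_sq_le ?_
    rw [toEnergy_norm_sq]
    have h1 := 𝓔.nonneg' v
    have h2 := mul_nonneg hα.le h1
    nlinarith [sq_nonneg ‖(v : Lp ℝ 2 m)‖]
  refine squeeze_zero (fun _ => norm_nonneg _)
    (fun i => (by simpa using hcomp' (𝓔.ofEnergy α (u i) - w))) ?_
  have := (hw.const_mul (1 + (α : ℝ))).sqrt
  simpa using this

variable (𝓔 α)

/-- The inclusion of the domain, with the norm of `𝓔_α`, into `L²(m)`. -/
def toL2 : 𝓔.EnergySpace α →L[ℝ] Lp ℝ 2 m :=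
  LinearMap.mkContinuous (𝓔.domain.subtype ∘ₗ (𝓔.ofEnergy α).toLinearMap)
    (√(1 / α)) fun u => by
      have hα : (0 : ℝ) < α := α.2
      rw [← Real.sqrt_sq (norm_nonneg u), ← Real.sqrt_mul (by positivity)]
      refine Real.le_sqrt_of_sq_le ?_
      rw [energy_norm_sq]
      have h1 := 𝓔.nonneg' (𝓔.ofEnergy α u)
      rw [mul_add]
      have : 1 / (α : ℝ) * (α * ‖(𝓔.ofEnergy α u : Lp ℝ 2 m)‖ ^ 2)
        = ‖(𝓔.ofEnergy α u : Lp ℝ 2 m)‖ ^ 2 := by field_simp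
      rw [this]
      exact le_add_of_nonneg_left (by positivity)

variable {𝓔 α}

theorem toL2_toEnergy (u : 𝓔.domain) : 𝓔.toL2 α (𝓔.toEnergy α u) = u := rfl

theorem toL2_injective : Function.Injective (𝓔.toL2 α) := fun _ _ h =>
  (𝓔.ofEnergy α).injective (Subtype.ext h)

/-- Lower semicontinuity of the energy: a bounded sequence in a closed subspace of the energy
space that converges in `L²` has its limit in this subspace. -/
theorem exists_limit_of_bounded (K : Submodule ℝ (𝓔.EnergySpace α))
    (hK : IsClosed (K : Set (𝓔.EnergySpace α))) (v : ℕ → 𝓔.EnergySpace α) (hv : ∀ n, v n ∈ K)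
    (u : Lp ℝ 2 m) (hu : Tendsto (fun n => 𝓔.toL2 α (v n)) atTop (𝓝 u)) (b : ℕ → ℝ) (c : ℝ)
    (hb : ∀ n, ‖v n‖ ≤ b n) (hbc : Tendsto b atTop (𝓝 c)) :
    ∃ w ∈ K, 𝓔.toL2 α w = u ∧ ‖w‖ ≤ c := by
  -- `G` is the graph of the inclusion restricted to `K`, with components swapped. It is closed
  -- because the inclusion is continuous, and the bound on the energies supplies a weak limit inside
  -- it.
  let G : Submodule ℝ (Lp ℝ 2 m × 𝓔.EnergySpace α) :=
    { carrier := {p | 𝓔.toL2 α p.2 = p.1 ∧ p.2 ∈ K}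
      add_mem' := fun {p q} hp hq => ⟨by rw [Prod.snd_add, map_add, hp.1, hq.1, Prod.fst_add],
        K.add_mem hp.2 hq.2⟩
      zero_mem' := ⟨by simp, K.zero_mem⟩
      smul_mem' := fun r p hp => ⟨by rw [Prod.smul_snd, map_smul, hp.1, Prod.smul_fst],
        K.smul_mem r hp.2⟩ }
  have hG : IsClosed (G : Set (Lp ℝ 2 m × 𝓔.EnergySpace α)) :=
    (isClosed_eq (by fun_prop) continuous_fst).inter (hK.preimage continuous_snd)
  obtain ⟨w, hw, hwc⟩ := exists_mem_of_tendsto_of_norm_le G hG (fun n => (𝓔.toL2 α (v n), v n))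
    (fun n => ⟨rfl, hv n⟩) u hu b c hb hbc
  exact ⟨w, hw.2, hw.1, hwc⟩

end Energy

end DirichletForm
end

noncomputable section


/-! ## Preliminaries on `L²(m)` -/

section LpTwo

variable {X : Type*} [MeasurableSpace X] {m : Measure X}

theorem Lp_two_inner_eq (f g : Lp ℝ 2 m) : ⟪f, g⟫_ℝ = ∫ x, f x * g x ∂m := by
  rw [L2.inner_def]
  exact integral_congr_ae (Eventually.of_forall fun x => by simp [mul_comm])

theorem Lp_two_norm_sq_eq (f : Lp ℝ 2 m) : ‖f‖ ^ 2 = ∫ x, f x ^ 2 ∂m := by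
  rw [← real_inner_self_eq_norm_sq, Lp_two_inner_eq]
  simp only [pow_two]

theorem Lp_two_integrable_mul (f g : Lp ℝ 2 m) : Integrable (fun x => f x * g x) m :=
  (Lp.memLp f).integrable_mul (Lp.memLp g)

/-- Dominated convergence for the squares `(f n - g) ^ 2`, whose majorant `b ^ 2` is integrable
because `b` is in `L²`. -/
theorem Lp_two_tendsto_of_dominated (f : ℕ → Lp ℝ 2 m) (g b : Lp ℝ 2 m)
    (hb : ∀ n, ∀ᵐ x ∂m, |f n x - g x| ≤ b x)
    (hlim : ∀ᵐ x ∂m, Tendsto (fun n => f n x) atTop (𝓝 (g x))) :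
    Tendsto f atTop (𝓝 g) := by
  have h1 : Tendsto (fun n => ∫ x, (f n x - g x) ^ 2 ∂m) atTop (𝓝 (∫ _, (0 : ℝ) ∂m)) := by
    refine tendsto_integral_of_dominated_convergence (fun x => b x ^ 2) (fun n => ?_) ?_
      (fun n => ?_) ?_
    · exact ((Lp.aestronglyMeasurable _).sub (Lp.aestronglyMeasurable _)).pow 2
    · exact (Lp.memLp b).integrable_sq
    · filter_upwards [hb n] with x hx
      rw [Real.norm_eq_abs, abs_pow]
      gcongr
    · filter_upwards [hlim] with x hx
      simpa using (hx.sub_const (g x)).pow 2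
  have h2 : ∀ n, ∫ x, (f n x - g x) ^ 2 ∂m = ‖f n - g‖ ^ 2 := by
    intro n
    rw [Lp_two_norm_sq_eq]
    refine integral_congr_ae ?_
    filter_upwards [Lp.coeFn_sub (f n) g] with x hx
    rw [hx, Pi.sub_apply]
  simp only [h2, integral_zero] at h1
  rw [tendsto_iff_norm_sub_tendsto_zero]
  simpa using h1.sqrt

/-- The unit contraction `x ↦ (x ∨ 0) ∧ 1`. -/
def unitClip (x : ℝ) : ℝ := min (max x 0) 1

theorem lipschitzWith_unitClip : LipschitzWith 1 unitClip :=
  (LipschitzWith.id.max_const 0).min_const 1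

theorem unitClip_zero : unitClip 0 = 0 := by simp [unitClip]

/-- The unit contraction of an element of `L²(m)`. -/
def clipL2 (f : Lp ℝ 2 m) : Lp ℝ 2 m := lipschitzWith_unitClip.compLp unitClip_zero f

theorem coeFn_clipL2 (f : Lp ℝ 2 m) : clipL2 f =ᵐ[m] fun x => min (max (f x) 0) 1 :=
  lipschitzWith_unitClip.coeFn_compLp unitClip_zero f

theorem norm_clipL2_le (f : Lp ℝ 2 m) : ‖clipL2 f‖ ≤ ‖f‖ := by
  simpa [clipL2] using lipschitzWith_unitClip.norm_compLp_le unitClip_zero f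

theorem norm_clipL2_sub_le (f g : Lp ℝ 2 m) : ‖clipL2 f - clipL2 g‖ ≤ ‖f - g‖ := by
  simpa [clipL2] using lipschitzWith_unitClip.norm_compLp_sub_le unitClip_zero f g

theorem continuous_clipL2 : Continuous (clipL2 : Lp ℝ 2 m → Lp ℝ 2 m) :=
  lipschitzWith_unitClip.continuous_compLp unitClip_zero

theorem clipL2_eq_self_iff (f : Lp ℝ 2 m) : clipL2 f = f ↔ ∀ᵐ x ∂m, 0 ≤ f x ∧ f x ≤ 1 := by
  constructor
  · intro h
    filter_upwards [coeFn_clipL2 f] with x hx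
    rw [h] at hx
    rw [hx]
    exact ⟨le_min (le_max_right _ _) zero_le_one, min_le_right _ _⟩
  · intro h
    refine Lp.ext ?_
    filter_upwards [coeFn_clipL2 f, h] with x hx hx2
    rw [hx, max_eq_left hx2.1, min_eq_left hx2.2]

theorem isClosed_unit_valued : IsClosed {f : Lp ℝ 2 m | ∀ᵐ x ∂m, 0 ≤ f x ∧ f x ≤ 1} := by
  simp_rw [← clipL2_eq_self_iff]
  exact isClosed_eq continuous_clipL2 continuous_id

theorem convex_unit_valued : Convex ℝ {f : Lp ℝ 2 m | ∀ᵐ x ∂m, 0 ≤ f x ∧ f x ≤ 1} := by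
  intro f hf g hg a b ha hb hab
  filter_upwards [hf, hg, Lp.coeFn_add (a • f) (b • g), Lp.coeFn_smul a f, Lp.coeFn_smul b g]
    with x h1 h2 h3 h4 h5
  rw [h3, Pi.add_apply, h4, h5]
  simp only [Pi.smul_apply, smul_eq_mul]
  constructor
  · have := mul_nonneg ha h1.1; have := mul_nonneg hb h2.1; positivity
  · nlinarith

/-- The truncations `(f ∨ 0) ∧ n` converge to the positive part. -/
theorem tendsto_smul_clipL2 (f : Lp ℝ 2 m) :
    Tendsto (fun n : ℕ => ((n : ℝ) + 1) • clipL2 (((n : ℝ) + 1)⁻¹ • f)) atTop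
      (𝓝 (Lp.posPart f)) := by
  have key : ∀ n : ℕ, ∀ᵐ x ∂m, (((n : ℝ) + 1) • clipL2 (((n : ℝ) + 1)⁻¹ • f)) x
      = min (max (f x) 0) (n + 1) := by
    intro n
    filter_upwards [Lp.coeFn_smul ((n : ℝ) + 1) (clipL2 (((n : ℝ) + 1)⁻¹ • f)),
      coeFn_clipL2 (((n : ℝ) + 1)⁻¹ • f), Lp.coeFn_smul ((n : ℝ) + 1)⁻¹ f] with x h1 h2 h3
    have hn : (0 : ℝ) < n + 1 := by positivity
    rw [h1, Pi.smul_apply, h2, h3, Pi.smul_apply, smul_eq_mul, smul_eq_mul, mul_min_of_nonneg _ _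
      hn.le, mul_max_of_nonneg _ _ hn.le, mul_inv_cancel_left₀ hn.ne', mul_zero, mul_one]
  refine Lp_two_tendsto_of_dominated _ _ |f| (fun n => ?_) ?_
  · filter_upwards [key n, Lp.coeFn_posPart f, Lp.coeFn_abs f] with x h1 h2 h3
    rw [h1, h2, h3]
    have hn : (0 : ℝ) < n + 1 := by positivity
    rcases le_total (max (f x) 0) (n + 1) with h | h
    · simp [min_eq_left h]
    · rw [min_eq_right h, abs_sub_comm, abs_of_nonneg (by linarith)]
      have : max (f x) 0 ≤ |f x| := max_le (le_abs_self _) (abs_nonneg _)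
      linarith
  · filter_upwards [ae_all_iff.2 key, Lp.coeFn_posPart f] with x h1 h2
    rw [h2]
    refine tendsto_const_nhds.congr' ?_
    obtain ⟨N, hN⟩ := exists_nat_ge (max (f x) 0)
    filter_upwards [eventually_ge_atTop N] with n hn
    rw [h1, min_eq_left]
    have : (N : ℝ) ≤ n := by exact_mod_cast hn
    linarith

end LpTwo

namespace DirichletForm

variable {X : Type*} [MeasurableSpace X] {m : Measure X} {𝓔 : DirichletForm m}

/-! ## Contractions -/

theorem clipL2_mem (u : 𝓔.domain) : ∃ h : clipL2 (u : Lp ℝ 2 m) ∈ 𝓔.domain,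
    𝓔.form ⟨_, h⟩ ⟨_, h⟩ ≤ 𝓔.form u u :=
  𝓔.markov' u _ (coeFn_clipL2 _)

/-- Rescaling the unit contraction gives truncations at height `n + 1` that do not increase the
energy. They converge in `L²` to the positive part, and the energy is lower semicontinuous. -/
theorem posPart_mem {α : Ioi (0 : ℝ)} (u : 𝓔.domain) :
    ∃ v : 𝓔.domain, (v : Lp ℝ 2 m) = Lp.posPart (u : Lp ℝ 2 m) ∧
      ‖𝓔.toEnergy α v‖ ≤ ‖𝓔.toEnergy α u‖ := by
  have h : ∀ n : ℕ, ∃ v : 𝓔.domain,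
      (v : Lp ℝ 2 m) = ((n : ℝ) + 1) • clipL2 (((n : ℝ) + 1)⁻¹ • (u : Lp ℝ 2 m)) ∧
        ‖𝓔.toEnergy α v‖ ≤ ‖𝓔.toEnergy α u‖ := by
    intro n
    have hn : (0 : ℝ) < n + 1 := by positivity
    have hα : (0 : ℝ) < α := α.2
    obtain ⟨h1, h2⟩ := clipL2_mem (((n : ℝ) + 1)⁻¹ • u)
    have h3 := norm_clipL2_le ((((n : ℝ) + 1)⁻¹ • u : 𝓔.domain) : Lp ℝ 2 m)
    refine ⟨((n : ℝ) + 1) • ⟨_, h1⟩, rfl, ?_⟩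
    have h4 : ‖𝓔.toEnergy α ⟨_, h1⟩‖ ≤ ‖𝓔.toEnergy α (((n : ℝ) + 1)⁻¹ • u)‖ := by
      refine le_of_sq_le_sq ?_ (norm_nonneg _)
      rw [toEnergy_norm_sq, toEnergy_norm_sq]
      gcongr
    rw [map_smul, norm_smul, Real.norm_of_nonneg hn.le]
    rw [map_smul, norm_smul, norm_inv, Real.norm_of_nonneg hn.le] at h4
    calc _ ≤ ((n : ℝ) + 1) * (((n : ℝ) + 1)⁻¹ * ‖𝓔.toEnergy α u‖) := by gcongr
      _ = _ := by rw [mul_inv_cancel_left₀ hn.ne']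
  choose v hv hvn using h
  obtain ⟨w, -, hw, hwn⟩ := exists_limit_of_bounded ⊤ isClosed_univ
    (fun n => 𝓔.toEnergy α (v n)) (fun _ => trivial) (Lp.posPart (u : Lp ℝ 2 m)) (by simpa [toL2_toEnergy, hv] using tendsto_smul_clipL2 _)
    (fun _ => ‖𝓔.toEnergy α u‖) _ hvn tendsto_const_nhds
  exact ⟨𝓔.ofEnergy α w, hw, by simpa using hwn⟩

/-! ## The resolvent -/

variable (𝓔) in
/-- `G_α f` as an element of the domain. -/
def resolventDom (α : Ioi (0 : ℝ)) (f : Lp ℝ 2 m) : 𝓔.domain :=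
  𝓔.ofEnergy α ((𝓔.toL2 α).adjoint f)

variable (𝓔) in
/-- The resolvent `G_α` on `L²(m)`. -/
def resolvent (α : Ioi (0 : ℝ)) : Lp ℝ 2 m →L[ℝ] Lp ℝ 2 m := 𝓔.toL2 α ∘L (𝓔.toL2 α).adjoint

theorem coe_resolventDom (α : Ioi (0 : ℝ)) (f : Lp ℝ 2 m) :
    (𝓔.resolventDom α f : Lp ℝ 2 m) = 𝓔.resolvent α f := rfl

/-- `G_α` is the adjoint of the inclusion of the energy space into `L²`, so its defining equation is
the adjoint identity. -/
theorem formα_resolventDom (α : Ioi (0 : ℝ)) (f : Lp ℝ 2 m) (v : 𝓔.domain) :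
    𝓔.formα α (𝓔.resolventDom α f) v = ⟪f, (v : Lp ℝ 2 m)⟫_ℝ := by
  have := ContinuousLinearMap.adjoint_inner_left (𝓔.toL2 α) (𝓔.toEnergy α v) f
  rwa [energy_inner, toL2_toEnergy] at this

theorem eq_resolventDom (α : Ioi (0 : ℝ)) (f : Lp ℝ 2 m) (u : 𝓔.domain)
    (h : ∀ v : 𝓔.domain, 𝓔.formα α u v = ⟪f, (v : Lp ℝ 2 m)⟫_ℝ) : u = 𝓔.resolventDom α f := by
  refine (𝓔.toEnergy α).injective (ext_inner_right ℝ fun v => ?_)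
  have h1 := h (𝓔.ofEnergy α v)
  rw [← formα_resolventDom α] at h1
  simpa [energy_inner] using h1

theorem resolvent_symm (α : Ioi (0 : ℝ)) (f g : Lp ℝ 2 m) :
    ⟪𝓔.resolvent α f, g⟫_ℝ = ⟪f, 𝓔.resolvent α g⟫_ℝ := by
  rw [resolvent, ContinuousLinearMap.comp_apply, ContinuousLinearMap.comp_apply,
    ← ContinuousLinearMap.adjoint_inner_right, ContinuousLinearMap.adjoint_inner_left]

/-- Resolvent equation: `G_β f` solves the problem for `α` with right-hand side `f + (α - β) G_β f`,
and solutions are unique. -/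
theorem resolvent_eq (α β : Ioi (0 : ℝ)) (f : Lp ℝ 2 m) :
    𝓔.resolvent β f = 𝓔.resolvent α (f + ((α : ℝ) - β) • 𝓔.resolvent β f) := by
  rw [← coe_resolventDom, ← coe_resolventDom α]
  congr 1
  refine eq_resolventDom α _ _ fun v => ?_
  have h1 := formα_resolventDom β f v
  rw [inner_add_left, real_inner_smul_left, ← h1]
  simp only [formα]
  ring

/-- The resolvent equations for `(α, β)` and `(β, α)` are compared; the common terms cancel and `α -
β ≠ 0` can be divided out. -/
theorem resolvent_comm (α β : Ioi (0 : ℝ)) (f : Lp ℝ 2 m) :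
    𝓔.resolvent α (𝓔.resolvent β f) = 𝓔.resolvent β (𝓔.resolvent α f) := by
  rcases eq_or_ne α β with rfl | h
  · rfl
  have h1 := 𝓔.resolvent_eq α β f
  have h2 := 𝓔.resolvent_eq β α f
  rw [map_add, map_smul] at h1 h2
  have hne : (α : ℝ) - β ≠ 0 := sub_ne_zero.2 fun h' => h (Subtype.ext h')
  have h3 : ((α : ℝ) - β) • 𝓔.resolvent α (𝓔.resolvent β f)
      = ((α : ℝ) - β) • 𝓔.resolvent β (𝓔.resolvent α f) := by
    have h4 : ((β : ℝ) - α) • 𝓔.resolvent β (𝓔.resolvent α f)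
      = -(((α : ℝ) - β) • 𝓔.resolvent β (𝓔.resolvent α f)) := by rw [← neg_smul, neg_sub]
    rw [h4] at h2
    rw [← sub_eq_iff_eq_add'] at h1
    rw [← h1, ← sub_eq_zero, sub_sub, sub_eq_zero]
    exact (eq_add_neg_iff_add_eq.1 h2).symm
  exact smul_right_injective _ hne h3

theorem norm_smul_resolvent_le (α : Ioi (0 : ℝ)) (f : Lp ℝ 2 m) :
    ‖(α : ℝ) • 𝓔.resolvent α f‖ ≤ ‖f‖ := by
  have hα : (0 : ℝ) < α := α.2
  -- Testing the equation of `u = G_α f` with `u` and dropping the energy leaves `α ‖u‖² ≤ ⟪f, u⟫ ≤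
  -- ‖f‖ ‖u‖`.
  have h1 := formα_resolventDom α f (𝓔.resolventDom α f)
  rw [formα_self] at h1
  have h2 := 𝓔.nonneg' (𝓔.resolventDom α f)
  have h3 := real_inner_le_norm f (𝓔.resolventDom α f : Lp ℝ 2 m)
  rw [coe_resolventDom] at *
  rw [norm_smul, Real.norm_of_nonneg hα.le]
  rcases (norm_nonneg (𝓔.resolvent α f)).eq_or_lt with h | h
  · rw [← h]; simp
  · refine le_of_mul_le_mul_right ?_ h
    nlinarith

/-- The minimizing property of `α G_α f`. -/
theorem resolvent_minimizes (α : Ioi (0 : ℝ)) (f : Lp ℝ 2 m) (v : 𝓔.domain) :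
    𝓔.form v v + α * ‖(v : Lp ℝ 2 m) - f‖ ^ 2 =
      𝓔.form ((α : ℝ) • 𝓔.resolventDom α f) ((α : ℝ) • 𝓔.resolventDom α f)
        + α * ‖(α : ℝ) • 𝓔.resolvent α f - f‖ ^ 2
        + ‖𝓔.toEnergy α (v - (α : ℝ) • 𝓔.resolventDom α f)‖ ^ 2 := by
  set u := (α : ℝ) • 𝓔.resolventDom α f with hu
  have hu' : (u : Lp ℝ 2 m) = (α : ℝ) • 𝓔.resolvent α f := rfl
  -- The Euler–Lagrange equation of the functional `v ↦ 𝓔(v, v) + α ‖v - f‖²`; its instances for `u`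
  -- and `v` complete the square.
  have key : ∀ w : 𝓔.domain, 𝓔.form u w + α * ⟪(u : Lp ℝ 2 m), (w : Lp ℝ 2 m)⟫_ℝ
      = α * ⟪f, (w : Lp ℝ 2 m)⟫_ℝ := by
    intro w
    rw [← formα_resolventDom α f w, ← formα_smul_left]
    rfl
  have k1 := key u
  have k2 := key v
  have k3 := 𝓔.symm' v u
  rw [toEnergy_norm_sq, ← hu']
  rw [real_inner_self_eq_norm_sq] at k1
  simp only [map_sub, LinearMap.sub_apply, Submodule.coe_sub, norm_sub_sq_real, k3]
  rw [real_inner_comm f (u : Lp ℝ 2 m), real_inner_comm f (v : Lp ℝ 2 m),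
    real_inner_comm (u : Lp ℝ 2 m) (v : Lp ℝ 2 m)]
  linear_combination (-2) * k1 + 2 * k2

/-- With `f = v` in the variational problem, `v` itself is a competitor of value `𝓔(v, v)`. The
resulting rate in `α` gives strong continuity of the resolvent. -/
theorem norm_smul_resolvent_sub_sq_le (α : Ioi (0 : ℝ)) (v : 𝓔.domain) :
    α * ‖(α : ℝ) • 𝓔.resolvent α (v : Lp ℝ 2 m) - v‖ ^ 2 ≤ 𝓔.form v v := by
  have h := resolvent_minimizes α (v : Lp ℝ 2 m) v
  have h1 := 𝓔.nonneg' ((α : ℝ) • 𝓔.resolventDom α (v : Lp ℝ 2 m))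
  rw [sub_self, norm_zero] at h
  nlinarith [sq_nonneg ‖𝓔.toEnergy α (v - (α : ℝ) • 𝓔.resolventDom α (v : Lp ℝ 2 m))‖]

/-- Strong continuity of the resolvent. -/
theorem tendsto_smul_resolvent (α : ℕ → Ioi (0 : ℝ))
    (hα : Tendsto (fun n => (α n : ℝ)) atTop atTop) (f : Lp ℝ 2 m) :
    Tendsto (fun n => (α n : ℝ) • 𝓔.resolvent (α n) f) atTop (𝓝 f) := by
  rw [Metric.tendsto_atTop]
  intro ε hε
  obtain ⟨v, hv, hvf⟩ := Metric.mem_closure_iff.1 (𝓔.dense' f) (ε / 3) (by positivity)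
  have h1 : Tendsto (fun n => 𝓔.form ⟨v, hv⟩ ⟨v, hv⟩ / α n) atTop (𝓝 0) :=
    tendsto_const_nhds.div_atTop hα
  obtain ⟨N, hN⟩ := eventually_atTop.1 (h1.eventually (gt_mem_nhds (show 0 < (ε / 3) ^ 2 by
    positivity)))
  refine ⟨N, fun n hn => ?_⟩
  have hα0 : (0 : ℝ) < α n := (α n).2
  have h2 := norm_smul_resolvent_sub_sq_le (α n) (⟨v, hv⟩ : 𝓔.domain)
  have h3 : ‖(α n : ℝ) • 𝓔.resolvent (α n) v - v‖ < ε / 3 := by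
    refine lt_of_pow_lt_pow_left₀ 2 (by positivity) (lt_of_le_of_lt ?_ (hN n hn))
    rw [le_div_iff₀' hα0]
    exact h2
  have h4 := norm_smul_resolvent_le (𝓔 := 𝓔) (α n) (f - v)
  rw [dist_eq_norm] at hvf ⊢
  calc ‖(α n : ℝ) • 𝓔.resolvent (α n) f - f‖
      = ‖(α n : ℝ) • 𝓔.resolvent (α n) (f - v) + ((α n : ℝ) • 𝓔.resolvent (α n) v - v)
        - (f - v)‖ := by rw [map_sub, smul_sub]; congr 1; abel
    _ ≤ ‖(α n : ℝ) • 𝓔.resolvent (α n) (f - v)‖ + ‖(α n : ℝ) • 𝓔.resolvent (α n) v - v‖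
        + ‖f - v‖ := (norm_sub_le _ _).trans (add_le_add_left (norm_add_le _ _) _)
    _ < ε := by linarith

/-- The positive number `n + 1`. -/
def succPos (n : ℕ) : Ioi (0 : ℝ) := ⟨(n : ℝ) + 1, mem_Ioi.2 (Nat.cast_add_one_pos n)⟩

theorem tendsto_succPos : Tendsto (fun n => (succPos n : ℝ)) atTop atTop :=
  tendsto_atTop_add_const_right atTop (1 : ℝ) tendsto_natCast_atTop_atTop

/-- By the resolvent equation all resolvents have the same range, so the approximations `(n + 1)
G_{n+1} f` of `f` lie in the range of `G_α`. -/
theorem denseRange_resolvent (α : Ioi (0 : ℝ)) : DenseRange (𝓔.resolvent α) := by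
  intro f
  refine mem_closure_of_tendsto (tendsto_smul_resolvent (𝓔 := 𝓔) succPos tendsto_succPos f)
    (Eventually.of_forall fun n => ?_)
  rw [resolvent_eq α, ← map_smul]
  exact mem_range_self _

/-- The resolvent is sub-Markovian. -/
theorem clipL2_smul_resolvent (α : Ioi (0 : ℝ)) (f : Lp ℝ 2 m) (hf : clipL2 f = f) :
    clipL2 ((α : ℝ) • 𝓔.resolvent α f) = (α : ℝ) • 𝓔.resolvent α f := by
  have hα : (0 : ℝ) < α := α.2
  obtain ⟨h1, h2⟩ := clipL2_mem ((α : ℝ) • 𝓔.resolventDom α f)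
  -- Clipping `α G_α f` does not increase its energy, nor its distance to `f`, because `f` is fixed
  -- by the clipping. Hence the defect term in the minimizing identity vanishes.
  have h3 := resolvent_minimizes α f ⟨_, h1⟩
  have h4 : ‖clipL2 (((α : ℝ) • 𝓔.resolventDom α f : 𝓔.domain) : Lp ℝ 2 m) - f‖ ^ 2
      ≤ ‖(α : ℝ) • 𝓔.resolvent α f - f‖ ^ 2 := by
    gcongr
    have := norm_clipL2_sub_le ((α : ℝ) • 𝓔.resolvent α f) f
    rwa [hf] at this
  have h5 := mul_le_mul_of_nonneg_left h4 hα.le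
  have h6 : ‖𝓔.toEnergy α (⟨_, h1⟩ - (α : ℝ) • 𝓔.resolventDom α f)‖ ^ 2 = 0 :=
    le_antisymm (by linarith) (sq_nonneg _)
  rw [sq_eq_zero_iff, norm_eq_zero, LinearEquiv.map_eq_zero_iff, sub_eq_zero] at h6
  exact congrArg Subtype.val h6

end DirichletForm
end

noncomputable section


/-! ## Exponentials of `c (J - 1)` -/

section Exponential

variable {E : Type*} [NormedAddCommGroup E] [NormedSpace ℝ E] [CompleteSpace E]

/-- The semigroup `exp (t c (J - 1))`. -/
def poissonExp (J : E →L[ℝ] E) (c t : ℝ) : E →L[ℝ] E :=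
  Real.exp (-(c * t)) • NormedSpace.exp ((c * t) • J)

theorem poissonExp_zero (J : E →L[ℝ] E) (c : ℝ) : poissonExp J c 0 = 1 := by
  simp [poissonExp]

theorem poissonExp_add (J : E →L[ℝ] E) (c s t : ℝ) :
    poissonExp J c (s + t) = poissonExp J c s * poissonExp J c t := by
  let : NormedAlgebra ℚ (E →L[ℝ] E) := NormedAlgebra.restrictScalars ℚ ℝ _
  rw [poissonExp, poissonExp, poissonExp, mul_add, add_smul, NormedSpace.exp_add_of_commute
    ((Commute.refl J).smul_left _ |>.smul_right _), smul_mul_smul_comm, ← Real.exp_add]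
  congr 2
  ring

theorem hasDerivAt_poissonExp (J : E →L[ℝ] E) (c t : ℝ) :
    HasDerivAt (poissonExp J c) (poissonExp J c t * (c • (J - 1))) t := by
  have h1 : HasDerivAt (fun t : ℝ => c * t) c t := by
    simpa using (hasDerivAt_id t).const_mul c
  have h2 : HasDerivAt (fun t : ℝ => NormedSpace.exp ((c * t) • J))
      (c • (NormedSpace.exp ((c * t) • J) * J)) t :=
    HasDerivAt.scomp t (hasDerivAt_exp_smul_const J (c * t)) h1
  have h3 := (h1.neg.exp).smul h2
  refine HasDerivAt.congr_deriv (f := poissonExp J c) h3 ?_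
  simp only [poissonExp, mul_smul_comm, mul_sub, mul_one, smul_mul_assoc, smul_sub]
  module

theorem commute_poissonExp {J K : E →L[ℝ] E} (h : Commute K J) (c t : ℝ) :
    Commute K (poissonExp J c t) := by
  let : NormedAlgebra ℚ (E →L[ℝ] E) := NormedAlgebra.restrictScalars ℚ ℝ _
  exact ((h.smul_right _).exp_right).smul_right _

/-- A closed convex set that contains `0` and is invariant under `J` is invariant under
`exp (t c (J - 1))`. -/
theorem poissonExp_mem {C : Set E} (hC : IsClosed C) (hconv : Convex ℝ C) (h0 : (0 : E) ∈ C)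
    (J : E →L[ℝ] E) (hJ : ∀ x ∈ C, J x ∈ C) {c t : ℝ} (hc : 0 ≤ c) (ht : 0 ≤ t) {x : E}
    (hx : x ∈ C) : poissonExp J c t x ∈ C := by
  set s := c * t with hs
  have hs0 : 0 ≤ s := mul_nonneg hc ht
  have hpow : ∀ k : ℕ, (J ^ k) x ∈ C := by
    intro k
    induction k with
    | zero => simpa using hx
    | succ k ih => rw [pow_succ']; exact hJ _ ih
  -- `exp (t c (J - 1)) x` is the mean of `J ^ k x` for `k` with the Poisson law of parameter `s`.
  have hsum : HasSum (fun k : ℕ => Real.exp (-s) • ((k.factorial : ℝ)⁻¹ * s ^ k) • (J ^ k) x)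
      (poissonExp J c t x) := by
    have h1 := NormedSpace.exp_series_hasSum_exp' (𝕂 := ℝ) (s • J)
    have h2 := (ContinuousLinearMap.apply ℝ E x).hasSum h1
    simp only [ContinuousLinearMap.apply_apply, smul_pow, smul_smul] at h2
    exact h2.const_smul (Real.exp (-s))
  have hexp : HasSum (fun k : ℕ => (k.factorial : ℝ)⁻¹ * s ^ k) (Real.exp s) := by
    have h1 := NormedSpace.exp_series_hasSum_exp' (𝕂 := ℝ) s
    rw [← Real.exp_eq_exp_ℝ] at h1
    simpa using h1
  refine hC.mem_of_tendsto hsum.tendsto_sum_nat (Eventually.of_forall fun N => ?_)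
  have hw : ∀ k : ℕ, 0 ≤ Real.exp (-s) * ((k.factorial : ℝ)⁻¹ * s ^ k) := fun k => by positivity
  -- Partial sums have total weight at most `1`; the missing weight can be put on `0 ∈ C`.
  have hW : ∑ k ∈ Finset.range N, Real.exp (-s) * ((k.factorial : ℝ)⁻¹ * s ^ k) ≤ 1 := by
    rw [← Finset.mul_sum, Real.exp_neg, inv_mul_le_iff₀ (Real.exp_pos _), mul_one]
    exact sum_le_hasSum _ (fun k _ => by positivity) hexp
  simp only [smul_smul]
  set W := ∑ k ∈ Finset.range N, Real.exp (-s) * ((k.factorial : ℝ)⁻¹ * s ^ k) with hWdef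
  rcases (Finset.sum_nonneg fun k (_ : k ∈ Finset.range N) => hw k).eq_or_lt with h | h
  · have h3 := (Finset.sum_eq_zero_iff_of_nonneg fun k _ => hw k).1 h.symm
    rw [Finset.sum_eq_zero fun k hk => by rw [h3 k hk, zero_smul]]
    exact h0
  · rw [← hWdef] at h
    have h4 := hconv.smul_mem_of_zero_mem h0 (hconv.sum_mem (t := Finset.range N)
      (w := fun k => W⁻¹ * (Real.exp (-s) * ((k.factorial : ℝ)⁻¹ * s ^ k)))
      (z := fun k => (J ^ k) x) (fun k _ => mul_nonneg (inv_nonneg.2 h.le) (hw k))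
      (by rw [← Finset.mul_sum, ← hWdef, inv_mul_cancel₀ h.ne']) (fun k _ => hpow k))
      (t := W) ⟨h.le, hW⟩
    rw [Finset.smul_sum] at h4
    simpa only [smul_smul, mul_inv_cancel_left₀ h.ne'] using h4

theorem norm_poissonExp_apply_le (J : E →L[ℝ] E) (hJ : ∀ x, ‖J x‖ ≤ ‖x‖) {c t : ℝ} (hc : 0 ≤ c)
    (ht : 0 ≤ t) (x : E) : ‖poissonExp J c t x‖ ≤ ‖x‖ := by
  have := poissonExp_mem (C := Metric.closedBall (0 : E) ‖x‖) Metric.isClosed_closedBall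
    (convex_closedBall _ _) (by simp) J
    (fun y hy => by simpa using (hJ y).trans (by simpa using hy)) hc ht (x := x) (by simp)
  simpa using this

/-- Comparison of an approximate solution of `S' = c (J - 1) S` with the exponential. -/
theorem norm_sub_poissonExp_le (J : E →L[ℝ] E) (hJ : ∀ x, ‖J x‖ ≤ ‖x‖) {c t : ℝ} (hc : 0 ≤ c)
    (ht : 0 ≤ t) (S S' : ℝ → E) (ε : ℝ)
    (hS : ∀ s ∈ Icc 0 t, HasDerivAt S (S' s) s)
    (hε : ∀ s ∈ Icc 0 t, ‖S' s - c • (J (S s) - S s)‖ ≤ ε) :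
    ‖S t - poissonExp J c t (S 0)‖ ≤ ε * t := by
  -- Duhamel's argument: along `s ↦ exp ((t - s) c (J - 1)) S(s)` only the defect of the equation
  -- contributes to the derivative, and the exponentials are contractions.
  have hder : ∀ s ∈ Icc 0 t, HasDerivWithinAt (fun s => poissonExp J c (t - s) (S s))
      (poissonExp J c (t - s) (S' s - c • (J (S s) - S s))) (Icc 0 t) s := by
    intro s hs
    have h1 : HasDerivAt (fun s => poissonExp J c (t - s))
        (-(poissonExp J c (t - s) * (c • (J - 1)))) s := by
      have h0 := HasDerivAt.scomp s (hasDerivAt_poissonExp J c (t - s))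
        ((hasDerivAt_id s).const_sub t)
      rwa [neg_one_smul] at h0
    have h2 := h1.clm_apply (hS s hs)
    convert h2.hasDerivWithinAt using 1
    simp only [neg_apply, mul_apply_eq_comp,
      smul_apply, sub_apply, one_apply_eq_self,
      map_sub]
    abel
  have := norm_image_sub_le_of_norm_deriv_le_segment' hder (C := ε) (fun s hs =>
    (norm_poissonExp_apply_le J hJ hc (sub_nonneg.2 hs.2.le) _).trans (hε s ⟨hs.1, hs.2.le⟩))
    t ⟨ht, le_rfl⟩
  simpa [poissonExp_zero] using this

end Exponential

namespace DirichletForm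

variable {X : Type*} [MeasurableSpace X] {m : Measure X} {𝓔 : DirichletForm m}

/-! ## The semigroup -/

variable (𝓔) in
/-- The contraction `(n + 1) G_{n + 1}`. -/
def scaledResolvent (n : ℕ) : Lp ℝ 2 m →L[ℝ] Lp ℝ 2 m :=
  (succPos n : ℝ) • 𝓔.resolvent (succPos n)

theorem norm_scaledResolvent_le (n : ℕ) (f : Lp ℝ 2 m) : ‖𝓔.scaledResolvent n f‖ ≤ ‖f‖ :=
  norm_smul_resolvent_le _ _

variable (𝓔) in
/-- The exponential of the Yosida approximation of the generator. -/
def yosidaExp (n : ℕ) (t : ℝ) : Lp ℝ 2 m →L[ℝ] Lp ℝ 2 m :=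
  poissonExp (𝓔.scaledResolvent n) (succPos n) t

theorem succPos_nonneg (n : ℕ) : (0 : ℝ) ≤ succPos n := (succPos n).2.le

theorem norm_yosidaExp_le (n : ℕ) {t : ℝ} (ht : 0 ≤ t) (f : Lp ℝ 2 m) :
    ‖𝓔.yosidaExp n t f‖ ≤ ‖f‖ :=
  norm_poissonExp_apply_le _ (norm_scaledResolvent_le n) (succPos_nonneg n) ht f

/-- The Yosida approximation of the generator on the range of the resolvent. -/
theorem yosida_resolvent (n : ℕ) (α : Ioi (0 : ℝ)) (h : Lp ℝ 2 m) :
    (succPos n : ℝ) • (𝓔.scaledResolvent n (𝓔.resolvent α h) - 𝓔.resolvent α h)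
      = 𝓔.scaledResolvent n ((α : ℝ) • 𝓔.resolvent α h - h) := by
  have h1 := 𝓔.resolvent_eq (succPos n) α h
  simp only [scaledResolvent, smul_apply]
  congr 1
  nth_rewrite 2 [h1]
  rw [← map_smul, ← map_sub]
  congr 1
  module

/-- The curve `s ↦ yosidaExp n s f` is an approximate solution of the `k`-th equation. All operators
commute, so its defect at time `s` is a contraction applied to the difference of the two approximate
generators at `f`. -/
theorem norm_yosidaExp_sub_le (n k : ℕ) {t : ℝ} (ht : 0 ≤ t) (f : Lp ℝ 2 m) :
    ‖𝓔.yosidaExp n t f - 𝓔.yosidaExp k t f‖ ≤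
      ‖(succPos n : ℝ) • (𝓔.scaledResolvent n f - f)
        - (succPos k : ℝ) • (𝓔.scaledResolvent k f - f)‖ * t := by
  have hcomm : Commute (𝓔.scaledResolvent k) (𝓔.yosidaExp n t) := by
    refine commute_poissonExp ?_ _ _
    refine Commute.smul_left (Commute.smul_right ?_ _) _
    exact ContinuousLinearMap.ext fun f => resolvent_comm _ _ f
  have hcomm' : ∀ s f, 𝓔.scaledResolvent k (𝓔.yosidaExp n s f)
      = 𝓔.yosidaExp n s (𝓔.scaledResolvent k f) := by
    intro s f
    have : Commute (𝓔.scaledResolvent k) (𝓔.yosidaExp n s) := by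
      refine commute_poissonExp ?_ _ _
      refine Commute.smul_left (Commute.smul_right ?_ _) _
      exact ContinuousLinearMap.ext fun f => resolvent_comm _ _ f
    exact congrArg (fun A : Lp ℝ 2 m →L[ℝ] Lp ℝ 2 m => A f) this
  have := norm_sub_poissonExp_le (𝓔.scaledResolvent k) (norm_scaledResolvent_le k)
    (succPos_nonneg k) ht (fun s => 𝓔.yosidaExp n s f)
    (fun s => 𝓔.yosidaExp n s ((succPos n : ℝ) • (𝓔.scaledResolvent n f - f)))
    ‖(succPos n : ℝ) • (𝓔.scaledResolvent n f - f)
        - (succPos k : ℝ) • (𝓔.scaledResolvent k f - f)‖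
    (fun s hs => by
      have := (hasDerivAt_poissonExp (𝓔.scaledResolvent n) (succPos n) s).clm_apply
        (hasDerivAt_const s f)
      simpa [yosidaExp] using this)
    (fun s hs => by
      rw [hcomm', ← map_sub, ← map_smul, ← map_sub]
      exact norm_yosidaExp_le n hs.1 _)
  simpa [yosidaExp, poissonExp_zero] using this

/-- The generator should map `G_α h` to `α G_α h - h`, and the Yosida approximations converge to
this. Since the range of `G_α` is dense, this is all the convergence that is needed. -/
theorem tendsto_yosida_resolvent (α : Ioi (0 : ℝ)) (h : Lp ℝ 2 m) :
    Tendsto (fun n => (succPos n : ℝ) • (𝓔.scaledResolvent n (𝓔.resolvent α h) - 𝓔.resolvent α h))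
      atTop (𝓝 ((α : ℝ) • 𝓔.resolvent α h - h)) := by
  simp only [yosida_resolvent]
  exact tendsto_smul_resolvent succPos tendsto_succPos _

/-- Pointwise convergence of contractions on a dense set extends to the whole space. -/
theorem tendsto_of_tendsto_on_denseRange {E F ι : Type*} [NormedAddCommGroup E]
    [NormedAddCommGroup F] [NormedSpace ℝ E] [NormedSpace ℝ F] {l : Filter ι}
    (A : ι → E →L[ℝ] F) (B : E →L[ℝ] F) (hA : ∀ n x, ‖A n x‖ ≤ ‖x‖) (hB : ∀ x, ‖B x‖ ≤ ‖x‖)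
    {κ : Type*} {g : κ → E} (hg : DenseRange g)
    (h : ∀ k, Tendsto (fun n => A n (g k)) l (𝓝 (B (g k)))) (x : E) :
    Tendsto (fun n => A n x) l (𝓝 (B x)) := by
  rw [Metric.tendsto_nhds]
  intro ε hε
  obtain ⟨k, hk⟩ := hg.exists_dist_lt x (show 0 < ε / 3 by positivity)
  filter_upwards [Metric.tendsto_nhds.1 (h k) (ε / 3) (by positivity)] with n hn
  rw [dist_eq_norm] at *
  have h1 := hA n (x - g k)
  have h2 := hB (x - g k)
  calc ‖A n x - B x‖ = ‖A n (x - g k) + (A n (g k) - B (g k)) - B (x - g k)‖ := by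
        rw [map_sub, map_sub]; congr 1; abel
    _ ≤ ‖A n (x - g k)‖ + ‖A n (g k) - B (g k)‖ + ‖B (x - g k)‖ :=
        (norm_sub_le _ _).trans (add_le_add_left (norm_add_le _ _) _)
    _ < ε := by linarith

theorem cauchySeq_yosidaExp {t : ℝ} (ht : 0 ≤ t) (f : Lp ℝ 2 m) :
    CauchySeq fun n => 𝓔.yosidaExp n t f := by
  rw [Metric.cauchySeq_iff]
  intro ε hε
  obtain ⟨h, hh⟩ := (denseRange_resolvent (𝓔 := 𝓔) (succPos 0)).exists_dist_lt f
    (show 0 < ε / 3 by positivity)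
  -- The divisor `t + 1` instead of `t` covers `t = 0`.
  obtain ⟨N, hN⟩ := Metric.cauchySeq_iff.1 (tendsto_yosida_resolvent (𝓔 := 𝓔) (succPos 0) h).cauchySeq
    (ε / 3 / (t + 1)) (by positivity)
  refine ⟨N, fun n hn k hk => ?_⟩
  have h1 := norm_yosidaExp_le (𝓔 := 𝓔) n ht (f - 𝓔.resolvent (succPos 0) h)
  have h2 := norm_yosidaExp_le (𝓔 := 𝓔) k ht (f - 𝓔.resolvent (succPos 0) h)
  have h3 := norm_yosidaExp_sub_le (𝓔 := 𝓔) n k ht (𝓔.resolvent (succPos 0) h)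
  have h4 := hN n hn k hk
  rw [dist_eq_norm] at *
  rw [lt_div_iff₀ (by positivity)] at h4
  have h5 : ‖𝓔.yosidaExp n t (𝓔.resolvent (succPos 0) h)
      - 𝓔.yosidaExp k t (𝓔.resolvent (succPos 0) h)‖ < ε / 3 := by
    refine h3.trans_lt (lt_of_le_of_lt ?_ h4)
    gcongr
    linarith
  calc ‖𝓔.yosidaExp n t f - 𝓔.yosidaExp k t f‖
      = ‖𝓔.yosidaExp n t (f - 𝓔.resolvent (succPos 0) h)
        + (𝓔.yosidaExp n t (𝓔.resolvent (succPos 0) h)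
          - 𝓔.yosidaExp k t (𝓔.resolvent (succPos 0) h))
        - 𝓔.yosidaExp k t (f - 𝓔.resolvent (succPos 0) h)‖ := by
        rw [map_sub, map_sub]; congr 1; abel
    _ ≤ _ := (norm_sub_le _ _).trans (add_le_add_left (norm_add_le _ _) _)
    _ < ε := by linarith

theorem exists_tendsto_yosidaExp (t : ℝ≥0) :
    ∃ F : Lp ℝ 2 m → Lp ℝ 2 m, Tendsto (fun n f => 𝓔.yosidaExp n t f) atTop (𝓝 F) := by
  have h : ∀ f : Lp ℝ 2 m, ∃ g, Tendsto (fun n => 𝓔.yosidaExp n t f) atTop (𝓝 g) := fun f =>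
    cauchySeq_tendsto_of_complete (cauchySeq_yosidaExp t.2 f)
  choose F hF using h
  exact ⟨F, tendsto_pi_nhds.2 hF⟩

variable (𝓔) in
/-- The semigroup of a Dirichlet form. -/
def semigroup (t : ℝ≥0) : Lp ℝ 2 m →L[ℝ] Lp ℝ 2 m :=
  continuousLinearMapOfTendsto (fun n => 𝓔.yosidaExp n t) (exists_tendsto_yosidaExp t).choose_spec

theorem tendsto_yosidaExp (t : ℝ≥0) (f : Lp ℝ 2 m) :
    Tendsto (fun n => 𝓔.yosidaExp n t f) atTop (𝓝 (𝓔.semigroup t f)) :=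
  tendsto_pi_nhds.1 (exists_tendsto_yosidaExp t).choose_spec f

theorem norm_semigroup_le (t : ℝ≥0) (f : Lp ℝ 2 m) : ‖𝓔.semigroup t f‖ ≤ ‖f‖ :=
  le_of_tendsto (tendsto_yosidaExp t f).norm
    (Eventually.of_forall fun n => norm_yosidaExp_le n t.2 f)

theorem tendsto_yosidaExp_of_tendsto (t : ℝ≥0) {g : ℕ → Lp ℝ 2 m} {f : Lp ℝ 2 m}
    (hg : Tendsto g atTop (𝓝 f)) :
    Tendsto (fun n => 𝓔.yosidaExp n t (g n)) atTop (𝓝 (𝓔.semigroup t f)) := by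
  have h1 : Tendsto (fun n => 𝓔.yosidaExp n t (g n - f)) atTop (𝓝 0) :=
    squeeze_zero_norm (fun n => norm_yosidaExp_le n t.2 _) (tendsto_iff_norm_sub_tendsto_zero.1 hg)
  have h2 := h1.add (tendsto_yosidaExp (𝓔 := 𝓔) t f)
  simpa [map_sub] using h2

theorem semigroup_zero (f : Lp ℝ 2 m) : 𝓔.semigroup 0 f = f := by
  refine tendsto_nhds_unique (tendsto_yosidaExp 0 f) ?_
  simp [yosidaExp, poissonExp_zero]

theorem semigroup_add (s t : ℝ≥0) (f : Lp ℝ 2 m) :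
    𝓔.semigroup (s + t) f = 𝓔.semigroup s (𝓔.semigroup t f) := by
  refine tendsto_nhds_unique (tendsto_yosidaExp (s + t) f) ?_
  refine (tendsto_yosidaExp_of_tendsto s (tendsto_yosidaExp t f)).congr fun n => ?_
  rw [yosidaExp, yosidaExp, yosidaExp, NNReal.coe_add, poissonExp_add]
  rfl

theorem semigroup_symm (t : ℝ≥0) (f g : Lp ℝ 2 m) :
    ⟪𝓔.semigroup t f, g⟫_ℝ = ⟪f, 𝓔.semigroup t g⟫_ℝ := by
  refine tendsto_nhds_unique ((tendsto_yosidaExp t f).inner tendsto_const_nhds)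
    ((tendsto_const_nhds.inner (tendsto_yosidaExp t g)).congr fun n => ?_)
  have h1 : IsSelfAdjoint (𝓔.scaledResolvent n) := by
    rw [ContinuousLinearMap.isSelfAdjoint_iff_isSymmetric]
    intro f g
    simp only [scaledResolvent, ContinuousLinearMap.coe_coe, smul_apply,
      real_inner_smul_left, real_inner_smul_right, resolvent_symm]
  have h2 : IsSelfAdjoint (𝓔.yosidaExp n t) := by
    refine IsSelfAdjoint.smul (IsSelfAdjoint.all _) ?_
    exact (IsSelfAdjoint.smul (IsSelfAdjoint.all _) h1).exp
  rw [ContinuousLinearMap.isSelfAdjoint_iff_isSymmetric] at h2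
  exact (h2 f g).symm

/-- Functions with values in `[0,1]` form a closed convex set that contains `0` and is invariant
under `(n + 1) G_{n+1}`, hence under the exponentials and their limit. -/
theorem clipL2_semigroup (t : ℝ≥0) (f : Lp ℝ 2 m) (hf : clipL2 f = f) :
    clipL2 (𝓔.semigroup t f) = 𝓔.semigroup t f := by
  rw [clipL2_eq_self_iff] at hf ⊢
  refine isClosed_unit_valued.mem_of_tendsto (tendsto_yosidaExp t f)
    (Eventually.of_forall fun n => ?_)
  refine poissonExp_mem isClosed_unit_valued convex_unit_valued ?_ _ (fun g hg => ?_)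
    (succPos_nonneg n) t.2 hf
  · filter_upwards [Lp.coeFn_zero ℝ 2 m] with x hx
    rw [hx]
    simp
  · exact (clipL2_eq_self_iff _).1 (clipL2_smul_resolvent _ _ ((clipL2_eq_self_iff _).2 hg))

/-- The constant curve at `G_α h`, with `α = succPos 0`, solves every Yosida equation up to a defect
of norm at most `‖α G_α h - h‖`. -/
theorem norm_semigroup_resolvent_sub_le (t : ℝ≥0) (h : Lp ℝ 2 m) :
    ‖𝓔.semigroup t (𝓔.resolvent (succPos 0) h) - 𝓔.resolvent (succPos 0) h‖
      ≤ ‖(succPos 0 : ℝ) • 𝓔.resolvent (succPos 0) h - h‖ * t := by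
  refine le_of_tendsto ((tendsto_yosidaExp t _).sub_const _).norm
    (Eventually.of_forall fun n => ?_)
  rw [norm_sub_rev]
  have := norm_sub_poissonExp_le (𝓔.scaledResolvent n) (norm_scaledResolvent_le n)
    (succPos_nonneg n) t.2 (fun _ => 𝓔.resolvent (succPos 0) h) (fun _ => 0)
    ‖(succPos 0 : ℝ) • 𝓔.resolvent (succPos 0) h - h‖ (fun s _ => hasDerivAt_const s _)
    (fun s _ => by
      rw [yosida_resolvent, zero_sub, norm_neg]
      exact norm_scaledResolvent_le n _)
  exact this

theorem continuous_semigroup (f : Lp ℝ 2 m) : Continuous fun t => 𝓔.semigroup t f := by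
  have h0 : ∀ f : Lp ℝ 2 m, Tendsto (fun t => 𝓔.semigroup t f) (𝓝 0) (𝓝 f) := by
    intro f
    refine tendsto_of_tendsto_on_denseRange 𝓔.semigroup (ContinuousLinearMap.id ℝ _)
      norm_semigroup_le (fun x => le_rfl) (denseRange_resolvent (𝓔 := 𝓔) (succPos 0))
      (fun h => ?_) f
    rw [tendsto_iff_norm_sub_tendsto_zero]
    refine squeeze_zero (fun _ => norm_nonneg _) (fun t => norm_semigroup_resolvent_sub_le t h) ?_
    have : Tendsto (fun t : ℝ≥0 => ‖(succPos 0 : ℝ) • 𝓔.resolvent (succPos 0) h - h‖ * (t : ℝ))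
        (𝓝 0) (𝓝 (‖(succPos 0 : ℝ) • 𝓔.resolvent (succPos 0) h - h‖ * ((0 : ℝ≥0) : ℝ))) :=
      (continuous_const.mul NNReal.continuous_coe).tendsto 0
    simpa using this
  -- Contractivity reduces continuity at any time to continuity at time `0`, applied to the time
  -- difference.
  have hmono : ∀ s t, s ≤ t → ‖𝓔.semigroup t f - 𝓔.semigroup s f‖
      ≤ ‖𝓔.semigroup (t - s) f - f‖ := by
    intro s t hst
    have : 𝓔.semigroup t f = 𝓔.semigroup s (𝓔.semigroup (t - s) f) := by
      rw [← semigroup_add, add_tsub_cancel_of_le hst]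
    rw [this, ← map_sub]
    exact norm_semigroup_le _ _
  rw [continuous_iff_continuousAt]
  intro t
  rw [ContinuousAt, tendsto_iff_norm_sub_tendsto_zero]
  have h1 : Tendsto (fun s : ℝ≥0 => ‖𝓔.semigroup (max s t - min s t) f - f‖) (𝓝 t) (𝓝 0) := by
    have h2 : Tendsto (fun s : ℝ≥0 => max s t - min s t) (𝓝 t) (𝓝 0) := by
      have : Continuous fun s : ℝ≥0 => max s t - min s t := by fun_prop
      simpa using this.tendsto t
    have := (((h0 f).comp h2).sub_const f).norm
    simpa using this
  refine squeeze_zero (fun _ => norm_nonneg _) (fun s => ?_) h1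
  rcases le_total s t with h | h
  · rw [max_eq_right h, min_eq_left h, norm_sub_rev]
    exact hmono s t h
  · rw [max_eq_left h, min_eq_right h]
    exact hmono t s h

theorem integrableOn_exp_smul_of_bounded {E : Type*} [NormedAddCommGroup E] [NormedSpace ℝ E]
    {α : ℝ} (hα : 0 < α) {F : ℝ → E} (hF : ContinuousOn F (Ici 0)) (C : ℝ)
    (hC : ∀ t ∈ Ioi (0 : ℝ), ‖F t‖ ≤ C) (a : ℝ) (ha : 0 ≤ a) :
    IntegrableOn (fun t => Real.exp (-(α * t)) • F t) (Ioi a) := by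
  have h1 : IntegrableOn (fun t => Real.exp (-α * t) * C) (Ioi a) :=
    (exp_neg_integrableOn_Ioi a hα).mul_const C
  refine Integrable.mono' h1 ?_ ?_
  · refine ContinuousOn.aestronglyMeasurable ?_ measurableSet_Ioi
    exact (by fun_prop : Continuous fun t => Real.exp (-(α * t))).continuousOn.smul
      (hF.mono fun t ht => ha.trans (le_of_lt ht))
  · refine (ae_restrict_mem measurableSet_Ioi).mono fun t ht => ?_
    rw [norm_smul, Real.norm_eq_abs, Real.abs_exp, neg_mul]
    gcongr
    exact hC t (ha.trans_lt ht)

/-- The integrand is the derivative of `-exp (-α t) yosidaExp n t g`, so only the boundary term at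
`0` remains: the Laplace transform inverts `α` minus the approximate generator. -/
theorem integral_yosidaExp (n : ℕ) (α : Ioi (0 : ℝ)) (g : Lp ℝ 2 m) :
    ∫ t in Ioi (0 : ℝ), Real.exp (-(α * t)) • 𝓔.yosidaExp n t
      ((α : ℝ) • g - (succPos n : ℝ) • (𝓔.scaledResolvent n g - g)) = g := by
  have hα : (0 : ℝ) < α := α.2
  have hd : ∀ t : ℝ, HasDerivAt (fun t => -(Real.exp (-(α * t)) • 𝓔.yosidaExp n t g))
      (Real.exp (-(α * t)) • 𝓔.yosidaExp n t
      ((α : ℝ) • g - (succPos n : ℝ) • (𝓔.scaledResolvent n g - g))) t := by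
    intro t
    have h1 : HasDerivAt (fun t : ℝ => Real.exp (-((α : ℝ) * t))) (Real.exp (-(α * t)) * -α) t := by
      simpa using ((hasDerivAt_id t).const_mul (α : ℝ)).neg.exp
    have h2 := (hasDerivAt_poissonExp (𝓔.scaledResolvent n) (succPos n) t).clm_apply
        (hasDerivAt_const t g)
    have h3 := (h1.smul h2).neg
    refine HasDerivAt.congr_deriv h3 ?_
    simp only [yosidaExp, mul_apply_eq_comp, smul_apply,
      sub_apply, one_apply_eq_self, map_sub, map_smul, map_zero,
      add_zero]
    module
  have hcont : Continuous fun t => 𝓔.yosidaExp n t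
      ((α : ℝ) • g - (succPos n : ℝ) • (𝓔.scaledResolvent n g - g)) :=
    continuous_iff_continuousAt.2 fun t => ((hasDerivAt_poissonExp (𝓔.scaledResolvent n)
      (succPos n) t).clm_apply (hasDerivAt_const t _)).continuousAt
  have h := integral_Ioi_of_hasDerivAt_of_tendsto (a := 0) (m := 0)
    (hd 0).continuousAt.continuousWithinAt (fun t _ => hd t)
    (integrableOn_exp_smul_of_bounded hα hcont.continuousOn _
      (fun t ht => norm_yosidaExp_le n (le_of_lt ht) _) 0 le_rfl) (by
      have h1 : Tendsto (fun t : ℝ => Real.exp (-(α * t)) * ‖g‖) atTop (𝓝 0) := by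
        have := (Real.tendsto_exp_neg_atTop_nhds_zero.comp
          (tendsto_id.const_mul_atTop hα)).mul_const ‖g‖
        simpa using this
      refine squeeze_zero_norm' ?_ h1
      filter_upwards [eventually_ge_atTop 0] with t ht
      rw [norm_neg, norm_smul, Real.norm_eq_abs, Real.abs_exp]
      gcongr
      exact norm_yosidaExp_le n ht g)
  rw [h]
  simp [yosidaExp, poissonExp_zero]

/-- For `g = G_α h`, applying `α` minus the `n`-th approximate generator to `g` gives vectors `y n`
that converge to `h`. The formula for the Yosida exponentials then passes to the limit by dominated
convergence. -/
theorem integral_semigroup (α : Ioi (0 : ℝ)) (h : Lp ℝ 2 m) :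
    ∫ t in Ioi (0 : ℝ), Real.exp (-(α * t)) • 𝓔.semigroup t.toNNReal h = 𝓔.resolvent α h := by
  have hα : (0 : ℝ) < α := α.2
  set g := 𝓔.resolvent α h
  set y : ℕ → Lp ℝ 2 m := fun n =>
    (α : ℝ) • g - (succPos n : ℝ) • (𝓔.scaledResolvent n g - g) with hy
  have hylim : Tendsto y atTop (𝓝 h) := by
    have := (tendsto_yosida_resolvent (𝓔 := 𝓔) α h).const_sub ((α : ℝ) • g)
    rwa [sub_sub_cancel] at this
  obtain ⟨C, hC⟩ := hylim.norm.bddAbove_range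
  have hint : ∀ n, ∫ t in Ioi (0 : ℝ), Real.exp (-(α * t)) • 𝓔.yosidaExp n t (y n) = g :=
    fun n => integral_yosidaExp n α g
  have hlim := tendsto_integral_of_dominated_convergence (μ := volume.restrict (Ioi (0 : ℝ)))
    (F := fun n t => Real.exp (-(α * t)) • 𝓔.yosidaExp n t (y n))
    (f := fun t => Real.exp (-(α * t)) • 𝓔.semigroup t.toNNReal h)
    (fun t => Real.exp (-α * t) * C) (fun n => by
      refine (Continuous.aestronglyMeasurable ?_)
      refine Continuous.smul (f := fun t : ℝ => Real.exp (-(α * t))) (by fun_prop) (continuous_iff_continuousAt.2 fun t =>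
        ((hasDerivAt_poissonExp (𝓔.scaledResolvent n)
          (succPos n) t).clm_apply (hasDerivAt_const t _)).continuousAt))
    ((exp_neg_integrableOn_Ioi 0 hα).mul_const C)
    (fun n => (ae_restrict_mem measurableSet_Ioi).mono fun t ht => by
      rw [norm_smul, Real.norm_eq_abs, Real.abs_exp, neg_mul]
      gcongr
      exact (norm_yosidaExp_le n (le_of_lt ht) _).trans (hC ⟨n, rfl⟩))
    ((ae_restrict_mem measurableSet_Ioi).mono fun t ht => by
      have := tendsto_yosidaExp_of_tendsto (𝓔 := 𝓔) t.toNNReal hylim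
      rw [Real.coe_toNNReal t (le_of_lt ht)] at this
      exact this.const_smul _)
  simp only [hint] at hlim
  exact (tendsto_nhds_unique hlim tendsto_const_nhds)

theorem isSemigroup_semigroup : 𝓔.IsSemigroup 𝓔.semigroup where
  zero := semigroup_zero
  add := semigroup_add
  contraction := norm_semigroup_le
  continuous := continuous_semigroup
  resolvent α hα f := ⟨𝓔.resolventDom ⟨α, hα⟩ f, (integral_semigroup ⟨α, hα⟩ f).symm,
    formα_resolventDom ⟨α, hα⟩ f⟩

end DirichletForm
end

noncomputable section


namespace DirichletForm

variable {X : Type*} [MeasurableSpace X] {m : Measure X} {𝓔 : DirichletForm m}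

/-! ## Uniqueness of the semigroup -/

section Uniqueness

variable {T : ℝ≥0 → Lp ℝ 2 m →L[ℝ] Lp ℝ 2 m}

theorem IsSemigroup.integral_eq (hT : 𝓔.IsSemigroup T) (α : Ioi (0 : ℝ)) (f : Lp ℝ 2 m) :
    ∫ t in Ioi (0 : ℝ), Real.exp (-(α * t)) • T t.toNNReal f = 𝓔.resolvent α f := by
  obtain ⟨u, hu, huv⟩ := hT.resolvent α α.2 f
  rw [← hu, ← coe_resolventDom]
  exact congrArg Subtype.val (eq_resolventDom α f u huv)

theorem IsSemigroup.continuous_toNNReal (hT : 𝓔.IsSemigroup T) (f : Lp ℝ 2 m) :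
    Continuous fun t : ℝ => T t.toNNReal f :=
  (hT.continuous f).comp continuous_real_toNNReal

theorem IsSemigroup.integrableOn (hT : 𝓔.IsSemigroup T) (α : Ioi (0 : ℝ)) (f : Lp ℝ 2 m) {a : ℝ}
    (ha : 0 ≤ a) : IntegrableOn (fun t : ℝ => Real.exp (-(α * t)) • T t.toNNReal f) (Ioi a) :=
  integrableOn_exp_smul_of_bounded α.2 (hT.continuous_toNNReal f).continuousOn ‖f‖
    (fun _ _ => hT.contraction _ f) a ha

theorem IsSemigroup.comm_resolvent (hT : 𝓔.IsSemigroup T) (α : Ioi (0 : ℝ)) (s : ℝ≥0)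
    (f : Lp ℝ 2 m) : 𝓔.resolvent α (T s f) = T s (𝓔.resolvent α f) := by
  rw [← hT.integral_eq, ← hT.integral_eq α f,
    ← ContinuousLinearMap.integral_comp_comm _ (hT.integrableOn α f le_rfl)]
  refine setIntegral_congr_fun measurableSet_Ioi fun t _ => ?_
  rw [map_smul, ← hT.add, ← hT.add, add_comm]

/-- Splitting the Laplace integral at `s` and shifting its tail by the semigroup law leaves an
integral over `[0, s]`. This makes `s ↦ T_s G_α h` differentiable without mention of a generator. -/
theorem IsSemigroup.apply_resolvent (hT : 𝓔.IsSemigroup T) (α : Ioi (0 : ℝ)) {s : ℝ} (hs : 0 ≤ s)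
    (h : Lp ℝ 2 m) : T s.toNNReal (𝓔.resolvent α h) = Real.exp (α * s) •
      (𝓔.resolvent α h - ∫ r in (0 : ℝ)..s, Real.exp (-(α * r)) • T r.toNNReal h) := by
  have h1 := intervalIntegral.integral_interval_add_Ioi (hT.integrableOn α h le_rfl)
    (hT.integrableOn α h hs)
  rw [hT.integral_eq] at h1
  rw [← h1, add_sub_cancel_left, h1, ← hT.integral_eq α h,
    ← ContinuousLinearMap.integral_comp_comm _ (hT.integrableOn α h le_rfl), ← integral_smul]
  have h2 := (measurePreserving_add_right volume s).setIntegral_preimage_emb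
    (measurableEmbedding_addRight s)
    (fun r => Real.exp (α * s) • Real.exp (-(α * r)) • T r.toNNReal h) (Ioi s)
  rw [← h2]
  have h3 : (fun x => x + s) ⁻¹' Ioi s = Ioi 0 := by
    ext x; simp
  rw [h3]
  refine setIntegral_congr_fun measurableSet_Ioi fun t ht => ?_
  have ht' : (0 : ℝ) < t := ht
  simp only [map_smul]
  rw [← hT.add, Real.toNNReal_add ht'.le hs, add_comm, smul_smul, ← Real.exp_add]
  congr 2
  ring

/-- A semigroup with the given resolvents solves the evolution equation on the range of `G_α`, and
comparison with the Yosida exponentials identifies it. A properly associated process therefore has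
the semigroup constructed above. -/
theorem IsSemigroup.eq_semigroup (hT : 𝓔.IsSemigroup T) : T = 𝓔.semigroup := by
  funext t
  set α : Ioi (0 : ℝ) := succPos 0
  refine ContinuousLinearMap.ext fun f => congrFun ((denseRange_resolvent (𝓔 := 𝓔) α).equalizer
    (T t).continuous (𝓔.semigroup t).continuous (funext fun h => ?_)) f
  change T t (𝓔.resolvent α h) = 𝓔.semigroup t (𝓔.resolvent α h)
  set f := 𝓔.resolvent α h
  -- `ψ` agrees with `s ↦ T_s f` for `s ≥ 0` but is defined smoothly across `0`, so that a two-sided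
  -- derivative exists there.
  set ψ : ℝ → Lp ℝ 2 m := fun s => Real.exp (α * s) •
      (f - ∫ r in (0 : ℝ)..s, Real.exp (-(α * r)) • T r.toNNReal h) with hψ
  have hψT : ∀ s, 0 ≤ s → ψ s = T s.toNNReal f := fun s hs => (hT.apply_resolvent α hs h).symm
  have hcont : Continuous fun r : ℝ => Real.exp (-((α : ℝ) * r)) • T r.toNNReal h :=
    Continuous.smul (f := fun r : ℝ => Real.exp (-((α : ℝ) * r))) (by fun_prop) (hT.continuous_toNNReal h)
  have hd : ∀ s, HasDerivAt ψ ((α : ℝ) • ψ s - T s.toNNReal h) s := by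
    intro s
    have h1 : HasDerivAt (fun s : ℝ => Real.exp ((α : ℝ) * s)) (Real.exp (α * s) * α) s := by
      simpa using ((hasDerivAt_id s).const_mul (α : ℝ)).exp
    have h2 := (hcont.integral_hasStrictDerivAt 0 s).hasDerivAt.const_sub f
    refine HasDerivAt.congr_deriv (h1.smul h2) ?_
    simp only [hψ, smul_neg, smul_smul, ← Real.exp_add]
    rw [add_neg_cancel, Real.exp_zero, one_smul, mul_comm (α : ℝ) (Real.exp _)]
    abel
  refine tendsto_nhds_unique ?_ (tendsto_yosidaExp t f)
  have hε : Tendsto (fun n => ‖((α : ℝ) • f - h)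
      - (succPos n : ℝ) • (𝓔.scaledResolvent n f - f)‖ * (t : ℝ)) atTop (𝓝 0) := by
    have := ((tendsto_yosida_resolvent (𝓔 := 𝓔) α h).const_sub ((α : ℝ) • f - h)).norm.mul_const
      (t : ℝ)
    rwa [sub_self, norm_zero, zero_mul] at this
  rw [tendsto_iff_norm_sub_tendsto_zero]
  refine squeeze_zero (fun _ => norm_nonneg _) (fun n => ?_) hε
  rw [norm_sub_rev]
  have hcomm : ∀ s, 𝓔.scaledResolvent n (T s f) = T s (𝓔.scaledResolvent n f) := fun s => by
    simp only [scaledResolvent, smul_apply, hT.comm_resolvent, map_smul]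
  have := norm_sub_poissonExp_le (𝓔.scaledResolvent n) (norm_scaledResolvent_le n)
    (succPos_nonneg n) t.2 ψ (fun s => (α : ℝ) • ψ s - T s.toNNReal h)
    ‖((α : ℝ) • f - h) - (succPos n : ℝ) • (𝓔.scaledResolvent n f - f)‖ (fun s _ => hd s)
    (fun s hs => by
      have h1 : (α : ℝ) • T s.toNNReal f - T s.toNNReal h
          - (succPos n : ℝ) • (T s.toNNReal (𝓔.scaledResolvent n f) - T s.toNNReal f)
          = T s.toNNReal (((α : ℝ) • f - h)
            - (succPos n : ℝ) • (𝓔.scaledResolvent n f - f)) := by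
        simp only [map_sub, map_smul]
      rw [hψT s hs.1, hcomm, h1]
      exact hT.contraction _ _)
  rw [hψT _ t.2, hψT _ le_rfl, Real.toNNReal_zero, hT.zero] at this
  simpa [yosidaExp] using this

end Uniqueness

/-! ## Conservativeness -/

theorem Lp_two_inner_le {f g h : Lp ℝ 2 m} (hf : ∀ᵐ x ∂m, 0 ≤ f x)
    (hg : ∀ᵐ x ∂m, g x ≤ h x) : ⟪f, g⟫_ℝ ≤ ⟪f, h⟫_ℝ := by
  rw [Lp_two_inner_eq, Lp_two_inner_eq]
  refine integral_mono_ae (Lp_two_integrable_mul f g) (Lp_two_integrable_mul f h) ?_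
  filter_upwards [hf, hg] with x h1 h2 using mul_le_mul_of_nonneg_left h2 h1

theorem Lp_two_inner_le_integral {f g : Lp ℝ 2 m} (hfi : Integrable f m)
    (hf : ∀ᵐ x ∂m, 0 ≤ f x) (hg : ∀ᵐ x ∂m, g x ≤ 1) : ⟪f, g⟫_ℝ ≤ ∫ x, f x ∂m := by
  rw [Lp_two_inner_eq]
  refine integral_mono_ae (Lp_two_integrable_mul f g) hfi ?_
  filter_upwards [hf, hg] with x h1 h2 using mul_le_of_le_one_right h1 h2

theorem semigroup_unit_valued (t : ℝ≥0) {f : Lp ℝ 2 m} (hf : ∀ᵐ x ∂m, 0 ≤ f x ∧ f x ≤ 1) :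
    ∀ᵐ x ∂m, 0 ≤ 𝓔.semigroup t f x ∧ 𝓔.semigroup t f x ≤ 1 := by
  rw [← clipL2_eq_self_iff] at hf ⊢
  exact clipL2_semigroup t f hf

/-- If `α G_α φ` has the full mass of `φ` then so does `T_t φ`. -/
theorem exists_lt_inner_semigroup (α : Ioi (0 : ℝ)) (φ : Lp ℝ 2 m)
    (hφ : ∀ᵐ x ∂m, 0 ≤ φ x ∧ φ x ≤ 1) (hφi : Integrable φ m) (ψ : ℕ → Lp ℝ 2 m)
    (hψ : ∀ k, ∀ᵐ x ∂m, 0 ≤ ψ k x ∧ ψ k x ≤ 1)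
    (hlim : Tendsto (fun k => ⟪(α : ℝ) • 𝓔.resolvent α φ, ψ k⟫_ℝ) atTop (𝓝 (∫ x, φ x ∂m)))
    (t₀ : ℝ≥0) {c : ℝ} (hc : c < ∫ x, φ x ∂m) :
    ∃ k : Lp ℝ 2 m, (∀ᵐ x ∂m, 0 ≤ k x ∧ k x ≤ 1) ∧ c < ⟪𝓔.semigroup t₀ φ, k⟫_ℝ := by
  -- If `T_{t₀} φ` had mass at most `c`, so would `T_t φ` for all later `t`, and the average `α G_α
  -- φ` would lose at least the mass `exp (-α t₀) (M - c)`, contrary to `hlim`.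
  by_contra! hcon
  have hα : (0 : ℝ) < α := α.2
  set M := ∫ x, φ x ∂m
  have hφ0 : ∀ᵐ x ∂m, 0 ≤ φ x := hφ.mono fun _ h => h.1
  have hb1 : ∀ t k, (∀ᵐ x ∂m, 0 ≤ k x ∧ k x ≤ 1) → ⟪𝓔.semigroup t φ, k⟫_ℝ ≤ M := by
    intro t k hk
    rw [semigroup_symm]
    exact Lp_two_inner_le_integral hφi hφ0 ((semigroup_unit_valued t hk).mono fun _ h => h.2)
  have hb2 : ∀ t k, t₀ ≤ t → (∀ᵐ x ∂m, 0 ≤ k x ∧ k x ≤ 1) → ⟪𝓔.semigroup t φ, k⟫_ℝ ≤ c := by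
    intro t k ht hk
    rw [← tsub_add_cancel_of_le ht, semigroup_add, semigroup_symm]
    exact hcon _ (semigroup_unit_valued _ hk)
  have hS := isSemigroup_semigroup (𝓔 := 𝓔)
  have hint := hS.integrableOn α φ le_rfl
  have hbound : ∀ k, (∀ᵐ x ∂m, 0 ≤ k x ∧ k x ≤ 1) →
      ⟪(α : ℝ) • 𝓔.resolvent α φ, k⟫_ℝ ≤ M - Real.exp (-(α * t₀)) * (M - c) := by
    intro k hk
    rw [← hS.integral_eq, real_inner_smul_left, real_inner_comm, ← integral_inner hint]
    have hexp : ∀ a : ℝ, 0 ≤ a → ∫ t in Ioi a, Real.exp (-(α * t)) = Real.exp (-(α * a)) / α := by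
      intro a _
      have := integral_exp_mul_Ioi (a := -(α : ℝ)) (by linarith) a
      simp only [neg_mul] at this
      rw [this, neg_div_neg_eq]
    have hint1 : ∀ a : ℝ, IntegrableOn (fun t : ℝ => Real.exp (-(α * t))) (Ioi a) := fun a => by
      simpa using exp_neg_integrableOn_Ioi a hα
    have hdom : IntegrableOn (fun t => M * Real.exp (-(α * t))
        - (Ioi (t₀ : ℝ)).indicator (fun t => (M - c) * Real.exp (-(α * t))) t) (Ioi (0 : ℝ)) :=
      ((hint1 0).const_mul M).sub (((hint1 0).const_mul (M - c)).indicator measurableSet_Ioi)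
    have hle : ∫ t in Ioi (0 : ℝ), ⟪k, Real.exp (-(α * t)) • 𝓔.semigroup t.toNNReal φ⟫_ℝ
        ≤ ∫ t in Ioi (0 : ℝ), (M * Real.exp (-(α * t))
        - (Ioi (t₀ : ℝ)).indicator (fun t => (M - c) * Real.exp (-(α * t))) t) := by
      refine setIntegral_mono_on (hint.const_inner k) hdom measurableSet_Ioi fun t ht => ?_
      rw [real_inner_smul_right, real_inner_comm]
      by_cases h : t ∈ Ioi (t₀ : ℝ)
      · rw [indicator_of_mem h]
        have := hb2 t.toNNReal k (by
          rw [← NNReal.coe_le_coe, Real.coe_toNNReal t (le_of_lt ht)]; exact le_of_lt h) hk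
        nlinarith [Real.exp_pos (-((α : ℝ) * t))]
      · rw [indicator_of_notMem h]
        have := hb1 t.toNNReal k hk
        nlinarith [Real.exp_pos (-((α : ℝ) * t))]
    have heval : ∫ t in Ioi (0 : ℝ), (M * Real.exp (-(α * t))
        - (Ioi (t₀ : ℝ)).indicator (fun t => (M - c) * Real.exp (-(α * t))) t)
        = M * (1 / α) - (M - c) * (Real.exp (-(α * t₀)) / α) := by
      rw [integral_sub ((hint1 0).const_mul M)
        (((hint1 0).const_mul (M - c)).indicator measurableSet_Ioi),
        setIntegral_indicator measurableSet_Ioi, integral_const_mul, integral_const_mul,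
        inter_eq_right.2 (Ioi_subset_Ioi (show (0 : ℝ) ≤ t₀ from t₀.2)), hexp _ le_rfl,
        hexp _ (show (0 : ℝ) ≤ t₀ from t₀.2)]
      simp
    rw [heval] at hle
    calc _ ≤ (α : ℝ) * (M * (1 / α) - (M - c) * (Real.exp (-(α * t₀)) / α)) := by gcongr
      _ = _ := by field_simp
  have h1 := le_of_tendsto hlim (Eventually.of_forall fun k => hbound (ψ k) (hψ k))
  nlinarith [Real.exp_pos (-((α : ℝ) * t₀))]

/-- A criterion for conservativeness: it is enough that `α G_α` preserves the mass of sufficiently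
many functions for one `α`. -/
theorem semigroup_tendsto_one (α : Ioi (0 : ℝ)) (φ : ℕ → Lp ℝ 2 m)
    (hφ : ∀ j, ∀ᵐ x ∂m, 0 ≤ φ j x ∧ φ j x ≤ 1) (hφi : ∀ j, Integrable (φ j) m)
    (hpos : ∀ᵐ x ∂m, ∃ j, 0 < φ j x) (ψ : ℕ → Lp ℝ 2 m)
    (hψ : ∀ k, ∀ᵐ x ∂m, 0 ≤ ψ k x ∧ ψ k x ≤ 1)
    (hlim : ∀ j, Tendsto (fun k => ⟪(α : ℝ) • 𝓔.resolvent α (φ j), ψ k⟫_ℝ) atTop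
      (𝓝 (∫ x, φ j x ∂m)))
    (t : ℝ≥0) (f : ℕ → Lp ℝ 2 m)
    (hf : ∀ᵐ x ∂m, 0 ≤ f 0 x ∧ Monotone (fun n => f n x) ∧
      Tendsto (fun n => f n x) atTop (𝓝 1)) :
    ∀ᵐ x ∂m, Tendsto (fun n => 𝓔.semigroup t (f n) x) atTop (𝓝 1) := by
  have hf01 : ∀ n, ∀ᵐ x ∂m, 0 ≤ f n x ∧ f n x ≤ 1 := by
    intro n
    filter_upwards [hf] with x hx
    exact ⟨hx.1.trans (hx.2.1 (Nat.zero_le n)), hx.2.1.ge_of_tendsto hx.2.2 n⟩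
  have hT01 : ∀ n, ∀ᵐ x ∂m, 0 ≤ 𝓔.semigroup t (f n) x ∧ 𝓔.semigroup t (f n) x ≤ 1 :=
    fun n => semigroup_unit_valued t (hf01 n)
  have hmono : ∀ n, ∀ᵐ x ∂m, 𝓔.semigroup t (f n) x ≤ 𝓔.semigroup t (f (n + 1)) x := by
    intro n
    have h1 : ∀ᵐ x ∂m, 0 ≤ (f (n + 1) - f n) x ∧ (f (n + 1) - f n) x ≤ 1 := by
      filter_upwards [hf, hf01 n, hf01 (n + 1), Lp.coeFn_sub (f (n + 1)) (f n)] with x h1 h2 h3 h4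
      rw [h4, Pi.sub_apply]
      exact ⟨sub_nonneg.2 (h1.2.1 n.le_succ), by linarith [h2.1, h3.2]⟩
    filter_upwards [semigroup_unit_valued (𝓔 := 𝓔) t h1,
      Lp.coeFn_sub (𝓔.semigroup t (f (n + 1))) (𝓔.semigroup t (f n))] with x h2 h3
    rw [map_sub, h3, Pi.sub_apply] at h2
    exact sub_nonneg.1 h2.1
  set L : X → ℝ := fun x => ⨆ n, 𝓔.semigroup t (f n) x with hL
  have hLlim : ∀ᵐ x ∂m, Tendsto (fun n => 𝓔.semigroup t (f n) x) atTop (𝓝 (L x)) := by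
    filter_upwards [ae_all_iff.2 hT01, ae_all_iff.2 hmono] with x h1 h2
    exact tendsto_atTop_ciSup (monotone_nat_of_le_succ h2) ⟨1, by rintro _ ⟨n, rfl⟩; exact (h1 n).2⟩
  have hLge : ∀ᵐ x ∂m, ∀ n, 𝓔.semigroup t (f n) x ≤ L x := by
    filter_upwards [ae_all_iff.2 hT01] with x h1 n
    exact le_ciSup (f := fun n => 𝓔.semigroup t (f n) x)
      ⟨1, by rintro _ ⟨n, rfl⟩; exact (h1 n).2⟩ n
  have hLle : ∀ᵐ x ∂m, L x ≤ 1 := by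
    filter_upwards [ae_all_iff.2 hT01] with x h1 using ciSup_le fun n => (h1 n).2
  have hLmeas : AEMeasurable L m := AEMeasurable.iSup fun n =>
    (Lp.aestronglyMeasurable _).aemeasurable
  have key : ∀ j, ∀ᵐ x ∂m, φ j x * (1 - L x) = 0 := by
    intro j
    have hφ0 : ∀ᵐ x ∂m, 0 ≤ φ j x := (hφ j).mono fun _ h => h.1
    have hTφ : ∀ᵐ x ∂m, 0 ≤ 𝓔.semigroup t (φ j) x :=
      (semigroup_unit_valued t (hφ j)).mono fun _ h => h.1
    -- Some `k` with values in `[0,1]` sees nearly all the mass of `T_t (φ j)`. Since `f n ↑ 1`, the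
    -- functions `k ⊓ f n` tend to `k`, and symmetry moves the semigroup onto `f n`.
    have h1 : ∀ ε : ℝ, 0 < ε → ∃ n, ∫ x, φ j x ∂m - ε < ⟪φ j, 𝓔.semigroup t (f n)⟫_ℝ := by
      intro ε hε
      obtain ⟨k, hk, hck⟩ := exists_lt_inner_semigroup α (φ j) (hφ j) (hφi j) ψ hψ (hlim j) t
        (sub_lt_self _ hε)
      have h2 : Tendsto (fun n => k ⊓ f n) atTop (𝓝 k) := by
        refine Lp_two_tendsto_of_dominated _ _ k (fun n => ?_) ?_
        · filter_upwards [hk, hf01 n, Lp.coeFn_inf k (f n)] with x h3 h4 h5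
          rw [h5, Pi.inf_apply, abs_le]
          have h6 : 0 ≤ k x ⊓ f n x := le_inf h3.1 h4.1
          have h7 : k x ⊓ f n x ≤ k x := inf_le_left
          exact ⟨by linarith, by linarith [h3.1]⟩
        · filter_upwards [hk, hf, ae_all_iff.2 fun n => Lp.coeFn_inf k (f n)] with x h3 h4 h5
          simp only [h5, Pi.inf_apply]
          have := (tendsto_const_nhds (x := k x)).min h4.2.2
          rwa [min_eq_left h3.2] at this
      have h3 := (tendsto_const_nhds (x := 𝓔.semigroup t (φ j))).inner (𝕜 := ℝ) h2
      obtain ⟨n, hn⟩ := (h3.eventually (lt_mem_nhds hck)).exists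
      refine ⟨n, ?_⟩
      rw [← semigroup_symm]
      refine hn.trans_le (Lp_two_inner_le hTφ ?_)
      filter_upwards [Lp.coeFn_inf k (f n)] with x h5
      rw [h5]
      exact inf_le_right
    have hnn : ∀ᵐ x ∂m, 0 ≤ φ j x * (1 - L x) := by
      filter_upwards [hφ0, hLle] with x h2 h3 using mul_nonneg h2 (by linarith)
    have hmeas : AEStronglyMeasurable (fun x => φ j x * (1 - L x)) m :=
      (Lp.aestronglyMeasurable _).mul (aestronglyMeasurable_const.sub hLmeas.aestronglyMeasurable)
    have hint0 : ∀ n, Integrable (fun x => φ j x - φ j x * 𝓔.semigroup t (f n) x) m := fun n =>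
      (hφi j).sub (Lp_two_integrable_mul _ _)
    have hle : ∀ n, ∀ᵐ x ∂m, φ j x * (1 - L x) ≤ φ j x - φ j x * 𝓔.semigroup t (f n) x := by
      intro n
      filter_upwards [hφ0, hLge] with x h2 h3
      nlinarith [h3 n]
    have hint : Integrable (fun x => φ j x * (1 - L x)) m := by
      refine (hint0 0).mono' hmeas ?_
      filter_upwards [hnn, hle 0] with x h2 h3
      rwa [Real.norm_of_nonneg h2]
    -- The integral is nonnegative and at most `∫ φ j - ⟪φ j, T_t f_n⟫`, which is below any given
    -- `ε` for a suitable `n`.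
    have hzero : ∫ x, φ j x * (1 - L x) ∂m = 0 := by
      refine le_antisymm (le_of_forall_pos_le_add fun ε hε => ?_) (integral_nonneg_of_ae hnn)
      obtain ⟨n, hn⟩ := h1 ε hε
      have h4 := integral_mono_ae hint (hint0 n) (hle n)
      rw [integral_sub (hφi j) (Lp_two_integrable_mul _ _), ← Lp_two_inner_eq] at h4
      linarith
    exact (integral_eq_zero_iff_of_nonneg_ae hnn hint).1 hzero
  filter_upwards [hLlim, ae_all_iff.2 key, hpos] with x h1 h2 ⟨j, h3⟩
  have h4 := (mul_eq_zero.1 (h2 j)).resolve_left h3.ne'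
  rwa [← sub_eq_zero.1 h4] at h1

end DirichletForm
end

noncomputable section


namespace DirichletForm

variable {X : Type*} [MeasurableSpace X] {m : Measure X} {𝓔 : DirichletForm m}

/-! ## Countable intersections of nests -/

/-- The number `1` as an index of the energy spaces. -/
def posOne : Ioi (0 : ℝ) := ⟨1, mem_Ioi.2 one_pos⟩

theorem toEnergy_posOne_norm_sq (u : 𝓔.domain) : ‖𝓔.toEnergy posOne u‖ ^ 2 = 𝓔.form₁ u u := by
  rw [toEnergy_norm_sq, form₁, real_inner_self_eq_norm_sq]
  simp [posOne]

variable (𝓔) in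
/-- The functions in the domain that vanish a.e. outside `F`. -/
def vanishing (F : Set X) : Submodule ℝ (𝓔.EnergySpace posOne) where
  carrier := {v | ∀ᵐ x ∂m, x ∉ F → 𝓔.toL2 posOne v x = 0}
  add_mem' {u v} hu hv := by
    filter_upwards [hu, hv, Lp.coeFn_add (𝓔.toL2 posOne u) (𝓔.toL2 posOne v)] with x h1 h2 h3 hx
    rw [map_add, h3, Pi.add_apply, h1 hx, h2 hx, add_zero]
  zero_mem' := by
    filter_upwards [Lp.coeFn_zero ℝ 2 m] with x h1 _
    rw [map_zero, h1, Pi.zero_apply]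
  smul_mem' r u hu := by
    filter_upwards [hu, Lp.coeFn_smul r (𝓔.toL2 posOne u)] with x h1 h2 hx
    rw [map_smul, h2, Pi.smul_apply, h1 hx, smul_zero]

theorem vanishing_mono {F F' : Set X} (h : F ⊆ F') : 𝓔.vanishing F ≤ 𝓔.vanishing F' :=
  fun u (hu : ∀ᵐ x ∂m, x ∉ F → 𝓔.toL2 posOne u x = 0) =>
    hu.mono fun _ h1 hx => h1 fun h2 => hx (h h2)

/-- The pointwise a.e. nonnegative functions in the domain. -/
def nonnegCone (𝓔 : DirichletForm m) : Set (𝓔.EnergySpace posOne) :=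
  {u | 0 ≤ 𝓔.toL2 posOne u}

theorem posPart_eq_self {f : Lp ℝ 2 m} (hf : 0 ≤ f) : Lp.posPart f = f := by
  refine Lp.ext ?_
  filter_upwards [Lp.coeFn_posPart f, (Lp.coeFn_nonneg f).2 hf] with x h1 h2
  rw [h1]
  exact max_eq_left h2

theorem exists_posPart (u : 𝓔.EnergySpace posOne) : ∃ v : 𝓔.EnergySpace posOne,
    𝓔.toL2 posOne v = Lp.posPart (𝓔.toL2 posOne u) ∧ ‖v‖ ≤ ‖u‖ := by
  obtain ⟨v, hv, hvn⟩ := posPart_mem (α := posOne) (𝓔.ofEnergy posOne u)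
  exact ⟨𝓔.toEnergy posOne v, hv, by simpa using hvn⟩

theorem posPart_nonneg (f : Lp ℝ 2 m) : 0 ≤ Lp.posPart f := by
  rw [← Lp.coeFn_nonneg]
  filter_upwards [Lp.coeFn_posPart f] with x hx
  rw [hx]
  exact le_max_right _ _

/-- The closed subspace generated by functions vanishing off the members of an increasing sequence
of sets is everything if it contains the nonnegative functions. -/
theorem eq_top_of_nonnegCone_subset (K : Submodule ℝ (𝓔.EnergySpace posOne))
    (h : 𝓔.nonnegCone ⊆ K) : K = ⊤ := by
  refine Submodule.eq_top_iff'.2 fun u => ?_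
  obtain ⟨v, hv, -⟩ := exists_posPart u
  obtain ⟨w, hw, -⟩ := exists_posPart (-u)
  have : u = v - w := by
    refine toL2_injective (Lp.ext ?_)
    rw [map_sub, hv, hw]
    filter_upwards [Lp.coeFn_sub (Lp.posPart (𝓔.toL2 posOne u)) (Lp.posPart (𝓔.toL2 posOne (-u))),
      Lp.coeFn_posPart (𝓔.toL2 posOne u), Lp.coeFn_posPart (𝓔.toL2 posOne (-u)),
      Lp.coeFn_neg (𝓔.toL2 posOne u)] with x h1 h2 h3 h4
    rw [h1, Pi.sub_apply, h2, h3, map_neg, h4, Pi.neg_apply]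
    rcases le_total (𝓔.toL2 posOne u x) 0 with h | h
    · rw [max_eq_right h, max_eq_left (by linarith)]; ring
    · rw [max_eq_left h, max_eq_right (by linarith)]; ring
  rw [this]
  refine K.sub_mem (h ?_) (h ?_)
  · change 0 ≤ 𝓔.toL2 posOne v
    rw [hv]; exact posPart_nonneg _
  · change 0 ≤ 𝓔.toL2 posOne w
    rw [hw]; exact posPart_nonneg _

section Nests

variable [TopologicalSpace X]

/-- The supremum is a union because `F` is increasing. Closed subspaces are convenient here since
they contain the weak limits of their bounded sequences. -/
theorem isNest_iff (F : ℕ → Set X) : 𝓔.IsNest F ↔ (∀ k, IsClosed (F k)) ∧ Monotone F ∧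
    (⨆ k, 𝓔.vanishing (F k)).topologicalClosure = ⊤ := by
  refine and_congr_right fun _ => and_congr_right fun hmono => ?_
  have hdir : Directed (· ≤ ·) fun k => 𝓔.vanishing (F k) :=
    (show Monotone fun k => 𝓔.vanishing (F k) from
      fun i j hij => vanishing_mono (hmono hij)).directed_le
  rw [Submodule.eq_top_iff']
  constructor
  · intro h u
    refine Metric.mem_closure_iff.2 fun ε hε => ?_
    obtain ⟨k, v, hv, hlt⟩ := h (𝓔.ofEnergy posOne u) (ε ^ 2) (by positivity)
    refine ⟨𝓔.toEnergy posOne v, (Submodule.mem_iSup_of_directed _ hdir).2 ⟨k, hv⟩, ?_⟩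
    rw [← toEnergy_posOne_norm_sq, map_sub, LinearEquiv.apply_symm_apply] at hlt
    rw [dist_eq_norm]
    exact lt_of_pow_lt_pow_left₀ 2 hε.le hlt
  · intro h u ε hε
    obtain ⟨v, hv, hlt⟩ := Metric.mem_closure_iff.1 (h (𝓔.toEnergy posOne u)) (√ε) (by positivity)
    obtain ⟨k, hk⟩ := (Submodule.mem_iSup_of_directed _ hdir).1 hv
    refine ⟨k, 𝓔.ofEnergy posOne v, hk, ?_⟩
    rw [← toEnergy_posOne_norm_sq, map_sub, LinearEquiv.apply_symm_apply]
    rw [dist_eq_norm, Real.lt_sqrt (norm_nonneg _)] at hlt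
    exact hlt

/-- If `u ≥ 0` is approximated by functions vanishing off the sets `F j`, fast enough in `j`, then
`u` is close to a function vanishing off `⋂ j, F j`. -/
theorem exists_vanishing_iInter (F : ℕ → Set X) (u : 𝓔.EnergySpace posOne)
    (hu : 0 ≤ 𝓔.toL2 posOne u) (δ : ℝ)
    (h : ∀ j, ∃ v ∈ 𝓔.vanishing (F j), ‖u - v‖ ≤ δ / 2 / 2 ^ j) :
    ∃ w ∈ 𝓔.vanishing (⋂ j, F j), ‖w‖ ≤ ‖u‖ + δ ∧
      ‖𝓔.toL2 posOne w - 𝓔.toL2 posOne u‖ ≤ ‖𝓔.toL2 posOne‖ * δ := by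
  choose v hv hvn using h
  -- Off `F j` the function `v j` vanishes, so `e j = (u - v j)⁺` is at least `u` there. The sum of
  -- the `e j` has norm at most `δ` and dominates each of them, hence `(u - ∑' j, e j)⁺` vanishes
  -- off every `F j`.
  choose e he hen using fun j => exists_posPart (u - v j)
  have hbd : ∀ j, ‖e j‖ ≤ δ / 2 / 2 ^ j := fun j => (hen j).trans (hvn j)
  have hsum : Summable e := Summable.of_norm_bounded (hasSum_geometric_two' δ).summable hbd
  have hnorm : ‖∑' j, e j‖ ≤ δ := tsum_of_norm_bounded (hasSum_geometric_two' δ) hbd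
  have hsum2 : HasSum (fun j => 𝓔.toL2 posOne (e j)) (𝓔.toL2 posOne (∑' j, e j)) :=
    (𝓔.toL2 posOne).hasSum hsum.hasSum
  have hle : ∀ j, 𝓔.toL2 posOne (e j) ≤ 𝓔.toL2 posOne (∑' j, e j) := fun j =>
    le_hasSum hsum2 j fun i _ => by rw [he]; exact posPart_nonneg _
  obtain ⟨w, hw, hwn⟩ := exists_posPart (u - ∑' j, e j)
  refine ⟨w, ?_, hwn.trans ((norm_sub_le _ _).trans (by gcongr)), ?_⟩
  · change ∀ᵐ x ∂m, _
    filter_upwards [ae_all_iff.2 fun j => (hv j : ∀ᵐ x ∂m, _),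
      ae_all_iff.2 fun j => (Lp.coeFn_le _ _).2 (hle j),
      ae_all_iff.2 fun j => Lp.coeFn_posPart (𝓔.toL2 posOne (u - v j)),
      ae_all_iff.2 fun j => Lp.coeFn_sub (𝓔.toL2 posOne u) (𝓔.toL2 posOne (v j)),
      Lp.coeFn_posPart (𝓔.toL2 posOne (u - ∑' j, e j)),
      Lp.coeFn_sub (𝓔.toL2 posOne u) (𝓔.toL2 posOne (∑' j, e j))] with x h1 h2 h3 h4 h5 h6 hx
    obtain ⟨j, hj⟩ := not_forall.1 (mt mem_iInter.2 hx)
    have h7 := h2 j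
    rw [he, h3, map_sub, h4, Pi.sub_apply, h1 j hj, sub_zero] at h7
    rw [hw, h5, map_sub, h6, Pi.sub_apply]
    exact max_eq_right (sub_nonpos.2 ((le_max_left _ _).trans h7))
  · have h1 : 𝓔.toL2 posOne w - 𝓔.toL2 posOne u
        = Lp.posPart (𝓔.toL2 posOne (u - ∑' j, e j)) - Lp.posPart (𝓔.toL2 posOne u) := by
      rw [hw, posPart_eq_self hu]
    rw [h1]
    have h2 := Lp.lipschitzWith_pos_part.norm_compLp_sub_le (by simp : max (0 : ℝ) 0 = 0)
      (𝓔.toL2 posOne (u - ∑' j, e j)) (𝓔.toL2 posOne u)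
    rw [NNReal.coe_one, one_mul] at h2
    refine h2.trans ?_
    rw [map_sub, sub_sub_cancel_left, norm_neg]
    exact ((𝓔.toL2 posOne).le_opNorm _).trans (by gcongr)

/-- A countable family of nests has a common refinement. -/
theorem exists_nest_forall_subset [TopologicalSpace.SeparableSpace (𝓔.EnergySpace posOne)]
    (F : ℕ → ℕ → Set X) (hF : ∀ j, 𝓔.IsNest (F j)) :
    ∃ F' : ℕ → Set X, 𝓔.IsNest F' ∧ ∀ j n, ∃ k, F' n ⊆ F j k := by
  have hne : (𝓔.nonnegCone).Nonempty := ⟨0, by simp [nonnegCone]⟩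
  have : Nonempty 𝓔.nonnegCone := hne.to_subtype
  have : SecondCountableTopology (𝓔.EnergySpace posOne) := UniformSpace.secondCountable_of_separable _
  set u := TopologicalSpace.denseSeq 𝓔.nonnegCone with hu
  -- At stage `n` the first `n + 1` elements of the dense sequence are approximated at once. The
  -- errors form a geometric series in `j` with sum `(1 / 2) ^ n`.
  have h1 : ∀ j n, ∃ k, ∀ i ≤ n, ∃ v ∈ 𝓔.vanishing (F j k),
      ‖(u i : 𝓔.EnergySpace posOne) - v‖ ≤ (1 / 2) ^ n / 2 / 2 ^ j := by
    intro j n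
    have h2 : ∀ i, ∃ k, ∃ v ∈ 𝓔.vanishing (F j k),
        ‖(u i : 𝓔.EnergySpace posOne) - v‖ ≤ (1 / 2) ^ n / 2 / 2 ^ j := by
      intro i
      obtain ⟨-, hmono, htop⟩ := (isNest_iff _).1 (hF j)
      have h3 : (u i : 𝓔.EnergySpace posOne) ∈ (⨆ k, 𝓔.vanishing (F j k)).topologicalClosure := by
        rw [htop]; trivial
      obtain ⟨v, hv, hlt⟩ := Metric.mem_closure_iff.1 h3 ((1 / 2) ^ n / 2 / 2 ^ j) (by positivity)
      obtain ⟨k, hk⟩ := (Submodule.mem_iSup_of_directed _ (show Monotone fun k =>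
        𝓔.vanishing (F j k) from fun i j hij => vanishing_mono (hmono hij)).directed_le).1 hv
      rw [dist_eq_norm] at hlt
      exact ⟨k, v, hk, hlt.le⟩
    choose k hk using h2
    refine ⟨(Finset.range (n + 1)).sup k, fun i hi => ?_⟩
    obtain ⟨v, hv, hvn⟩ := hk i
    exact ⟨v, vanishing_mono ((hF j).2.1 (Finset.le_sup (f := k)
      (Finset.mem_range.2 (Nat.lt_succ_of_le hi)))) hv, hvn⟩
  choose k hk using h1
  -- Maxima over the earlier stages make the indices, and so the refined sets, increase with `n`.
  set K : ℕ → ℕ → ℕ := fun j n => (Finset.range (n + 1)).sup (k j) with hKdef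
  have hKmono : ∀ j, Monotone (K j) := fun j a b hab =>
    Finset.sup_mono (Finset.range_mono (Nat.succ_le_succ hab))
  have hkK : ∀ j n, k j n ≤ K j n := fun j n => Finset.le_sup (f := k j)
    (Finset.mem_range.2 n.lt_succ_self)
  refine ⟨fun n => ⋂ j, F j (K j n), (isNest_iff _).2 ⟨fun n => isClosed_iInter fun j => (hF j).1 _,
    fun a b hab => iInter_mono fun j => (hF j).2.1 (hKmono j hab), ?_⟩,
    fun j n => ⟨K j n, iInter_subset _ j⟩⟩
  set C := (⨆ n, 𝓔.vanishing (⋂ j, F j (K j n))).topologicalClosure with hC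
  have hCcl : IsClosed (C : Set (𝓔.EnergySpace posOne)) := Submodule.isClosed_topologicalClosure _
  refine eq_top_of_nonnegCone_subset C ?_
  have hdense : ∀ i, (u i : 𝓔.EnergySpace posOne) ∈ C := by
    intro i
    -- From stage `i` on, `u i` is among the approximated elements; hence the shift to `n + i`.
    have h4 : ∀ n, ∃ w ∈ 𝓔.vanishing (⋂ j, F j (K j (n + i))),
        ‖w‖ ≤ ‖(u i : 𝓔.EnergySpace posOne)‖ + (1 / 2) ^ (n + i) ∧
        ‖𝓔.toL2 posOne w - 𝓔.toL2 posOne (u i)‖ ≤ ‖𝓔.toL2 posOne‖ * (1 / 2) ^ (n + i) := by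
      intro n
      refine exists_vanishing_iInter _ _ (u i).2 _ fun j => ?_
      obtain ⟨v, hv, hvn⟩ := hk j (n + i) i (Nat.le_add_left _ _)
      exact ⟨v, vanishing_mono ((hF j).2.1 (hkK _ _)) hv, hvn⟩
    choose w hw hwn hwd using h4
    have hpow : Tendsto (fun n : ℕ => (1 / 2 : ℝ) ^ (n + i)) atTop (𝓝 0) :=
      (tendsto_pow_atTop_nhds_zero_of_lt_one (by norm_num) (by norm_num)).comp
        (tendsto_add_atTop_nat i)
    -- The `w n` are known to converge to `u i` only in `L²`, but their energies are bounded, so the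
    -- limit stays in the closed subspace `C`.
    obtain ⟨w', hw'C, hw', -⟩ := exists_limit_of_bounded C hCcl w
      (fun n => Submodule.le_topologicalClosure _ (Submodule.mem_iSup_of_mem _ (hw n)))
      (𝓔.toL2 posOne (u i))
      (tendsto_iff_norm_sub_tendsto_zero.2 (squeeze_zero (fun _ => norm_nonneg _) hwd
        (by simpa using hpow.const_mul ‖𝓔.toL2 posOne‖)))
      _ _ hwn (hpow.const_add _)
    rwa [← toL2_injective hw']
  intro v hv
  have h5 : (⟨v, hv⟩ : 𝓔.nonnegCone) ∈ closure (range u) := TopologicalSpace.denseRange_denseSeq _ _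
  have h6 : closure (range u) ⊆ Subtype.val ⁻¹' (C : Set (𝓔.EnergySpace posOne)) :=
    closure_minimal (by rintro _ ⟨i, rfl⟩; exact hdense i) (hCcl.preimage continuous_subtype_val)
  exact h6 h5

theorem quasiEverywhere_all [TopologicalSpace.SeparableSpace (𝓔.EnergySpace posOne)]
    {p : ℕ → X → Prop} (h : ∀ j, 𝓔.QuasiEverywhere (p j)) :
    𝓔.QuasiEverywhere fun x => ∀ j, p j x := by
  choose F hF hFp using h
  obtain ⟨F', hF', hsub⟩ := exists_nest_forall_subset F hF
  refine ⟨F', hF', fun x hx => mem_iInter.2 fun n hn => ?_⟩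
  obtain ⟨j, hj⟩ := not_forall.1 hx
  obtain ⟨k, hk⟩ := hsub j n
  exact mem_iInter.1 (hFp j hj) k (hk hn)

theorem QuasiEverywhere.mono {p q : X → Prop} (h : 𝓔.QuasiEverywhere p) (hpq : ∀ x, p x → q x) :
    𝓔.QuasiEverywhere q := by
  obtain ⟨F, hF, hFp⟩ := h
  exact ⟨F, hF, fun x hx => hFp fun hp => hx (hpq x hp)⟩

/-- A quasi-continuous function that vanishes a.e. vanishes quasi-everywhere. -/
theorem IsQuasiContinuous.quasiEverywhere_eq_zero [SecondCountableTopology X]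
    [OpensMeasurableSpace X] {f : X → ℝ} (hf : 𝓔.IsQuasiContinuous f) (h0 : f =ᵐ[m] 0) :
    𝓔.QuasiEverywhere fun x => f x = 0 := by
  obtain ⟨F, hF, hFc⟩ := hf
  -- The nest is shrunk to the supports of `m` restricted to the sets `F k`, which removes null sets
  -- only. On such a support, continuity and vanishing a.e. give vanishing everywhere.
  have hsub : ∀ k, (m.restrict (F k)).support ⊆ F k := fun k =>
    Measure.support_subset_of_isClosed (hF.1 k) (ae_restrict_mem (hF.1 k).measurableSet)
  refine ⟨fun k => (m.restrict (F k)).support, ⟨fun k => Measure.isClosed_support,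
    fun i j hij => Measure.support_mono (Measure.restrict_mono (hF.2.1 hij) le_rfl), ?_⟩, ?_⟩
  · intro u ε hε
    obtain ⟨k, v, hv, hlt⟩ := hF.2.2 u ε hε
    refine ⟨k, v, ?_, hlt⟩
    have h1 : ∀ᵐ x ∂m, x ∈ F k → x ∈ (m.restrict (F k)).support :=
      (ae_restrict_iff' (hF.1 k).measurableSet).1 Measure.support_mem_ae
    filter_upwards [hv, h1] with x h2 h3 hx using h2 fun h4 => hx (h3 h4)
  · intro x hx
    refine mem_iInter.2 fun k hk => hx ?_
    by_contra hne
    have h1 : {y | f y ≠ 0} ∈ 𝓝[F k] x :=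
      (hFc k x (hsub k hk)).eventually (isOpen_ne.mem_nhds hne)
    obtain ⟨U, hU, hUx, hUF⟩ := mem_nhdsWithin.1 h1
    have h2 := (Measure.mem_support_iff_forall x).1 hk U (hU.mem_nhds hUx)
    rw [Measure.restrict_apply hU.measurableSet] at h2
    refine h2.ne' (measure_mono_null hUF ?_)
    exact h0

end Nests

end DirichletForm
end

noncomputable section


/-! ## Extension by zero to the one-point compactification -/

section ExtendZero

variable {X : Type*}

@[simp] theorem extendZero_coe (f : X → ℝ) (x : X) : extendZero f (x : OnePoint X) = f x := rfl

@[simp] theorem extendZero_infty (f : X → ℝ) : extendZero f OnePoint.infty = 0 := rfl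

theorem extendZero_indicator_one (B : Set X) : extendZero (B.indicator fun _ => (1 : ℝ))
    = ((fun x : X => (x : OnePoint X)) '' B).indicator fun _ => (1 : ℝ) := by
  classical
  funext z
  induction z using OnePoint.rec with
  | infty => simp
  | coe x =>
    by_cases hx : x ∈ B
    · rw [extendZero_coe, indicator_of_mem hx, indicator_of_mem (mem_image_of_mem _ hx)]
    · rw [extendZero_coe, indicator_of_notMem hx, indicator_of_notMem]
      rintro ⟨y, hy, hyx⟩
      exact hx (OnePoint.coe_injective hyx ▸ hy)

variable [TopologicalSpace X]

theorem continuous_extendZero {f : X → ℝ} (hf : Continuous f) (hc : HasCompactSupport f) :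
    Continuous (extendZero f) := by
  rw [OnePoint.continuous_iff]
  refine ⟨?_, hf⟩
  rw [extendZero_infty]
  refine tendsto_const_nhds.congr' ?_
  have : (tsupport f)ᶜ ∈ coclosedCompact X :=
    (hasBasis_coclosedCompact.mem_iff).2 ⟨tsupport f, ⟨isClosed_tsupport f, hc⟩, Subset.rfl⟩
  filter_upwards [this] with x hx
  rw [extendZero_coe, image_eq_zero_of_notMem_tsupport hx]

theorem measurableEmbedding_onePoint_coe [MeasurableSpace X] [BorelSpace X] :
    MeasurableEmbedding (fun x : X => (x : OnePoint X)) :=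
  OnePoint.isOpenEmbedding_coe.measurableEmbedding

end ExtendZero

namespace DirichletForm

/-! ## Strict quasi-regularity -/

section StrictQuasiRegular

variable {X : Type*} [TopologicalSpace X] [MeasurableSpace X] {m : Measure X} {𝓔 : DirichletForm m}

/-- For the empty set the constraint is void, so `0` competes and the reduced function is `0`. -/
theorem cap_empty (g : 𝓔.domain) : 𝓔.cap g ∅ = 0 := by
  simp only [cap, ENNReal.iSup_eq_zero]
  rintro h w ⟨-, -, -, hw⟩
  have h1 := hw 0 (by simp)
  rw [form₁, real_inner_self_eq_norm_sq] at h1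
  have h2 := 𝓔.nonneg' w
  have h3 : ‖(w : Lp ℝ 2 m)‖ ^ 2 = 0 := by
    refine le_antisymm ?_ (sq_nonneg _)
    simp only [form₁, map_zero, Submodule.coe_zero, inner_zero_right, add_zero] at h1
    linarith
  have h4 : w = 0 := Subtype.ext (by simpa using h3)
  simp [h4, form₁]

theorem exists_weight (m : Measure X) [SigmaFinite m] :
    ∃ φ : Lp ℝ 2 m, Integrable φ m ∧ ∀ᵐ x ∂m, 0 < φ x ∧ φ x ≤ 1 := by
  obtain ⟨g, hg, hgm, hgi⟩ := exists_pos_lintegral_lt_of_sigmaFinite m one_ne_zero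
  set φ : X → ℝ := fun x => min (g x : ℝ) 1 with hφ
  have hmeas : Measurable φ := hgm.coe_nnreal_real.min measurable_const
  have hpos : ∀ x, 0 < φ x ∧ φ x ≤ 1 := fun x =>
    ⟨lt_min (NNReal.coe_pos.2 (hg x)) one_pos, min_le_right _ _⟩
  have hint : Integrable φ m := by
    refine ⟨hmeas.aestronglyMeasurable, lt_of_le_of_lt (lintegral_mono fun x => ?_)
      (hgi.trans ENNReal.one_lt_top)⟩
    rw [Real.enorm_of_nonneg (hpos x).1.le, ← ENNReal.ofReal_coe_nnreal]
    exact ENNReal.ofReal_le_ofReal (min_le_left _ _)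
  have hL2 : MemLp φ 2 m := by
    rw [memLp_two_iff_integrable_sq hmeas.aestronglyMeasurable]
    refine hint.mono' (hmeas.pow_const 2).aestronglyMeasurable (Eventually.of_forall fun x => ?_)
    rw [Real.norm_of_nonneg (sq_nonneg _)]
    nlinarith [hpos x]
  refine ⟨hL2.toLp φ, hint.congr hL2.coeFn_toLp.symm, ?_⟩
  filter_upwards [hL2.coeFn_toLp] with x hx
  rw [hx]
  exact hpos x

/-- The complements are empty and have capacity zero. This constant nest is enough for strict
quasi-regularity, because the whole space together with `Δ` is the compact one-point
compactification. -/
theorem isStrictNest_univ [SigmaFinite m] : 𝓔.IsStrictNest fun _ => univ := by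
  obtain ⟨φ, hφi, hφ⟩ := exists_weight m
  refine ⟨fun _ => isClosed_univ, monotone_const, φ, 𝓔.resolventDom posOne φ, hφi, hφ,
    fun v => ?_, ?_⟩
  · rw [← formα_resolventDom posOne]
    exact (formα_one 𝓔 _ _).symm
  · simp [cap_empty]

theorem isStrictlyQuasiContinuous_of_continuous [SigmaFinite m] {f : X → ℝ} (hf : Continuous f)
    (hc : HasCompactSupport f) : 𝓔.IsStrictlyQuasiContinuous f :=
  ⟨_, isStrictNest_univ, fun _ => (continuous_extendZero hf hc).continuousOn⟩

/-- A regular Dirichlet form with a countable point-separating family of continuous compactly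
supported functions in its domain is strictly quasi-regular. -/
theorem isStrictlyQuasiRegular_of_separating [SigmaFinite m] (hreg : 𝓔.IsRegular)
    (u : ℕ → 𝓔.domain) (f : ℕ → X → ℝ) (hf : ∀ n, Continuous (f n))
    (hc : ∀ n, HasCompactSupport (f n)) (hu : ∀ n, (u n : Lp ℝ 2 m) =ᵐ[m] f n)
    (hne : ∀ x, ∃ n, f n x ≠ 0) (hsep : ∀ x y, x ≠ y → ∃ n, f n x ≠ f n y) :
    𝓔.IsStrictlyQuasiRegular where
  compact_nest := by
    refine ⟨_, isStrictNest_univ, fun _ => ?_⟩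
    have : insert OnePoint.infty ((fun x : X => (x : OnePoint X)) '' univ) = univ := by
      rw [image_univ, ← OnePoint.range_coe_union_infty, union_comm]
      rfl
    rw [this]
    exact isCompact_univ
  dense_quasiContinuous v ε hε := by
    obtain ⟨w, g, hg, hgc, hwg, hlt⟩ := hreg.dense_domain v ε hε
    exact ⟨w, g, isStrictlyQuasiContinuous_of_continuous hg hgc, hwg, hlt⟩
  separating := by
    refine ⟨u, f, ∅, fun n => ⟨isStrictlyQuasiContinuous_of_continuous (hf n) (hc n), hu n⟩,
      ⟨_, isStrictNest_univ, empty_subset _⟩, fun y z _ _ hyz => ?_⟩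
    induction y using OnePoint.rec with
    | infty =>
      induction z using OnePoint.rec with
      | infty => exact absurd rfl hyz
      | coe z =>
        obtain ⟨n, hn⟩ := hne z
        exact ⟨n, by simpa using hn.symm⟩
    | coe y =>
      induction z using OnePoint.rec with
      | infty =>
        obtain ⟨n, hn⟩ := hne y
        exact ⟨n, by simpa using hn⟩
      | coe z =>
        obtain ⟨n, hn⟩ := hsep y z fun h => hyz (by rw [h])
        exact ⟨n, by simpa using hn⟩

end StrictQuasiRegular

end DirichletForm

/-! ## The life time of a process associated with a conservative form -/

namespace MarkovProcess

variable {X : Type*} [TopologicalSpace X] {Ω : Type*} [MeasurableSpace Ω] (M : MarkovProcess X Ω)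

/-- The event that the process is alive at time `t`. -/
def alive (t : ℝ≥0) : Set Ω := M.path t ⁻¹' {OnePoint.infty}ᶜ

instance (z : OnePoint X) : IsProbabilityMeasure (M.P z) := M.isProbabilityMeasure z

theorem mem_alive {t : ℝ≥0} {ω : Ω} : ω ∈ M.alive t ↔ (t : ℝ≥0∞) < M.lifetime ω := by
  rw [alive, mem_preimage, mem_compl_singleton_iff, Ne, M.path_eq_infty_iff, not_le]

theorem alive_anti {s t : ℝ≥0} (h : s ≤ t) : M.alive t ⊆ M.alive s := fun ω hω => by
  rw [mem_alive] at hω ⊢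
  exact lt_of_le_of_lt (ENNReal.coe_le_coe.2 h) hω

theorem measurable_path (t : ℝ≥0) : Measurable (M.path t) :=
  (M.adapted t).mono (M.filtration.le t) le_rfl

theorem measurableSet_compl_infty : MeasurableSet ({OnePoint.infty}ᶜ : Set (OnePoint X)) := by
  rw [OnePoint.compl_infty]
  exact OnePoint.isOpen_range_coe.measurableSet

theorem measurableSet_alive (t : ℝ≥0) : MeasurableSet (M.alive t) :=
  M.measurable_path t measurableSet_compl_infty

theorem measureReal_infty_alive (t : ℝ≥0) : (M.P OnePoint.infty).real (M.alive t) = 0 := by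
  rw [measureReal_def, ENNReal.toReal_eq_zero_iff]
  left
  refine measure_mono_null (fun ω hω => ?_) (ae_iff.1 (M.normal OnePoint.infty))
  intro h
  rw [M.path_eq_infty_iff] at h
  rw [mem_alive] at hω
  exact (lt_of_lt_of_le hω h).not_ge (by simp)

theorem measurable_alive (t : ℝ≥0) : Measurable fun z => (M.P z).real (M.alive t) :=
  (M.measurable_transition t _ measurableSet_compl_infty).ennreal_toReal

/-- The Chapman–Kolmogorov equation for the survival probabilities. -/
theorem integral_alive (z : OnePoint X) (s t : ℝ≥0) :
    ∫ ω, (M.P (M.path s ω)).real (M.alive t) ∂(M.P z) = (M.P z).real (M.alive (s + t)) := by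
  have h1 := M.markov z s t _ measurableSet_compl_infty
  change ∫ ω, (M.P (M.path s ω)).real (M.path t ⁻¹' {OnePoint.infty}ᶜ) ∂(M.P z) = _
  rw [← integral_congr_ae h1, integral_condExp (M.filtration.le s)]
  exact integral_indicator_one (M.measurableSet_alive (s + t))

variable [MeasurableSpace X]

theorem transition_indicator [BorelSpace X] (t : ℝ≥0) {B : Set X} (hB : MeasurableSet B) (x : X) :
    M.transition t (B.indicator fun _ => (1 : ℝ)) x
      = (M.P x).real (M.path t ⁻¹' ((fun x : X => (x : OnePoint X)) '' B)) := by
  rw [transition, extendZero_indicator_one]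
  exact integral_indicator_one
    (M.measurable_path t (measurableEmbedding_onePoint_coe.measurableSet_image.2 hB))

theorem tendsto_transition_indicator [BorelSpace X] (t : ℝ≥0) {B : ℕ → Set X}
    (hB : ∀ n, MeasurableSet (B n)) (hmono : Monotone B) (hU : ⋃ n, B n = univ) (x : X) :
    Tendsto (fun n => M.transition t ((B n).indicator fun _ => (1 : ℝ)) x) atTop
      (𝓝 ((M.P x).real (M.alive t))) := by
  simp only [M.transition_indicator t (hB _)]
  have h1 : M.alive t = ⋃ n, M.path t ⁻¹' ((fun x : X => (x : OnePoint X)) '' B n) := by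
    rw [← preimage_iUnion, ← image_iUnion, hU, image_univ, ← OnePoint.compl_infty]
    rfl
  rw [h1]
  exact (ENNReal.continuousAt_toReal (measure_ne_top _ _)).tendsto.comp
    (tendsto_measure_iUnion_atTop fun i j hij => preimage_mono (image_mono (hmono hij)))

/-- The function `1 - p_t 1`. -/
def deathProb (t : ℝ≥0) (x : X) : ℝ := 1 - (M.P x).real (M.alive t)

/-- By Chapman–Kolmogorov, `p_s (1 - p_t 1)` is the probability of dying in `(s, s + t]`. At `Δ`
there is no survival, which matches the extension by zero. -/
theorem transition_deathProb [BorelSpace X] (s t : ℝ≥0) (x : X) :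
    M.transition s (M.deathProb t) x
      = (M.P x).real (M.alive s) - (M.P x).real (M.alive (s + t)) := by
  have h1 : extendZero (M.deathProb t) = fun z =>
      ({OnePoint.infty}ᶜ : Set (OnePoint X)).indicator (fun _ => (1 : ℝ)) z
        - (M.P z).real (M.alive t) := by
    funext z
    induction z using OnePoint.rec with
    | infty => simp [measureReal_infty_alive]
    | coe x => simp [deathProb]
  rw [transition, h1, ← M.integral_alive x s t]
  have h2 : ∫ ω, ({OnePoint.infty}ᶜ : Set (OnePoint X)).indicator (fun _ => (1 : ℝ)) (M.path s ω)
      ∂(M.P x) = (M.P x).real (M.alive s) := integral_indicator_one (M.measurableSet_alive s)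
  rw [← h2]
  refine integral_sub ?_ ?_
  · exact (integrable_const (1 : ℝ)).indicator (M.measurableSet_alive s)
  · refine Integrable.of_bound
      ((M.measurable_alive t).comp (M.measurable_path s)).aestronglyMeasurable 1
      (Eventually.of_forall fun ω => ?_)
    rw [Real.norm_of_nonneg measureReal_nonneg]
    exact measureReal_le_one

variable {m : Measure X} {𝓔 : DirichletForm m}

/-- A process that is properly associated with a conservative Dirichlet form has infinite life time
from quasi-every starting point. -/
theorem quasiEverywhere_lifetime_eq_top [BorelSpace X] [SecondCountableTopology X]
    [TopologicalSpace.SeparableSpace (𝓔.EnergySpace DirichletForm.posOne)]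
    (hM : M.IsProperlyAssociated 𝓔) (B : ℕ → Set X) (hB : ∀ n, MeasurableSet (B n))
    (hmono : Monotone B) (hU : ⋃ n, B n = univ) (hfin : ∀ n, m (B n) ≠ ∞)
    (hcons : ∀ (t : ℝ≥0) (f : ℕ → Lp ℝ 2 m), (∀ᵐ x ∂m, 0 ≤ f 0 x ∧ Monotone (fun n => f n x) ∧
      Tendsto (fun n => f n x) atTop (𝓝 1)) →
      ∀ᵐ x ∂m, Tendsto (fun n => 𝓔.semigroup t (f n) x) atTop (𝓝 1)) :
    𝓔.QuasiEverywhere fun x => M.P (x : OnePoint X) {ω | M.lifetime ω < ⊤} = 0 := by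
  obtain ⟨T, hT, hTM⟩ := hM
  have hmem : ∀ n, MemLp ((B n).indicator fun _ => (1 : ℝ)) 2 m := fun n =>
    memLp_indicator_const 2 (hB n) 1 (Or.inr (hfin n))
  have hmeas : ∀ n, Measurable ((B n).indicator fun _ => (1 : ℝ)) := fun n =>
    measurable_const.indicator (hB n)
  -- Conservativeness along the indicators of `B n` gives `p_t 1 = 1` a.e., since uniqueness
  -- identifies the semigroup of the process.
  have hone : ∀ t : ℝ≥0, 0 < t → ∀ᵐ (x : X) ∂m, (M.P (x : OnePoint X)).real (M.alive t) = 1 := by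
    intro t ht
    have h1 := hcons t (fun n => (hmem n).toLp _) (by
      filter_upwards [ae_all_iff.2 fun n => (hmem n).coeFn_toLp] with x hx
      simp only [hx]
      refine ⟨indicator_nonneg (fun _ _ => zero_le_one) _, fun i j hij =>
        indicator_le_indicator_of_subset (hmono hij) (fun _ => zero_le_one) x, ?_⟩
      refine tendsto_const_nhds.congr' ?_
      obtain ⟨N, hN⟩ := mem_iUnion.1 (hU ▸ mem_univ x)
      filter_upwards [eventually_ge_atTop N] with n hn
      rw [indicator_of_mem (hmono hn hN)])
    filter_upwards [h1, ae_all_iff.2 fun n => (hTM t ht _ (hmeas n) ⟨1, fun x => by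
      rw [abs_le, indicator]; split_ifs <;> norm_num⟩ (hmem n)).2] with x h2 h3
    refine tendsto_nhds_unique (M.tendsto_transition_indicator t hB hmono hU x) ?_
    simp only [h3, hT.eq_semigroup]
    exact h2
  -- `1 - p_1 1` vanishes a.e. but need not be quasi-continuous. Applying `p_s` with `s > 0` makes
  -- it so, and then it vanishes quasi-everywhere.
  have hκm : Measurable (M.deathProb 1) := measurable_const.sub
    ((M.measurable_alive 1).comp measurableEmbedding_onePoint_coe.measurable)
  have hκ0 : M.deathProb 1 =ᵐ[m] 0 := by
    filter_upwards [hone 1 one_pos] with x hx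
    simp [deathProb, hx]
  have hκL : MemLp (M.deathProb 1) 2 m := (MemLp.zero).ae_eq hκ0.symm
  have hκb : ∃ C : ℝ, ∀ x, |M.deathProb 1 x| ≤ C := ⟨1, fun x => by
    have h1 : (M.P (x : OnePoint X)).real (M.alive 1) ≤ 1 := measureReal_le_one
    have h2 : 0 ≤ (M.P (x : OnePoint X)).real (M.alive 1) := measureReal_nonneg
    rw [abs_le, deathProb]
    constructor <;> linarith⟩
  -- Countably many times suffice, so the exceptional sets can be collected into one.
  set s : ℕ → ℝ≥0 := TopologicalSpace.denseSeq ℝ≥0 with hs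
  have hqe : ∀ j, 𝓔.QuasiEverywhere fun x => 0 < s j → M.transition (s j) (M.deathProb 1) x = 0 := by
    intro j
    rcases (show 0 ≤ s j from bot_le).eq_or_lt with h | h
    · refine (DirichletForm.IsQuasiContinuous.quasiEverywhere_eq_zero (𝓔 := 𝓔)
        (f := fun _ => (0 : ℝ)) ?_ (Eventually.of_forall fun _ => rfl)).mono ?_
      · exact ⟨fun _ => univ, ⟨fun _ => isClosed_univ, monotone_const, fun u ε hε =>
          ⟨0, u, by simp, by simpa [DirichletForm.form₁] using hε⟩⟩,
          fun _ => continuousOn_const⟩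
      · intro x _ h'
        exact absurd h' (by rw [← h]; exact lt_irrefl _)
    · obtain ⟨h1, h2⟩ := hTM (s j) h _ hκm hκb hκL
      refine (h1.quasiEverywhere_eq_zero ?_).mono fun x hx _ => hx
      refine h2.trans ?_
      have h3 : hκL.toLp (M.deathProb 1) = 0 := by
        rw [← Lp.toLp_coeFn (0 : Lp ℝ 2 m) (Lp.memLp 0)]
        exact MemLp.toLp_congr _ _ (hκ0.trans (Lp.coeFn_zero ℝ 2 m).symm)
      rw [h3, map_zero]
      exact Lp.coeFn_zero ℝ 2 m
  refine (DirichletForm.quasiEverywhere_all hqe).mono fun x hx => ?_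
  have hnull : ∀ j, 0 < s j → M.P (x : OnePoint X) (M.alive (s j) \ M.alive (s j + 1)) = 0 := by
    intro j hj
    have h1 := hx j hj
    rw [M.transition_deathProb] at h1
    rw [← measureReal_eq_zero_iff, measureReal_sdiff (M.alive_anti le_self_add)
      (M.measurableSet_alive _), h1]
  refine measure_mono_null (t := {ω | ¬ M.path 0 ω = (x : OnePoint X)} ∪
    ⋃ j, ⋃ (_ : 0 < s j), (M.alive (s j) \ M.alive (s j + 1))) (fun ω hω => ?_)
    (measure_union_null (ae_iff.1 (M.normal x)) (measure_iUnion_null fun j =>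
      measure_iUnion_null fun hj => hnull j hj))
  by_cases h0 : M.path 0 ω = (x : OnePoint X)
  · right
    have hpos : ω ∈ M.alive 0 := by
      rw [alive, mem_preimage, h0]
      exact OnePoint.coe_ne_infty x
    rw [mem_alive, ENNReal.coe_zero] at hpos
    obtain ⟨l, hl⟩ : ∃ l : ℝ≥0, (l : ℝ≥0∞) = M.lifetime ω :=
      ⟨_, ENNReal.coe_toNNReal (ne_of_lt (show M.lifetime ω < ⊤ from hω))⟩
    rw [← hl, ENNReal.coe_pos] at hpos
    -- A positive finite life time `l` lies in `(s j, s j + 1]` as soon as `s j` is chosen between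
    -- `max 0 (l - 1)` and `l`.
    obtain ⟨j, hr1, hr2⟩ := (TopologicalSpace.denseRange_denseSeq ℝ≥0).exists_mem_open
      (isOpen_Ioo (a := max 0 (l - 1)) (b := l))
      (nonempty_Ioo.2 (max_lt hpos (tsub_lt_self hpos one_pos)))
    refine mem_iUnion.2 ⟨j, mem_iUnion.2 ⟨lt_of_le_of_lt (le_max_left _ _) hr1, ?_, ?_⟩⟩
    · rw [mem_alive, ← hl]
      exact ENNReal.coe_lt_coe.2 hr2
    · rw [mem_alive, ← hl, ENNReal.coe_lt_coe, not_lt]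
      have := lt_of_le_of_lt (le_max_right _ _) hr1
      exact tsub_le_iff_right.1 this.le
  · exact Or.inl h0

end MarkovProcess
end

noncomputable section


/-! ## The cone is proper -/

instance : Fact ((2 : ℝ≥0∞) ≠ ∞) := ⟨ENNReal.ofNat_ne_top⟩

/-- `ξ` is constant near both end points of `[0,1]`. -/
structure FlatEnds (ξ : I → ℝ) (δ : ℝ) : Prop where
  pos : 0 < δ
  lt_half : δ < 1 / 2
  left : ∀ u : I, (u : ℝ) < δ → ξ u = ξ 0
  right : ∀ u : I, 1 - δ < (u : ℝ) → ξ u = ξ 1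

theorem unitInterval.exists_mem_Ioo_of_ae {p : I → Prop} (h : ∀ᵐ u, p u) {a b : I} (hab : a < b) :
    ∃ u ∈ Ioo a b, p u := by
  by_contra! hc
  have h1 : volume (Ioo a b) = 0 := measure_mono_null (fun u hu => hc u hu) (ae_iff.1 h)
  rw [unitInterval.volume_Ioo, ENNReal.ofReal_eq_zero, sub_nonpos] at h1
  exact (not_lt.2 h1) hab

theorem comap_le_borel {ξ : I → ℝ} (hξ : Monotone ξ) :
    MeasurableSpace.comap ξ inferInstance ≤ (inferInstance : MeasurableSpace I) :=
  hξ.measurable.comap_le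

theorem mem_L2of_iff {ξ : I → ℝ} {g : L2I} : g ∈ L2of ξ ↔
    AEStronglyMeasurable[MeasurableSpace.comap ξ inferInstance] g volume :=
  mem_lpMeas_iff_aestronglyMeasurable

theorem isClosed_L2of {ξ : I → ℝ} (hξ : Monotone ξ) : IsClosed (L2of ξ : Set L2I) := by
  convert isClosed_aestronglyMeasurable (F := ℝ) (p := 2) (μ := (volume : Measure I))
    (comap_le_borel hξ) using 1
  ext g
  exact mem_L2of_iff

/-- An element of `L_2(ξ)` is a.e. a function of `ξ`. -/
theorem ae_eq_const_of_mem_L2of {ξ : I → ℝ} {g : L2I} (hg : g ∈ L2of ξ) {S : Set I} {v : ℝ}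
    (hS : ∀ u ∈ S, ξ u = v) : ∃ c : ℝ, ∀ᵐ u, u ∈ S → g u = c := by
  obtain ⟨h, hh, hgh⟩ := mem_L2of_iff.1 hg
  obtain ⟨ψ, -, rfl⟩ := hh.exists_eq_measurable_comp
  refine ⟨ψ v, ?_⟩
  filter_upwards [hgh] with u hu huS
  rw [hu, Function.comp_apply, hS u huS]

theorem abs_mul_sqrt_le_norm {g : L2I} {S : Set I} (hS : MeasurableSet S) {c : ℝ}
    (h : ∀ᵐ u, u ∈ S → g u = c) : |c| * √(volume.real S) ≤ ‖g‖ := by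
  have h1 : ‖indicatorConstLp 2 hS (measure_ne_top volume S) c‖ = |c| * √(volume.real S) := by
    rw [norm_indicatorConstLp two_ne_zero ENNReal.ofNat_ne_top, Real.sqrt_eq_rpow]
    simp
  rw [← h1]
  refine Lp.norm_le_norm_of_ae_le ?_
  filter_upwards [h, indicatorConstLp_coeFn (p := 2) (hs := hS) (hμs := measure_ne_top volume S)
    (c := c)] with u hu hu'
  rw [hu']
  by_cases huS : u ∈ S
  · rw [indicator_of_mem huS, hu huS]
  · rw [indicator_of_notMem huS, norm_zero]
    exact norm_nonneg _

/-- The value at `1` is replaced by the left limit, and then right limits are taken. A monotone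
function has countably many discontinuities, so only a null set is affected. -/
theorem mem_L2up_of_monotone {g : L2I} {f : I → ℝ} (hf : Monotone f) (hgf : g =ᵐ[volume] f) :
    g ∈ L2up := by
  classical
  have hne1 : (𝓝[<] (1 : I)).NeBot := nhdsLT_neBot_of_exists_lt ⟨0, zero_lt_one⟩
  set H : I → ℝ := Function.update f 1 (Function.leftLim f 1) with hH
  have hne : ∀ u : I, u ≠ 1 → H u = f u := fun u hu => Function.update_of_ne hu _ _
  have h1 : H 1 = Function.leftLim f 1 := Function.update_self _ _ _
  have hmono : Monotone H := by
    intro u v huv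
    by_cases hu : u = 1
    · have hv : v = 1 := le_antisymm v.2.2 (hu ▸ huv)
      rw [hu, hv]
    · rw [hne u hu]
      by_cases hv : v = 1
      · rw [hv, h1]
        exact hf.le_leftLim (lt_of_le_of_ne u.2.2 hu)
      · rw [hne v hv]
        exact hf huv
  have hlim : Tendsto H (𝓝 1) (𝓝 (H 1)) := by
    have h2 : Tendsto H (𝓝[<] 1) (𝓝 (H 1)) := by
      rw [h1]
      refine (hf.tendsto_leftLim 1).congr' ?_
      filter_upwards [self_mem_nhdsWithin] with u hu
      exact (hne u (ne_of_lt hu)).symm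
    have h3 : 𝓝 (1 : I) = 𝓝[≤] 1 := by
      rw [show Iic (1 : I) = univ from Set.eq_univ_of_forall fun u => u.2.2, nhdsWithin_univ]
    rw [h3]
    exact continuousWithinAt_Iio_iff_Iic.1 h2
  set s := hmono.stieltjesFunction with hs
  have hs1 : s 1 = H 1 := by
    rw [hs, hmono.stieltjesFunction_eq]
    exact rightLim_eq_of_isTop fun u => u.2.2
  have hsc : ContinuousAt s 1 := by
    rw [ContinuousAt]
    refine tendsto_of_tendsto_of_tendsto_of_le_of_le (hs1 ▸ hlim) tendsto_const_nhds
      (fun u => ?_) (fun u => s.mono u.2.2)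
    rw [hs, hmono.stieltjesFunction_eq]
    exact hmono.le_rightLim le_rfl
  refine ⟨fun u => (s u : EReal), ⟨fun u v huv => EReal.coe_le_coe_iff.2 (s.mono huv), fun u =>
    continuous_coe_real_ereal.continuousAt.comp_continuousWithinAt (s.right_continuous u),
    continuous_coe_real_ereal.continuousAt.comp hsc⟩, ?_⟩
  have hcount : ∀ᵐ u : I, u ∉ {u | ¬ContinuousAt H u} :=
    (hmono.countable_not_continuousAt).ae_notMem volume
  have hcount1 : ∀ᵐ u : I, u ≠ 1 := (countable_singleton (1 : I)).ae_notMem volume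
  filter_upwards [hgf, hcount, hcount1] with u hu hu2 hu1
  have hu3 : ContinuousAt H u := not_not.1 hu2
  have h4 : s u = H u := by
    rw [hs, hmono.stieltjesFunction_eq]
    exact hu3.continuousWithinAt.rightLim_eq
  rw [h4, hne u hu1, hu]

/-- `g` is a.e. equal to constants `c` and `d` on the flat ends. Truncating an extended-valued
version to `[c, d]` makes it finite and changes it at `0` and `1` at most, while `|c| √δ` and `|d|
√δ` are bounded by the norm. This control of the supremum by the `L_2` norm is the source of
compactness and of the growth bound for `Ξ`. -/
theorem exists_monotone_version {ξ : I → ℝ} {δ : ℝ} (h : FlatEnds ξ δ) {g : L2I} (hg : g ∈ L2up)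
    (hg' : g ∈ L2of ξ) : ∃ f : I → ℝ, Monotone f ∧ g =ᵐ[volume] f ∧
      (∀ u : I, (u : ℝ) < δ → f u = f 0) ∧ (∀ u : I, 1 - δ < (u : ℝ) → f u = f 1) ∧
      ∀ u, |f u| ≤ ‖g‖ / √δ := by
  have hδ := h.pos
  have hδ2 := h.lt_half
  obtain ⟨G, ⟨hGm, -, -⟩, hG⟩ := hg
  set a : I := ⟨δ, hδ.le, by linarith⟩ with ha
  set b : I := ⟨1 - δ, by linarith, by linarith⟩ with hb
  obtain ⟨c, hc⟩ := ae_eq_const_of_mem_L2of hg' (S := Iio a) (v := ξ 0) fun u hu => h.left u hu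
  obtain ⟨d, hd⟩ := ae_eq_const_of_mem_L2of hg' (S := Ioi b) (v := ξ 1) fun u hu => h.right u hu
  have h01 : (0 : I) < a := hδ
  have hb1 : b < (1 : I) := show (1 - δ : ℝ) < 1 by linarith
  have hab : a < b := show δ < 1 - δ by linarith
  have hc_le : ∀ v : I, 0 < v → (c : EReal) ≤ G v := fun v hv => by
    obtain ⟨u, hu, hu1, hu2⟩ := unitInterval.exists_mem_Ioo_of_ae (hc.and hG) (lt_min h01 hv)
    rw [← hu1 (lt_of_lt_of_le hu.2 (min_le_left _ _)), hu2]
    exact hGm (hu.2.le.trans (min_le_right _ _))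
  have hle_c : ∀ v : I, v < a → G v ≤ c := fun v hv => by
    obtain ⟨u, hu, hu1, hu2⟩ := unitInterval.exists_mem_Ioo_of_ae (hc.and hG) hv
    rw [← hu1 hu.2, hu2]
    exact hGm hu.1.le
  have hle_d : ∀ v : I, v < 1 → G v ≤ d := fun v hv => by
    obtain ⟨u, hu, hu1, hu2⟩ := unitInterval.exists_mem_Ioo_of_ae (hd.and hG) (max_lt hb1 hv)
    rw [← hu1 (lt_of_le_of_lt (le_max_left _ _) hu.1), hu2]
    exact hGm ((le_max_right _ _).trans hu.1.le)
  have hd_le : ∀ v : I, b < v → (d : EReal) ≤ G v := fun v hv => by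
    obtain ⟨u, hu, hu1, hu2⟩ := unitInterval.exists_mem_Ioo_of_ae (hd.and hG) hv
    rw [← hu1 hu.1, hu2]
    exact hGm hu.2.le
  have hcd : c ≤ d := EReal.coe_le_coe_iff.1
    ((hc_le a h01).trans (hle_d a (hab.trans hb1)))
  set F : I → EReal := fun u => max (c : EReal) (min (d : EReal) (G u)) with hF
  have hFm : Monotone F := fun u v huv => max_le_max le_rfl (min_le_min le_rfl (hGm huv))
  have hFc : ∀ u, (c : EReal) ≤ F u := fun u => le_max_left _ _
  have hFd : ∀ u, F u ≤ (d : EReal) := fun u =>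
    max_le (EReal.coe_le_coe_iff.2 hcd) (min_le_left _ _)
  have hFbot : ∀ u, F u ≠ ⊥ := fun u => ne_bot_of_le_ne_bot (EReal.coe_ne_bot c) (hFc u)
  have hFtop : ∀ u, F u ≠ ⊤ := fun u => ne_top_of_le_ne_top (EReal.coe_ne_top d) (hFd u)
  have hFleft : ∀ u : I, (u : ℝ) < δ → F u = c := fun u hu =>
    max_eq_left ((min_le_right _ _).trans (hle_c u hu))
  have hFright : ∀ u : I, 1 - δ < (u : ℝ) → F u = d := fun u hu => by
    rw [hF]
    simp only
    rw [min_eq_left (hd_le u hu), max_eq_right (EReal.coe_le_coe_iff.2 hcd)]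
  have hbound : ∀ e : ℝ, ∀ S : Set I, MeasurableSet S → volume.real S = δ →
      (∀ᵐ u, u ∈ S → g u = e) → |e| ≤ ‖g‖ / √δ := fun e S hS hSδ he => by
    rw [le_div_iff₀ (Real.sqrt_pos.2 hδ), ← hSδ]
    exact abs_mul_sqrt_le_norm hS he
  refine ⟨fun u => (F u).toReal, fun u v huv => EReal.toReal_le_toReal (hFm huv) (hFbot u)
    (hFtop v), ?_, fun u hu => ?_, fun u hu => ?_, fun u => ?_⟩
  · have h0 : ∀ᵐ u : I, u ≠ 0 := (countable_singleton (0 : I)).ae_notMem volume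
    have h1 : ∀ᵐ u : I, u ≠ 1 := (countable_singleton (1 : I)).ae_notMem volume
    filter_upwards [hG, h0, h1] with u hu hu0 hu1
    have h2 : F u = G u := by
      rw [hF]
      simp only
      rw [min_eq_right (hle_d u (lt_of_le_of_ne u.2.2 hu1)),
        max_eq_right (hc_le u (lt_of_le_of_ne u.2.1 hu0.symm))]
    rw [h2, ← hu, EReal.toReal_coe]
  · simp only [hFleft u hu, hFleft 0 hδ]
  · simp only [hFright u hu, hFright 1 (by simpa using hδ)]
  · have hc1 := hbound c (Iio a) measurableSet_Iio
      (by rw [measureReal_def, unitInterval.volume_Iio, ENNReal.toReal_ofReal hδ.le]) hc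
    have hd1 := hbound d (Ioi b) measurableSet_Ioi
      (by rw [measureReal_def, unitInterval.volume_Ioi, sub_sub_cancel,
        ENNReal.toReal_ofReal hδ.le]) hd
    have h2 : c ≤ (F u).toReal := by
      simpa using EReal.toReal_le_toReal (hFc u) (EReal.coe_ne_bot c) (hFtop u)
    have h3 : (F u).toReal ≤ d := by
      simpa using EReal.toReal_le_toReal (hFd u) (hFbot u) (EReal.coe_ne_top d)
    rw [abs_le] at hc1 hd1 ⊢
    exact ⟨hc1.1.trans h2, h3.trans hd1.2⟩

/-- Helly's selection theorem, with convergence almost everywhere. -/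
theorem exists_subseq_ae_tendsto_of_monotone (f : ℕ → I → ℝ) (hf : ∀ n, Monotone (f n)) (C : ℝ)
    (hC : ∀ n u, |f n u| ≤ C) : ∃ (φ : ℕ → ℕ) (F : I → ℝ), StrictMono φ ∧ Monotone F ∧
      (∀ u, |F u| ≤ C) ∧ ∀ᵐ u, Tendsto (fun n => f (φ n) u) atTop (𝓝 (F u)) := by
  obtain ⟨a, φ, hφ, hlim⟩ := CompactSpace.tendsto_subseq (X := ℕ → Icc (-C) C)
    fun n k => ⟨f n (TopologicalSpace.denseSeq I k), abs_le.1 (hC n _)⟩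
  have hpt : ∀ k, Tendsto (fun n => f (φ n) (TopologicalSpace.denseSeq I k)) atTop
      (𝓝 (a k : ℝ)) := fun k =>
    (continuous_subtype_val.tendsto _).comp ((tendsto_pi_nhds.1 hlim) k)
  have hub : ∀ u, IsBoundedUnder (· ≤ ·) atTop fun n => f (φ n) u := fun u =>
    isBoundedUnder_of ⟨C, fun n => (abs_le.1 (hC _ u)).2⟩
  have hlb : ∀ u, IsBoundedUnder (· ≥ ·) atTop fun n => f (φ n) u := fun u =>
    isBoundedUnder_of ⟨-C, fun n => (abs_le.1 (hC _ u)).1⟩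
  set F : I → ℝ := fun u => limsup (fun n => f (φ n) u) atTop with hF
  set F' : I → ℝ := fun u => liminf (fun n => f (φ n) u) atTop with hF'
  have hFm : Monotone F := fun u v huv => limsup_le_limsup
    (Eventually.of_forall fun n => hf _ huv) (hlb u).isCoboundedUnder_le (hub v)
  have hFm' : Monotone F' := fun u v huv => liminf_le_liminf
    (Eventually.of_forall fun n => hf _ huv) (hlb u) (hub v).isCoboundedUnder_ge
  -- The upper and lower limits are monotone and agree on a dense set, hence at every common point
  -- of continuity, that is, off a countable set.
  have heq : ∀ u, ContinuousAt F u → ContinuousAt F' u → F u = F' u := by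
    intro u h1 h2
    by_contra hne
    have h3 : ∀ᶠ v in 𝓝 u, F v - F' v ≠ 0 := (h1.sub h2).eventually_ne (sub_ne_zero.2 hne)
    obtain ⟨s, hs, hso, hus⟩ := eventually_nhds_iff.1 h3
    obtain ⟨k, hk⟩ := (TopologicalSpace.denseRange_denseSeq I).exists_mem_open hso ⟨u, hus⟩
    exact hs _ hk (sub_eq_zero.2 ((hpt k).limsup_eq.trans (hpt k).liminf_eq.symm))
  refine ⟨φ, F, hφ, hFm, fun u => abs_le.2 ⟨?_, ?_⟩, ?_⟩
  · exact le_limsup_of_frequently_le (Frequently.of_forall fun n => (abs_le.1 (hC _ u)).1) (hub u)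
  · exact limsup_le_of_le (hlb u).isCoboundedUnder_le
      (Eventually.of_forall fun n => (abs_le.1 (hC _ u)).2)
  · filter_upwards [hFm.countable_not_continuousAt.ae_notMem volume,
      hFm'.countable_not_continuousAt.ae_notMem volume] with u h1 h2
    exact tendsto_of_liminf_eq_limsup (heq u (not_not.1 h1) (not_not.1 h2)).symm rfl (hub u) (hlb u)

/-- The monotone versions are bounded by `R / √δ`. Helly's theorem gives an a.e. convergent
subsequence, and the uniform bound upgrades this to convergence in `L_2`. -/
theorem isCompact_cone_closedBall {ξ : I → ℝ} {δ : ℝ} (hξ : Monotone ξ) (h : FlatEnds ξ δ)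
    (R : ℝ) : IsCompact {g : L2I | (g ∈ L2up ∧ g ∈ L2of ξ) ∧ ‖g‖ ≤ R} := by
  refine IsSeqCompact.isCompact fun g hg => ?_
  choose f hfm hgf _ _ hb using fun n => exists_monotone_version h (hg n).1.1 (hg n).1.2
  have hδ := Real.sqrt_pos.2 h.pos
  obtain ⟨φ, F, hφ, hFm, hFb, hlim⟩ := exists_subseq_ae_tendsto_of_monotone f hfm (R / √δ)
    fun n u => (hb n u).trans (by gcongr; exact (hg n).2)
  have hL : MemLp F 2 (volume : Measure I) :=
    MemLp.of_bound hFm.measurable.aestronglyMeasurable _ (Eventually.of_forall hFb)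
  have hconst : MemLp (fun _ : I => 2 * (R / √δ)) 2 (volume : Measure I) := memLp_const _
  have htend : Tendsto (g ∘ φ) atTop (𝓝 (hL.toLp F)) := by
    refine Lp_two_tendsto_of_dominated _ _ (hconst.toLp _) (fun n => ?_) ?_
    · filter_upwards [hgf (φ n), hL.coeFn_toLp, hconst.coeFn_toLp] with u h1 h2 h3
      rw [Function.comp_apply, h1, h2, h3]
      have h4 := (hb (φ n) u).trans
        ((div_le_div_iff_of_pos_right hδ).2 (hg (φ n)).2)
      calc |f (φ n) u - F u| ≤ |f (φ n) u| + |F u| := abs_sub _ _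
        _ ≤ 2 * (R / √δ) := by linarith [hFb u]
    · filter_upwards [hlim, hL.coeFn_toLp, ae_all_iff.2 fun n => hgf (φ n)] with u h1 h2 h3
      simp only [Function.comp_apply, h3, h2]
      exact h1
  refine ⟨_, ⟨⟨mem_L2up_of_monotone hFm hL.coeFn_toLp, ?_⟩, ?_⟩, φ, hφ, htend⟩
  · exact (isClosed_L2of hξ).mem_of_tendsto htend (Eventually.of_forall fun n => (hg (φ n)).1.2)
  · exact le_of_tendsto htend.norm (Eventually.of_forall fun n => (hg (φ n)).2)

theorem zero_mem_cone (ξ : I → ℝ) : (0 : L2I) ∈ L2up ∧ (0 : L2I) ∈ L2of ξ :=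
  ⟨mem_L2up_of_monotone (f := 0) monotone_const (Lp.coeFn_zero ℝ 2 volume), zero_mem _⟩

theorem isCompact_norm_le {ξ : I → ℝ} {δ : ℝ} (hξ : Monotone ξ) (h : FlatEnds ξ δ) (R : ℝ) :
    IsCompact {g : ConeOf ξ | ‖(g : L2I)‖ ≤ R} := by
  rw [Subtype.isCompact_iff]
  convert isCompact_cone_closedBall hξ h R using 1
  ext g
  constructor
  · rintro ⟨g, hg, rfl⟩
    exact ⟨g.2, hg⟩
  · rintro ⟨h1, h2⟩
    exact ⟨⟨g, h1⟩, h2, rfl⟩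

theorem properSpace_coneOf {ξ : I → ℝ} {δ : ℝ} (hξ : Monotone ξ) (h : FlatEnds ξ δ) :
    ProperSpace (ConeOf ξ) := by
  refine ⟨fun g R => (isCompact_norm_le hξ h (‖(g : L2I)‖ + R)).of_isClosed_subset
    Metric.isClosed_closedBall fun v hv => ?_⟩
  have h1 : dist (v : L2I) g ≤ R := hv
  rw [dist_eq_norm] at h1
  calc ‖(v : L2I)‖ = ‖(g : L2I) + (v - g)‖ := by rw [add_sub_cancel]
    _ ≤ ‖(g : L2I)‖ + ‖(v : L2I) - g‖ := norm_add_le _ _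
    _ ≤ ‖(g : L2I)‖ + R := by linarith

theorem isClosed_cone {ξ : I → ℝ} {δ : ℝ} (hξ : Monotone ξ) (h : FlatEnds ξ δ) :
    IsClosed {g : L2I | g ∈ L2up ∧ g ∈ L2of ξ} := by
  have := properSpace_coneOf hξ h
  exact (completeSpace_coe_iff_isComplete.1
    (inferInstance : CompleteSpace (ConeOf ξ))).isClosed
end

noncomputable section


/-! ## Step functions -/

theorem isOpen_setOf_strictMono {X α : Type*} [TopologicalSpace X] [TopologicalSpace α]
    [LinearOrder α] [OrderClosedTopology α] {n : ℕ} {f : X → Fin (n + 1) → α}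
    (hf : ∀ i, Continuous fun x => f x i) : IsOpen {x | StrictMono (f x)} := by
  simp only [Fin.strictMono_iff_lt_succ, setOf_forall]
  exact isOpen_iInter_of_finite fun i => isOpen_lt (hf _) (hf _)

section Partition

variable {k : ℕ}

@[simp] theorem partitionPoints_zero (q : Fin k → I) : partitionPoints q 0 = 0 := rfl

theorem partitionPoints_succ (q : Fin k → I) (i : Fin (k + 1)) :
    partitionPoints q i.succ = Fin.snoc (α := fun _ => I) q 1 i := by
  rw [partitionPoints, Fin.cons_succ]

@[simp] theorem partitionPoints_last (q : Fin k → I) : partitionPoints q (Fin.last (k + 1)) = 1 := by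
  rw [← Fin.succ_last, partitionPoints_succ, Fin.snoc_last]

theorem partitionPoints_succ_castSucc (q : Fin k → I) (j : Fin k) :
    partitionPoints q j.castSucc.succ = q j := by
  rw [partitionPoints_succ, Fin.snoc_castSucc]

/-- Case distinction for the partition points. -/
theorem partitionPoints_mem {P : I → Prop} (q : Fin k → I) (h0 : P 0) (h1 : P 1)
    (h : ∀ j, P (q j)) (i : Fin (k + 2)) : P (partitionPoints q i) := by
  induction i using Fin.cases with
  | zero => exact h0
  | succ i =>
    induction i using Fin.lastCases with
    | last => rw [Fin.succ_last, partitionPoints_last]; exact h1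
    | cast j => rw [partitionPoints_succ_castSucc]; exact h j

theorem continuous_partitionPoints (i : Fin (k + 2)) :
    Continuous fun q : Fin k → I => partitionPoints q i := by
  induction i using Fin.cases with
  | zero => exact continuous_const
  | succ i =>
    induction i using Fin.lastCases with
    | last => simp only [Fin.succ_last, partitionPoints_last]; exact continuous_const
    | cast j => simp only [partitionPoints_succ_castSucc]; exact continuous_apply j

theorem isOpen_QSimplex : IsOpen (QSimplex k) :=
  isOpen_setOf_strictMono fun i => continuous_partitionPoints i

/-- The cells `[q_i, q_{i+1})` of a partition. -/
def cell (q : Fin k → I) (i : Fin (k + 1)) : Set I :=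
  Ico (partitionPoints q i.castSucc) (partitionPoints q i.succ)

theorem measurableSet_cell (q : Fin k → I) (i : Fin (k + 1)) : MeasurableSet (cell q i) :=
  measurableSet_Ico

/-- The length of a cell. -/
def cellLen (q : Fin k → I) (i : Fin (k + 1)) : ℝ :=
  (partitionPoints q i.succ : ℝ) - partitionPoints q i.castSucc

/-- The indicator of a cell, as an element of `L_2`. -/
def cellInd (q : Fin k → I) (i : Fin (k + 1)) : L2I :=
  indicatorConstLp 2 (μ := (volume : Measure I)) (s := cell q i)
    (measurableSet_cell q i) (measure_ne_top _ _) (1 : ℝ)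

theorem stepFun_eq (q : Fin k → I) (x : Fin (k + 1) → ℝ) :
    stepFun q x = ∑ i, x i • cellInd q i := rfl

theorem cellLen_pos {q : Fin k → I} (hq : q ∈ QSimplex k) (i : Fin (k + 1)) : 0 < cellLen q i :=
  sub_pos.2 (hq (Fin.castSucc_lt_succ (i := i)))

theorem sum_cellLen (q : Fin k → I) : ∑ i, cellLen q i = 1 := by
  have h := Fin.sum_univ_succ fun i => (partitionPoints q i : ℝ)
  rw [Fin.sum_univ_castSucc fun i => (partitionPoints q i : ℝ)] at h
  simp only [cellLen, Finset.sum_sub_distrib]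
  simp only [partitionPoints_zero, partitionPoints_last, Icc.coe_one, Icc.coe_zero] at h
  linarith

theorem volume_cell {q : Fin k → I} (hq : q ∈ QSimplex k) (i : Fin (k + 1)) :
    (volume : Measure I).real (cell q i) = cellLen q i := by
  rw [measureReal_def, cell, unitInterval.volume_Ico]
  exact ENNReal.toReal_ofReal (cellLen_pos hq i).le

theorem cell_disjoint {q : Fin k → I} (hq : q ∈ QSimplex k) {i j : Fin (k + 1)} (hij : i ≠ j) :
    Disjoint (cell q i) (cell q j) := by
  rw [Set.disjoint_left]
  intro u hi hj
  rcases lt_or_gt_of_ne hij with h | h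
  · exact absurd (hi.2.trans_le ((hq.monotone (Fin.succ_le_castSucc_iff.2 h)).trans hj.1))
      (lt_irrefl u)
  · exact absurd (hj.2.trans_le ((hq.monotone (Fin.succ_le_castSucc_iff.2 h)).trans hi.1))
      (lt_irrefl u)

theorem exists_mem_cell (q : Fin k → I) {u : I} (hu : u < 1) : ∃ i, u ∈ cell q i := by
  by_contra! h
  have h1 : ∀ i : Fin (k + 2), partitionPoints q i ≤ u := by
    intro i
    induction i using Fin.induction with
    | zero => exact u.2.1
    | succ i ih =>
      by_contra! hlt
      exact h i ⟨ih, hlt⟩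
  have h2 := h1 (Fin.last _)
  rw [partitionPoints_last] at h2
  exact absurd hu (not_lt.2 h2)

theorem ae_exists_mem_cell (q : Fin k → I) : ∀ᵐ u, ∃ i, u ∈ cell q i := by
  filter_upwards [(countable_singleton (1 : I)).ae_notMem volume] with u hu
  exact exists_mem_cell q (lt_of_le_of_ne u.2.2 hu)

theorem cellInd_coeFn (q : Fin k → I) (i : Fin (k + 1)) :
    cellInd q i =ᵐ[volume] (cell q i).indicator fun _ => 1 := indicatorConstLp_coeFn

theorem sum_smul_cellInd_coeFn {q : Fin k → I} (hq : q ∈ QSimplex k) (x : Fin (k + 1) → ℝ) :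
    ∀ᵐ u, ∀ i, u ∈ cell q i → (∑ i, x i • cellInd q i : L2I) u = x i := by
  have h1 : ∀ s : Finset (Fin (k + 1)), (∑ i ∈ s, x i • cellInd q i : L2I) =ᵐ[volume]
      fun u => ∑ i ∈ s, x i * (cell q i).indicator (fun _ => (1 : ℝ)) u := by
    classical
    intro s
    induction s using Finset.induction_on with
    | empty =>
      simp only [Finset.sum_empty]
      exact Lp.coeFn_zero ℝ 2 (volume : Measure I)
    | insert i s hi ih =>
      rw [Finset.sum_insert hi]
      filter_upwards [Lp.coeFn_add (x i • cellInd q i) (∑ i ∈ s, x i • cellInd q i), ih,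
        Lp.coeFn_smul (x i) (cellInd q i), cellInd_coeFn q i] with u h1 h2 h3 h4
      rw [h1, Pi.add_apply, h2, h3, Pi.smul_apply, h4, Finset.sum_insert hi, smul_eq_mul]
  filter_upwards [h1 Finset.univ] with u hu i hi
  rw [hu, Finset.sum_eq_single i]
  · rw [indicator_of_mem hi, mul_one]
  · intro j _ hj
    rw [indicator_of_notMem fun h => (Set.disjoint_left.1 (cell_disjoint hq hj)) h hi, mul_zero]
  · simp

theorem stepFun_coeFn {q : Fin k → I} (hq : q ∈ QSimplex k) (x : Fin (k + 1) → ℝ) :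
    ∀ᵐ u, ∀ i, u ∈ cell q i → stepFun q x u = x i :=
  sum_smul_cellInd_coeFn hq x

theorem inner_cellInd_cellInd {q : Fin k → I} (hq : q ∈ QSimplex k) (i j : Fin (k + 1)) :
    ⟪cellInd q i, cellInd q j⟫_ℝ = if i = j then cellLen q i else 0 := by
  rw [cellInd, cellInd, L2.real_inner_indicatorConstLp_one_indicatorConstLp_one]
  split_ifs with h
  · rw [h, inter_self, volume_cell hq]
  · rw [(cell_disjoint hq h).inter_eq, measureReal_empty]

theorem norm_cellInd_le_one (q : Fin k → I) (i : Fin (k + 1)) : ‖cellInd q i‖ ≤ 1 := by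
  rw [cellInd, norm_indicatorConstLp two_ne_zero ENNReal.ofNat_ne_top, norm_one, one_mul]
  exact Real.rpow_le_one measureReal_nonneg measureReal_le_one (by norm_num)

theorem inner_cellInd_sum {q : Fin k → I} (hq : q ∈ QSimplex k) (i : Fin (k + 1))
    (c : Fin (k + 1) → ℝ) : ⟪cellInd q i, ∑ j, c j • cellInd q j⟫_ℝ = c i * cellLen q i := by
  simp [inner_sum, inner_smul_right, inner_cellInd_cellInd hq]

theorem continuous_cellInd (i : Fin (k + 1)) : Continuous fun q : Fin k → I => cellInd q i := by
  refine continuous_indicatorConstLp_set ENNReal.ofNat_ne_top fun q => ?_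
  -- Two half-open intervals differ only between corresponding end points, so the difference has
  -- small measure when the partition points are close.
  have hsub : ∀ a b c d : I, symmDiff (Ico a b) (Ico c d) ⊆ uIoc a c ∪ {a, c} ∪ (uIoc b d ∪ {b, d}) := by
    intro a b c d u hu
    simp only [Set.mem_symmDiff, mem_Ico, mem_union, mem_insert_iff, mem_singleton_iff,
      Set.mem_uIoc] at hu ⊢
    grind
  refine tendsto_of_tendsto_of_tendsto_of_le_of_le (g := fun _ => 0)
    (h := fun p => volume (uIoc (partitionPoints p i.castSucc) (partitionPoints q i.castSucc))
      + volume (uIoc (partitionPoints p i.succ) (partitionPoints q i.succ))) tendsto_const_nhds ?_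
    (fun _ => bot_le) fun p => (measure_mono (hsub _ _ _ _)).trans ?_
  · have h1 : ∀ j, Tendsto (fun p : Fin k → I => edist (partitionPoints q j) (partitionPoints p j))
        (𝓝 q) (𝓝 0) := fun j => by
      have := (continuous_const (y := partitionPoints q j)).edist (continuous_partitionPoints j)
      simpa using this.tendsto q
    simp only [unitInterval.volume_uIoc]
    simpa using (h1 i.castSucc).add (h1 i.succ)
  · refine (measure_union_le _ _).trans (add_le_add ?_ ?_) <;>
    · refine (measure_union_le _ _).trans ?_
      rw [(Set.Finite.countable (Set.toFinite {_, _})).measure_zero volume, add_zero]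

theorem continuous_stepFun :
    Continuous fun p : (Fin k → I) × (Fin (k + 1) → ℝ) => stepFun p.1 p.2 := by
  simp only [stepFun_eq]
  refine continuous_finsetSum _ fun i _ => ?_
  exact ((continuous_apply i).comp continuous_snd).smul
    ((continuous_cellInd i).comp continuous_fst)

end Partition

/-! ## The points of left increase of `ξ` -/

/-- The points at which `ξ` increases from the left. -/
def leftIncr (ξ : I → ℝ) : Set I := {t | ∀ u < t, ξ u < ξ t}

/-- At such a point the interval `[0, t)` is `{ξ < ξ t}` and belongs to `σ(ξ)`. This is why step
functions that jump at these points lie in `L_2(ξ)`. -/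
theorem leftIncr_iff {ξ : I → ℝ} (hξ : Monotone ξ) {t : I} (ht : t ∈ leftIncr ξ) (u : I) :
    u < t ↔ ξ u < ξ t :=
  ⟨ht u, fun h => lt_of_not_ge fun h' => h.not_ge (hξ h')⟩

/-- A point that is not of left increase ends a flat piece `(d, t]` of `ξ` with `d` in a countable
dense set, and flat pieces carry no mass. -/
theorem measure_compl_leftIncr (ξ : StieltjesFunction I) : ξ.measure (leftIncr ξ)ᶜ = 0 := by
  have h1 : (leftIncr ξ)ᶜ ⊆ ⋃ n : ℕ, {t | TopologicalSpace.denseSeq I n < t ∧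
      ξ t = ξ (TopologicalSpace.denseSeq I n)} := by
    intro t ht
    simp only [leftIncr, mem_compl_iff, mem_setOf_eq, not_forall, not_lt] at ht
    obtain ⟨u, hut, hle⟩ := ht
    obtain ⟨n, hn⟩ := (TopologicalSpace.denseRange_denseSeq I).exists_mem_open isOpen_Ioo
      (nonempty_Ioo.2 hut)
    exact mem_iUnion.2 ⟨n, hn.2, le_antisymm (hle.trans (ξ.mono hn.1.le)) (ξ.mono hn.2.le)⟩
  refine measure_mono_null h1 (measure_iUnion_null fun n => ?_)
  set d := TopologicalSpace.denseSeq I n with hd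
  have hnull : ∀ t, ξ t = ξ d → ξ.measure (Ioc d t) = 0 := fun t ht => by
    rw [ξ.measure_Ioc, ht, sub_self, ENNReal.ofReal_zero]
  refine measure_null_of_locally_null _ fun t ht => ?_
  -- If `ξ` stays flat beyond `t`, a flat piece is a neighbourhood of `t`. Otherwise `t` is the last
  -- point of the set, and `(d, t]` is a neighbourhood relative to it.
  by_cases hmax : ∃ t', t < t' ∧ ξ t' = ξ d
  · obtain ⟨t', htt', ht'⟩ := hmax
    exact ⟨Ioc d t', mem_nhdsWithin_of_mem_nhds (Ioc_mem_nhds ht.1 htt'), hnull t' ht'⟩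
  · refine ⟨Ioc d t, ?_, hnull t ht.2⟩
    filter_upwards [self_mem_nhdsWithin] with s hs
    exact ⟨hs.1, not_lt.1 fun h => hmax ⟨s, h, hs.2⟩⟩

/-- The Stieltjes measure has no mass at the smallest point, so only the increment over `(0, 1]`
counts. -/
theorem measure_univ_eq (ξ : StieltjesFunction I) :
    ξ.measure univ = ENNReal.ofReal (ξ 1 - ξ 0) := by
  have h1 : (univ : Set I) = botSet ∪ Ioc 0 1 := by
    ext u
    simp only [mem_univ, mem_union, true_iff, mem_Ioc]
    rcases eq_or_lt_of_le u.2.1 with h | h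
    · exact Or.inl fun v => (show u = 0 from Subtype.ext h.symm) ▸ v.2.1
    · exact Or.inr ⟨h, u.2.2⟩
  rw [← ξ.measure_Ioc]
  refine le_antisymm ?_ (measure_mono (subset_univ _))
  rw [h1]
  refine (measure_union_le _ _).trans ?_
  rw [ξ.measure_botSet, zero_add]

/-! ### The weighted measures on partitions: total mass and concentration on points of left increase
-/

section Measures

variable {k : ℕ} (ξ : StieltjesFunction I)

theorem muQ_absolutelyContinuous :
    muQ ξ k ≪ (Measure.pi fun _ : Fin k => ξ.measure).restrict (QSimplex k) :=
  withDensity_absolutelyContinuous _ _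

/-- The partitions whose inner points are points of left increase of `ξ`. -/
def goodPartitions (ξ : I → ℝ) (k : ℕ) : Set (Fin k → I) :=
  {q | q ∈ QSimplex k ∧ ∀ j, q j ∈ leftIncr ξ}

theorem ae_goodPartitions : ∀ᵐ q ∂(muQ ξ k), q ∈ goodPartitions ξ k := by
  refine (muQ_absolutelyContinuous ξ).ae_le ?_
  filter_upwards [ae_restrict_mem isOpen_QSimplex.measurableSet,
    ae_restrict_of_ae (ae_all_iff.2 fun j : Fin k =>
      Measure.tendsto_eval_ae_ae (i := j) (μ := fun _ : Fin k => ξ.measure)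
        (compl_mem_ae_iff.2 (measure_compl_leftIncr ξ)))] with q h1 h2
  exact ⟨h1, fun j => not_not.1 (h2 j)⟩

/-- The lengths sum to `1`, so the inequality of arithmetic and geometric means bounds the product
by `(k + 1)^{-(k + 1)}`. The weaker factorial bound is what makes an exponential series later. -/
theorem prod_cellLen_le {q : Fin k → I} (hq : q ∈ QSimplex k) :
    ∏ i, cellLen q i ≤ ((k + 1).factorial : ℝ)⁻¹ := by
  have hn : (0 : ℝ) < (k + 1 : ℕ) := by positivity
  have h1 := Real.geom_mean_le_arith_mean_weighted Finset.univ (fun _ : Fin (k + 1) =>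
    ((k + 1 : ℕ) : ℝ)⁻¹) (cellLen q) (fun _ _ => by positivity) (by
      rw [Finset.sum_const, Finset.card_univ, Fintype.card_fin, nsmul_eq_mul,
        mul_inv_cancel₀ hn.ne']) (fun i _ => (cellLen_pos hq i).le)
  rw [← Finset.mul_sum, sum_cellLen, mul_one,
    Real.finsetProd_rpow _ _ fun i _ => (cellLen_pos hq i).le] at h1
  have h2 := pow_le_pow_left₀ (Real.rpow_nonneg
    (Finset.prod_nonneg fun i _ => (cellLen_pos hq i).le) _) h1 (k + 1)
  rw [Real.rpow_inv_natCast_pow (Finset.prod_nonneg fun i _ => (cellLen_pos hq i).le)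
    (Nat.succ_ne_zero k), inv_pow] at h2
  refine h2.trans (inv_anti₀ (by positivity) ?_)
  exact_mod_cast Nat.factorial_le_pow (k + 1)

theorem muQ_univ_le :
    muQ ξ k univ ≤ ENNReal.ofReal (((k + 1).factorial : ℝ)⁻¹ * (ξ 1 - ξ 0) ^ k) := by
  have h0 : 0 ≤ ξ 1 - ξ 0 := sub_nonneg.2 (ξ.mono zero_le_one)
  rw [muQ, withDensity_apply _ MeasurableSet.univ, Measure.restrict_univ]
  calc ∫⁻ q in QSimplex k, ∏ i : Fin (k + 1), ENNReal.ofReal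
        ((partitionPoints q i.succ : ℝ) - (partitionPoints q i.castSucc : ℝ))
          ∂(Measure.pi fun _ : Fin k => ξ.measure)
      ≤ ∫⁻ _ in QSimplex k, ENNReal.ofReal ((k + 1).factorial : ℝ)⁻¹
          ∂(Measure.pi fun _ : Fin k => ξ.measure) := by
        refine setLIntegral_mono measurable_const fun q hq => ?_
        change ∏ i, ENNReal.ofReal (cellLen q i) ≤ _
        rw [← ENNReal.ofReal_prod_of_nonneg fun i _ => (cellLen_pos hq i).le]
        exact ENNReal.ofReal_le_ofReal (prod_cellLen_le hq)
    _ ≤ ENNReal.ofReal ((k + 1).factorial : ℝ)⁻¹ * ENNReal.ofReal (ξ 1 - ξ 0) ^ k := by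
        rw [setLIntegral_const]
        gcongr
        refine (measure_mono (subset_univ _)).trans ?_
        rw [Measure.pi_univ]
        simp [measure_univ_eq]
    _ = _ := by
        rw [ENNReal.ofReal_mul (by positivity), ENNReal.ofReal_pow h0]

theorem cellInd_mem_L2of {q : Fin k → I} (hq : q ∈ goodPartitions ξ k) (i : Fin (k + 1)) :
    cellInd q i ∈ L2of ξ := by
  have h1 : ∀ j : Fin (k + 2), ∃ S : Set I, MeasurableSet[MeasurableSpace.comap ξ inferInstance] S ∧
      ∀ u : I, u < 1 → (u < partitionPoints q j ↔ u ∈ S) := by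
    intro j
    refine partitionPoints_mem (P := fun t => ∃ S : Set I,
      MeasurableSet[MeasurableSpace.comap ξ inferInstance] S ∧ ∀ u : I, u < 1 → (u < t ↔ u ∈ S))
      q ?_ ?_ (fun j => ?_) j
    · exact ⟨∅, @MeasurableSet.empty _ (MeasurableSpace.comap ξ inferInstance), fun u _ => by simpa using u.2.1⟩
    · exact ⟨univ, @MeasurableSet.univ _ (MeasurableSpace.comap ξ inferInstance), fun u hu => by simpa using hu⟩
    · exact ⟨ξ ⁻¹' Iio (ξ (q j)), ⟨_, measurableSet_Iio, rfl⟩, fun u _ =>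
        leftIncr_iff ξ.mono (hq.2 j) u⟩
  obtain ⟨S, hS, hSu⟩ := h1 i.castSucc
  obtain ⟨T, hT, hTu⟩ := h1 i.succ
  rw [mem_L2of_iff]
  refine ⟨(T \ S).indicator fun _ => 1, ?_, ?_⟩
  · exact (@stronglyMeasurable_const I ℝ (MeasurableSpace.comap ξ inferInstance) _ 1).indicator
      (hT.diff hS)
  · filter_upwards [cellInd_coeFn q i, (countable_singleton (1 : I)).ae_notMem volume] with u hu hu1
    have hlt : u < 1 := lt_of_le_of_ne u.2.2 hu1
    have h2 : u ∈ cell q i ↔ u ∈ T \ S := by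
      rw [cell, mem_Ico, ← not_lt, hSu u hlt, hTu u hlt, and_comm]
      rfl
    rw [hu]
    by_cases h : u ∈ cell q i
    · rw [indicator_of_mem h, indicator_of_mem (h2.1 h)]
    · rw [indicator_of_notMem h, indicator_of_notMem fun h' => h (h2.2 h')]

theorem stepFun_mem_cone {q : Fin k → I} (hq : q ∈ goodPartitions ξ k) {x : Fin (k + 1) → ℝ}
    (hx : Monotone x) : stepFun q x ∈ L2up ∧ stepFun q x ∈ L2of ξ := by
  refine ⟨?_, Submodule.sum_mem _ fun i _ => Submodule.smul_mem _ _ (cellInd_mem_L2of ξ hq i)⟩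
  have hex : ∀ u : I, u < 1 → ∃ i, u ∈ cell q i := fun u hu => exists_mem_cell q hu
  choose! ι hι using hex
  classical
  refine mem_L2up_of_monotone (f := fun u => if u < 1 then x (ι u) else x (Fin.last k))
    (fun u v huv => ?_) ?_
  · simp only
    by_cases hv : v < 1
    · have hu : u < 1 := huv.trans_lt hv
      rw [if_pos hu, if_pos hv]
      refine hx (le_of_not_gt fun h => ?_)
      have h1 := (hι v hv).2.trans_le
        ((hq.1.monotone (Fin.succ_le_castSucc_iff.2 h)).trans (hι u hu).1)
      exact absurd huv (not_le.2 h1)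
    · rw [if_neg hv]
      split_ifs
      · exact hx (Fin.le_last _)
      · exact le_rfl
  · filter_upwards [stepFun_coeFn hq.1 x, (countable_singleton (1 : I)).ae_notMem volume]
      with u hu hu1
    have hlt : u < 1 := lt_of_le_of_ne u.2.2 hu1
    rw [if_pos hlt, hu _ (hι u hlt)]

end Measures
end

noncomputable section


/-! ## The measure `Ξ` as a sum of image measures -/

/-- `ξ` is constant near both end points of `[0,1]`. -/
class FlatStieltjes (ξ : StieltjesFunction I) : Prop where
  exists_flatEnds : ∃ δ, FlatEnds ξ δ

instance (ξ : StieltjesFunction I) [h : FlatStieltjes ξ] : ProperSpace (ConeOf ξ) := by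
  obtain ⟨δ, hδ⟩ := h.exists_flatEnds
  exact properSpace_coneOf ξ.mono hδ

theorem measurableSet_cone (ξ : StieltjesFunction I) [h : FlatStieltjes ξ] :
    MeasurableSet {g : L2I | g ∈ L2up ∧ g ∈ L2of ξ} := by
  obtain ⟨δ, hδ⟩ := h.exists_flatEnds
  exact (isClosed_cone ξ.mono hδ).measurableSet

/-- The parameter space of the step functions with `k + 1` values. -/
abbrev StepParam (k : ℕ) : Type := (Fin k → I) × (Fin (k + 1) → ℝ)

/-- The measure on the parameter space whose image is `Ξ_{k+1}`. -/
def stepMeas (ξ : StieltjesFunction I) (k : ℕ) : Measure (StepParam k) :=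
  (muQ ξ k).prod ((volume : Measure (Fin (k + 1) → ℝ)).restrict {x | Monotone x})

open Classical in
/-- Step functions as elements of the cone. -/
def coneStep (ξ : StieltjesFunction I) (k : ℕ) (p : StepParam k) : ConeOf ξ :=
  ⟨if stepFun p.1 p.2 ∈ L2up ∧ stepFun p.1 p.2 ∈ L2of ξ then stepFun p.1 p.2 else 0, by
    split_ifs with h
    · exact h
    · exact zero_mem_cone ξ⟩

theorem coe_coneStep (ξ : StieltjesFunction I) {k : ℕ} {p : StepParam k}
    (hp : stepFun p.1 p.2 ∈ L2up ∧ stepFun p.1 p.2 ∈ L2of ξ) :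
    (coneStep ξ k p : L2I) = stepFun p.1 p.2 := if_pos hp

/-- Parameters in general position. -/
def regularParam (k : ℕ) : Set (StepParam k) := {p | p.1 ∈ QSimplex k ∧ StrictMono p.2}

theorem isOpen_regularParam (k : ℕ) : IsOpen (regularParam k) :=
  (isOpen_QSimplex.preimage continuous_fst).inter
    ((isOpen_setOf_strictMono fun i => continuous_apply i).preimage continuous_snd)

theorem volume_eq_coord {n : ℕ} {i j : Fin n} (hij : i ≠ j) :
    volume {x : Fin n → ℝ | x i = x j} = 0 := by
  set f : (Fin n → ℝ) →ₗ[ℝ] ℝ :=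
    LinearMap.proj (R := ℝ) (φ := fun _ : Fin n => ℝ) i - LinearMap.proj j with hf
  have h1 : {x : Fin n → ℝ | x i = x j} = (LinearMap.ker f : Set (Fin n → ℝ)) := by
    ext x
    simp [hf, sub_eq_zero]
  rw [h1]
  refine Measure.addHaar_submodule _ _ fun htop => ?_
  have h2 : Pi.single i (1 : ℝ) ∈ LinearMap.ker f := htop ▸ Submodule.mem_top
  simp [hf, hij.symm] at h2

theorem ae_strictMono (n : ℕ) : ∀ᵐ x ∂((volume : Measure (Fin (n + 1) → ℝ)).restrict
    {x | Monotone x}), StrictMono x := by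
  have h1 : ∀ᵐ x : Fin (n + 1) → ℝ, ∀ i : Fin n, x i.castSucc ≠ x i.succ :=
    ae_all_iff.2 fun i => ae_iff.2 (by
      simpa using volume_eq_coord (Fin.castSucc_lt_succ (i := i)).ne)
  have hm : MeasurableSet {x : Fin (n + 1) → ℝ | Monotone x} := isClosed_monotone.measurableSet
  filter_upwards [ae_restrict_of_ae h1, ae_restrict_mem hm] with x h2 h3
  exact Fin.strictMono_iff_lt_succ.2 fun i =>
    lt_of_le_of_ne (h3 (Fin.castSucc_lt_succ (i := i)).le) (h2 i)

theorem ae_stepMeas (ξ : StieltjesFunction I) (k : ℕ) :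
    ∀ᵐ p ∂(stepMeas ξ k), p.1 ∈ goodPartitions ξ k ∧ StrictMono p.2 := by
  filter_upwards [Measure.quasiMeasurePreserving_fst.ae (ae_goodPartitions ξ),
    Measure.quasiMeasurePreserving_snd.ae (ae_strictMono k)] with p h1 h2
  exact ⟨h1, h2⟩

theorem ae_coneStep (ξ : StieltjesFunction I) (k : ℕ) :
    ∀ᵐ p ∂(stepMeas ξ k), p ∈ regularParam k ∧ (coneStep ξ k p : L2I) = stepFun p.1 p.2 := by
  filter_upwards [ae_stepMeas ξ k] with p hp
  exact ⟨⟨hp.1.1, hp.2⟩, coe_coneStep ξ (stepFun_mem_cone ξ hp.1 hp.2.monotone)⟩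

section Image

variable (ξ : StieltjesFunction I) [hflat : FlatStieltjes ξ] (k : ℕ)

theorem measurable_coneStep : Measurable (coneStep ξ k) := by
  refine Measurable.subtype_mk ?_
  exact Measurable.ite (continuous_stepFun.measurable (measurableSet_cone ξ))
    continuous_stepFun.measurable measurable_const

/-- The image measures on `L_2` are pulled back to the cone; almost every step function lies in the
cone, so the images can be taken there directly. -/
theorem Xi_eq_sum : Xi ξ = Measure.sum fun k => (stepMeas ξ k).map (coneStep ξ k) := by
  ext s hs
  have himg : MeasurableSet (Subtype.val '' s : Set L2I) :=
    (MeasurableEmbedding.subtype_coe (measurableSet_cone ξ)).measurableSet_image.2 hs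
  refine ((MeasurableEmbedding.subtype_coe (measurableSet_cone ξ)).comap_apply
    (Measure.sum fun k => XiStep ξ k) s).trans ?_
  rw [Measure.sum_apply _ hs]
  refine (Measure.sum_apply _ himg).trans ?_
  refine tsum_congr fun k => ?_
  rw [Measure.map_apply (measurable_coneStep ξ k) hs, XiStep]
  refine (Measure.map_apply continuous_stepFun.measurable himg).trans ?_
  refine measure_congr ?_
  filter_upwards [ae_coneStep ξ k] with p hp
  refine propext ⟨?_, fun h => ⟨_, h, hp.2⟩⟩
  rintro ⟨g, hg, hgp⟩
  have : coneStep ξ k p = g := Subtype.ext (hp.2.trans hgp.symm)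
  exact (show coneStep ξ k p ∈ s from this ▸ hg)

theorem map_coneStep_le : (stepMeas ξ k).map (coneStep ξ k) ≤ Xi ξ := by
  rw [Xi_eq_sum]
  exact Measure.le_sum _ k

theorem quasiMeasurePreserving_coneStep :
    Measure.QuasiMeasurePreserving (coneStep ξ k) (stepMeas ξ k) (Xi ξ) :=
  ⟨measurable_coneStep ξ k, (map_coneStep_le ξ k).absolutelyContinuous⟩

end Image

/-- The set of values determines `x`, because `x` is strictly increasing. The measures of the level
sets then determine the lengths of the cells and hence `q`. -/
theorem stepFun_injOn (k : ℕ) : InjOn (fun p : StepParam k => stepFun p.1 p.2) (regularParam k) := by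
  rintro ⟨q, x⟩ ⟨hq, hx⟩ ⟨q', x'⟩ ⟨hq', hx'⟩ heq
  simp only at hq hx hq' hx' heq
  have hsub : ∀ (r r' : Fin k → I) (y y' : Fin (k + 1) → ℝ), r ∈ QSimplex k → r' ∈ QSimplex k →
      stepFun r y = stepFun r' y' → range y ⊆ range y' := by
    rintro r r' y y' hr hr' he _ ⟨i, rfl⟩
    obtain ⟨u, hu, h1, h2, j, hj⟩ := unitInterval.exists_mem_Ioo_of_ae
      ((stepFun_coeFn hr y).and ((stepFun_coeFn hr' y').and (ae_exists_mem_cell r')))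
      (hr (Fin.castSucc_lt_succ (i := i)))
    exact ⟨j, by rw [← h2 j hj, ← he, h1 i ⟨hu.1.le, hu.2⟩]⟩
  have hxx : x = x' := (hx.range_inj hx').1
    (Subset.antisymm (hsub q q' x x' hq hq' heq) (hsub q' q x' x hq' hq heq.symm))
  subst hxx
  have hlen : ∀ i, cellLen q i = cellLen q' i := fun i => by
    rw [← volume_cell hq, ← volume_cell hq']
    refine measureReal_congr ?_
    filter_upwards [stepFun_coeFn hq x, stepFun_coeFn hq' x, ae_exists_mem_cell q,
      ae_exists_mem_cell q'] with u h1 h2 ⟨j, hj⟩ ⟨j', hj'⟩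
    have hjj : j = j' := hx.injective (by rw [← h1 j hj, heq, h2 j' hj'])
    subst hjj
    have hmem : ∀ r : Fin k → I, r ∈ QSimplex k → u ∈ cell r j → (u ∈ cell r i ↔ i = j) :=
      fun r hr hu => ⟨fun h => by_contra fun hne =>
        Set.disjoint_left.1 (cell_disjoint hr hne) h hu, fun h => h ▸ hu⟩
    exact propext ((hmem q hq hj).trans (hmem q' hq' hj').symm)
  have hpp : ∀ i, partitionPoints q i = partitionPoints q' i := by
    intro i
    induction i using Fin.induction with
    | zero => rfl
    | succ i ih =>
      have := hlen i
      rw [cellLen, cellLen, ih, sub_left_inj] at this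
      exact Subtype.ext this
  refine Prod.ext (funext fun j => ?_) rfl
  change q j = q' j
  rw [← partitionPoints_succ_castSucc q, ← partitionPoints_succ_castSucc q', hpp]

/-! ### Transfer of a.e. statements and of measurability from the parameter spaces to `Ξ` -/

section Embedding

variable (ξ : StieltjesFunction I) [hflat : FlatStieltjes ξ] (k : ℕ)

/-- The set on which `coneStep` is an embedding. -/
def embParam : Set (StepParam k) :=
  regularParam k ∩ {p | stepFun p.1 p.2 ∈ L2up ∧ stepFun p.1 p.2 ∈ L2of ξ}

theorem measurableSet_embParam : MeasurableSet (embParam ξ k) :=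
  (isOpen_regularParam k).measurableSet.inter
    (continuous_stepFun.measurable (measurableSet_cone ξ))

/-- A continuous injection of a Borel subset of a Polish space is a measurable embedding
(Lusin–Souslin). With it, statements about sets and functions not known to be measurable can be
checked on the parameters. -/
theorem measurableEmbedding_coneStep :
    MeasurableEmbedding ((embParam ξ k).domRestrict (coneStep ξ k)) := by
  refine ContinuousOn.measurableEmbedding (measurableSet_embParam ξ k) ?_ ?_
  · refine (Topology.IsInducing.subtypeVal
      (t := {f : L2I | f ∈ L2up ∧ f ∈ L2of ξ})).continuousOn_iff.2 ?_
    refine continuous_stepFun.continuousOn.congr fun p hp => ?_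
    exact coe_coneStep ξ hp.2
  · intro p hp p' hp' h
    refine stepFun_injOn k hp.1 hp'.1 ?_
    simp only
    rw [← coe_coneStep ξ hp.2, ← coe_coneStep ξ hp'.2, h]

theorem ae_mem_embParam : ∀ᵐ p ∂(stepMeas ξ k), p ∈ embParam ξ k := by
  filter_upwards [ae_stepMeas ξ k] with p hp
  exact ⟨⟨hp.1.1, hp.2⟩, stepFun_mem_cone ξ hp.1 hp.2.monotone⟩

theorem map_val_comap_stepMeas : ((stepMeas ξ k).comap ((↑) : embParam ξ k → StepParam k)).map
    (↑) = stepMeas ξ k := by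
  rw [(MeasurableEmbedding.subtype_coe (measurableSet_embParam ξ k)).map_comap,
    Subtype.range_coe, Measure.restrict_eq_self_of_ae_mem (ae_mem_embParam ξ k)]

theorem map_coneStep_eq : (stepMeas ξ k).map (coneStep ξ k)
    = ((stepMeas ξ k).comap ((↑) : embParam ξ k → StepParam k)).map
      ((embParam ξ k).domRestrict (coneStep ξ k)) := by
  conv_lhs => rw [← map_val_comap_stepMeas ξ k]
  rw [Measure.map_map (measurable_coneStep ξ k) measurable_subtype_coe]
  rfl

/-- Almost everywhere statements for `Ξ` can be checked on the parameter spaces. -/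
theorem ae_Xi_iff {P : ConeOf ξ → Prop} :
    (∀ᵐ g ∂(Xi ξ), P g) ↔ ∀ k, ∀ᵐ p ∂(stepMeas ξ k), P (coneStep ξ k p) := by
  refine ⟨fun h k => (quasiMeasurePreserving_coneStep ξ k).ae h, fun h => ?_⟩
  rw [Xi_eq_sum, Measure.ae_sum_iff]
  intro k
  rw [map_coneStep_eq, (measurableEmbedding_coneStep ξ k).ae_map_iff]
  have h1 := h k
  rw [← map_val_comap_stepMeas ξ k,
    (MeasurableEmbedding.subtype_coe (measurableSet_embParam ξ k)).ae_map_iff] at h1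
  exact h1

/-- Measurability with respect to `Ξ` can be checked on the parameter spaces. -/
theorem aestronglyMeasurable_Xi {β : Type*} [TopologicalSpace β]
    [TopologicalSpace.PseudoMetrizableSpace β] {F : ConeOf ξ → β}
    (h : ∀ k, AEStronglyMeasurable (fun p => F (coneStep ξ k p)) (stepMeas ξ k)) :
    AEStronglyMeasurable F (Xi ξ) := by
  rw [Xi_eq_sum, aestronglyMeasurable_sum_measure_iff]
  intro k
  rw [map_coneStep_eq, (measurableEmbedding_coneStep ξ k).aestronglyMeasurable_map_iff]
  have h1 := h k
  rw [← map_val_comap_stepMeas ξ k, (MeasurableEmbedding.subtype_coe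
    (measurableSet_embParam ξ k)).aestronglyMeasurable_map_iff] at h1
  exact h1

end Embedding

/-! ## Growth of `Ξ` -/

theorem abs_le_of_stepFun {ξ : StieltjesFunction I} {δ : ℝ} (h : FlatEnds ξ δ) {k : ℕ}
    {q : Fin k → I} (hq : q ∈ goodPartitions ξ k) {x : Fin (k + 1) → ℝ} (hx : Monotone x)
    (i : Fin (k + 1)) : |x i| ≤ ‖stepFun q x‖ / √δ := by
  obtain ⟨h1, h2⟩ := stepFun_mem_cone ξ hq hx
  obtain ⟨f, -, hf, -, -, hb⟩ := exists_monotone_version h h1 h2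
  obtain ⟨u, hu, hu1, hu2⟩ := unitInterval.exists_mem_Ioo_of_ae
    ((stepFun_coeFn hq.1 x).and hf) (hq.1 (Fin.castSucc_lt_succ (i := i)))
  rw [← hu1 i ⟨hu.1.le, hu.2⟩, hu2]
  exact hb u

theorem measurable_coe_norm (ξ : I → ℝ) : Measurable fun g : ConeOf ξ => ‖(g : L2I)‖ :=
  (continuous_norm.comp continuous_subtype_val).measurable

/-- In a ball of radius `r` all values lie in a cube of side `2 r / √δ`, and the partitions have
mass of order `1 / (k + 1)!`. The assumption `1 ≤ M` raises the power `k` of the total variation to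
`k + 1`, so that summation over `k` gives an exponential. -/
theorem map_coneStep_ball_le {ξ : StieltjesFunction I} [FlatStieltjes ξ] {δ : ℝ}
    (hδ : FlatEnds ξ δ) (k : ℕ) {M r : ℝ} (hM1 : 1 ≤ M) (hM : ξ 1 - ξ 0 ≤ M) (hr : 0 ≤ r) :
    (stepMeas ξ k).map (coneStep ξ k) {g | ‖(g : L2I)‖ ≤ r}
      ≤ ENNReal.ofReal ((M * (2 / √δ) * r) ^ (k + 1) / (k + 1).factorial) := by
  have hs := Real.sqrt_pos.2 hδ.pos
  have h0 : 0 ≤ ξ 1 - ξ 0 := sub_nonneg.2 (ξ.mono zero_le_one)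
  have hmeas : MeasurableSet {g : ConeOf ξ | ‖(g : L2I)‖ ≤ r} :=
    measurableSet_le (measurable_coe_norm ξ) measurable_const
  rw [Measure.map_apply (measurable_coneStep ξ k) hmeas]
  have h1 : stepMeas ξ k (coneStep ξ k ⁻¹' {g | ‖(g : L2I)‖ ≤ r})
      ≤ stepMeas ξ k (univ ×ˢ Icc (fun _ => -(r / √δ)) fun _ => r / √δ) := by
    refine measure_mono_ae ?_
    filter_upwards [ae_stepMeas ξ k, ae_coneStep ξ k] with p hp hp2 hmem
    have hmem' : ‖(coneStep ξ k p : L2I)‖ ≤ r := hmem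
    refine ⟨mem_univ _, ?_⟩
    have h2 : ∀ i, |p.2 i| ≤ r / √δ := fun i =>
      (abs_le_of_stepFun hδ hp.1 hp.2.monotone i).trans
        ((div_le_div_iff_of_pos_right hs).2 (hp2.2 ▸ hmem'))
    exact ⟨fun i => (abs_le.1 (h2 i)).1, fun i => (abs_le.1 (h2 i)).2⟩
  refine h1.trans ?_
  rw [stepMeas, Measure.prod_prod]
  have h3 : (ξ 1 - ξ 0) ^ k ≤ M ^ (k + 1) :=
    (pow_le_pow_left₀ h0 hM k).trans (pow_le_pow_right₀ hM1 k.le_succ)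
  have h4 : r / √δ - -(r / √δ) = 2 / √δ * r := by ring
  have h5 : (volume.restrict {x | Monotone x})
      (Icc (fun _ : Fin (k + 1) => -(r / √δ)) fun _ => r / √δ)
      ≤ ENNReal.ofReal ((2 / √δ * r) ^ (k + 1)) := by
    refine (Measure.restrict_apply_le _ _).trans ?_
    rw [Real.volume_Icc_pi, Finset.prod_const, Finset.card_univ, Fintype.card_fin, h4,
      ENNReal.ofReal_pow (by positivity)]
  refine (mul_le_mul' (muQ_univ_le ξ) h5).trans ?_
  rw [← ENNReal.ofReal_mul (by positivity)]
  refine ENNReal.ofReal_le_ofReal ?_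
  have h6 : (M * (2 / √δ) * r) ^ (k + 1) / (k + 1).factorial
      = ((k + 1).factorial : ℝ)⁻¹ * M ^ (k + 1) * (2 / √δ * r) ^ (k + 1) := by
    rw [mul_assoc M, mul_pow M]
    ring
  rw [h6]
  exact mul_le_mul_of_nonneg_right (mul_le_mul_of_nonneg_left h3 (by positivity)) (by positivity)

theorem tsum_pow_succ_div_factorial_le {y : ℝ} (hy : 0 ≤ y) :
    ∑' k : ℕ, ENNReal.ofReal (y ^ (k + 1) / (k + 1).factorial) ≤ ENNReal.ofReal (Real.exp y) := by
  have hsum : HasSum (fun n : ℕ => y ^ n / n.factorial) (Real.exp y) := by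
    rw [Real.exp_eq_exp_ℝ]
    exact NormedSpace.expSeries_div_hasSum_exp y
  have hnn : ∀ n : ℕ, 0 ≤ y ^ n / n.factorial := fun n => by positivity
  rw [← hsum.tsum_eq, ENNReal.ofReal_tsum_of_nonneg hnn hsum.summable]
  exact ENNReal.tsum_comp_le_tsum_of_injective (add_left_injective 1)
    fun n : ℕ => ENNReal.ofReal (y ^ n / n.factorial)

/-- `Ξ` grows at most exponentially. -/
theorem exists_Xi_ball_le (ξ : StieltjesFunction I) [hflat : FlatStieltjes ξ] :
    ∃ c : ℝ, 0 < c ∧ ∀ r : ℝ, 0 ≤ r →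
      Xi ξ {g | ‖(g : L2I)‖ ≤ r} ≤ ENNReal.ofReal (Real.exp (c * r)) := by
  obtain ⟨δ, hδ⟩ := hflat.exists_flatEnds
  have hs := Real.sqrt_pos.2 hδ.pos
  have hM1 : 1 ≤ max 1 (ξ 1 - ξ 0) := le_max_left _ _
  refine ⟨max 1 (ξ 1 - ξ 0) * (2 / √δ), by positivity, fun r hr => ?_⟩
  have hmeas : MeasurableSet {g : ConeOf ξ | ‖(g : L2I)‖ ≤ r} :=
    measurableSet_le (measurable_coe_norm ξ) measurable_const
  rw [Xi_eq_sum, Measure.sum_apply _ hmeas]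
  refine (ENNReal.tsum_le_tsum fun k => map_coneStep_ball_le hδ k hM1 (le_max_right _ _) hr).trans ?_
  exact tsum_pow_succ_div_factorial_le (by positivity)

instance (ξ : StieltjesFunction I) [hflat : FlatStieltjes ξ] :
    IsFiniteMeasureOnCompacts (Xi ξ) := ⟨fun K hK => by
  obtain ⟨c, -, hc⟩ := exists_Xi_ball_le ξ
  obtain ⟨r, hr⟩ := hK.bddAbove_image
    (f := fun g : ConeOf ξ => ‖(g : L2I)‖) (continuous_norm.comp continuous_subtype_val).continuousOn
  refine lt_of_le_of_lt ((measure_mono fun g hg => ?_).trans (hc (max r 0) (le_max_right _ _)))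
    ENNReal.ofReal_lt_top
  exact (hr (mem_image_of_mem _ hg)).trans (le_max_left _ _)⟩
end

noncomputable section


/-! ## `Ξ` has full support -/

theorem mem_QSimplex_of {k : ℕ} {q : Fin k → I} (hq : StrictMono q) (h0 : ∀ j, 0 < q j)
    (h1 : ∀ j, q j < 1) : q ∈ QSimplex k := by
  refine Fin.strictMono_iff_lt_succ.2 fun i => ?_
  induction i using Fin.cases with
  | zero =>
    rw [Fin.castSucc_zero, partitionPoints_zero]
    induction (0 : Fin (k + 1)) using Fin.lastCases with
    | last => rw [Fin.succ_last, partitionPoints_last]; exact zero_lt_one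
    | cast j => rw [partitionPoints_succ_castSucc]; exact h0 j
  | succ j =>
    rw [← Fin.succ_castSucc, partitionPoints_succ_castSucc]
    induction h : j.succ using Fin.lastCases with
    | last => rw [Fin.succ_last, partitionPoints_last]; exact h1 j
    | cast j' =>
      rw [partitionPoints_succ_castSucc]
      refine hq ?_
      rw [← Fin.castSucc_lt_castSucc_iff, ← h]
      exact Fin.castSucc_lt_succ

/-- The levels `c + (n + 1) h` have spacing `h`, so one of them lies in `(a, b]`; its index is the
integer part of `(a - c) / h`. -/
theorem exists_level {a b c d h : ℝ} (hh : 0 < h) (hca : c ≤ a) (hab : a + h ≤ b) (hbd : b ≤ d) :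
    ∃ n : ℕ, n < ⌈(d - c) / h⌉₊ ∧ a < c + (n + 1) * h ∧ c + (n + 1) * h ≤ b := by
  have h0 : 0 ≤ (a - c) / h := div_nonneg (sub_nonneg.2 hca) hh.le
  have h1 := Nat.floor_le h0
  have h2 := Nat.lt_floor_add_one ((a - c) / h)
  rw [le_div_iff₀ hh] at h1
  rw [div_lt_iff₀ hh] at h2
  refine ⟨⌊(a - c) / h⌋₊, ?_, by linarith, by linarith⟩
  rw [Nat.lt_ceil, lt_div_iff₀ hh]
  nlinarith

/-- A point at which the classes in `L_2(ξ)` can jump or grow lies in the support of `dξ`. -/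
theorem measure_pos_of_level {ξ : StieltjesFunction I} {g : L2I} (hg : g ∈ L2of ξ) {f : I → ℝ}
    (hgf : g =ᵐ[volume] f) {t : I} (ht0 : 0 < t) (ht1 : t < 1) {y : ℝ} (hl : ∀ u < t, f u < y)
    (hr : ∀ u, t < u → y ≤ f u) {U : Set I} (hU : U ∈ 𝓝 t) : 0 < ξ.measure U := by
  rw [pos_iff_ne_zero]
  intro hz
  obtain ⟨a, b, ⟨hat, htb⟩, hab⟩ := (mem_nhds_iff_exists_Ioo_subset' ⟨0, ht0⟩ ⟨1, ht1⟩).1 hU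
  obtain ⟨a', ha', hat'⟩ := exists_between hat
  obtain ⟨b', hb', hbt'⟩ := exists_between htb
  have h1 : ξ.measure (Ioc a' b') = 0 := measure_mono_null
    (fun u hu => hab ⟨ha'.trans hu.1, hu.2.trans_lt hbt'⟩) hz
  rw [ξ.measure_Ioc, ENNReal.ofReal_eq_zero] at h1
  -- Without mass near `t` the function `ξ`, and hence `g`, is constant on `(a', b')`. This
  -- contradicts the crossing of the level `y` at `t`.
  obtain ⟨c, hc⟩ := ae_eq_const_of_mem_L2of hg (S := Ioo a' b') (v := ξ a') fun u hu =>
    le_antisymm ((ξ.mono hu.2.le).trans (by linarith)) (ξ.mono hu.1.le)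
  obtain ⟨u, hu, hu1, hu2⟩ := unitInterval.exists_mem_Ioo_of_ae (hc.and hgf) hat'
  obtain ⟨v, hv, hv1, hv2⟩ := unitInterval.exists_mem_Ioo_of_ae (hc.and hgf) hb'
  have h2 := hu1 ⟨hu.1, hu.2.trans hb'⟩
  have h3 := hv1 ⟨hat'.trans hv.1, hv.2⟩
  have h4 := hl u hu.2
  have h5 := hr v hv.1
  rw [← hu2, h2] at h4
  rw [← hv2, h3] at h5
  exact absurd h4 (not_lt.2 h5)

/-- Elements of the cone can be approximated by step functions that jump in the support of `dξ`. -/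
theorem exists_stepFun_near {ξ : StieltjesFunction I} {δ : ℝ} (hδ : FlatEnds ξ δ) {g : L2I}
    (hg : g ∈ L2up) (hg' : g ∈ L2of ξ) {h : ℝ} (hh : 0 < h) :
    ∃ (k : ℕ) (q : Fin k → I) (x : Fin (k + 1) → ℝ), q ∈ QSimplex k ∧ StrictMono x ∧
      (∀ j, ∀ U ∈ 𝓝 (q j), 0 < ξ.measure U) ∧ ‖stepFun q x - g‖ ≤ h := by
  classical
  obtain ⟨f, hf, hgf, hf0, hf1, -⟩ := exists_monotone_version hδ hg hg'
  have hpos := hδ.pos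
  have hlt := hδ.lt_half
  -- `t n` is the point at which `f` crosses the level `f 0 + (n + 1) h`. Flatness keeps it away
  -- from `0`, and away from `1` for the levels up to `f 1`.
  set t : ℕ → I := fun n => sInf {u | f 0 + (n + 1) * h ≤ f u} with ht
  have htl : ∀ n, ∀ u < t n, f u < f 0 + (n + 1) * h := fun n u hu =>
    not_le.1 fun hle => (sInf_le (show u ∈ {u | f 0 + (n + 1) * h ≤ f u} from hle)).not_gt hu
  have htr : ∀ n u, t n < u → f 0 + (n + 1) * h ≤ f u := fun n u hu => by
    obtain ⟨v, hv, hvu⟩ := sInf_lt_iff.1 hu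
    exact (show f 0 + (n + 1) * h ≤ f v from hv).trans (hf hvu.le)
  have ht0 : ∀ n, 0 < t n := fun n => by
    have h1 : (⟨δ, hpos.le, by linarith⟩ : I) ≤ t n := le_sInf fun u hu => by
      by_contra hlt'
      have h2 : f u = f 0 := hf0 u (not_le.1 hlt')
      have h3 : f 0 + (n + 1) * h ≤ f u := hu
      rw [h2] at h3
      have : 0 < ((n : ℝ) + 1) * h := by positivity
      linarith
    exact lt_of_lt_of_le (show (0 : ℝ) < δ from hpos) h1
  have ht1 : ∀ n : ℕ, f 0 + ((n : ℝ) + 1) * h ≤ f 1 → t n < 1 := fun n hn => by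
    have h1 : t n ≤ (⟨1 - δ / 2, by linarith, by linarith⟩ : I) := sInf_le (by
      rw [mem_setOf_eq, hf1 ⟨1 - δ / 2, by linarith, by linarith⟩
        (show 1 - δ < 1 - δ / 2 by linarith)]
      exact hn)
    exact lt_of_le_of_lt h1 (show 1 - δ / 2 < (1 : ℝ) by linarith)
  set N : Finset ℕ := (Finset.range ⌈(f 1 - f 0) / h⌉₊).filter
    fun n => f 0 + (n + 1) * h ≤ f 1 with hN
  -- Several levels may be crossed in one jump, so the crossing points are first collected in a set
  -- and only then listed in increasing order.
  set T : Finset I := N.image t with hT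
  have hTmem : ∀ s ∈ T, ∃ n, t n = s ∧ f 0 + (n + 1) * h ≤ f 1 := fun s hs => by
    obtain ⟨n, hn, rfl⟩ := Finset.mem_image.1 hs
    exact ⟨n, rfl, (Finset.mem_filter.1 hn).2⟩
  set k := T.card with hk
  set q : Fin k → I := fun j => T.orderEmbOfFin hk.symm j with hq
  have hqT : ∀ j, q j ∈ T := fun j => T.orderEmbOfFin_mem hk.symm j
  have hqS : q ∈ QSimplex k := by
    refine mem_QSimplex_of (T.orderEmbOfFin hk.symm).strictMono (fun j => ?_) fun j => ?_
    · obtain ⟨n, hn, -⟩ := hTmem _ (hqT j)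
      exact hn ▸ ht0 n
    · obtain ⟨n, hn, hn1⟩ := hTmem _ (hqT j)
      exact hn ▸ ht1 n hn1
  have hcell : ∀ i : Fin (k + 1), ∀ s ∈ T, s ∉ Ioo (partitionPoints q i.castSucc)
      (partitionPoints q i.succ) := by
    intro i s hs hmem
    have h1 : s ∈ range q := by
      have h0 := Finset.range_orderEmbOfFin T hk.symm
      exact h0.symm ▸ (Finset.mem_coe.2 hs)
    obtain ⟨j, rfl⟩ := h1
    rw [← partitionPoints_succ_castSucc q j] at hmem
    have h2 := hqS.lt_iff_lt.1 hmem.1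
    have h3 := hqS.lt_iff_lt.1 hmem.2
    rw [Fin.castSucc_lt_iff_succ_le] at h2
    exact h3.not_ge h2
  choose m hm using fun i : Fin (k + 1) => exists_between (hqS (Fin.castSucc_lt_succ (i := i)))
  refine ⟨k, q, fun i => f (m i), hqS, ?_, fun j U hU => ?_, ?_⟩
  · refine Fin.strictMono_iff_lt_succ.2 fun j => ?_
    obtain ⟨n, hn, -⟩ := hTmem _ (hqT j)
    have h1 : m j.castSucc < t n := by
      rw [hn, ← partitionPoints_succ_castSucc q j]
      exact (hm j.castSucc).2
    have h2 : t n < m j.succ := by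
      rw [hn, ← partitionPoints_succ_castSucc q j, Fin.succ_castSucc]
      exact (hm j.succ).1
    exact (htl n _ h1).trans_le (htr n _ h2)
  · obtain ⟨n, hn, hn1⟩ := hTmem _ (hqT j)
    rw [← hn] at hU
    exact measure_pos_of_level hg' hgf (ht0 n) (ht1 n hn1) (htl n) (htr n) hU
  -- No crossing point lies in the interior of a cell, so `f` oscillates there by less than `h`, and
  -- sampling it at the interior point `m i` is accurate enough.
  · have hosc : ∀ i : Fin (k + 1), ∀ u ∈ Ioo (partitionPoints q i.castSucc)
        (partitionPoints q i.succ), ∀ v ∈ Ioo (partitionPoints q i.castSucc)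
        (partitionPoints q i.succ), f v < f u + h := by
      intro i u hu v hv
      by_contra! hle
      obtain ⟨n, hn, hn1, hn2⟩ := exists_level hh (hf (show 0 ≤ u from u.2.1)) hle
        (hf (show v ≤ 1 from v.2.2))
      have h1 : u ≤ t n := not_lt.1 fun hlt' => (htr n u hlt').not_gt hn1
      have h2 : t n ≤ v := not_lt.1 fun hlt' => (htl n v hlt').not_ge hn2
      refine hcell i (t n) (Finset.mem_image_of_mem _ (Finset.mem_filter.2
        ⟨Finset.mem_range.2 hn, hn2.trans (hf (show v ≤ 1 from v.2.2))⟩)) ⟨hu.1.trans_le h1, h2.trans_lt hv.2⟩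
    have hnorm := Lp.norm_le_of_ae_bound (f := stepFun q (fun i => f (m i)) - g) hh.le (by
      have hne : ∀ᵐ u : I, ∀ i, u ≠ partitionPoints q i :=
        ae_all_iff.2 fun i => (countable_singleton _).ae_notMem volume
      filter_upwards [Lp.coeFn_sub (stepFun q fun i => f (m i)) g, hgf,
        stepFun_coeFn hqS fun i => f (m i), ae_exists_mem_cell q, hne] with u h1 h2 h3 ⟨i, hi⟩ h4
      rw [h1, Pi.sub_apply, h2, h3 i hi, Real.norm_eq_abs, abs_le]
      have hu : u ∈ Ioo (partitionPoints q i.castSucc) (partitionPoints q i.succ) :=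
        ⟨lt_of_le_of_ne hi.1 (h4 _).symm, hi.2⟩
      have h5 := hosc i u hu _ (hm i)
      have h6 := hosc i _ (hm i) u hu
      constructor <;> linarith)
    refine hnorm.trans (le_of_eq ?_)
    simp [measureUnivNNReal]

theorem muQ_pos {ξ : StieltjesFunction I} {k : ℕ} {q : Fin k → I}
    (hsupp : ∀ j, ∀ U ∈ 𝓝 (q j), 0 < ξ.measure U) {V : Set (Fin k → I)} (hV : IsOpen V)
    (hqV : q ∈ V) (hVS : V ⊆ QSimplex k) : 0 < muQ ξ k V := by
  have h1 : 0 < (Measure.pi fun _ : Fin k => ξ.measure) V := by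
    obtain ⟨W, hW, hWV⟩ := isOpen_pi_iff'.1 hV q hqV
    refine lt_of_lt_of_le ?_ (measure_mono hWV)
    rw [Measure.pi_pi, pos_iff_ne_zero, Finset.prod_ne_zero_iff]
    exact fun j _ => (hsupp j _ ((hW j).1.mem_nhds (hW j).2)).ne'
  rw [muQ, withDensity_apply _ hV.measurableSet, Measure.restrict_restrict hV.measurableSet,
    inter_eq_left.2 hVS]
  rw [setLIntegral_pos_iff]
  · refine lt_of_lt_of_le h1 (measure_mono fun p hp => ⟨?_, hp⟩)
    rw [Function.mem_support, Finset.prod_ne_zero_iff]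
    exact fun i _ => (ENNReal.ofReal_pos.2 (cellLen_pos (hVS hp) i)).ne'
  · refine Finset.measurable_prod _ fun i _ => ENNReal.measurable_ofReal.comp ?_
    exact ((continuous_subtype_val.comp (continuous_partitionPoints _)).sub
      (continuous_subtype_val.comp (continuous_partitionPoints _))).measurable

/-- An open set around `g` contains the step functions with parameters close to those of an
approximating one. These parameters have positive measure, since the jumps lie in the support of
`dξ` and the cells have positive length. -/
instance (ξ : StieltjesFunction I) [hflat : FlatStieltjes ξ] : (Xi ξ).IsOpenPosMeasure := by
  obtain ⟨δ, hδ⟩ := hflat.exists_flatEnds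
  refine ⟨fun U hU ⟨g, hg⟩ hz => ?_⟩
  obtain ⟨r, hr, hrU⟩ := Metric.isOpen_iff.1 hU g hg
  obtain ⟨k, q, x, hq, hx, hsupp, hnear⟩ := exists_stepFun_near hδ g.2.1 g.2.2 (half_pos hr)
  set O : Set (StepParam k) := regularParam k ∩ {p | ‖stepFun p.1 p.2 - g‖ < r} with hO
  have hOo : IsOpen O := (isOpen_regularParam k).inter
    (isOpen_lt (continuous_stepFun.sub continuous_const).norm continuous_const)
  obtain ⟨V, W, hV, hW, hqV, hxW, hVW⟩ := isOpen_prod_iff.1 hOo q x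
    ⟨⟨hq, hx⟩, lt_of_le_of_lt hnear (half_lt_self hr)⟩
  have hWm : W ⊆ {x | Monotone x} := fun y hy => (hVW (mk_mem_prod hqV hy)).1.2.monotone
  have h1 : stepMeas ξ k (V ×ˢ W) = 0 := by
    have h2 : (stepMeas ξ k).map (coneStep ξ k) U = 0 := le_antisymm
      ((map_coneStep_le ξ k U).trans hz.le) bot_le
    rw [Measure.map_apply (measurable_coneStep ξ k) hU.measurableSet] at h2
    refine le_antisymm ((measure_mono_ae ?_).trans h2.le) bot_le
    filter_upwards [ae_coneStep ξ k] with p hp hpVW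
    refine hrU ?_
    rw [Metric.mem_ball, Subtype.dist_eq, hp.2, dist_eq_norm]
    exact (hVW hpVW).2
  rw [stepMeas, Measure.prod_prod, Measure.restrict_apply hW.measurableSet,
    inter_eq_left.2 hWm, mul_eq_zero] at h1
  rcases h1 with h1 | h1
  · exact (muQ_pos hsupp hV hqV fun p hp => (hVW (mk_mem_prod hp hxW)).1.1).ne' h1
  · exact (hW.measure_pos volume ⟨x, hxW⟩).ne' h1
end

noncomputable section


/-! ## The projections `pr_g` -/

section Projection

/-- The functions measurable with respect to `g`. -/
def measSubspace (g : L2I) : Submodule ℝ L2I :=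
  lpMeas ℝ ℝ (MeasurableSpace.comap g inferInstance) 2 (volume : Measure I)

theorem prL2_mem (g h : L2I) : prL2 g h ∈ measSubspace g :=
  (condExpL2 (μ := (volume : Measure I)) ℝ ℝ
    (Lp.stronglyMeasurable g).measurable.comap_le h).2

/-- `pr_g` as a continuous linear map. -/
def prCLM (g : L2I) : L2I →L[ℝ] L2I :=
  (lpMeas ℝ ℝ (MeasurableSpace.comap g inferInstance) 2 (volume : Measure I)).subtypeL ∘L
    condExpL2 (μ := (volume : Measure I)) ℝ ℝ (Lp.stronglyMeasurable g).measurable.comap_le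

theorem prL2_add (g h h' : L2I) : prL2 g (h + h') = prL2 g h + prL2 g h' := (prCLM g).map_add h h'

theorem prL2_smul (g : L2I) (c : ℝ) (h : L2I) : prL2 g (c • h) = c • prL2 g h :=
  (prCLM g).map_smul c h

theorem norm_prL2_le (g h : L2I) : ‖prL2 g h‖ ≤ ‖h‖ := norm_condExpL2_coe_le _ h

theorem inner_prL2_left (g h w : L2I) : ⟪prL2 g h, w⟫_ℝ = ⟪h, prL2 g w⟫_ℝ :=
  inner_condExpL2_left_eq_right _

theorem prL2_of_mem {g h : L2I} (hh : h ∈ measSubspace g) : prL2 g h = h := by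
  have hm := (Lp.stronglyMeasurable g).measurable.comap_le
  have h1 : ⟪h - prL2 g h, h - prL2 g h⟫_ℝ = 0 := by
    have h2 : ∀ w ∈ measSubspace g, ⟪prL2 g h, w⟫_ℝ = ⟪h, w⟫_ℝ := fun w hw =>
      inner_condExpL2_eq_inner_fun hm h w (mem_lpMeas_iff_aestronglyMeasurable.1 hw)
    rw [inner_sub_left, h2 _ (Submodule.sub_mem _ hh (prL2_mem g h)), sub_self]
  exact (sub_eq_zero.1 (inner_self_eq_zero.1 h1)).symm

theorem prL2_self (g : L2I) : prL2 g g = g := by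
  refine prL2_of_mem (mem_lpMeas_iff_aestronglyMeasurable.2 ?_)
  exact (Measurable.stronglyMeasurable
    (@Measurable.of_comap_le I ℝ (MeasurableSpace.comap g inferInstance) _ _ le_rfl)
      ).aestronglyMeasurable

variable {k : ℕ} {q : Fin k → I} {x : Fin (k + 1) → ℝ}

/-- The values `x i` are distinct, so each cell is a.e. a level set of the step function. -/
theorem cellInd_mem_measSubspace (hq : q ∈ QSimplex k) (hx : StrictMono x) (i : Fin (k + 1)) :
    cellInd q i ∈ measSubspace (stepFun q x) := by
  refine mem_lpMeas_iff_aestronglyMeasurable.2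
    ⟨(stepFun q x ⁻¹' {x i}).indicator fun _ => 1, ?_, ?_⟩
  · exact (@stronglyMeasurable_const I ℝ (MeasurableSpace.comap (stepFun q x) inferInstance) _ 1
      ).indicator ⟨_, measurableSet_singleton _, rfl⟩
  · filter_upwards [cellInd_coeFn q i, stepFun_coeFn hq x, ae_exists_mem_cell q]
      with u h1 h2 ⟨j, hj⟩
    rw [h1]
    have h3 : u ∈ cell q i ↔ u ∈ stepFun q x ⁻¹' {x i} := by
      rw [mem_preimage, mem_singleton_iff, h2 j hj]
      refine ⟨fun hi => ?_, fun hi => hx.injective hi ▸ hj⟩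
      by_contra hne
      exact Set.disjoint_left.1 (cell_disjoint hq (fun h => hne (by rw [h]) : i ≠ j)) hi hj
    by_cases h : u ∈ cell q i
    · rw [indicator_of_mem h, indicator_of_mem (h3.1 h)]
    · rw [indicator_of_notMem h, indicator_of_notMem fun h' => h (h3.2 h')]

theorem exists_eq_sum_of_mem_measSubspace (hq : q ∈ QSimplex k) {v : L2I}
    (hv : v ∈ measSubspace (stepFun q x)) :
    ∃ c : Fin (k + 1) → ℝ, v = ∑ i, c i • cellInd q i := by
  obtain ⟨f, hf, hvf⟩ := mem_lpMeas_iff_aestronglyMeasurable.1 hv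
  obtain ⟨ψ, -, rfl⟩ := hf.exists_eq_measurable_comp
  refine ⟨fun i => ψ (x i), Lp.ext ?_⟩
  filter_upwards [hvf, stepFun_coeFn hq x, sum_smul_cellInd_coeFn hq fun i => ψ (x i),
    ae_exists_mem_cell q] with u h1 h2 h3 ⟨i, hi⟩
  rw [h1, h3 i hi, Function.comp_apply, h2 i hi]

/-- For such `g` the subspace `L_2(g)` is spanned by the orthogonal cell indicators, so `pr_g` is
averaging over the cells. -/
theorem prL2_stepFun (hq : q ∈ QSimplex k) (hx : StrictMono x) (h : L2I) :
    prL2 (stepFun q x) h = ∑ i, (⟪h, cellInd q i⟫_ℝ / cellLen q i) • cellInd q i := by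
  obtain ⟨c, hc⟩ := exists_eq_sum_of_mem_measSubspace hq (prL2_mem (stepFun q x) h)
  rw [hc]
  refine Finset.sum_congr rfl fun i _ => ?_
  congr 1
  rw [eq_div_iff (cellLen_pos hq i).ne', ← inner_cellInd_sum hq i c, ← hc, real_inner_comm,
    inner_prL2_left, prL2_of_mem (cellInd_mem_measSubspace hq hx i)]

/-- Tested against a cell indicator the projection disappears, and a partial derivative in the
values of the step function remains. -/
theorem inner_gradD_cellInd (hq : q ∈ QSimplex k) (hx : StrictMono x) (U : L2I → ℝ)
    (i : Fin (k + 1)) :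
    ⟪gradD U (stepFun q x), cellInd q i⟫_ℝ = ⟪gradient U (stepFun q x), cellInd q i⟫_ℝ := by
  rw [gradD, inner_prL2_left, prL2_of_mem (cellInd_mem_measSubspace hq hx i)]

end Projection

/-- The dependence of `pr_g` on `g` is not evidently measurable. On the parameter spaces the
explicit averages over cells are, and this transfers to `Ξ`. -/
theorem aestronglyMeasurable_gradD (ξ : StieltjesFunction I) [FlatStieltjes ξ] {U : L2I → ℝ}
    (hU : Continuous (gradient U)) :
    AEStronglyMeasurable (fun g : ConeOf ξ => gradD U g) (Xi ξ) := by
  have : SecondCountableTopology L2I := inferInstance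
  refine aestronglyMeasurable_Xi ξ fun k => ?_
  have h1 : AEStronglyMeasurable (fun p : StepParam k => ∑ i,
      (⟪gradient U (stepFun p.1 p.2), cellInd p.1 i⟫_ℝ / cellLen p.1 i) • cellInd p.1 i)
      (stepMeas ξ k) := by
    refine Finset.aestronglyMeasurable_fun_sum _ fun i _ => ?_
    have hc : Continuous fun p : StepParam k => cellInd p.1 i :=
      (continuous_cellInd i).comp continuous_fst
    have hn : Measurable fun p : StepParam k =>
        ⟪gradient U (stepFun p.1 p.2), cellInd p.1 i⟫_ℝ :=
      ((hU.comp continuous_stepFun).inner hc).measurable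
    have hd : Measurable fun p : StepParam k => cellLen p.1 i :=
      (((continuous_subtype_val.comp (continuous_partitionPoints _)).sub
        (continuous_subtype_val.comp (continuous_partitionPoints _))).comp
          continuous_fst).measurable
    exact (hn.div hd).aestronglyMeasurable.smul hc.aestronglyMeasurable
  refine h1.congr ?_
  filter_upwards [ae_coneStep ξ k] with p hp
  rw [hp.2, gradD, prL2_stepFun hp.1.1 hp.1.2]
end

noncomputable section


/-! ## Cylinder functions -/

theorem isCbInfty_of_hasCompactSupport {n : ℕ} {u : (Fin n → ℝ) → ℝ}
    (hu : ContDiff ℝ ((⊤ : ℕ∞) : WithTop ℕ∞) u) (hc : HasCompactSupport u) : IsCbInfty u :=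
  ⟨hu, fun k => (hu.continuous_iteratedFDeriv (m := k) (by exact_mod_cast le_top)
    ).bounded_above_of_compact_support (hc.iteratedFDeriv k)⟩

theorem exists_bound_of_hasCompactSupport_real {φ : ℝ → ℝ} (hφ : HasCompactSupport φ) :
    ∃ R : ℝ, 0 ≤ R ∧ ∀ s, R < |s| → φ s = 0 := by
  obtain ⟨R, hR⟩ := hφ.isCompact.isBounded.exists_norm_le
  refine ⟨max R 0, le_max_right _ _, fun s hs => image_eq_zero_of_notMem_tsupport fun h => ?_⟩
  exact absurd hs (not_lt.2 ((hR s h).trans (le_max_left _ _)))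

section CylFun

variable {ξ : I → ℝ}

/-- No bounds on `u` are needed in the definition of the cylinder functions. -/
theorem mem_CylFun_of_smooth {n : ℕ} {u : (Fin n → ℝ) → ℝ} {φ : ℝ → ℝ} {h : Fin n → L2I}
    (hu : ContDiff ℝ ((⊤ : ℕ∞) : WithTop ℕ∞) u) (hφ : ContDiff ℝ ((⊤ : ℕ∞) : WithTop ℕ∞) φ)
    (hφc : HasCompactSupport φ) (hh : ∀ j, h j ∈ L2of ξ) :
    (fun g : L2I => u (fun j => ⟪g, h j⟫_ℝ) * φ (‖g‖ ^ 2)) ∈ CylFun ξ := by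
  obtain ⟨R, hR0, hR⟩ := exists_bound_of_hasCompactSupport_real hφc
  -- Where `φ (‖g‖ ^ 2)` is not zero, all `⟪g, h j⟫` are bounded by `ρ`. Multiplying `u` by a bump
  -- that is `1` there changes nothing and makes all derivatives bounded.
  set ρ : ℝ := √R * ∑ j, ‖h j‖ with hρ
  have hρ0 : 0 ≤ ρ := by positivity
  let b : ContDiffBump (0 : Fin n → ℝ) := ⟨ρ + 1, ρ + 2, by positivity, by linarith⟩
  refine Submodule.subset_span ⟨n, fun y => b y * u y, φ, h,
    isCbInfty_of_hasCompactSupport (b.contDiff.mul hu) b.hasCompactSupport.mul_right, hφ, hφc, hh,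
    funext fun g => ?_⟩
  by_cases hg : R < |‖g‖ ^ 2|
  · simp only [hR _ hg, mul_zero]
  · have h1 : ‖g‖ ≤ √R := Real.le_sqrt_of_sq_le ((le_abs_self _).trans (not_lt.1 hg))
    have h2 : b (fun j => ⟪g, h j⟫_ℝ) = 1 := by
      refine b.one_of_mem_closedBall (mem_closedBall_zero_iff.2 ?_)
      refine (pi_norm_le_iff_of_nonneg (by positivity)).2 fun j => ?_
      calc ‖⟪g, h j⟫_ℝ‖ ≤ ‖g‖ * ‖h j‖ := norm_inner_le_norm _ _
        _ ≤ √R * ∑ j, ‖h j‖ := mul_le_mul h1 (Finset.single_le_sum (f := fun j => ‖h j‖)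
            (fun _ _ => norm_nonneg _) (Finset.mem_univ j)) (norm_nonneg _) (Real.sqrt_nonneg _)
        _ ≤ ρ + 1 := by linarith
    simp only [h2, one_mul]

@[elab_as_elim]
theorem CylFun_induction {P : (U : L2I → ℝ) → U ∈ CylFun ξ → Prop}
    (hgen : ∀ (n : ℕ) (u : (Fin n → ℝ) → ℝ) (φ : ℝ → ℝ) (h : Fin n → L2I)
      (hu : ContDiff ℝ ((⊤ : ℕ∞) : WithTop ℕ∞) u) (hφ : ContDiff ℝ ((⊤ : ℕ∞) : WithTop ℕ∞) φ)
      (hφc : HasCompactSupport φ) (hh : ∀ j, h j ∈ L2of ξ),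
      P (fun g => u (fun j => ⟪g, h j⟫_ℝ) * φ (‖g‖ ^ 2)) (mem_CylFun_of_smooth hu hφ hφc hh))
    (hzero : P 0 (zero_mem _))
    (hadd : ∀ U V hU hV, P U hU → P V hV → P (U + V) (add_mem hU hV))
    (hsmul : ∀ (c : ℝ) U hU, P U hU → P (c • U) (Submodule.smul_mem _ c hU))
    {U : L2I → ℝ} (hU : U ∈ CylFun ξ) : P U hU := by
  induction hU using Submodule.span_induction with
  | mem U hU =>
    obtain ⟨n, u, φ, h, hu, hφ, hφc, hh, rfl⟩ := hU
    exact hgen n u φ h hu.1 hφ hφc hh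
  | zero => exact hzero
  | add U V hU' hV' hU hV => exact hadd U V hU' hV' hU hV
  | smul c U hU' hU => exact hsmul c U hU' hU

theorem contDiff_of_mem_CylFun {U : L2I → ℝ} (hU : U ∈ CylFun ξ) :
    ContDiff ℝ ((⊤ : ℕ∞) : WithTop ℕ∞) U := by
  induction hU using CylFun_induction with
  | hgen n u φ h hu hφ hφc hh =>
    exact (hu.comp (contDiff_pi.2 fun j => contDiff_id.inner ℝ contDiff_const)).mul
      (hφ.comp (contDiff_norm_sq ℝ))
  | hzero => exact contDiff_const
  | hadd U V _ _ hU hV => exact hU.add hV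
  | hsmul c U _ hU => exact contDiff_const.smul hU

theorem exists_bound_support_of_mem_CylFun {U : L2I → ℝ} (hU : U ∈ CylFun ξ) :
    ∃ R : ℝ, ∀ g, R < ‖g‖ → U g = 0 := by
  induction hU using CylFun_induction with
  | hgen n u φ h hu hφ hφc hh =>
    obtain ⟨R, hR0, hR⟩ := exists_bound_of_hasCompactSupport_real hφc
    refine ⟨√R, fun g hg => ?_⟩
    change _ * φ (‖g‖ ^ 2) = 0
    rw [hR _ (((Real.sqrt_lt' (lt_of_le_of_lt (Real.sqrt_nonneg _) hg)).1 hg).trans_le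
      (le_abs_self _)), mul_zero]
  | hzero => exact ⟨0, fun _ _ => rfl⟩
  | hadd U V _ _ hU hV =>
    obtain ⟨R, hR⟩ := hU
    obtain ⟨R', hR'⟩ := hV
    refine ⟨max R R', fun g hg => ?_⟩
    rw [Pi.add_apply, hR g ((le_max_left _ _).trans_lt hg), hR' g ((le_max_right _ _).trans_lt hg),
      add_zero]
  | hsmul c U _ hU =>
    obtain ⟨R, hR⟩ := hU
    exact ⟨R, fun g hg => by rw [Pi.smul_apply, hR g hg, smul_zero]⟩

theorem mul_mem_CylFun {U V : L2I → ℝ} (hU : U ∈ CylFun ξ) (hV : V ∈ CylFun ξ) :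
    U * V ∈ CylFun ξ := by
  induction hU using CylFun_induction with
  | hgen n u φ h hu hφ hφc hh =>
    induction hV using CylFun_induction with
    | hgen m v ψ h' hv hψ hψc hh' =>
      have h1 : ContDiff ℝ ((⊤ : ℕ∞) : WithTop ℕ∞) fun y : Fin (n + m) → ℝ =>
          u (fun j => y (Fin.castAdd m j)) * v (fun j => y (Fin.natAdd n j)) :=
        (hu.comp (contDiff_pi.2 fun j => contDiff_apply ℝ ℝ _)).mul
          (hv.comp (contDiff_pi.2 fun j => contDiff_apply ℝ ℝ _))
      have h2 := mem_CylFun_of_smooth (ξ := ξ) (h := Fin.append h h') h1 (hφ.mul hψ) hφc.mul_right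
        (fun j => by
          induction j using Fin.addCases with
          | left j => rw [Fin.append_left]; exact hh j
          | right j => rw [Fin.append_right]; exact hh' j)
      simp only [Fin.append_left, Fin.append_right] at h2
      convert h2 using 1
      funext g
      simp only [Pi.mul_apply]
      ring
    | hzero => rw [mul_zero]; exact zero_mem _
    | hadd V W _ _ hV hW => rw [mul_add]; exact add_mem hV hW
    | hsmul c V _ hV => rw [mul_smul_comm]; exact Submodule.smul_mem _ _ hV
  | hzero => rw [zero_mul]; exact zero_mem _
  | hadd U W _ _ hU hW => rw [add_mul]; exact add_mem hU hW
  | hsmul c U _ hU => rw [smul_mul_assoc]; exact Submodule.smul_mem _ _ hU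

theorem radial_mul_mem_CylFun {W : ℝ → ℝ} (hW : ContDiff ℝ ((⊤ : ℕ∞) : WithTop ℕ∞) W)
    {U : L2I → ℝ} (hU : U ∈ CylFun ξ) : (fun g => W (‖g‖ ^ 2) * U g) ∈ CylFun ξ := by
  induction hU using CylFun_induction with
  | hgen n u φ h hu hφ hφc hh =>
    convert mem_CylFun_of_smooth (ξ := ξ) hu (hW.mul hφ) hφc.mul_left hh using 1
    funext g
    ring
  | hzero =>
    convert zero_mem (CylFun ξ)
    simp
  | hadd U V _ _ hU hV =>
    convert add_mem hU hV
    simp [mul_add]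
  | hsmul c U _ hU =>
    convert Submodule.smul_mem _ c hU
    simp only [Pi.smul_apply, smul_eq_mul]
    ring

theorem pow_succ_mem_CylFun {U : L2I → ℝ} (hU : U ∈ CylFun ξ) (n : ℕ) :
    U ^ (n + 1) ∈ CylFun ξ := by
  induction n with
  | zero => simpa using hU
  | succ n ih => rw [pow_succ]; exact mul_mem_CylFun ih hU

theorem polynomial_mem_CylFun {P : Polynomial ℝ} (hP : P.eval 0 = 0) {U : L2I → ℝ}
    (hU : U ∈ CylFun ξ) : (fun g => P.eval (U g)) ∈ CylFun ξ := by
  have h1 : (fun g => P.eval (U g)) = ∑ i ∈ Finset.range (P.natDegree + 1), P.coeff i • U ^ i := by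
    funext g
    simp [Polynomial.eval_eq_sum_range]
  rw [h1]
  refine Submodule.sum_mem _ fun i _ => ?_
  cases i with
  | zero =>
    rw [Polynomial.coeff_zero_eq_eval_zero, hP, zero_smul]
    exact zero_mem _
  | succ i => exact Submodule.smul_mem _ _ (pow_succ_mem_CylFun hU i)

/-! ### Cut-off functions -/

/-- A smooth function on `ℝ` that is `1` on `[-1,1]` and `0` off `(-2,2)`. -/
def smoothCut : ContDiffBump (0 : ℝ) := ⟨1, 2, one_pos, one_lt_two⟩

/-- The function `s ↦ smoothCut (s / R²)`. -/
def radialCut (R s : ℝ) : ℝ := smoothCut (s / R ^ 2)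

theorem contDiff_radialCut (R : ℝ) : ContDiff ℝ ((⊤ : ℕ∞) : WithTop ℕ∞) (radialCut R) :=
  smoothCut.contDiff.comp (contDiff_id.div_const _)

theorem radialCut_nonneg (R s : ℝ) : 0 ≤ radialCut R s := smoothCut.nonneg

theorem radialCut_le_one (R s : ℝ) : radialCut R s ≤ 1 := smoothCut.le_one

theorem radialCut_eq_one {R s : ℝ} (hR : 0 < R) (hs : |s| ≤ R ^ 2) : radialCut R s = 1 := by
  refine smoothCut.one_of_mem_closedBall (mem_closedBall_zero_iff.2 ?_)
  rw [norm_div, Real.norm_eq_abs, Real.norm_of_nonneg (sq_nonneg R)]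
  exact div_le_one_of_le₀ hs (sq_nonneg R)

theorem radialCut_eq_zero {R s : ℝ} (hR : 0 < R) (hs : 2 * R ^ 2 ≤ |s|) : radialCut R s = 0 := by
  refine smoothCut.zero_of_le_dist ?_
  rw [dist_zero_right, norm_div, Real.norm_eq_abs, Real.norm_of_nonneg (sq_nonneg R)]
  exact (le_div_iff₀ (by positivity)).2 hs

theorem hasCompactSupport_radialCut {R : ℝ} (hR : 0 < R) : HasCompactSupport (radialCut R) := by
  refine HasCompactSupport.intro (isCompact_closedBall (0 : ℝ) (2 * R ^ 2)) fun s hs => ?_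
  refine radialCut_eq_zero hR ?_
  rw [mem_closedBall_zero_iff, not_le, Real.norm_eq_abs] at hs
  exact hs.le

theorem cut_mem_CylFun {R : ℝ} (hR : 0 < R) : (fun g : L2I => radialCut R (‖g‖ ^ 2)) ∈ CylFun ξ := by
  have := mem_CylFun_of_smooth (ξ := ξ) (n := 0) (u := fun _ => 1) (h := fun _ => 0) contDiff_const
    (contDiff_radialCut R) (hasCompactSupport_radialCut hR) (fun j => j.elim0)
  simpa using this

theorem inner_cut_mem_CylFun {R : ℝ} (hR : 0 < R) {h : L2I} (hh : h ∈ L2of ξ) :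
    (fun g : L2I => ⟪g, h⟫_ℝ * radialCut R (‖g‖ ^ 2)) ∈ CylFun ξ :=
  mem_CylFun_of_smooth (ξ := ξ) (n := 1) (u := fun y => y 0) (h := fun _ => h)
    (contDiff_apply ℝ ℝ _) (contDiff_radialCut R) (hasCompactSupport_radialCut hR) (fun _ => hh)

end CylFun

/-! ### Restrictions of cylinder functions to the cone -/

section Cone

variable {ξ : StieltjesFunction I} [FlatStieltjes ξ]

theorem isCompact_setOf_norm_le (ξ : StieltjesFunction I) [hflat : FlatStieltjes ξ] (R : ℝ) :
    IsCompact {g : ConeOf ξ | ‖(g : L2I)‖ ≤ R} := by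
  obtain ⟨δ, hδ⟩ := hflat.exists_flatEnds
  exact isCompact_norm_le ξ.mono hδ R

theorem hasCompactSupport_of_bounded {β : Type*} [Zero β] {F : ConeOf ξ → β} {R : ℝ}
    (hF : ∀ g : ConeOf ξ, R < ‖(g : L2I)‖ → F g = 0) : HasCompactSupport F :=
  HasCompactSupport.intro (isCompact_setOf_norm_le ξ R) fun g hg => hF g (not_le.1 hg)

theorem continuous_CylFun {U : L2I → ℝ} (hU : U ∈ CylFun ξ) : Continuous fun g : ConeOf ξ => U g :=
  (contDiff_of_mem_CylFun hU).continuous.comp continuous_subtype_val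

theorem hasCompactSupport_CylFun {U : L2I → ℝ} (hU : U ∈ CylFun ξ) :
    HasCompactSupport fun g : ConeOf ξ => U g := by
  obtain ⟨R, hR⟩ := exists_bound_support_of_mem_CylFun hU
  exact hasCompactSupport_of_bounded fun g hg => hR g hg

theorem exists_bound_CylFun {U : L2I → ℝ} (hU : U ∈ CylFun ξ) : ∃ C, ∀ g : ConeOf ξ, |U g| ≤ C :=
  (continuous_CylFun hU).bounded_above_of_compact_support (hasCompactSupport_CylFun hU)

theorem exists_norm_bound_of_hasCompactSupport {f : ConeOf ξ → ℝ} (hf : HasCompactSupport f) :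
    ∃ R : ℝ, 0 < R ∧ ∀ g : ConeOf ξ, R < ‖(g : L2I)‖ → f g = 0 := by
  obtain ⟨R, hR⟩ := hf.isCompact.bddAbove_image
    (f := fun g : ConeOf ξ => ‖(g : L2I)‖) (continuous_norm.comp continuous_subtype_val).continuousOn
  refine ⟨max R 1, by positivity, fun g hg => image_eq_zero_of_notMem_tsupport fun h => ?_⟩
  exact absurd hg (not_lt.2 ((hR (mem_image_of_mem _ h)).trans (le_max_left _ _)))

variable (ξ) in
/-- The restrictions of cylinder functions to a ball of the cone. -/
def cylSubalgebra {R : ℝ} (hR : 0 < R) :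
    Subalgebra ℝ C({g : ConeOf ξ | ‖(g : L2I)‖ ≤ R}, ℝ) where
  carrier := {F | ∃ U ∈ CylFun ξ, ∀ g, F g = U g}
  mul_mem' := by
    rintro F G ⟨U, hU, hF⟩ ⟨V, hV, hG⟩
    exact ⟨U * V, mul_mem_CylFun hU hV, fun g => by simp [hF, hG]⟩
  add_mem' := by
    rintro F G ⟨U, hU, hF⟩ ⟨V, hV, hG⟩
    exact ⟨U + V, add_mem hU hV, fun g => by simp [hF, hG]⟩
  algebraMap_mem' r := by
    refine ⟨r • fun g : L2I => radialCut R (‖g‖ ^ 2), Submodule.smul_mem _ _ (cut_mem_CylFun hR),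
      fun g => ?_⟩
    have h1 : radialCut R (‖((g : ConeOf ξ) : L2I)‖ ^ 2) = 1 := radialCut_eq_one hR (by
      rw [abs_of_nonneg (sq_nonneg _)]
      exact pow_le_pow_left₀ (norm_nonneg _) g.2 2)
    simp [h1]

/-- Two points are separated by pairing with their difference, which lies in `L_2(ξ)`; on the ball
the cut-off is `1`. -/
theorem cylSubalgebra_separatesPoints {R : ℝ} (hR : 0 < R) :
    (cylSubalgebra ξ hR).SeparatesPoints := by
  intro g g' hne
  have hcut : ∀ v : {g : ConeOf ξ | ‖(g : L2I)‖ ≤ R},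
      radialCut R (‖((v : ConeOf ξ) : L2I)‖ ^ 2) = 1 := fun v => radialCut_eq_one hR (by
    rw [abs_of_nonneg (sq_nonneg _)]
    exact pow_le_pow_left₀ (norm_nonneg _) v.2 2)
  have hh : (((g : ConeOf ξ) : L2I) - ((g' : ConeOf ξ) : L2I)) ∈ L2of ξ :=
    Submodule.sub_mem _ (g : ConeOf ξ).2.2 (g' : ConeOf ξ).2.2
  have hU := inner_cut_mem_CylFun hR hh
  refine ⟨_, ⟨⟨fun v => ⟪((v : ConeOf ξ) : L2I), _⟫_ℝ * radialCut R (‖((v : ConeOf ξ) : L2I)‖ ^ 2),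
    (continuous_CylFun hU).comp continuous_subtype_val⟩, ⟨_, hU, fun v => rfl⟩, rfl⟩, ?_⟩
  simp only [ContinuousMap.coe_mk, hcut, mul_one]
  intro heq
  rw [← sub_eq_zero, ← inner_sub_left, inner_self_eq_zero, sub_eq_zero] at heq
  exact hne (Subtype.ext (Subtype.ext heq))

/-- Cylinder functions are uniformly dense in the continuous compactly supported functions. -/
theorem exists_CylFun_near {f : ConeOf ξ → ℝ} (hf : Continuous f) (hc : HasCompactSupport f)
    {ε : ℝ} (hε : 0 < ε) : ∃ U ∈ CylFun ξ, ∀ g : ConeOf ξ, |f g - U g| < ε := by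
  obtain ⟨R, hR, hfR⟩ := exists_norm_bound_of_hasCompactSupport hc
  -- The approximation takes place on the larger ball because `radialCut R` is `1` up to radius `R`
  -- but vanishes only from radius `√2 R` on.
  have hR2 : 0 < 2 * R := by positivity
  have : CompactSpace {g : ConeOf ξ | ‖(g : L2I)‖ ≤ 2 * R} :=
    isCompact_iff_compactSpace.1 (isCompact_setOf_norm_le ξ (2 * R))
  set F : C({g : ConeOf ξ | ‖(g : L2I)‖ ≤ 2 * R}, ℝ) :=
    ⟨fun g => f g, hf.comp continuous_subtype_val⟩ with hF
  obtain ⟨⟨G, V, hV, hGV⟩, hG⟩ :=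
    ContinuousMap.exists_mem_subalgebra_near_continuousMap_of_separatesPoints
      (cylSubalgebra ξ hR2) (cylSubalgebra_separatesPoints hR2) F ε hε
  refine ⟨_, radial_mul_mem_CylFun (contDiff_radialCut R) hV, fun g => ?_⟩
  by_cases hg : ‖(g : L2I)‖ ≤ 2 * R
  · have h1 : |f g - V g| < ε := by
      have h2 := lt_of_le_of_lt ((G - F).norm_coe_le_norm ⟨g, hg⟩) hG
      rw [ContinuousMap.sub_apply, hGV, norm_sub_rev, Real.norm_eq_abs] at h2
      exact h2
    by_cases hg2 : ‖(g : L2I)‖ ≤ R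
    · rw [radialCut_eq_one hR (by
        rw [abs_of_nonneg (sq_nonneg _)]
        exact pow_le_pow_left₀ (norm_nonneg _) hg2 2), one_mul]
      exact h1
    · rw [hfR g (not_le.1 hg2), zero_sub, abs_neg] at h1 ⊢
      rw [abs_mul, abs_of_nonneg (radialCut_nonneg _ _)]
      exact lt_of_le_of_lt (mul_le_of_le_one_left (abs_nonneg _) (radialCut_le_one _ _)) h1
  · rw [not_le] at hg
    rw [hfR g (by linarith), radialCut_eq_zero hR (by
      rw [abs_of_nonneg (sq_nonneg _)]
      nlinarith), zero_mul, sub_zero, abs_zero]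
    exact hε

instance (ξ : I → ℝ) : Nonempty (ConeOf ξ) := ⟨⟨0, zero_mem_cone ξ⟩⟩

variable (ξ) in
/-- A countable family of cylinder functions that separates the points of the cone. -/
def sepFun : ℕ × Option ℕ → L2I → ℝ
  | (n, none), g => radialCut (n + 1) (‖g‖ ^ 2)
  | (n, some j), g => ⟪g, (TopologicalSpace.denseSeq (ConeOf ξ) j : L2I)⟫_ℝ *
      radialCut (n + 1) (‖g‖ ^ 2)

theorem sepFun_mem (n : ℕ × Option ℕ) : sepFun ξ n ∈ CylFun ξ := by
  obtain ⟨n, _ | j⟩ := n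
  · exact cut_mem_CylFun (by positivity)
  · exact inner_cut_mem_CylFun (by positivity) (TopologicalSpace.denseSeq (ConeOf ξ) j).2.2

theorem exists_radialCut_eq_one (g : L2I) :
    ∀ᶠ n : ℕ in atTop, radialCut ((n : ℝ) + 1) (‖g‖ ^ 2) = 1 := by
  obtain ⟨N, hN⟩ := exists_nat_ge ‖g‖
  filter_upwards [eventually_ge_atTop N] with n hn
  refine radialCut_eq_one (by positivity) ?_
  rw [abs_of_nonneg (sq_nonneg _)]
  refine pow_le_pow_left₀ (norm_nonneg _) ?_ 2
  have : (N : ℝ) ≤ n := by exact_mod_cast hn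
  linarith

theorem exists_sepFun_ne_zero (g : ConeOf ξ) : ∃ n, sepFun ξ n g ≠ 0 := by
  obtain ⟨n, hn⟩ := (exists_radialCut_eq_one (g : L2I)).exists
  exact ⟨(n, none), by rw [sepFun, hn]; exact one_ne_zero⟩

theorem exists_sepFun_ne {g g' : ConeOf ξ} (hne : g ≠ g') : ∃ n, sepFun ξ n g ≠ sepFun ξ n g' := by
  by_contra! h
  obtain ⟨n, hn, hn'⟩ :=
    ((exists_radialCut_eq_one (g : L2I)).and (exists_radialCut_eq_one (g' : L2I))).exists
  have h1 : ∀ j, ⟪(g : L2I) - g', (TopologicalSpace.denseSeq (ConeOf ξ) j : L2I)⟫_ℝ = 0 := fun j => by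
    have := h (n, some j)
    rw [sepFun, sepFun, hn, hn', mul_one, mul_one] at this
    rw [inner_sub_left, this, sub_self]
  have h2 : ∀ v : ConeOf ξ, ⟪(g : L2I) - g', (v : L2I)⟫_ℝ = 0 := fun v => by
    have hc : Continuous fun v : ConeOf ξ => ⟪(g : L2I) - g', (v : L2I)⟫_ℝ :=
      continuous_const.inner continuous_subtype_val
    exact congrFun ((TopologicalSpace.denseRange_denseSeq (ConeOf ξ)).equalizer hc continuous_const
      (funext h1)) v
  have h3 : ⟪(g : L2I) - g', (g : L2I) - g'⟫_ℝ = 0 := by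
    rw [inner_sub_right, h2, h2, sub_self]
  exact hne (Subtype.ext (sub_eq_zero.1 (inner_self_eq_zero.1 h3)))

end Cone
end

noncomputable section


/-! ## Calculus for the gradient `D` -/

section Calculus

theorem gradD_add {U V : L2I → ℝ} {g : L2I} (hU : DifferentiableAt ℝ U g)
    (hV : DifferentiableAt ℝ V g) : gradD (U + V) g = gradD U g + gradD V g := by
  have h1 : HasGradientAt (U + V) (gradient U g + gradient V g) g := by
    rw [hasGradientAt_iff_hasFDerivAt, map_add]
    exact hU.hasGradientAt.hasFDerivAt.add hV.hasGradientAt.hasFDerivAt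
  rw [gradD, h1.gradient, prL2_add]
  rfl

theorem gradD_smul {U : L2I → ℝ} {g : L2I} (c : ℝ) (hU : DifferentiableAt ℝ U g) :
    gradD (c • U) g = c • gradD U g := by
  have h1 : HasGradientAt (c • U) (c • gradient U g) g := by
    rw [hasGradientAt_iff_hasFDerivAt, map_smulₛₗ]
    exact hU.hasGradientAt.hasFDerivAt.const_smul c
  rw [gradD, h1.gradient, prL2_smul]
  rfl

theorem gradD_comp {U : L2I → ℝ} {g : L2I} {F : ℝ → ℝ} {F' : ℝ} (hF : HasDerivAt F F' (U g))
    (hU : DifferentiableAt ℝ U g) : gradD (fun v => F (U v)) g = F' • gradD U g := by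
  have h1 : HasGradientAt (fun v => F (U v)) (F' • gradient U g) g := by
    rw [hasGradientAt_iff_hasFDerivAt, map_smulₛₗ]
    exact hF.comp_hasFDerivAt g hU.hasGradientAt.hasFDerivAt
  rw [gradD, h1.gradient, prL2_smul]
  rfl

/-- Since `∇ ‖g‖² = 2 g` and `pr_g g = g`, the projection leaves the gradient of the radial factor
intact. -/
theorem gradD_radial_mul {U : L2I → ℝ} {g : L2I} {W : ℝ → ℝ} {W' : ℝ}
    (hW : HasDerivAt W W' (‖g‖ ^ 2)) (hU : DifferentiableAt ℝ U g) :
    gradD (fun v => W (‖v‖ ^ 2) * U v) g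
      = W (‖g‖ ^ 2) • gradD U g + (2 * W' * U g) • g := by
  have h0 : HasFDerivAt (fun v : L2I => W (‖v‖ ^ 2)) (W' • (2 • innerSL ℝ g)) g :=
    HasDerivAt.comp_hasFDerivAt g hW (hasStrictFDerivAt_norm_sq g).hasFDerivAt
  have h1 : HasGradientAt (fun v => W (‖v‖ ^ 2) * U v)
      (W (‖g‖ ^ 2) • gradient U g + (2 * W' * U g) • g) g := by
    rw [hasGradientAt_iff_hasFDerivAt]
    refine (h0.mul hU.hasGradientAt.hasFDerivAt).congr_fderiv ?_
    ext v
    simp [inner_add_left, inner_smul_left]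
    ring
  rw [gradD, h1.gradient, prL2_add, prL2_smul, prL2_smul, prL2_self]
  rfl

variable {ξ : I → ℝ} {U V : L2I → ℝ}

theorem differentiable_CylFun (hU : U ∈ CylFun ξ) : Differentiable ℝ U :=
  (contDiff_of_mem_CylFun hU).differentiable (by simp)

theorem continuous_gradient_CylFun (hU : U ∈ CylFun ξ) : Continuous (gradient U) :=
  (InnerProductSpace.toDual ℝ L2I).symm.continuous.comp
    ((contDiff_of_mem_CylFun hU).continuous_fderiv (by simp))

theorem exists_bound_support_gradD (hU : U ∈ CylFun ξ) : ∃ R : ℝ, ∀ g, R < ‖g‖ →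
    gradient U g = 0 := by
  obtain ⟨R, hR⟩ := exists_bound_support_of_mem_CylFun hU
  refine ⟨R, fun g hg => ?_⟩
  have h1 : U =ᶠ[𝓝 g] fun _ => 0 := by
    filter_upwards [(isOpen_lt continuous_const continuous_norm).mem_nhds hg] with v hv
    exact hR v hv
  rw [h1.gradient_eq, gradient_fun_const]

end Calculus

/-! ### Square integrability of `U` and `D U`, and the closed graph of `D` -/

section Integrability

variable {ξ : StieltjesFunction I} [FlatStieltjes ξ]

theorem exists_bound_gradD {U : L2I → ℝ} (hU : U ∈ CylFun ξ) :
    ∃ C, ∀ g : ConeOf ξ, ‖gradD U g‖ ≤ C := by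
  obtain ⟨R, hR⟩ := exists_bound_support_gradD hU
  obtain ⟨C, hC⟩ := ((continuous_gradient_CylFun hU).comp
    continuous_subtype_val).bounded_above_of_compact_support
      (hasCompactSupport_of_bounded (ξ := ξ) fun g hg => hR g hg)
  exact ⟨C, fun g => (norm_prL2_le _ _).trans (hC g)⟩

theorem gradD_eq_zero_of_norm {U : L2I → ℝ} (hU : U ∈ CylFun ξ) :
    ∃ R : ℝ, ∀ g : ConeOf ξ, R < ‖(g : L2I)‖ → gradD U g = 0 := by
  obtain ⟨R, hR⟩ := exists_bound_support_gradD hU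
  exact ⟨R, fun g hg => by rw [gradD, hR g hg]; exact (prCLM (g : L2I)).map_zero⟩

/-- Bounded functions supported in a ball of the cone are square integrable. -/
theorem memLp_of_bounded_support {E : Type*} [NormedAddCommGroup E] {F : ConeOf ξ → E}
    (hF : AEStronglyMeasurable F (Xi ξ)) {C R : ℝ} (hC : ∀ g, ‖F g‖ ≤ C)
    (hR : ∀ g : ConeOf ξ, R < ‖(g : L2I)‖ → F g = 0) (p : ℝ≥0∞) : MemLp F p (Xi ξ) := by
  have hK := isCompact_setOf_norm_le ξ R
  have h1 : MemLp ({g : ConeOf ξ | ‖(g : L2I)‖ ≤ R}.indicator fun _ => C) p (Xi ξ) :=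
    memLp_indicator_const p hK.measurableSet C (Or.inr hK.measure_lt_top.ne)
  refine h1.mono hF (Eventually.of_forall fun g => ?_)
  by_cases hg : ‖(g : L2I)‖ ≤ R
  · rw [indicator_of_mem (show g ∈ {g : ConeOf ξ | ‖(g : L2I)‖ ≤ R} from hg)]
    exact (hC g).trans (le_abs_self C)
  · rw [hR g (not_le.1 hg), norm_zero]
    exact norm_nonneg _

theorem memLp_CylFun {U : L2I → ℝ} (hU : U ∈ CylFun ξ) (p : ℝ≥0∞) :
    MemLp (fun g : ConeOf ξ => U g) p (Xi ξ) := by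
  obtain ⟨C, hC⟩ := exists_bound_CylFun hU
  obtain ⟨R, hR⟩ := exists_bound_support_of_mem_CylFun hU
  exact memLp_of_bounded_support (continuous_CylFun hU).aestronglyMeasurable hC
    (fun g hg => hR g hg) p

theorem memLp_gradD {U : L2I → ℝ} (hU : U ∈ CylFun ξ) (p : ℝ≥0∞) :
    MemLp (fun g : ConeOf ξ => gradD U g) p (Xi ξ) := by
  obtain ⟨C, hC⟩ := exists_bound_gradD hU
  obtain ⟨R, hR⟩ := gradD_eq_zero_of_norm hU
  exact memLp_of_bounded_support (aestronglyMeasurable_gradD ξ (continuous_gradient_CylFun hU))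
    hC hR p

variable (ξ) in
/-- The map `U ↦ (U, D U)` with values in `L²(Ξ) × L²(Ξ; L_2)`. -/
def cylEmbed : CylFun ξ →ₗ[ℝ] Lp ℝ 2 (Xi ξ) × Lp L2I 2 (Xi ξ) where
  toFun U := ((memLp_CylFun U.2 2).toLp _, (memLp_gradD U.2 2).toLp _)
  map_add' U V := by
    refine Prod.ext rfl ?_
    change (memLp_gradD (U + V).2 2).toLp _ = (memLp_gradD U.2 2).toLp _ + (memLp_gradD V.2 2).toLp _
    rw [← MemLp.toLp_add]
    exact MemLp.toLp_congr (memLp_gradD (U + V).2 2) _ (Eventually.of_forall fun g =>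
      gradD_add (differentiable_CylFun U.2 g) (differentiable_CylFun V.2 g))
  map_smul' c U := by
    refine Prod.ext rfl ?_
    change (memLp_gradD (c • U).2 2).toLp _ = c • (memLp_gradD U.2 2).toLp _
    rw [← MemLp.toLp_const_smul]
    exact MemLp.toLp_congr (memLp_gradD (c • U).2 2) _ (Eventually.of_forall fun g =>
      gradD_smul c (differentiable_CylFun U.2 g))

theorem cylEmbed_fst (U : CylFun ξ) :
    (cylEmbed ξ U).1 =ᵐ[Xi ξ] fun g => (U : L2I → ℝ) g :=
  (memLp_CylFun U.2 2).coeFn_toLp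

theorem cylEmbed_snd (U : CylFun ξ) :
    (cylEmbed ξ U).2 =ᵐ[Xi ξ] fun g => gradD U g := (memLp_gradD U.2 2).coeFn_toLp

variable (ξ) in
/-- The closure of the graph of `D` on cylinder functions. -/
def cylGraph : Submodule ℝ (Lp ℝ 2 (Xi ξ) × Lp L2I 2 (Xi ξ)) :=
  (LinearMap.range (cylEmbed ξ)).topologicalClosure

theorem isClosed_cylGraph : IsClosed (cylGraph ξ : Set (Lp ℝ 2 (Xi ξ) × Lp L2I 2 (Xi ξ))) :=
  Submodule.isClosed_topologicalClosure _

theorem cylEmbed_mem_cylGraph (U : CylFun ξ) : cylEmbed ξ U ∈ cylGraph ξ :=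
  Submodule.le_topologicalClosure _ ⟨U, rfl⟩

theorem exists_cylEmbed_near {p : Lp ℝ 2 (Xi ξ) × Lp L2I 2 (Xi ξ)} (hp : p ∈ cylGraph ξ) {ε : ℝ}
    (hε : 0 < ε) : ∃ U : CylFun ξ, ‖(cylEmbed ξ U).1 - p.1‖ < ε ∧ ‖(cylEmbed ξ U).2 - p.2‖ < ε := by
  obtain ⟨-, ⟨U, rfl⟩, hU⟩ := Metric.mem_closure_iff.1 hp ε hε
  rw [Prod.dist_eq, max_lt_iff, dist_comm, dist_comm p.2, dist_eq_norm, dist_eq_norm] at hU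
  exact ⟨U, hU⟩

theorem exists_seq_cylEmbed {p : Lp ℝ 2 (Xi ξ) × Lp L2I 2 (Xi ξ)} (hp : p ∈ cylGraph ξ) :
    ∃ U : ℕ → CylFun ξ, Tendsto (fun n => (cylEmbed ξ (U n)).1) atTop (𝓝 p.1) ∧
      Tendsto (fun n => (cylEmbed ξ (U n)).2) atTop (𝓝 p.2) := by
  choose U h1 h2 using fun n : ℕ => exists_cylEmbed_near hp (Nat.one_div_pos_of_nat (α := ℝ) (n := n))
  exact ⟨U, tendsto_iff_norm_sub_tendsto_zero.2 (squeeze_zero (fun _ => norm_nonneg _)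
    (fun n => (h1 n).le) tendsto_one_div_add_atTop_nhds_zero_nat),
    tendsto_iff_norm_sub_tendsto_zero.2 (squeeze_zero (fun _ => norm_nonneg _)
    (fun n => (h2 n).le) tendsto_one_div_add_atTop_nhds_zero_nat)⟩

end Integrability

/-! ## Closability -/

theorem Lp_two_lintegral_eq {α E : Type*} [MeasurableSpace α] [NormedAddCommGroup E]
    {μ : Measure α} (f : Lp E 2 μ) : ∫⁻ x, ‖f x‖ₑ ^ 2 ∂μ = ENNReal.ofReal (‖f‖ ^ 2) := by
  have h1 := eLpNorm_nnreal_pow_eq_lintegral (f := f) (μ := μ) (p := 2) two_ne_zero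
  simp only [NNReal.coe_ofNat, ENNReal.coe_ofNat, ENNReal.rpow_ofNat] at h1
  rw [← h1, Lp.norm_def, ENNReal.ofReal_pow ENNReal.toReal_nonneg,
    ENNReal.ofReal_toReal (Lp.eLpNorm_ne_top f)]

/-- The integrals against a fixed square integrable function of a sequence tending to `0` in
`L²` tend to `0`. -/
theorem tendsto_integral_mul_zero {α : Type*} [MeasurableSpace α] {μ : Measure α} {b : α → ℝ}
    (hb : MemLp b 2 μ) {f : ℕ → α → ℝ} (hf : ∀ n, AEStronglyMeasurable (f n) μ)
    (hlim : Tendsto (fun n => ∫⁻ x, ‖f n x‖ₑ ^ 2 ∂μ) atTop (𝓝 0)) :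
    Tendsto (fun n => ∫ x, b x * f n x ∂μ) atTop (𝓝 0) := by
  rw [tendsto_zero_iff_enorm_tendsto_zero]
  have hB : (∫⁻ x, ‖b x‖ₑ ^ (2 : ℝ) ∂μ) ^ (1 / 2 : ℝ) ≠ ∞ := by
    have h1 := eLpNorm_nnreal_pow_eq_lintegral (f := b) (μ := μ) (p := 2) two_ne_zero
    simp only [NNReal.coe_ofNat, ENNReal.coe_ofNat] at h1
    rw [← h1]
    exact ENNReal.rpow_ne_top_of_nonneg (by norm_num)
      (ENNReal.rpow_ne_top_of_nonneg (by norm_num) hb.2.ne)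
  have hlim2 : Tendsto (fun n => (∫⁻ x, ‖b x‖ₑ ^ (2 : ℝ) ∂μ) ^ (1 / 2 : ℝ) *
      (∫⁻ x, ‖f n x‖ₑ ^ (2 : ℝ) ∂μ) ^ (1 / 2 : ℝ)) atTop (𝓝 0) := by
    have h2 : Tendsto (fun n => (∫⁻ x, ‖f n x‖ₑ ^ (2 : ℝ) ∂μ) ^ (1 / 2 : ℝ)) atTop (𝓝 0) := by
      have h3 := (ENNReal.continuous_rpow_const (y := 1 / 2)).tendsto 0 |>.comp hlim
      rw [ENNReal.zero_rpow_of_pos (by norm_num)] at h3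
      refine h3.congr fun n => ?_
      simp only [Function.comp_apply, ENNReal.rpow_ofNat]
    have h4 := ENNReal.Tendsto.const_mul h2 (Or.inr hB)
    rwa [mul_zero] at h4
  refine tendsto_of_tendsto_of_tendsto_of_le_of_le tendsto_const_nhds hlim2 (fun _ => bot_le)
    fun n => ?_
  refine (enorm_integral_le_lintegral_enorm _).trans ?_
  simp only [enorm_mul]
  exact ENNReal.lintegral_mul_le_Lp_mul_Lq μ Real.HolderConjugate.two_two hb.1.enorm (hf n).enorm

/-- A directional derivative in the sense of `L²` limits is unique. -/
theorem ae_eq_zero_of_tendsto_fderiv {n : ℕ} {O : Set (Fin n → ℝ)} (hO : IsOpen O)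
    {V : ℕ → (Fin n → ℝ) → ℝ} (hV : ∀ j, ContDiff ℝ 1 (V j)) (v : Fin n → ℝ)
    {z : (Fin n → ℝ) → ℝ} (hz : AEStronglyMeasurable z (volume.restrict O))
    (h0 : Tendsto (fun j => ∫⁻ x in O, ‖V j x‖ₑ ^ 2) atTop (𝓝 0))
    (h1 : Tendsto (fun j => ∫⁻ x in O, ‖z x - fderiv ℝ (V j) x v‖ₑ ^ 2) atTop (𝓝 0)) :
    ∀ᵐ x, x ∈ O → z x = 0 := by
  have hdc : ∀ j, Continuous fun x => fderiv ℝ (V j) x v := fun j =>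
    ((hV j).continuous_fderiv one_ne_zero).clm_apply continuous_const
  -- `z` differs from a continuous function by a square integrable one, hence can be tested against
  -- smooth functions.
  have hloc : LocallyIntegrableOn z O := by
    obtain ⟨j, hj⟩ := (h1.eventually_lt_const one_pos).exists
    have h2 : MemLp (fun x => z x - fderiv ℝ (V j) x v) 2 (volume.restrict O) := by
      refine ⟨hz.sub (hdc j).aestronglyMeasurable, ?_⟩
      have h3 := eLpNorm_nnreal_pow_eq_lintegral (f := fun x => z x - fderiv ℝ (V j) x v)
        (μ := volume.restrict O) (p := 2) two_ne_zero
      simp only [NNReal.coe_ofNat, ENNReal.coe_ofNat, ENNReal.rpow_ofNat] at h3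
      rw [← h3] at hj
      by_contra htop
      rw [not_lt, top_le_iff] at htop
      rw [htop] at hj
      exact absurd hj (by simp)
    have h4 : LocallyIntegrable (fun x => z x - fderiv ℝ (V j) x v) (volume.restrict O) :=
      h2.locallyIntegrable one_le_two
    have h5 : LocallyIntegrable z (volume.restrict O) := by
      have h5' : ((fun x => z x - fderiv ℝ (V j) x v) + fun x => fderiv ℝ (V j) x v) = z := by
        funext x
        simp
      exact h5' ▸ h4.add (hdc j).locallyIntegrable
    exact fun x hx => by
      have h6 := h5 x
      rw [IntegrableAtFilter] at h6
      obtain ⟨s, hs, hsi⟩ := h6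
      refine ⟨O ∩ s, inter_mem_nhdsWithin O hs, ?_⟩
      rw [IntegrableOn, Measure.restrict_restrict' hO.measurableSet, inter_comm] at hsi
      exact hsi
  refine hO.ae_eq_zero_of_integral_contDiff_smul_eq_zero hloc fun b hb hbc hbO => ?_
  have hb1 : ContDiff ℝ 1 b := hb.of_le (by exact_mod_cast le_top)
  have hbL : MemLp b 2 (volume.restrict O) :=
    (hb.continuous.memLp_of_hasCompactSupport hbc).restrict O
  have hdb : Continuous fun x => fderiv ℝ b x v :=
    (hb1.continuous_fderiv one_ne_zero).clm_apply continuous_const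
  have hdbc : HasCompactSupport fun x => fderiv ℝ b x v := hbc.fderiv_apply ℝ v
  have hdbL : MemLp (fun x => fderiv ℝ b x v) 2 (volume.restrict O) :=
    (hdb.memLp_of_hasCompactSupport hdbc).restrict O
  have hoff : ∀ x, x ∉ O → b x = 0 := fun x hx =>
    image_eq_zero_of_notMem_tsupport fun h => hx (hbO h)
  have hoffd : ∀ x, x ∉ O → fderiv ℝ b x v = 0 := fun x hx => by
    have : fderiv ℝ b x = 0 := image_eq_zero_of_notMem_tsupport
      fun h => hx (hbO (tsupport_fderiv_subset ℝ h))
    rw [this]; rfl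
  -- The test function `b` has compact support in `O`, so there is no boundary term. In the limit
  -- the left side becomes `∫ b z` and the right side `0`.
  have hparts : ∀ j, ∫ x in O, b x * fderiv ℝ (V j) x v = -∫ x in O, fderiv ℝ b x v * V j x := by
    intro j
    rw [setIntegral_eq_integral_of_forall_compl_eq_zero fun x hx => by rw [hoff x hx, zero_mul],
      setIntegral_eq_integral_of_forall_compl_eq_zero fun x hx => by rw [hoffd x hx, zero_mul]]
    refine integral_mul_fderiv_eq_neg_fderiv_mul_of_integrable ?_ ?_ ?_
      (fun x _ => hb1.differentiable one_ne_zero x) (fun x _ => (hV j).differentiable one_ne_zero x)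
    · exact (hdb.mul (hV j).continuous).integrable_of_hasCompactSupport hdbc.mul_right
    · exact (hb.continuous.mul (hdc j)).integrable_of_hasCompactSupport hbc.mul_right
    · exact (hb.continuous.mul (hV j).continuous).integrable_of_hasCompactSupport hbc.mul_right
  have hlim1 := tendsto_integral_mul_zero hdbL
    (fun j => (hV j).continuous.aestronglyMeasurable) h0
  have hlim2 := tendsto_integral_mul_zero hbL
    (fun j => hz.sub (hdc j).aestronglyMeasurable) h1
  have hbz : Integrable (fun x => b x * z x) (volume.restrict O) := by
    obtain ⟨j, hj⟩ := (h1.eventually_lt_const one_pos).exists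
    have h3 := (hloc.mono_set hbO).integrableOn_isCompact hbc
    have h4 : IntegrableOn (fun x => b x * z x) (tsupport b) :=
      h3.continuousOn_mul hb.continuous.continuousOn hbc
    have h5 : Integrable fun x => b x * z x := by
      rw [← integrableOn_iff_integrable_of_support_subset (s := tsupport b)]
      · exact h4
      · exact (Function.support_mul_subset_left _ _).trans subset_closure
    exact h5.restrict
  have hconst : ∀ j, ∫ x in O, b x * z x = (∫ x in O, b x * (z x - fderiv ℝ (V j) x v))
      - ∫ x in O, fderiv ℝ b x v * V j x := by
    intro j
    have h6 : Integrable (fun x => b x * fderiv ℝ (V j) x v) (volume.restrict O) :=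
      ((hb.continuous.mul (hdc j)).integrable_of_hasCompactSupport hbc.mul_right).restrict
    have h7 : Integrable (fun x => b x * (z x - fderiv ℝ (V j) x v)) (volume.restrict O) :=
      (hbz.sub h6).congr (Eventually.of_forall fun x => by simp [mul_sub])
    rw [sub_eq_add_neg, ← hparts j, ← integral_add h7 h6]
    refine integral_congr_ae (Eventually.of_forall fun x => ?_)
    simp only
    ring
  simp only [smul_eq_mul]
  rw [← setIntegral_eq_integral_of_forall_compl_eq_zero (s := O)
    fun x hx => by rw [hoff x hx, zero_mul]]
  refine tendsto_nhds_unique (l := atTop) (f := fun _ : ℕ => ∫ x in O, b x * z x) tendsto_const_nhds ?_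
  have h7 := hlim2.sub hlim1
  rw [sub_zero] at h7
  exact h7.congr fun j => (hconst j).symm
end

noncomputable section


/-! ## Closability of the gradient -/

section Closable

/-- The step function with fixed partition as a continuous linear map of its values. -/
def stepCLM {k : ℕ} (q : Fin k → I) : (Fin (k + 1) → ℝ) →L[ℝ] L2I :=
  ∑ i, (ContinuousLinearMap.proj (R := ℝ) (φ := fun _ : Fin (k + 1) => ℝ) i).smulRight (cellInd q i)

theorem stepCLM_apply {k : ℕ} (q : Fin k → I) (x : Fin (k + 1) → ℝ) :
    stepCLM q x = stepFun q x := by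
  simp [stepCLM, stepFun_eq, ContinuousLinearMap.sum_apply]

theorem stepCLM_single {k : ℕ} (q : Fin k → I) (i : Fin (k + 1)) :
    stepCLM q (Pi.single i 1) = cellInd q i := by
  rw [stepCLM_apply, stepFun_eq, Finset.sum_eq_single i]
  · simp
  · intro j _ hj
    simp [hj]
  · simp

theorem fderiv_comp_stepFun {k : ℕ} (q : Fin k → I) {U : L2I → ℝ} (hU : Differentiable ℝ U)
    (x : Fin (k + 1) → ℝ) (i : Fin (k + 1)) :
    fderiv ℝ (fun x => U (stepFun q x)) x (Pi.single i 1)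
      = ⟪gradient U (stepFun q x), cellInd q i⟫_ℝ := by
  have h1 : HasFDerivAt (fun x => U (stepCLM q x)) ((fderiv ℝ U (stepCLM q x)).comp (stepCLM q)) x :=
    (hU _).hasFDerivAt.comp x (stepCLM q).hasFDerivAt
  simp only [stepCLM_apply] at h1
  rw [h1.fderiv, ContinuousLinearMap.comp_apply, stepCLM_single, inner_gradient_left]

variable {ξ : StieltjesFunction I} [FlatStieltjes ξ]

/-- If cylinder functions `U_n` tend to `0` fast while `D U_n` tends to `Z`, then `Z` is orthogonal
to the indicators of the cells of almost every step function. -/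
theorem ae_inner_cellInd_eq_zero {Z : Lp L2I 2 (Xi ξ)} {U : ℕ → CylFun ξ}
    (h0 : ∀ n, ‖(cylEmbed ξ (U n)).1‖ < (1 / 2) ^ n)
    (h1 : ∀ n, ‖(cylEmbed ξ (U n)).2 - Z‖ < (1 / 2) ^ n) (k : ℕ) :
    ∀ᵐ p ∂(stepMeas ξ k), ∀ i, ⟪Z (coneStep ξ k p), cellInd p.1 i⟫_ℝ = 0 := by
  -- The geometric rates make the squared errors summable. By Fubini, for almost every partition
  -- their integrals over the values tend to `0` along the whole sequence.
  set e : ℕ → ConeOf ξ → ℝ≥0∞ := fun n g =>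
    ‖(cylEmbed ξ (U n)).1 g‖ₑ ^ 2 + ‖((cylEmbed ξ (U n)).2 - Z) g‖ₑ ^ 2 with he
  have hem : ∀ n, Measurable (e n) := fun n =>
    ((Lp.stronglyMeasurable _).enorm.pow_const 2).add ((Lp.stronglyMeasurable _).enorm.pow_const 2)
  have hZm : StronglyMeasurable Z := Lp.stronglyMeasurable Z
  have hint : ∀ n, ∫⁻ p, e n (coneStep ξ k p) ∂(stepMeas ξ k) ≤ ENNReal.ofReal (2 * (1 / 4) ^ n) := by
    intro n
    rw [← lintegral_map (hem n) (measurable_coneStep ξ k)]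
    refine (lintegral_mono' (map_coneStep_le ξ k) le_rfl).trans ?_
    rw [he]
    simp only
    rw [lintegral_add_left ((Lp.stronglyMeasurable _).enorm.pow_const 2), Lp_two_lintegral_eq,
      Lp_two_lintegral_eq, ← ENNReal.ofReal_add (sq_nonneg _) (sq_nonneg _)]
    refine ENNReal.ofReal_le_ofReal ?_
    have h2 := pow_le_pow_left₀ (norm_nonneg _) (h0 n).le 2
    have h3 := pow_le_pow_left₀ (norm_nonneg _) (h1 n).le 2
    have h4 : (((1 : ℝ) / 2) ^ n) ^ 2 = (1 / 4) ^ n := by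
      rw [← pow_mul, mul_comm, pow_mul]
      norm_num
    rw [h4] at h2 h3
    linarith
  have hsum : ∫⁻ p, ∑' n, e n (coneStep ξ k p) ∂(stepMeas ξ k) ≠ ∞ := by
    have hm : ∀ n, AEMeasurable (fun p => e n (coneStep ξ k p)) (stepMeas ξ k) := fun n =>
      ((hem n).comp (measurable_coneStep ξ k)).aemeasurable
    rw [lintegral_tsum hm]
    refine ne_top_of_le_ne_top ?_ (ENNReal.tsum_le_tsum hint)
    have hs : Summable fun n : ℕ => 2 * (1 / 4 : ℝ) ^ n :=
      (summable_geometric_of_lt_one (by norm_num) (by norm_num)).mul_left 2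
    rw [← ENNReal.ofReal_tsum_of_nonneg (fun n => by positivity) hs]
    exact ENNReal.ofReal_ne_top
  have hsm : Measurable fun p : StepParam k => ∑' n, e n (coneStep ξ k p) :=
    Measurable.ennreal_tsum fun n => (hem n).comp (measurable_coneStep ξ k)
  have hae : ∀ᵐ p ∂(stepMeas ξ k), (p.1 ∈ goodPartitions ξ k ∧ StrictMono p.2) ∧
      (coneStep ξ k p : L2I) = stepFun p.1 p.2 ∧
      ∀ n, (cylEmbed ξ (U n)).1 (coneStep ξ k p) = (U n : L2I → ℝ) (coneStep ξ k p) ∧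
        ((cylEmbed ξ (U n)).2 - Z) (coneStep ξ k p)
          = gradD (U n) (coneStep ξ k p) - Z (coneStep ξ k p) := by
    have h2 : ∀ᵐ p ∂(stepMeas ξ k), ∀ n, (cylEmbed ξ (U n)).1 (coneStep ξ k p)
        = (U n : L2I → ℝ) (coneStep ξ k p) ∧ ((cylEmbed ξ (U n)).2 - Z) (coneStep ξ k p)
          = gradD (U n) (coneStep ξ k p) - Z (coneStep ξ k p) := by
      suffices h2' : ∀ᵐ (g : ConeOf ξ) ∂(Xi ξ), ∀ n, (cylEmbed ξ (U n)).1 g = (U n : L2I → ℝ) g ∧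
          ((cylEmbed ξ (U n)).2 - Z) g = gradD (U n) g - Z g from
        (quasiMeasurePreserving_coneStep ξ k).ae h2'
      refine ae_all_iff.2 fun n => ?_
      filter_upwards [cylEmbed_fst (U n), cylEmbed_snd (U n),
        Lp.coeFn_sub (cylEmbed ξ (U n)).2 Z] with g h3 h4 h5
      exact ⟨h3, by rw [h5, Pi.sub_apply, h4]⟩
    filter_upwards [ae_stepMeas ξ k, ae_coneStep ξ k, h2] with p hp hp2 hp3
    exact ⟨hp, hp2.2, hp3⟩
  rw [stepMeas, lintegral_prod _ hsm.aemeasurable] at hsum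
  have hfin := ae_lt_top (hsm.lintegral_prod_right') hsum
  have hmeas : MeasurableSet {p : StepParam k | ∀ i, ⟪Z (coneStep ξ k p), cellInd p.1 i⟫_ℝ = 0} := by
    simp only [setOf_forall]
    refine MeasurableSet.iInter fun i => ?_
    have hc : Continuous fun p : StepParam k => cellInd p.1 i :=
      (continuous_cellInd i).comp continuous_fst
    have hm : StronglyMeasurable fun p : StepParam k => ⟪Z (coneStep ξ k p), cellInd p.1 i⟫_ℝ :=
      (hZm.comp_measurable (measurable_coneStep ξ k)).inner hc.stronglyMeasurable
    exact hm.measurable (measurableSet_singleton 0)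
  rw [stepMeas, Measure.ae_prod_iff_ae_ae hmeas]
  have hO : IsOpen {x : Fin (k + 1) → ℝ | StrictMono x} :=
    isOpen_setOf_strictMono fun i => continuous_apply i
  filter_upwards [hfin, Measure.ae_ae_of_ae_prod hae] with q hq hqae
  -- Strictly increasing values form an open set, of full measure among the monotone ones, on which
  -- the uniqueness of derivatives applies for each fixed `q`.
  have hOE : volume.restrict {x : Fin (k + 1) → ℝ | StrictMono x}
      ≤ volume.restrict {x : Fin (k + 1) → ℝ | Monotone x} :=
    Measure.restrict_mono (fun x hx => StrictMono.monotone hx) le_rfl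
  have hlim : Tendsto (fun n => ∫⁻ x in {x | StrictMono x}, e n (coneStep ξ k (q, x))) atTop (𝓝 0) := by
    refine ENNReal.tendsto_atTop_zero_of_tsum_ne_top ?_
    have hm : ∀ n, AEMeasurable (fun x => e n (coneStep ξ k (q, x)))
        (volume.restrict {x | StrictMono x}) := fun n =>
      ((hem n).comp ((measurable_coneStep ξ k).comp measurable_prodMk_left)).aemeasurable
    rw [← lintegral_tsum hm]
    exact ((lintegral_mono' hOE le_rfl).trans_lt hq).ne
  have hqae' := hOE.absolutelyContinuous.ae_le hqae
  rw [ae_all_iff]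
  intro i
  have hzero := ae_eq_zero_of_tendsto_fderiv hO (V := fun n x => (U n : L2I → ℝ) (stepFun q x))
    (v := Pi.single i 1) (z := fun x => ⟪Z (coneStep ξ k (q, x)), cellInd q i⟫_ℝ) ?_ ?_ ?_ ?_
  · filter_upwards [ae_restrict_of_ae hzero, ae_strictMono k] with x hx hx2
    exact hx hx2
  · intro n
    have h2 : ContDiff ℝ 1 fun x => (U n : L2I → ℝ) (stepCLM q x) :=
      ((contDiff_of_mem_CylFun (U n).2).of_le (by exact_mod_cast le_top)).comp (stepCLM q).contDiff
    simpa only [stepCLM_apply] using h2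
  · exact ((hZm.comp_measurable ((measurable_coneStep ξ k).comp
      measurable_prodMk_left)).inner stronglyMeasurable_const).aestronglyMeasurable
  · refine tendsto_of_tendsto_of_tendsto_of_le_of_le tendsto_const_nhds hlim (fun _ => bot_le)
      fun n => lintegral_mono_ae ?_
    filter_upwards [hqae'] with x hx
    obtain ⟨-, hx2, hx3⟩ := hx
    simp only [he]
    rw [(hx3 n).1, hx2]
    exact le_self_add
  · refine tendsto_of_tendsto_of_tendsto_of_le_of_le tendsto_const_nhds hlim (fun _ => bot_le)
      fun n => lintegral_mono_ae ?_
    filter_upwards [hqae'] with x hx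
    obtain ⟨⟨hx0, hx1⟩, hx2, hx3⟩ := hx
    simp only [he]
    rw [(hx3 n).2]
    refine le_trans ?_ le_add_self
    gcongr
    -- The partial derivative is the pairing of `D U_n` with a cell indicator, whose norm is at most
    -- `1`.
    rw [fderiv_comp_stepFun q (differentiable_CylFun (U n).2), ← inner_gradD_cellInd hx0.1 hx1,
      hx2, ← inner_sub_left, ← ofReal_norm, ← ofReal_norm, ← norm_neg (gradD _ _ - _), neg_sub]
    refine ENNReal.ofReal_le_ofReal ((norm_inner_le_norm _ _).trans ?_)
    exact mul_le_of_le_one_right (norm_nonneg _) (norm_cellInd_le_one q i)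

/-- The gradient on cylinder functions is closable. -/
theorem cylGraph_zero {Z : Lp L2I 2 (Xi ξ)}
    (hZ : ((0, Z) : Lp ℝ 2 (Xi ξ) × Lp L2I 2 (Xi ξ)) ∈ cylGraph ξ) : Z = 0 := by
  choose U h0 h1 using fun n : ℕ =>
    exists_cylEmbed_near hZ (show (0 : ℝ) < (1 / 2) ^ n by positivity)
  simp only [sub_zero] at h0
  -- Almost everywhere `D V` is a combination of cell indicators, so `Z` is orthogonal to every `D
  -- V`. As a limit of the `D U_n` it is orthogonal to itself.
  have hort : ∀ V : CylFun ξ, ⟪(cylEmbed ξ V).2, Z⟫_ℝ = 0 := by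
    intro V
    rw [L2.inner_def]
    refine integral_eq_zero_of_ae ?_
    have h2 : ∀ᵐ (g : ConeOf ξ) ∂(Xi ξ), ⟪gradD V g, Z g⟫_ℝ = 0 := by
      refine (ae_Xi_iff ξ).2 fun k => ?_
      filter_upwards [ae_coneStep ξ k, ae_inner_cellInd_eq_zero h0 h1 k] with p hp hp2
      rw [hp.2, gradD, prL2_stepFun hp.1.1 hp.1.2, sum_inner]
      refine Finset.sum_eq_zero fun i _ => ?_
      rw [inner_smul_left, real_inner_comm (Z (coneStep ξ k p)), hp2 i, mul_zero]
    filter_upwards [cylEmbed_snd V, h2] with g h3 h4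
    rw [h3, h4]
    rfl
  have hlim : Tendsto (fun n => ⟪(cylEmbed ξ (U n)).2, Z⟫_ℝ) atTop (𝓝 ⟪Z, Z⟫_ℝ) := by
    refine Tendsto.inner ?_ tendsto_const_nhds
    refine tendsto_iff_norm_sub_tendsto_zero.2 (squeeze_zero (fun _ => norm_nonneg _)
      (fun n => (h1 n).le) ?_)
    exact tendsto_pow_atTop_nhds_zero_of_lt_one (by norm_num) (by norm_num)
  simp only [hort] at hlim
  exact inner_self_eq_zero.1 (tendsto_nhds_unique hlim tendsto_const_nhds)

theorem cylGraph_unique {u : Lp ℝ 2 (Xi ξ)} {z z' : Lp L2I 2 (Xi ξ)} (h : (u, z) ∈ cylGraph ξ)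
    (h' : (u, z') ∈ cylGraph ξ) : z = z' := by
  have h1 := Submodule.sub_mem _ h h'
  rw [Prod.mk_sub_mk, sub_self] at h1
  exact sub_eq_zero.1 (cylGraph_zero h1)

end Closable
end

noncomputable section


/-! ## Polynomial approximation of the unit contraction -/

theorem Polynomial.exists_derivative_eq (Q : Polynomial ℝ) :
    ∃ P : Polynomial ℝ, P.derivative = Q ∧ P.eval 0 = 0 := by
  induction Q using Polynomial.induction_on' with
  | add p q hp hq =>
    obtain ⟨P, hP, hP0⟩ := hp
    obtain ⟨P', hP', hP0'⟩ := hq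
    exact ⟨P + P', by simp [hP, hP'], by simp [hP0, hP0']⟩
  | monomial n a =>
    refine ⟨Polynomial.monomial (n + 1) (a / (n + 1)), ?_, by simp⟩
    rw [Polynomial.derivative_monomial]
    congr 1
    push_cast
    field_simp

/-- A smooth approximation of the unit contraction. -/
def smoothClip (ε x : ℝ) : ℝ := (√(x ^ 2 + ε ^ 2) - √((x - 1) ^ 2 + ε ^ 2) - ε + √(1 + ε ^ 2)) / 2

/-- The derivative of `smoothClip`. -/
def smoothClipDeriv (ε x : ℝ) : ℝ :=
  (x / √(x ^ 2 + ε ^ 2) - (x - 1) / √((x - 1) ^ 2 + ε ^ 2)) / 2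

theorem hasDerivAt_smoothClip {ε : ℝ} (hε : 0 < ε) (x : ℝ) :
    HasDerivAt (smoothClip ε) (smoothClipDeriv ε x) x := by
  have key : ∀ a : ℝ, HasDerivAt (fun x : ℝ => √((x - a) ^ 2 + ε ^ 2))
      ((x - a) / √((x - a) ^ 2 + ε ^ 2)) x := by
    intro a
    have h1 : HasDerivAt (fun x : ℝ => (x - a) ^ 2 + ε ^ 2) (2 * (x - a)) x := by
      simpa using (((hasDerivAt_id x).sub_const a).pow 2).add_const (ε ^ 2)
    have h2 := h1.sqrt (by positivity)
    rwa [mul_div_mul_left _ _ two_ne_zero] at h2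
  have h3 := ((((key 0).sub (key 1)).sub_const ε).add_const (√(1 + ε ^ 2))).div_const 2
  simp only [sub_zero] at h3
  exact h3

theorem continuous_smoothClipDeriv {ε : ℝ} (hε : 0 < ε) : Continuous (smoothClipDeriv ε) := by
  have h1 : ∀ x : ℝ, √(x ^ 2 + ε ^ 2) ≠ 0 := fun x => (Real.sqrt_pos.2 (by positivity)).ne'
  have h2 : ∀ x : ℝ, √((x - 1) ^ 2 + ε ^ 2) ≠ 0 := fun x => (Real.sqrt_pos.2 (by positivity)).ne'
  unfold smoothClipDeriv
  fun_prop (disch := assumption)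

theorem abs_smoothClipDeriv_le {ε : ℝ} (hε : 0 < ε) (x : ℝ) : |smoothClipDeriv ε x| ≤ 1 := by
  have key : ∀ y : ℝ, |y / √(y ^ 2 + ε ^ 2)| ≤ 1 := by
    intro y
    have h1 : 0 < √(y ^ 2 + ε ^ 2) := Real.sqrt_pos.2 (by positivity)
    rw [abs_div, abs_of_pos h1, div_le_one h1]
    exact Real.abs_le_sqrt (by nlinarith)
  have h2 := abs_le.1 (key x)
  have h3 := abs_le.1 (key (x - 1))
  rw [smoothClipDeriv, abs_le]
  constructor <;> linarith

theorem abs_smoothClip_sub_le {ε : ℝ} (hε : 0 < ε) (x : ℝ) : |smoothClip ε x - unitClip x| ≤ ε := by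
  have key : ∀ y : ℝ, |y| ≤ √(y ^ 2 + ε ^ 2) ∧ √(y ^ 2 + ε ^ 2) ≤ |y| + ε := by
    intro y
    refine ⟨Real.abs_le_sqrt (by nlinarith), Real.sqrt_le_iff.2 ⟨by positivity, ?_⟩⟩
    have := sq_abs y
    nlinarith [mul_nonneg (abs_nonneg y) hε.le]
  have h1 := key x
  have h2 := key (x - 1)
  have h3 := key 1
  rw [abs_one, one_pow] at h3
  -- The formula behind `smoothClip`: absolute values become `√(y² + ε²)`, and the constants are
  -- adjusted so that the value at `0` is `0`.
  have h4 : unitClip x = (|x| - |x - 1| + 1) / 2 := by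
    rw [unitClip]
    rcases le_total x 0 with h | h
    · rw [max_eq_right h, min_eq_left zero_le_one, abs_of_nonpos h, abs_of_nonpos (by linarith)]
      ring
    · rcases le_total x 1 with h' | h'
      · rw [max_eq_left h, min_eq_left h', abs_of_nonneg h, abs_of_nonpos (by linarith)]
        ring
      · rw [max_eq_left h, min_eq_right h', abs_of_nonneg h, abs_of_nonneg (by linarith)]
        ring
  rw [smoothClip, h4, abs_le]
  constructor <;> linarith [h1.1, h1.2, h2.1, h2.2, h3.1, h3.2]

theorem smoothClip_zero {ε : ℝ} (hε : 0 < ε) : smoothClip ε 0 = 0 := by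
  simp [smoothClip, Real.sqrt_sq hε.le]

/-- On a compact interval the unit contraction is a limit of polynomials which vanish at `0` and
whose derivative is almost bounded by `1`. -/
theorem exists_polynomial_near_unitClip (M : ℝ) {ε : ℝ} (hε : 0 < ε) :
    ∃ P : Polynomial ℝ, P.eval 0 = 0 ∧ ∀ x, |x| ≤ M →
      |P.eval x - unitClip x| ≤ ε ∧ |P.derivative.eval x| ≤ 1 + ε := by
  have hM : 0 < |M| + 1 := by positivity
  -- The derivative is approximated within `η` and integrated from `0`. The bound `η ≤ ε` serves the
  -- derivative, and `η (|M| + 1) ≤ ε / 2` the function; the other `ε / 2` is the error of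
  -- `smoothClip`.
  set η := min ε (ε / 2 / (|M| + 1)) with hη
  have hη0 : 0 < η := by positivity
  have hε2 : 0 < ε / 2 := half_pos hε
  obtain ⟨Q, hQ⟩ := exists_polynomial_near_of_continuousOn (-M) M (smoothClipDeriv (ε / 2))
    (continuous_smoothClipDeriv hε2).continuousOn η hη0
  obtain ⟨P, hP, hP0⟩ := Polynomial.exists_derivative_eq Q
  refine ⟨P, hP0, fun x hx => ?_⟩
  have hd : ∀ y ∈ Icc (-M) M, HasDerivWithinAt (fun y => P.eval y - smoothClip (ε / 2) y)
      (Q.eval y - smoothClipDeriv (ε / 2) y) (Icc (-M) M) y := fun y _ =>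
    ((hP ▸ P.hasDerivAt y).sub (hasDerivAt_smoothClip hε2 y)).hasDerivWithinAt
  have hM0 : 0 ≤ M := (abs_nonneg x).trans hx
  have h1 := (convex_Icc (-M) M).norm_image_sub_le_of_norm_hasDerivWithin_le hd
    (fun y hy => (hQ y hy).le) (⟨by linarith, hM0⟩ : (0 : ℝ) ∈ Icc (-M) M)
    (abs_le.1 hx : x ∈ Icc (-M) M)
  rw [hP0, smoothClip_zero hε2, sub_zero, sub_zero, sub_zero, Real.norm_eq_abs, Real.norm_eq_abs]
    at h1
  have h2 : η * |x| ≤ ε / 2 := by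
    calc η * |x| ≤ ε / 2 / (|M| + 1) * (|M| + 1) := by
          gcongr
          · exact min_le_right _ _
          · linarith [le_abs_self M]
      _ = ε / 2 := div_mul_cancel₀ _ hM.ne'
  constructor
  · calc |P.eval x - unitClip x| ≤ |P.eval x - smoothClip (ε / 2) x|
          + |smoothClip (ε / 2) x - unitClip x| := abs_sub_le _ _ _
      _ ≤ ε / 2 + ε / 2 := add_le_add (h1.trans h2) (abs_smoothClip_sub_le hε2 x)
      _ = ε := add_halves ε
  · rw [hP]
    have h3 := (hQ x (abs_le.1 hx)).le.trans (min_le_left _ _)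
    calc |Q.eval x| = |(Q.eval x - smoothClipDeriv (ε / 2) x) + smoothClipDeriv (ε / 2) x| := by
          rw [sub_add_cancel]
      _ ≤ |Q.eval x - smoothClipDeriv (ε / 2) x| + |smoothClipDeriv (ε / 2) x| := abs_add_le _ _
      _ ≤ ε + 1 := add_le_add h3 (abs_smoothClipDeriv_le hε2 x)
      _ = 1 + ε := add_comm _ _

/-! ## The closed form -/

section CylForm

variable {ξ : StieltjesFunction I} [FlatStieltjes ξ]

/-- The differences vanish off a common ball of finite measure, so uniform convergence implies
convergence in `L²`. -/
theorem tendsto_cylEmbed_fst_of_le {f : Lp ℝ 2 (Xi ξ)} {V : ℕ → CylFun ξ} {R : ℝ} {ε : ℕ → ℝ}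
    (hε1 : ∀ n, ε n ≤ 1) (hε : Tendsto ε atTop (𝓝 0))
    (hV : ∀ n, ∀ᵐ (g : ConeOf ξ) ∂(Xi ξ), |(V n : L2I → ℝ) g - f g| ≤ ε n ∧
      (R < ‖(g : L2I)‖ → (V n : L2I → ℝ) g - f g = 0)) :
    Tendsto (fun n => (cylEmbed ξ (V n)).1) atTop (𝓝 f) := by
  have hK := isCompact_setOf_norm_le ξ R
  refine Lp_two_tendsto_of_dominated _ _
    (indicatorConstLp 2 hK.measurableSet hK.measure_lt_top.ne (1 : ℝ)) (fun n => ?_) ?_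
  · filter_upwards [cylEmbed_fst (V n), hV n,
      indicatorConstLp_coeFn (p := 2) (hs := hK.measurableSet) (hμs := hK.measure_lt_top.ne)
        (c := (1 : ℝ))] with g h1 h2 h3
    rw [h1, h3]
    by_cases hg : ‖(g : L2I)‖ ≤ R
    · rw [indicator_of_mem (by exact hg)]
      exact h2.1.trans (hε1 n)
    · rw [indicator_of_notMem (by exact hg), h2.2 (not_le.1 hg), abs_zero]
  · filter_upwards [ae_all_iff.2 fun n => cylEmbed_fst (V n), ae_all_iff.2 hV] with g h1 h2
    refine tendsto_iff_norm_sub_tendsto_zero.2 (squeeze_zero (fun _ => norm_nonneg _)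
      (fun n => ?_) hε)
    rw [h1]
    exact (h2 n).1

/-- The unit contraction operates on cylinder functions. -/
theorem exists_clip_mem_cylGraph_of_CylFun (U : CylFun ξ) :
    ∃ z, (clipL2 (cylEmbed ξ U).1, z) ∈ cylGraph ξ ∧ ‖z‖ ≤ ‖(cylEmbed ξ U).2‖ := by
  obtain ⟨M, hM⟩ := exists_bound_CylFun U.2
  obtain ⟨R, hR⟩ := exists_bound_support_of_mem_CylFun U.2
  choose P hP0 hP using fun n : ℕ =>
    exists_polynomial_near_unitClip M (Nat.one_div_pos_of_nat (α := ℝ) (n := n))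
  set V : ℕ → CylFun ξ := fun n => ⟨_, polynomial_mem_CylFun (hP0 n) U.2⟩ with hVdef
  -- The polynomials in `U` converge in `L²` to the clipped function, while their gradients have
  -- norms at most `(1 + 1 / (n + 1)) ‖D U‖`; a weak limit of the gradients is the required `z`.
  refine exists_mem_of_tendsto_of_norm_le (cylGraph ξ) isClosed_cylGraph
    (fun n => cylEmbed ξ (V n)) (fun n => cylEmbed_mem_cylGraph _) _ ?_
    (fun n => (1 + 1 / ((n : ℝ) + 1)) * ‖(cylEmbed ξ U).2‖) _ ?_ ?_
  · refine tendsto_cylEmbed_fst_of_le (R := R) (ε := fun n => 1 / ((n : ℝ) + 1)) (fun n => ?_)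
      tendsto_one_div_add_atTop_nhds_zero_nat fun n => ?_
    · rw [div_le_one (by positivity)]
      linarith [(Nat.cast_nonneg n : (0 : ℝ) ≤ n)]
    · filter_upwards [cylEmbed_fst U, coeFn_clipL2 (cylEmbed ξ U).1] with g h1 h2
      rw [h2, h1]
      refine ⟨((hP n) _ (hM g)).1, fun hg => ?_⟩
      change (P n).eval ((U : L2I → ℝ) g) - _ = 0
      rw [hR _ hg, hP0]
      simp
  · intro n
    refine Lp.norm_le_mul_norm_of_ae_le_mul ?_
    filter_upwards [cylEmbed_snd U, cylEmbed_snd (V n)] with g h1 h2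
    rw [h1, h2]
    change ‖gradD (fun v => (P n).eval ((U : L2I → ℝ) v)) g‖ ≤ _
    rw [gradD_comp ((P n).hasDerivAt _) (differentiable_CylFun U.2 g), norm_smul]
    gcongr
    exact ((hP n) _ (hM g)).2
  · have h1 := (tendsto_one_div_add_atTop_nhds_zero_nat (𝕜 := ℝ)).const_add 1
    simpa using h1.mul_const ‖(cylEmbed ξ U).2‖

/-- The unit contraction operates on the closure of `D`. -/
theorem exists_clip_mem_cylGraph {u : Lp ℝ 2 (Xi ξ)} {z : Lp L2I 2 (Xi ξ)}
    (h : (u, z) ∈ cylGraph ξ) : ∃ z', (clipL2 u, z') ∈ cylGraph ξ ∧ ‖z'‖ ≤ ‖z‖ := by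
  obtain ⟨U, h1, h2⟩ := exists_seq_cylEmbed h
  choose y hy1 hy2 using fun n => exists_clip_mem_cylGraph_of_CylFun (U n)
  -- Clipping is continuous on `L²` and the norms of the approximating gradients converge to `‖z‖`,
  -- so the case of cylinder functions passes to the limit.
  exact exists_mem_of_tendsto_of_norm_le (cylGraph ξ) isClosed_cylGraph
    (fun n => (clipL2 (cylEmbed ξ (U n)).1, y n)) hy1 _
    ((continuous_clipL2.tendsto u).comp h1) _ _ hy2 h2.norm

variable (ξ) in
-- Continuous compactly supported functions are dense in `L²` and uniformly approximated by cylinder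
-- functions; a further cut-off gives these a common bounded support.
theorem denseRange_cylEmbed_fst : DenseRange fun U : CylFun ξ => (cylEmbed ξ U).1 := by
  intro f
  rw [Metric.mem_closure_iff]
  intro ε hε
  obtain ⟨φ, hφc, hφ, hφm, hφL⟩ := (Lp.memLp f).exists_hasCompactSupport_eLpNorm_sub_le
    (by norm_num) (ε := ENNReal.ofReal (ε / 2)) (by simpa using hε)
  obtain ⟨R, hR, hφR⟩ := exists_norm_bound_of_hasCompactSupport hφc
  choose U hU hUφ using fun n : ℕ =>
    exists_CylFun_near hφm hφc (Nat.one_div_pos_of_nat (α := ℝ) (n := n))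
  have hlim : Tendsto (fun n => (cylEmbed ξ
      ⟨_, mul_mem_CylFun (cut_mem_CylFun hR) (hU n)⟩).1) atTop (𝓝 (hφL.toLp φ)) := by
    refine tendsto_cylEmbed_fst_of_le (R := 2 * R) (ε := fun n => 1 / ((n : ℝ) + 1)) (fun n => ?_)
      tendsto_one_div_add_atTop_nhds_zero_nat fun n => ?_
    · rw [div_le_one (by positivity)]
      linarith [(Nat.cast_nonneg n : (0 : ℝ) ≤ n)]
    · filter_upwards [hφL.coeFn_toLp] with g h1
      rw [h1]
      simp only [Pi.mul_apply]
      refine ⟨?_, fun hg => ?_⟩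
      · by_cases hg : ‖(g : L2I)‖ ≤ R
        · rw [radialCut_eq_one hR (by rw [abs_of_nonneg (by positivity)]; gcongr), one_mul, abs_sub_comm]
          exact (hUφ n g).le
        · have h2 := (hUφ n g).le
          rw [hφR g (not_le.1 hg), zero_sub, abs_neg] at h2
          rw [hφR g (not_le.1 hg), sub_zero, abs_mul, abs_of_nonneg (radialCut_nonneg _ _)]
          exact (mul_le_of_le_one_left (abs_nonneg _) (radialCut_le_one _ _)).trans h2
      · rw [hφR g (by linarith), radialCut_eq_zero hR, zero_mul, sub_zero]
        rw [abs_of_nonneg (by positivity)]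
        nlinarith
  obtain ⟨n, hn⟩ := ((Metric.tendsto_nhds.1 hlim) (ε / 2) (half_pos hε)).exists
  rw [dist_comm] at hn
  have h3 : dist f (hφL.toLp φ) ≤ ε / 2 := by
    rw [Lp.dist_def]
    refine ENNReal.toReal_le_of_le_ofReal (half_pos hε).le ?_
    refine (eLpNorm_congr_ae ?_).trans_le hφ
    filter_upwards [hφL.coeFn_toLp] with g h1
    simp [h1]
  refine ⟨_, mem_range_self _, (dist_triangle f (hφL.toLp φ) _).trans_lt
    ((add_lt_add_of_le_of_lt h3 hn).trans_eq (add_halves ε))⟩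

variable (ξ) in
/-- The closure of `D` as an unbounded operator. -/
def gradClosure : Lp ℝ 2 (Xi ξ) →ₗ.[ℝ] Lp L2I 2 (Xi ξ) := (cylGraph ξ).toLinearPMap

/-- Closability means that the closed graph contains no nonzero vertical vector, which is what makes
it the graph of an operator. -/
theorem gradClosure_graph : (gradClosure ξ).graph = cylGraph ξ :=
  Submodule.toLinearPMap_graph_eq _ fun x hx h => cylGraph_zero (Z := x.2) (by rw [← h]; exact hx)

theorem gradClosure_mem (u : (gradClosure ξ).domain) :
    ((u : Lp ℝ 2 (Xi ξ)), gradClosure ξ u) ∈ cylGraph ξ := by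
  rw [← gradClosure_graph]
  exact (gradClosure ξ).mem_graph u

theorem exists_gradClosure_eq {u : Lp ℝ 2 (Xi ξ)} {z : Lp L2I 2 (Xi ξ)} (h : (u, z) ∈ cylGraph ξ) :
    ∃ hu : u ∈ (gradClosure ξ).domain, gradClosure ξ ⟨u, hu⟩ = z := by
  rw [← gradClosure_graph, LinearPMap.mem_graph_iff] at h
  obtain ⟨y, rfl, hy⟩ := h
  exact ⟨y.2, hy⟩

variable (ξ) in
/-- The bilinear form `½ ∫ ⟨D u, D v⟩ dΞ`. -/
def gradForm : (gradClosure ξ).domain →ₗ[ℝ] (gradClosure ξ).domain →ₗ[ℝ] ℝ :=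
  ((1 / 2 : ℝ) • innerₗ (Lp L2I 2 (Xi ξ))).compl₁₂ (gradClosure ξ).toFun (gradClosure ξ).toFun

theorem gradForm_apply (u v : (gradClosure ξ).domain) :
    gradForm ξ u v = 1 / 2 * ⟪gradClosure ξ u, gradClosure ξ v⟫_ℝ := rfl

theorem gradForm_self (u : (gradClosure ξ).domain) :
    gradForm ξ u u = 1 / 2 * ‖gradClosure ξ u‖ ^ 2 := by
  rw [gradForm_apply, real_inner_self_eq_norm_sq]

theorem gradForm_sub_self (u v : (gradClosure ξ).domain) :
    gradForm ξ (u - v) (u - v) = 1 / 2 * ‖gradClosure ξ u - gradClosure ξ v‖ ^ 2 := by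
  rw [gradForm_self, LinearPMap.map_sub]

/-- A Cauchy sequence for `𝓔₁` is one for the pairs `(u, D u)`, and their limit lies in the closed
graph. -/
theorem exists_tendsto_gradForm (u : ℕ → (gradClosure ξ).domain)
    (hu : ∀ ε : ℝ, 0 < ε → ∃ N, ∀ i ≥ N, ∀ j ≥ N, gradForm ξ (u i - u j) (u i - u j)
      + ‖((u i - u j : (gradClosure ξ).domain) : Lp ℝ 2 (Xi ξ))‖ ^ 2 < ε) :
    ∃ w, Tendsto (fun i => gradForm ξ (u i - w) (u i - w)
      + ‖((u i - w : (gradClosure ξ).domain) : Lp ℝ 2 (Xi ξ))‖ ^ 2) atTop (𝓝 0) := by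
  have hlt : ∀ {a b ε : ℝ}, 0 < ε → 1 / 2 * a ^ 2 + b ^ 2 < 1 / 2 * ε ^ 2 →
      a < ε ∧ b < ε := fun {a b ε} hε h =>
    ⟨lt_of_pow_lt_pow_left₀ 2 hε.le (by linarith [sq_nonneg b]),
      lt_of_pow_lt_pow_left₀ 2 hε.le (by linarith [sq_nonneg a, sq_nonneg ε])⟩
  have h1 : CauchySeq fun i => (((u i : Lp ℝ 2 (Xi ξ)), gradClosure ξ (u i)) :
      Lp ℝ 2 (Xi ξ) × Lp L2I 2 (Xi ξ)) := by
    refine Metric.cauchySeq_iff.2 fun ε hε => ?_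
    obtain ⟨N, hN⟩ := hu (1 / 2 * ε ^ 2) (by positivity)
    refine ⟨N, fun i hi j hj => ?_⟩
    have h2 := hN i hi j hj
    rw [gradForm_sub_self] at h2
    have h3 := hlt hε h2
    rw [dist_eq_norm, Prod.mk_sub_mk, Prod.norm_mk]
    exact max_lt h3.2 h3.1
  obtain ⟨⟨w, z⟩, hw⟩ := cauchySeq_tendsto_of_complete h1
  obtain ⟨hwD, hwz⟩ := exists_gradClosure_eq
    (isClosed_cylGraph.mem_of_tendsto hw (Eventually.of_forall fun i => gradClosure_mem (u i)))
  refine ⟨⟨w, hwD⟩, ?_⟩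
  simp only [gradForm_sub_self, hwz]
  have h3 := tendsto_iff_norm_sub_tendsto_zero.1 ((continuous_fst.tendsto _).comp hw)
  have h4 := tendsto_iff_norm_sub_tendsto_zero.1 ((continuous_snd.tendsto _).comp hw)
  have h5 := ((h4.pow 2).const_mul (1 / 2)).add (h3.pow 2)
  rw [zero_pow two_ne_zero, mul_zero, add_zero] at h5
  exact h5

theorem gradForm_clip (u : (gradClosure ξ).domain) (v : Lp ℝ 2 (Xi ξ))
    (hv : ∀ᵐ x ∂(Xi ξ), v x = min (max ((u : Lp ℝ 2 (Xi ξ)) x) 0) 1) :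
    ∃ hv : v ∈ (gradClosure ξ).domain, gradForm ξ ⟨v, hv⟩ ⟨v, hv⟩ ≤ gradForm ξ u u := by
  obtain ⟨z, hz, hle⟩ := exists_clip_mem_cylGraph (gradClosure_mem u)
  have h1 : v = clipL2 (u : Lp ℝ 2 (Xi ξ)) := by
    refine Lp.ext ?_
    filter_upwards [hv, coeFn_clipL2 (u : Lp ℝ 2 (Xi ξ))] with g h2 h3
    rw [h2, h3]
  obtain ⟨hw, hz'⟩ := exists_gradClosure_eq hz
  subst h1
  refine ⟨hw, ?_⟩
  rw [gradForm_self, gradForm_self, hz']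
  gcongr

variable (ξ) in
theorem dense_domain_gradClosure : Dense ((gradClosure ξ).domain : Set (Lp ℝ 2 (Xi ξ))) := by
  refine (denseRange_cylEmbed_fst ξ).mono ?_
  rintro - ⟨U, rfl⟩
  exact (exists_gradClosure_eq (cylEmbed_mem_cylGraph U)).1

variable (ξ) in
/-- The Dirichlet form `𝓔(u, v) = ½ ∫ ⟨D u, D v⟩ dΞ`. -/
def cylForm : DirichletForm (Xi ξ) where
  domain := (gradClosure ξ).domain
  form := gradForm ξ
  dense' := dense_domain_gradClosure ξ
  symm' u v := by rw [gradForm_apply, gradForm_apply, real_inner_comm]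
  nonneg' u := by rw [gradForm_self]; positivity
  closed' := exists_tendsto_gradForm
  markov' := gradForm_clip

variable (ξ) in
/-- The closure of `D` as a linear map on the domain of the form. -/
def gradL2 : (cylForm ξ).domain →ₗ[ℝ] Lp L2I 2 (Xi ξ) := (gradClosure ξ).toFun

theorem cylForm_apply (u v : (cylForm ξ).domain) :
    (cylForm ξ).form u v = 1 / 2 * ⟪gradL2 ξ u, gradL2 ξ v⟫_ℝ := rfl

theorem gradL2_mem (u : (cylForm ξ).domain) :
    ((u : Lp ℝ 2 (Xi ξ)), gradL2 ξ u) ∈ cylGraph ξ := gradClosure_mem u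

theorem exists_gradL2_eq {u : Lp ℝ 2 (Xi ξ)} {z : Lp L2I 2 (Xi ξ)} (h : (u, z) ∈ cylGraph ξ) :
    ∃ hu : u ∈ (cylForm ξ).domain, gradL2 ξ ⟨u, hu⟩ = z := exists_gradClosure_eq h

theorem exists_domain_of_CylFun (U : CylFun ξ) : ∃ u : (cylForm ξ).domain,
    (u : Lp ℝ 2 (Xi ξ)) = (cylEmbed ξ U).1 ∧ gradL2 ξ u = (cylEmbed ξ U).2 := by
  obtain ⟨h1, h2⟩ := exists_gradL2_eq (cylEmbed_mem_cylGraph U)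
  exact ⟨⟨_, h1⟩, rfl, h2⟩

theorem gradL2_eq_of_ae {U : CylFun ξ} {u : (cylForm ξ).domain}
    (hu : (u : Lp ℝ 2 (Xi ξ)) =ᵐ[Xi ξ] fun g => (U : L2I → ℝ) g) :
    gradL2 ξ u = (cylEmbed ξ U).2 := by
  have h1 : (u : Lp ℝ 2 (Xi ξ)) = (cylEmbed ξ U).1 := Lp.ext (hu.trans (cylEmbed_fst U).symm)
  refine cylGraph_unique (gradL2_mem u) ?_
  rw [h1]
  exact cylEmbed_mem_cylGraph U

variable (ξ) in
theorem isClosureOfCylForm_cylForm : IsClosureOfCylForm ξ (cylForm ξ) where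
  mem_domain U hU := by
    obtain ⟨u, hu, -⟩ := exists_domain_of_CylFun (⟨U, hU⟩ : CylFun ξ)
    exact ⟨u, by rw [hu]; exact cylEmbed_fst _⟩
  form_eq U hU V hV u v hu hv := by
    refine ⟨?_, ?_⟩
    · refine (L2.integrable_inner (𝕜 := ℝ) ((memLp_gradD hU 2).toLp _)
        ((memLp_gradD hV 2).toLp _)).congr ?_
      filter_upwards [(memLp_gradD hU 2).coeFn_toLp, (memLp_gradD hV 2).coeFn_toLp] with g h1 h2
      rw [h1, h2]
    · rw [cylForm_apply, gradL2_eq_of_ae (U := ⟨U, hU⟩) hu,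
        gradL2_eq_of_ae (U := ⟨V, hV⟩) hv, L2.inner_def]
      congr 1
      refine integral_congr_ae ?_
      filter_upwards [cylEmbed_snd (⟨U, hU⟩ : CylFun ξ), cylEmbed_snd (⟨V, hV⟩ : CylFun ξ)] with g h1 h2
      rw [h1, h2]
  dense_core u ε hε := by
    -- The value of `𝓔₁` at the difference will be below `½ η² + η²`, hence below `2 η² ≤ ε`.
    obtain ⟨η, hη, hηε⟩ : ∃ η : ℝ, 0 < η ∧ 2 * η ^ 2 ≤ ε :=
      ⟨√(ε / 2), by positivity, by rw [Real.sq_sqrt (by positivity)]; linarith⟩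
    obtain ⟨U, h1, h2⟩ := exists_cylEmbed_near (gradL2_mem u) hη
    obtain ⟨v, hv, hv'⟩ := exists_domain_of_CylFun U
    refine ⟨U, U.2, v, by rw [hv]; exact cylEmbed_fst _, ?_⟩
    have h3 : gradL2 ξ (u - v) = gradL2 ξ u - gradL2 ξ v := map_sub _ u v
    rw [DirichletForm.form₁, cylForm_apply, h3, Submodule.coe_sub, real_inner_self_eq_norm_sq,
      real_inner_self_eq_norm_sq, hv, hv', norm_sub_rev, norm_sub_rev (u : Lp ℝ 2 (Xi ξ))]
    simp only at h1 h2
    have h4 := pow_lt_pow_left₀ h1 (norm_nonneg _) two_ne_zero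
    have h5 := pow_lt_pow_left₀ h2 (norm_nonneg _) two_ne_zero
    linarith [sq_nonneg η]

end CylForm
end

noncomputable section


/-! ## Conservativeness -/

/-! ### Radial weights and derivatives of radial cut-offs -/

section Radial

/-- A bounded radial weight of exponential growth on the ball of radius `R`. -/
def radialWeight (a R s : ℝ) : ℝ := Real.exp (2 * a * R * (1 - Real.exp (-(s / R ^ 2))))

theorem contDiff_radialWeight (a R : ℝ) :
    ContDiff ℝ ((⊤ : ℕ∞) : WithTop ℕ∞) (radialWeight a R) := by
  unfold radialWeight
  fun_prop

theorem radialWeight_pos (a R s : ℝ) : 0 < radialWeight a R s := Real.exp_pos _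

theorem radialWeight_le {a R : ℝ} (ha : 0 ≤ a) (hR : 0 ≤ R) (s : ℝ) :
    radialWeight a R s ≤ Real.exp (2 * a * R) := by
  refine Real.exp_le_exp.2 (mul_le_of_le_one_right (by positivity) ?_)
  linarith [Real.exp_pos (-(s / R ^ 2))]

/-- From `1 - exp (-x) ≤ x` the exponent is at most `2 a s / R`. The bound is independent of `R`:
the weights stay bounded on a fixed ball although they exceed `exp (a R)` from radius `R` on. -/
theorem radialWeight_le_of_le {a R r s : ℝ} (ha : 0 ≤ a) (hR : 1 ≤ R) (hs0 : 0 ≤ s)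
    (hs : s ≤ r ^ 2) : radialWeight a R s ≤ Real.exp (2 * a * r ^ 2) := by
  have hR0 : 0 < R := by linarith
  refine Real.exp_le_exp.2 ?_
  have h1 : 1 - Real.exp (-(s / R ^ 2)) ≤ s / R ^ 2 := by
    linarith [Real.add_one_le_exp (-(s / R ^ 2))]
  calc 2 * a * R * (1 - Real.exp (-(s / R ^ 2))) ≤ 2 * a * R * (s / R ^ 2) := by gcongr
    _ = 2 * a * (s / R) := by field_simp
    _ ≤ 2 * a * r ^ 2 := by
      gcongr
      exact (div_le_self hs0 hR).trans hs

theorem le_radialWeight {a R s : ℝ} (ha : 0 ≤ a) (hR : 0 < R) (hs : R ^ 2 ≤ s) :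
    Real.exp (a * R) ≤ radialWeight a R s := by
  refine Real.exp_le_exp.2 ?_
  have h1 : 1 ≤ s / R ^ 2 := (one_le_div (by positivity)).2 hs
  have h2 : Real.exp (-(s / R ^ 2)) ≤ 1 / 2 := by
    rw [Real.exp_neg, ← one_div]
    refine one_div_le_one_div_of_le two_pos ?_
    linarith [Real.add_one_le_exp (s / R ^ 2)]
  nlinarith [mul_nonneg ha hR.le]

/-- With `x = √s / R`, the logarithmic derivative times `√s` is `2 a x exp (-x²)`, and `x exp (-x²)
≤ 1 / 2` follows from `2 x ≤ 1 + x² ≤ exp (x²)`. -/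
theorem abs_deriv_radialWeight_mul_le {a R s : ℝ} (ha : 0 ≤ a) (hR : 0 < R) (hs : 0 ≤ s) :
    |deriv (radialWeight a R) s| * √s ≤ a * radialWeight a R s := by
  have h1 : HasDerivAt (radialWeight a R)
      (radialWeight a R s * (2 * a * R * (Real.exp (-(s / R ^ 2)) * (1 / R ^ 2)))) s := by
    have h2 : HasDerivAt (fun s : ℝ => -(s / R ^ 2)) (-(1 / R ^ 2)) s :=
      ((hasDerivAt_id s).div_const _).neg
    have h3 := ((h2.exp.const_sub 1).const_mul (2 * a * R)).exp
    exact (h3 : HasDerivAt (radialWeight a R) _ s).congr_deriv (by unfold radialWeight; ring)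
  have hW := radialWeight_pos a R s
  rw [h1.deriv, abs_of_nonneg (by positivity)]
  have h4 : Real.exp (-(s / R ^ 2)) * (√s / R) ≤ 1 / 2 := by
    have h5 := Real.add_one_le_exp (s / R ^ 2)
    have h6 : s / R ^ 2 = (√s / R) ^ 2 := by rw [div_pow, Real.sq_sqrt hs]
    rw [Real.exp_neg, inv_mul_le_iff₀ (Real.exp_pos _)]
    nlinarith [sq_nonneg (√s / R - 1)]
  calc radialWeight a R s * (2 * a * R * (Real.exp (-(s / R ^ 2)) * (1 / R ^ 2))) * √s
      = a * radialWeight a R s * (2 * (Real.exp (-(s / R ^ 2)) * (√s / R))) := by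
        field_simp
    _ ≤ a * radialWeight a R s * 1 := by gcongr; linarith
    _ = a * radialWeight a R s := mul_one _

/-- The cut-off is constant near `t²` unless `R ≤ t ≤ 2 R`. There its derivative is at most `L /
R²`, with `L` a bound for the derivative of `smoothCut`, and `t ≤ 2 R` gives `K = 4 L`. -/
theorem exists_deriv_radialCut_le : ∃ K : ℝ, ∀ R : ℝ, 0 < R → ∀ t : ℝ, 0 ≤ t →
    |2 * deriv (radialCut R) (t ^ 2)| * t ≤ (if R ≤ t ∧ t ≤ 2 * R then K / R else 0) := by
  obtain ⟨L, hL⟩ := ((smoothCut.contDiff (n := 1)).continuous_deriv_one).bounded_above_of_compact_support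
    smoothCut.hasCompactSupport.deriv
  refine ⟨4 * L, fun R hR t ht => ?_⟩
  split_ifs with h
  · have h1 : HasDerivAt (radialCut R) (deriv smoothCut (t ^ 2 / R ^ 2) * (1 / R ^ 2)) (t ^ 2) :=
      HasDerivAt.comp (t ^ 2)
        ((smoothCut.contDiff (n := 1)).differentiable one_ne_zero _).hasDerivAt
        ((hasDerivAt_id _).div_const _)
    rw [h1.deriv, abs_mul, abs_mul, abs_of_pos (show (0 : ℝ) < 1 / R ^ 2 by positivity), abs_two]
    have hL' := hL (t ^ 2 / R ^ 2)
    rw [Real.norm_eq_abs] at hL'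
    calc 2 * (|deriv smoothCut (t ^ 2 / R ^ 2)| * (1 / R ^ 2)) * t
        ≤ 2 * (L * (1 / R ^ 2)) * (2 * R) := by
          have := (abs_nonneg _).trans hL'
          gcongr
          exact h.2
      _ = 4 * L / R := by field_simp; ring
  · have h1 : deriv (radialCut R) (t ^ 2) = 0 := by
      rcases not_and_or.1 h with h2 | h2
      · have h3 : radialCut R =ᶠ[𝓝 (t ^ 2)] fun _ => 1 := by
          have h4 : |t ^ 2| < R ^ 2 := by
            rw [abs_of_nonneg (by positivity)]
            exact pow_lt_pow_left₀ (not_le.1 h2) ht two_ne_zero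
          filter_upwards [(isOpen_lt continuous_abs continuous_const).mem_nhds h4] with s hs
          exact radialCut_eq_one hR (le_of_lt hs)
        rw [h3.deriv_eq, deriv_const]
      · have h3 : radialCut R =ᶠ[𝓝 (t ^ 2)] fun _ => 0 := by
          have h4 : 2 * R ^ 2 < |t ^ 2| := by
            rw [abs_of_nonneg (by positivity)]
            nlinarith [not_le.1 h2]
          filter_upwards [(isOpen_lt continuous_const continuous_abs).mem_nhds h4] with s hs
          exact radialCut_eq_zero hR (le_of_lt hs)
        rw [h3.deriv_eq, deriv_const]
    rw [h1, mul_zero, abs_zero, zero_mul]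

end Radial

/-! ### Weighted energy estimates and absence of mass loss at infinity -/

section Weighted

variable {ξ : StieltjesFunction I} [FlatStieltjes ξ]

/-- The Leibniz rule for multiplication with a radial function. -/
theorem exists_radial_mul_mem_cylGraph {W : ℝ → ℝ} (hW : ContDiff ℝ ((⊤ : ℕ∞) : WithTop ℕ∞) W)
    {C C' : ℝ} (hC : ∀ s, 0 ≤ s → |W s| ≤ C) (hC' : ∀ s, 0 ≤ s → |deriv W s| * √s ≤ C')
    {u : Lp ℝ 2 (Xi ξ)} {z : Lp L2I 2 (Xi ξ)} (h : (u, z) ∈ cylGraph ξ) :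
    ∃ v y, (v, y) ∈ cylGraph ξ ∧ (∀ᵐ (g : ConeOf ξ) ∂(Xi ξ), v g = W (‖(g : L2I)‖ ^ 2) * u g) ∧
      ∀ᵐ (g : ConeOf ξ) ∂(Xi ξ), y g = W (‖(g : L2I)‖ ^ 2) • z g
        + (2 * deriv W (‖(g : L2I)‖ ^ 2) * u g) • (g : L2I) := by
  have hn : Continuous fun g : ConeOf ξ => ‖(g : L2I)‖ ^ 2 := by fun_prop
  have hWm : MemLp (fun g : ConeOf ξ => W (‖(g : L2I)‖ ^ 2)) ∞ (Xi ξ) :=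
    memLp_top_of_bound (hW.continuous.comp hn).aestronglyMeasurable C
      (Eventually.of_forall fun g => hC _ (sq_nonneg _))
  have hW'c : Continuous (deriv W) := hW.continuous_deriv (by simp)
  have hDm : MemLp (fun g : ConeOf ξ => (2 * deriv W (‖(g : L2I)‖ ^ 2)) • (g : L2I)) ∞ (Xi ξ) := by
    refine memLp_top_of_bound (C := 2 * C') (((continuous_const.mul (hW'c.comp hn)).smul
      continuous_subtype_val).aestronglyMeasurable) (Eventually.of_forall fun g => ?_)
    have h1 := hC' _ (sq_nonneg ‖(g : L2I)‖)
    rw [Real.sqrt_sq (norm_nonneg _)] at h1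
    rw [norm_smul, Real.norm_eq_abs, abs_mul, abs_two]
    linarith
  -- The three multiplications are bounded operators by Hölder's inequality with exponents `∞` and
  -- `2`, so closedness of the graph reduces the rule to cylinder functions.
  set T₁ := (ContinuousLinearMap.lsmul ℝ ℝ (E := ℝ)).holderL (Xi ξ) ∞ 2 2 (hWm.toLp _) with hT₁
  set T₂ := (ContinuousLinearMap.lsmul ℝ ℝ (E := L2I)).holderL (Xi ξ) ∞ 2 2 (hWm.toLp _) with hT₂
  set T₃ := ((ContinuousLinearMap.lsmul ℝ ℝ (E := L2I)).holderL (Xi ξ) 2 ∞ 2).flip (hDm.toLp _)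
    with hT₃
  have e₁ : ∀ u, ∀ᵐ (g : ConeOf ξ) ∂(Xi ξ), T₁ u g = W (‖(g : L2I)‖ ^ 2) * u g := by
    intro u
    filter_upwards [ContinuousLinearMap.coeFn_holder (r := 2) (ContinuousLinearMap.lsmul ℝ ℝ (E := ℝ))
      (hWm.toLp _) u, hWm.coeFn_toLp] with g h1 h2
    rw [hT₁, ContinuousLinearMap.holderL_apply_apply, h1, h2]
    rfl
  have e₂ : ∀ u z, ∀ᵐ (g : ConeOf ξ) ∂(Xi ξ), (T₂ z + T₃ u) g = W (‖(g : L2I)‖ ^ 2) • z g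
        + (2 * deriv W (‖(g : L2I)‖ ^ 2) * u g) • (g : L2I) := by
    intro u z
    filter_upwards [ContinuousLinearMap.coeFn_holder (r := 2) (ContinuousLinearMap.lsmul ℝ ℝ (E := L2I))
      (hWm.toLp _) z, hWm.coeFn_toLp, ContinuousLinearMap.coeFn_holder (r := 2)
      (ContinuousLinearMap.lsmul ℝ ℝ (E := L2I)) u (hDm.toLp _), hDm.coeFn_toLp,
      Lp.coeFn_add (T₂ z) (T₃ u)] with g h1 h2 h3 h4 h5
    rw [h5, Pi.add_apply, hT₂, hT₃, ContinuousLinearMap.flip_apply,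
      ContinuousLinearMap.holderL_apply_apply, ContinuousLinearMap.holderL_apply_apply, h1, h2, h3, h4]
    simp only [ContinuousLinearMap.lsmul_apply, smul_smul]
    rw [mul_comm (u g)]
  refine ⟨T₁ u, T₂ z + T₃ u, ?_, e₁ u, e₂ u z⟩
  obtain ⟨U, hU1, hU2⟩ := exists_seq_cylEmbed h
  have hlim : Tendsto (fun n => (T₁ (cylEmbed ξ (U n)).1,
      T₂ (cylEmbed ξ (U n)).2 + T₃ (cylEmbed ξ (U n)).1)) atTop (𝓝 (T₁ u, T₂ z + T₃ u)) :=
    ((T₁.continuous.tendsto u).comp hU1).prodMk_nhds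
      (((T₂.continuous.tendsto z).comp hU2).add ((T₃.continuous.tendsto u).comp hU1))
  refine isClosed_cylGraph.mem_of_tendsto hlim (Eventually.of_forall fun n => ?_)
  have hV := radial_mul_mem_CylFun hW (U n).2
  suffices hVe : (T₁ (cylEmbed ξ (U n)).1, T₂ (cylEmbed ξ (U n)).2 + T₃ (cylEmbed ξ (U n)).1)
      = cylEmbed ξ ⟨_, hV⟩ by
    have h1 := cylEmbed_mem_cylGraph (⟨_, hV⟩ : CylFun ξ)
    rwa [← hVe] at h1
  refine Prod.ext (Lp.ext ?_) (Lp.ext ?_)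
  · filter_upwards [e₁ (cylEmbed ξ (U n)).1, cylEmbed_fst (U n),
      cylEmbed_fst (⟨_, hV⟩ : CylFun ξ)] with g h1 h2 h3
    rw [h1, h2, h3]
  · filter_upwards [e₂ (cylEmbed ξ (U n)).1 (cylEmbed ξ (U n)).2, cylEmbed_fst (U n),
      cylEmbed_snd (U n), cylEmbed_snd (⟨_, hV⟩ : CylFun ξ)] with g h1 h2 h3 h4
    rw [h1, h2, h3, h4]
    exact (gradD_radial_mul (hW.differentiable (by simp) _).hasDerivAt
      (differentiable_CylFun (U n).2 g)).symm

theorem integrable_radial_mul {W : ℝ → ℝ} (hW : Continuous W) {C : ℝ}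
    (hC : ∀ s, 0 ≤ s → |W s| ≤ C) {f : ConeOf ξ → ℝ} (hf : Integrable f (Xi ξ)) :
    Integrable (fun g : ConeOf ξ => W (‖(g : L2I)‖ ^ 2) * f g) (Xi ξ) := by
  have hn : Continuous fun g : ConeOf ξ => ‖(g : L2I)‖ ^ 2 := by fun_prop
  exact hf.bdd_mul (c := C) (hW.comp hn).aestronglyMeasurable
    (Eventually.of_forall fun g => hC _ (sq_nonneg _))

/-- A weighted energy estimate for the resolvent. -/
theorem integral_weight_mul_norm_sq_le {W : ℝ → ℝ} (hW : ContDiff ℝ ((⊤ : ℕ∞) : WithTop ℕ∞) W)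
    {C a : ℝ} (ha : 0 ≤ a) (hW0 : ∀ s, 0 ≤ s → 0 ≤ W s) (hC : ∀ s, 0 ≤ s → W s ≤ C)
    (hW' : ∀ s, 0 ≤ s → |deriv W s| * √s ≤ a * W s) {α : Ioi (0 : ℝ)} (hα : a ^ 2 + 1 ≤ (α : ℝ))
    (f : Lp ℝ 2 (Xi ξ)) :
    ∫ g : ConeOf ξ, W (‖(g : L2I)‖ ^ 2) * ‖gradL2 ξ ((cylForm ξ).resolventDom α f) g‖ ^ 2 ∂(Xi ξ)
      ≤ 2 * ∫ g : ConeOf ξ, W (‖(g : L2I)‖ ^ 2) * f g ^ 2 ∂(Xi ξ) := by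
  set u := (cylForm ξ).resolventDom α f with hu
  set z := gradL2 ξ u with hz
  have hCa : ∀ s, 0 ≤ s → |W s| ≤ C := fun s hs => by
    rw [abs_of_nonneg (hW0 s hs)]
    exact hC s hs
  -- The resolvent equation will be tested with `v = W u`.
  obtain ⟨v, y, hvy, hv, hy⟩ := exists_radial_mul_mem_cylGraph hW (C' := a * C) hCa
    (fun s hs => (hW' s hs).trans (mul_le_mul_of_nonneg_left (hC s hs) ha)) (gradL2_mem u)
  obtain ⟨hvD, hvz⟩ := exists_gradL2_eq hvy
  have heq := DirichletForm.formα_resolventDom α f (⟨v, hvD⟩ : (cylForm ξ).domain)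
  have hzy : Integrable (fun g => ⟪z g, y g⟫_ℝ) (Xi ξ) := L2.integrable_inner (𝕜 := ℝ) z y
  have huv := Lp_two_integrable_mul (u : Lp ℝ 2 (Xi ξ)) v
  have hfv := Lp_two_integrable_mul f v
  rw [← hu, DirichletForm.formα, cylForm_apply, hvz, ← hz, L2.inner_def, Lp_two_inner_eq,
    Lp_two_inner_eq] at heq
  have hz2 : Integrable (fun g : ConeOf ξ => W (‖(g : L2I)‖ ^ 2) * ‖z g‖ ^ 2) (Xi ξ) :=
    integrable_radial_mul hW.continuous hCa ((memLp_two_iff_integrable_sq_norm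
      (Lp.aestronglyMeasurable z)).1 (Lp.memLp z))
  have hf2 : Integrable (fun g : ConeOf ξ => W (‖(g : L2I)‖ ^ 2) * f g ^ 2) (Xi ξ) :=
    integrable_radial_mul hW.continuous hCa ((memLp_two_iff_integrable_sq
      (Lp.aestronglyMeasurable f)).1 (Lp.memLp f))
  have hsum : Integrable (fun g => 1 / 2 * ⟪z g, y g⟫_ℝ + α * ((u : Lp ℝ 2 (Xi ξ)) g * v g)) (Xi ξ) :=
    (hzy.const_mul _).add (huv.const_mul _)
  have hle : ∫ g : ConeOf ξ, (1 / 4 * (W (‖(g : L2I)‖ ^ 2) * ‖z g‖ ^ 2)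
      - 1 / 2 * (W (‖(g : L2I)‖ ^ 2) * f g ^ 2)) ∂(Xi ξ)
      ≤ ∫ g, (1 / 2 * ⟪z g, y g⟫_ℝ + α * ((u : Lp ℝ 2 (Xi ξ)) g * v g) - f g * v g) ∂(Xi ξ) := by
    refine integral_mono_ae ((hz2.const_mul _).sub (hf2.const_mul _)) (hsum.sub hfv) ?_
    filter_upwards [hv, hy] with g h1 h2
    have h3 := hW0 _ (sq_nonneg ‖(g : L2I)‖)
    have h4 := hW' _ (sq_nonneg ‖(g : L2I)‖)
    rw [Real.sqrt_sq (norm_nonneg _)] at h4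
    rw [h1, h2, inner_add_right, inner_smul_right, inner_smul_right, real_inner_self_eq_norm_sq]
    set w := W (‖(g : L2I)‖ ^ 2)
    set w' := deriv W (‖(g : L2I)‖ ^ 2)
    set ug := (u : Lp ℝ 2 (Xi ξ)) g
    -- Young's inequality absorbs the derivative of the weight: it costs a quarter of `w ‖z‖²`, and
    -- the remaining `a² w u²` is covered by `α ≥ a² + 1`.
    have h5 : |w' * ug * ⟪z g, (g : L2I)⟫_ℝ| ≤ w * (1 / 4 * ‖z g‖ ^ 2 + a ^ 2 * ug ^ 2) := by
      calc |w' * ug * ⟪z g, (g : L2I)⟫_ℝ| = |w'| * |ug| * |⟪z g, (g : L2I)⟫_ℝ| := by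
            rw [abs_mul, abs_mul]
        _ ≤ |w'| * |ug| * (‖z g‖ * ‖(g : L2I)‖) := by
            gcongr
            exact abs_real_inner_le_norm _ _
        _ = (|w'| * ‖(g : L2I)‖) * (|ug| * ‖z g‖) := by ring
        _ ≤ (a * w) * (|ug| * ‖z g‖) := by gcongr
        _ = w * (a * |ug| * ‖z g‖) := by ring
        _ ≤ w * (1 / 4 * ‖z g‖ ^ 2 + a ^ 2 * ug ^ 2) := by
            gcongr
            rw [← sq_abs ug]
            nlinarith [sq_nonneg (1 / 2 * ‖z g‖ - a * |ug|)]
    have h6 := (abs_le.1 h5).1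
    have h7 : 0 ≤ w * (ug - f g) ^ 2 := by positivity
    have h8 : 0 ≤ w * ug ^ 2 * (α - (a ^ 2 + 1)) := mul_nonneg (by positivity) (by linarith)
    have h9 : 0 ≤ w * ug ^ 2 := by positivity
    linear_combination h6 + 1 / 2 * h7 + h8 + 1 / 2 * h9
  rw [integral_sub (hz2.const_mul _) (hf2.const_mul _), integral_const_mul, integral_const_mul,
    integral_sub hsum hfv, integral_add (hzy.const_mul _) (huv.const_mul _), integral_const_mul,
    integral_const_mul] at hle
  linarith

theorem gradD_radial {W : ℝ → ℝ} {g : L2I} (hW : DifferentiableAt ℝ W (‖g‖ ^ 2)) :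
    gradD (fun v => W (‖v‖ ^ 2)) g = (2 * deriv W (‖g‖ ^ 2)) • g := by
  have h1 := gradD_radial_mul (U := fun _ => 1) hW.hasDerivAt (differentiableAt_const (1 : ℝ))
  simp only [mul_one] at h1
  have h2 : gradD (fun _ : L2I => (1 : ℝ)) g = 0 := by
    rw [gradD, gradient_fun_const]
    exact (prCLM g).map_zero
  rw [h1, h2, smul_zero, zero_add]

variable (ξ) in
/-- The cut-off function `radialCut R` as an element of the domain. -/
theorem exists_cut_mem_domain {R : ℝ} (hR : 0 < R) : ∃ ψ : (cylForm ξ).domain,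
    (∀ᵐ (g : ConeOf ξ) ∂(Xi ξ), (ψ : Lp ℝ 2 (Xi ξ)) g = radialCut R (‖(g : L2I)‖ ^ 2)) ∧
    ∀ᵐ (g : ConeOf ξ) ∂(Xi ξ), gradL2 ξ ψ g = (2 * deriv (radialCut R) (‖(g : L2I)‖ ^ 2)) • (g : L2I) := by
  obtain ⟨ψ, h1, h2⟩ := exists_domain_of_CylFun (⟨_, cut_mem_CylFun hR⟩ : CylFun ξ)
  refine ⟨ψ, by rw [h1]; exact cylEmbed_fst _, ?_⟩
  filter_upwards [cylEmbed_snd (⟨_, cut_mem_CylFun hR⟩ : CylFun ξ)] with g h3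
  rw [h2, h3]
  exact gradD_radial ((contDiff_radialCut R).differentiable (by simp) _)

/-- The energy between the resolvent of a function supported in a ball and the cut-off functions
decays exponentially. -/
theorem exists_form_cut_le {c : ℝ} (hc : 0 < c) (hcΞ : ∀ r : ℝ, 0 ≤ r →
      Xi ξ {g | ‖(g : L2I)‖ ≤ r} ≤ ENNReal.ofReal (Real.exp (c * r))) {α : Ioi (0 : ℝ)}
    (hα : (4 * c) ^ 2 + 1 ≤ (α : ℝ)) (f : Lp ℝ 2 (Xi ξ)) {r : ℝ}
    (hf : ∀ᵐ (g : ConeOf ξ) ∂(Xi ξ), r < ‖(g : L2I)‖ → f g = 0) :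
    ∃ B : ℝ, ∀ R : ℝ, 1 ≤ R → ∀ ψ : (cylForm ξ).domain,
      (∀ᵐ (g : ConeOf ξ) ∂(Xi ξ), gradL2 ξ ψ g
        = (2 * deriv (radialCut R) (‖(g : L2I)‖ ^ 2)) • (g : L2I)) →
      |(cylForm ξ).form ((cylForm ξ).resolventDom α f) ψ| ≤ B * Real.exp (-(c * R)) := by
  obtain ⟨K, hK⟩ := exists_deriv_radialCut_le
  -- `F` bounds the weighted energy uniformly in `R ≥ 1`, because the weight is at most `exp (8 c
  -- r²)` where `f` lives.
  set F := 2 * (Real.exp (2 * (4 * c) * r ^ 2) * ‖f‖ ^ 2) with hF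
  refine ⟨1 / 4 * F + 1 / 4 * K ^ 2, fun R hR ψ hψ => ?_⟩
  have hR0 : 0 < R := by linarith
  have ha : 0 ≤ 4 * c := by positivity
  set u := (cylForm ξ).resolventDom α f with hu
  set z := gradL2 ξ u with hz
  set W := radialWeight (4 * c) R with hW
  have hWc : Continuous W := (contDiff_radialWeight _ _).continuous
  have hWb : ∀ s, 0 ≤ s → |W s| ≤ Real.exp (2 * (4 * c) * R) := fun s _ => by
    rw [abs_of_pos (radialWeight_pos _ _ _)]
    exact radialWeight_le ha hR0.le s
  have hz2 : Integrable (fun g : ConeOf ξ => W (‖(g : L2I)‖ ^ 2) * ‖z g‖ ^ 2) (Xi ξ) :=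
    integrable_radial_mul hWc hWb ((memLp_two_iff_integrable_sq_norm
      (Lp.aestronglyMeasurable z)).1 (Lp.memLp z))
  have hff : Integrable (fun g => f g ^ 2) (Xi ξ) :=
    (memLp_two_iff_integrable_sq (Lp.aestronglyMeasurable f)).1 (Lp.memLp f)
  have hA : ∫ g : ConeOf ξ, W (‖(g : L2I)‖ ^ 2) * ‖z g‖ ^ 2 ∂(Xi ξ) ≤ F := by
    refine (integral_weight_mul_norm_sq_le (contDiff_radialWeight _ _) ha
      (fun s _ => (radialWeight_pos _ _ s).le) (fun s _ => radialWeight_le ha hR0.le s)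
      (fun s hs => abs_deriv_radialWeight_mul_le ha hR0 hs) hα f).trans ?_
    rw [hF, Lp_two_norm_sq_eq, ← integral_const_mul (Real.exp _)]
    refine mul_le_mul_of_nonneg_left ?_ two_pos.le
    refine integral_mono_ae (integrable_radial_mul hWc hWb hff) (hff.const_mul _) ?_
    filter_upwards [hf] with g hg
    rcases lt_or_ge r ‖(g : L2I)‖ with h | h
    · rw [hg h]
      simp
    · exact mul_le_mul_of_nonneg_right (radialWeight_le_of_le ha hR (sq_nonneg _)
        (pow_le_pow_left₀ (norm_nonneg _) h 2)) (sq_nonneg _)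
  have hS := isCompact_setOf_norm_le ξ (2 * R)
  set S : Set (ConeOf ξ) := {g | ‖(g : L2I)‖ ≤ 2 * R} with hSdef
  have hSi : Integrable (S.indicator fun _ => (1 : ℝ)) (Xi ξ) :=
    (integrable_indicator_iff hS.measurableSet).2 (integrableOn_const hS.measure_lt_top.ne)
  have hSv : ∫ g, S.indicator (fun _ => (1 : ℝ)) g ∂(Xi ξ) ≤ Real.exp (c * (2 * R)) := by
    refine (integral_indicator_one hS.measurableSet).trans_le ?_
    exact ENNReal.toReal_le_of_le_ofReal (Real.exp_pos _).le (hcΞ _ (by positivity))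
  -- On `R ≤ ‖g‖ ≤ 2 R` the weight is at least `exp (4 c R)`. Young's inequality with the factor
  -- `exp (3 c R)` leaves `exp (-c R)` times the weighted energy, and `exp (-3 c R)` times the
  -- measure of the ball of radius `2 R`, which is at most `exp (2 c R)`. Both parts decay like `exp
  -- (-c R)`.
  have hpt : ∀ᵐ (g : ConeOf ξ) ∂(Xi ξ), ‖⟪z g, gradL2 ξ ψ g⟫_ℝ‖ ≤
      1 / 2 * Real.exp (-(c * R)) * (W (‖(g : L2I)‖ ^ 2) * ‖z g‖ ^ 2)
        + 1 / 2 * (Real.exp (-(3 * c * R)) * K ^ 2) * S.indicator (fun _ => (1 : ℝ)) g := by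
    filter_upwards [hψ] with g hg
    have h1 := hK R hR0 ‖(g : L2I)‖ (norm_nonneg _)
    have h2 : ‖⟪z g, gradL2 ξ ψ g⟫_ℝ‖
        ≤ ‖z g‖ * (|2 * deriv (radialCut R) (‖(g : L2I)‖ ^ 2)| * ‖(g : L2I)‖) := by
      refine (norm_inner_le_norm _ _).trans_eq ?_
      rw [hg, norm_smul, Real.norm_eq_abs]
    have h3 : 0 ≤ W (‖(g : L2I)‖ ^ 2) := (radialWeight_pos _ _ _).le
    have h4 : 0 ≤ S.indicator (fun _ => (1 : ℝ)) g := indicator_nonneg (fun _ _ => zero_le_one) _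
    split_ifs at h1 with h
    · have h5 : Real.exp (4 * c * R) ≤ W (‖(g : L2I)‖ ^ 2) :=
        le_radialWeight ha hR0 (pow_le_pow_left₀ hR0.le h.1 2)
      rw [indicator_of_mem (show g ∈ S from h.2)]
      have hK0 : 0 ≤ K / R := le_trans (by positivity) h1
      have h6 : K / R ≤ K := div_le_self (by
        rw [le_div_iff₀ hR0, zero_mul] at hK0; exact hK0) hR
      have h7 : ‖⟪z g, gradL2 ξ ψ g⟫_ℝ‖ ≤ ‖z g‖ * K :=
        h2.trans (mul_le_mul_of_nonneg_left (h1.trans h6) (norm_nonneg _))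
      have h8 : Real.exp (-(c * R)) * Real.exp (4 * c * R) = Real.exp (3 * c * R) := by
        rw [← Real.exp_add]; ring_nf
      have h9 : Real.exp (3 * c * R) * ‖z g‖ ^ 2
          ≤ Real.exp (-(c * R)) * (W (‖(g : L2I)‖ ^ 2) * ‖z g‖ ^ 2) := by
        rw [← h8, mul_assoc]
        gcongr
      have h10 : Real.exp (-(3 * c * R)) * Real.exp (3 * c * R) = 1 := by
        rw [← Real.exp_add]; simp
      set x := Real.exp (-(3 * c * R)) with hx
      set y := Real.exp (3 * c * R) with hy
      have hy0 : 0 < y := Real.exp_pos _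
      have h11 : ‖z g‖ * K ≤ 1 / 2 * (y * ‖z g‖ ^ 2) + 1 / 2 * (x * K ^ 2) := by
        have h12 : 0 ≤ x * (y * ‖z g‖ - K) ^ 2 := mul_nonneg (Real.exp_pos _).le (sq_nonneg _)
        have h13 : x * (y * ‖z g‖ - K) ^ 2
            = x * y * (y * ‖z g‖ ^ 2) - 2 * (x * y) * (‖z g‖ * K) + x * K ^ 2 := by ring
        rw [h10] at h13
        linarith
      linarith
    · have h5 : ‖⟪z g, gradL2 ξ ψ g⟫_ℝ‖ ≤ 0 :=
        h2.trans (mul_nonpos_of_nonneg_of_nonpos (norm_nonneg _) h1)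
      exact h5.trans (by positivity)
  rw [cylForm_apply, L2.inner_def, abs_mul, abs_of_pos (show (0 : ℝ) < 1 / 2 by norm_num)]
  have hI := norm_integral_le_of_norm_le ((hz2.const_mul _).add (hSi.const_mul _)) hpt
  rw [integral_add' (hz2.const_mul _) (hSi.const_mul _), integral_const_mul, integral_const_mul,
    Real.norm_eq_abs] at hI
  have h14 : Real.exp (-(3 * c * R)) * Real.exp (c * (2 * R)) = Real.exp (-(c * R)) := by
    rw [← Real.exp_add]; ring_nf
  have h15 : 1 / 2 * Real.exp (-(c * R)) * ∫ g : ConeOf ξ, W (‖(g : L2I)‖ ^ 2) * ‖z g‖ ^ 2 ∂(Xi ξ)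
      ≤ 1 / 2 * Real.exp (-(c * R)) * F := by gcongr
  have h16 : 1 / 2 * (Real.exp (-(3 * c * R)) * K ^ 2) * ∫ g, S.indicator (fun _ => (1 : ℝ)) g ∂(Xi ξ)
      ≤ 1 / 2 * (Real.exp (-(3 * c * R)) * K ^ 2) * Real.exp (c * (2 * R)) := by gcongr
  have h17 : 1 / 2 * (Real.exp (-(3 * c * R)) * K ^ 2) * Real.exp (c * (2 * R))
      = 1 / 2 * K ^ 2 * Real.exp (-(c * R)) := by
    rw [← h14]; ring
  linarith

variable (ξ) in
-- For `φ` the indicator of a ball, testing the resolvent equation with growing cut-offs `ψ n` gives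
-- `α ⟪G_α φ, ψ n⟫ = ∫ φ - 𝓔(G_α φ, ψ n)` for large `n`. The energy term decays exponentially, so `α
-- G_α` preserves the mass of `φ`.
theorem cylForm_semigroup_tendsto_one (t : ℝ≥0) (f : ℕ → Lp ℝ 2 (Xi ξ))
    (hf : ∀ᵐ x ∂(Xi ξ), 0 ≤ f 0 x ∧ Monotone (fun n => f n x) ∧
      Tendsto (fun n => f n x) atTop (𝓝 1)) :
    ∀ᵐ x ∂(Xi ξ), Tendsto (fun n => (cylForm ξ).semigroup t (f n) x) atTop (𝓝 1) := by
  obtain ⟨c, hc, hcΞ⟩ := exists_Xi_ball_le ξ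
  have hB : ∀ j : ℕ, IsCompact {g : ConeOf ξ | ‖(g : L2I)‖ ≤ j} := fun j => isCompact_setOf_norm_le ξ j
  set φ : ℕ → Lp ℝ 2 (Xi ξ) := fun j =>
    indicatorConstLp 2 (hB j).measurableSet (hB j).measure_lt_top.ne (1 : ℝ) with hφ
  have hφe : ∀ j, ∀ᵐ (g : ConeOf ξ) ∂(Xi ξ), φ j g
      = {g : ConeOf ξ | ‖(g : L2I)‖ ≤ j}.indicator (fun _ => (1 : ℝ)) g := fun j =>
    indicatorConstLp_coeFn
  choose ψ hψ hψ' using fun n : ℕ =>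
    exists_cut_mem_domain ξ (show (0 : ℝ) < (n : ℝ) + 1 by positivity)
  refine DirichletForm.semigroup_tendsto_one
    (⟨(4 * c) ^ 2 + 1, mem_Ioi.2 (by positivity)⟩ : Ioi (0 : ℝ)) φ (fun j => ?_) (fun j => ?_) ?_
    (fun n => ψ n) (fun n => ?_) (fun j => ?_) t f hf
  · filter_upwards [hφe j] with g hg
    rw [hg]
    exact ⟨indicator_nonneg (fun _ _ => zero_le_one) _, indicator_le_self' (fun _ _ => zero_le_one) _⟩
  · exact ((integrable_indicator_iff (hB j).measurableSet).2
      (integrableOn_const (hB j).measure_lt_top.ne)).congr ((hφe j).mono fun _ h => h.symm)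
  · filter_upwards [ae_all_iff.2 hφe] with g hg
    obtain ⟨j, hj⟩ := exists_nat_ge ‖(g : L2I)‖
    refine ⟨j, ?_⟩
    rw [hg j, indicator_of_mem (by exact hj)]
    exact one_pos
  · filter_upwards [hψ n] with g hg
    rw [hg]
    exact ⟨radialCut_nonneg _ _, radialCut_le_one _ _⟩
  · set α : Ioi (0 : ℝ) := ⟨(4 * c) ^ 2 + 1, mem_Ioi.2 (by positivity)⟩ with hα
    have hsupp : ∀ᵐ (g : ConeOf ξ) ∂(Xi ξ), (j : ℝ) < ‖(g : L2I)‖ → φ j g = 0 := by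
      filter_upwards [hφe j] with g hg hj
      rw [hg, indicator_of_notMem (by simpa using hj)]
    obtain ⟨B, hBd⟩ := exists_form_cut_le (α := α) hc hcΞ le_rfl (φ j) hsupp
    have hform : Tendsto (fun n => (cylForm ξ).form ((cylForm ξ).resolventDom α (φ j)) (ψ n))
        atTop (𝓝 0) := by
      refine squeeze_zero_norm (fun n => hBd _ ?_ _ (hψ' n)) ?_
      · linarith [(Nat.cast_nonneg n : (0 : ℝ) ≤ n)]
      · have h1 : Tendsto (fun n : ℕ => c * ((n : ℝ) + 1)) atTop atTop :=
          (tendsto_natCast_atTop_atTop.atTop_add tendsto_const_nhds).const_mul_atTop hc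
        have h2 := (Real.tendsto_exp_neg_atTop_nhds_zero.comp h1).const_mul B
        rw [mul_zero] at h2
        exact h2
    have hφψ : ∀ᶠ n in atTop, ⟪φ j, (ψ n : Lp ℝ 2 (Xi ξ))⟫_ℝ = ∫ g, φ j g ∂(Xi ξ) := by
      filter_upwards [eventually_ge_atTop j] with n hn
      rw [Lp_two_inner_eq]
      refine integral_congr_ae ?_
      filter_upwards [hψ n, hsupp] with g h1 h2
      rw [h1]
      rcases lt_or_ge (j : ℝ) ‖(g : L2I)‖ with h | h
      · rw [h2 h, zero_mul]
      · have hn' : (j : ℝ) ≤ n := Nat.cast_le.2 hn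
        rw [radialCut_eq_one (by positivity), mul_one]
        rw [abs_of_nonneg (sq_nonneg _)]
        exact pow_le_pow_left₀ (norm_nonneg _) (by linarith) 2
    have h3 := (tendsto_const_nhds (x := ∫ g, φ j g ∂(Xi ξ))).sub hform
    rw [sub_zero] at h3
    refine h3.congr' ?_
    filter_upwards [hφψ] with n hn
    have h4 := DirichletForm.formα_resolventDom α (φ j) (ψ n)
    rw [DirichletForm.formα, hn, DirichletForm.coe_resolventDom] at h4
    rw [real_inner_smul_left]
    linarith

end Weighted
end

noncomputable section


/-! ## The main theorem -/

section Main

variable (ξ : StieltjesFunction I) [FlatStieltjes ξ]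

instance isSeparable_Xi : MeasureTheory.IsSeparable (Xi ξ) := isSeparable_of_sigmaFinite (Xi ξ)

/-- The map `u ↦ (u, D u)` is bi-Lipschitz into a product of separable `L²` spaces. Separability is
what allows countably many nests to be intersected. -/
instance separableSpace_energySpace :
    TopologicalSpace.SeparableSpace ((cylForm ξ).EnergySpace DirichletForm.posOne) := by
  set T : (cylForm ξ).EnergySpace DirichletForm.posOne → Lp ℝ 2 (Xi ξ) × Lp L2I 2 (Xi ξ) :=
    fun u => (((cylForm ξ).ofEnergy DirichletForm.posOne u : Lp ℝ 2 (Xi ξ)),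
      gradL2 ξ ((cylForm ξ).ofEnergy DirichletForm.posOne u)) with hT
  have hns : ∀ u, ‖u‖ ^ 2 = 1 / 2 * ‖(T u).2‖ ^ 2 + ‖(T u).1‖ ^ 2 := by
    intro u
    rw [DirichletForm.energy_norm_sq, cylForm_apply, real_inner_self_eq_norm_sq]
    simp [hT, DirichletForm.posOne]
  have hsub : ∀ u v, T u - T v = T (u - v) := by
    intro u v
    simp only [hT, map_sub, Submodule.coe_sub, Prod.mk_sub_mk]
  have h1 : AntilipschitzWith 2 T := by
    refine AntilipschitzWith.of_le_mul_dist fun u v => ?_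
    rw [dist_eq_norm, dist_eq_norm, hsub]
    have h2 := hns (u - v)
    have h3 : ‖(T (u - v)).1‖ ≤ ‖T (u - v)‖ := norm_fst_le _
    have h4 : ‖(T (u - v)).2‖ ≤ ‖T (u - v)‖ := norm_snd_le _
    refine abs_le_of_sq_le_sq' ?_ (by positivity) |>.2
    rw [h2]
    have h5 := pow_le_pow_left₀ (norm_nonneg _) h3 2
    have h6 := pow_le_pow_left₀ (norm_nonneg _) h4 2
    rw [NNReal.coe_ofNat, mul_pow]
    linarith [sq_nonneg ‖T (u - v)‖]
  have h2 : LipschitzWith 2 T := by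
    refine LipschitzWith.of_dist_le_mul fun u v => ?_
    rw [dist_eq_norm, dist_eq_norm, hsub, Prod.norm_def]
    have h2 := hns (u - v)
    refine max_le ?_ ?_ <;>
    · refine abs_le_of_sq_le_sq' ?_ (by positivity) |>.2
      rw [NNReal.coe_ofNat, mul_pow, h2]
      linarith [sq_nonneg ‖(T (u - v)).1‖, sq_nonneg ‖(T (u - v)).2‖]
  have h3 := (h1.isUniformInducing h2.uniformContinuous).isInducing
  have := h3.secondCountableTopology
  infer_instance

theorem isRegular_cylForm : (cylForm ξ).IsRegular where
  finite_compact := inferInstance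
  full_support := inferInstance
  dense_domain u ε hε := by
    obtain ⟨U, hU, v, hv, hlt⟩ := (isClosureOfCylForm_cylForm ξ).dense_core u ε hε
    exact ⟨v, _, continuous_CylFun hU, hasCompactSupport_CylFun hU, hv, hlt⟩
  dense_uniform f hf hc ε hε := by
    obtain ⟨U, hU, hfU⟩ := exists_CylFun_near hf hc hε
    obtain ⟨v, hv⟩ := (isClosureOfCylForm_cylForm ξ).mem_domain U hU
    exact ⟨v, _, continuous_CylFun hU, hasCompactSupport_CylFun hU, hv, hfU⟩

theorem isStrictlyQuasiRegular_cylForm : (cylForm ξ).IsStrictlyQuasiRegular := by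
  set e : ℕ ≃ ℕ × Option ℕ := (Denumerable.eqv (ℕ × Option ℕ)).symm with he
  choose u hu using fun n => (isClosureOfCylForm_cylForm ξ).mem_domain _ (sepFun_mem (ξ := ξ) (e n))
  refine DirichletForm.isStrictlyQuasiRegular_of_separating (isRegular_cylForm ξ) u
    (fun n g => sepFun ξ (e n) g) (fun n => continuous_CylFun (sepFun_mem _))
    (fun n => hasCompactSupport_CylFun (sepFun_mem _)) hu (fun g => ?_) (fun g g' hne => ?_)
  · obtain ⟨n, hn⟩ := exists_sepFun_ne_zero g
    exact ⟨e.symm n, by rwa [e.apply_symm_apply]⟩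
  · obtain ⟨n, hn⟩ := exists_sepFun_ne hne
    exact ⟨e.symm n, by rwa [e.apply_symm_apply]⟩

end Main
theorem mainTheorem5 (ξ : StieltjesFunction unitInterval) (δ : ℝ) (hδ : 0 < δ)
    (hδ' : δ < 1 / 2)
    (hξ0 : ∀ u : unitInterval, (u : ℝ) < δ → ξ u = ξ 0)
    (hξ1 : ∀ u : unitInterval, 1 - δ < (u : ℝ) → ξ u = ξ 1) :
    LocallyCompactSpace (ConeOf ξ) ∧
    ∃ 𝓔 : DirichletForm (Xi ξ), IsClosureOfCylForm ξ 𝓔 ∧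
      𝓔.IsRegular ∧ 𝓔.IsStrictlyQuasiRegular ∧ 𝓔.IsConservative ∧
      ∀ (Ω : Type*) [MeasurableSpace Ω] (M : MarkovProcess (ConeOf ξ) Ω),
        M.IsProperlyAssociated 𝓔 →
        𝓔.QuasiEverywhere fun g => M.P (g : OnePoint (ConeOf ξ)) {ω | M.lifetime ω < ⊤} = 0 := by
  have : FlatStieltjes ξ := ⟨δ, hδ, hδ', hξ0, hξ1⟩
  refine ⟨inferInstance, cylForm ξ, isClosureOfCylForm_cylForm ξ, isRegular_cylForm ξ,
    isStrictlyQuasiRegular_cylForm ξ, ⟨_, (cylForm ξ).isSemigroup_semigroup,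
      fun t _ f hf => cylForm_semigroup_tendsto_one ξ t f hf⟩, fun Ω _ M hM => ?_⟩
  have hB : ∀ n : ℕ, IsCompact {g : ConeOf ξ | ‖(g : L2I)‖ ≤ n} := fun n => isCompact_setOf_norm_le ξ n
  refine MarkovProcess.quasiEverywhere_lifetime_eq_top M hM
    (fun n : ℕ => {g : ConeOf ξ | ‖(g : L2I)‖ ≤ n}) (fun n => (hB n).measurableSet)
    (fun i j hij g (hg : ‖(g : L2I)‖ ≤ i) => hg.trans (Nat.cast_le.2 hij)) ?_
    (fun n => (hB n).measure_lt_top.ne) (cylForm_semigroup_tendsto_one ξ)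
  refine eq_univ_of_forall fun g => mem_iUnion.2 ?_
  exact exists_nat_ge ‖(g : L2I)‖
end
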